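/- Let $n\ge 3$ and let $\mathbb B$ be the open unit ball of $\mathbb R^n$. Let $x$ be a smooth function (up to the boundary) that is positive on $\mathbb B$ and vanishes to first order on $\partial\mathbb B$, and let $R\in(0,1)$ be such that $(x,\theta)$, $\theta=y/|y|\in\mathbb S^{n-1}$, are coordinates on the closure of $\mathbb A:=\{R<|y|<1\}$ (the radial derivative of $x$ is negative there). Let $\chi$ be a smooth cutoff with $0\le\chi\le1$, equal to $1$ near $\partial\mathbb B$ and vanishing outside $\mathbb A$. Let $X_1,\dots,X_M$ be smooth vector fields on $\mathbb S^{n-1}$ that span the tangent space at each point, and write $\partial_\theta^\beta:=X_1^{\beta_1}\cdots X_M^{\beta_M}$ and $|\beta|:=\beta_1+\cdots+\beta_M$ for $\beta\in\mathbb N^M$. In $\mathbb A$ the derivatives $\partial_x$ and $\partial_\theta^\beta$ are taken in the coordinates $(x,\theta)$, and $$\mathcal D_{k,\beta}:=(x\partial_x)^k\partial_\theta^\beta .$$ $L^2(\mathbb A)$ is taken with respect to the measure $x\,dx\,d\theta$, where $d\theta$ is the canonical measure of $\mathbb S^{n-1}$, and $\|f\|_{\mathbf L^2}:=\|\chi f\|_{L^2(\mathbb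 A)}+\|(1-\chi)f\|_{L^2(\mathbb B)}$. For $\varphi\in C_0^\infty(\mathbb B)$ and integers $m,r\ge0$ set $$\|\varphi\|_{\mathcal H^m}:=\sum_{j+|\beta|\le m}\|x^{j-m}\partial_x^j\partial_\theta^\beta(\chi\varphi)\|_{L^2(\mathbb A)}+\|(1-\chi)\varphi\|_{H^m(\mathbb B)},\qquad \|\varphi\|_{\mathcal H^{m,r}}:=\sum_{j=0}^r\|x^j\varphi\|_{\mathcal H^{m+j}},$$ with $H^m(\mathbb B)$ the usual Sobolev norm, and let $\mathcal H^{m,r}$ be the closure of $C^\infty_0(\mathbb B)$ in this norm (a space of real functions in $\mathbf L^2$). On $\mathcal H^{m,r}$ the operators $\mathcal D_{k,\beta}$ are understood as closures in $\mathbf L^2$ of the classical operators on $C_0^\infty(\mathbb B)$. Let $r$ be an integer with $r>\frac{n-1}2$ and let $N\ge0$ be an integer. (1) There is a constant $C$ such that, for all $w_1,\dots,w_N\in\mathcal H^{1,r}$, all $u\in\mathcal H^{0,r}$ (in particular for those supported in $\mathbb A$) and all indices with $\sum_{i=1}^{N+1}(k_i+|\beta_i|)\le r$, the derivatives $\mathcal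 D_{k_i,\beta_i}w_i$ $(i\le N)$ and $\mathcal D_{k_{N+1},\beta_{N+1}}u$ exist in $L^2(\mathbb A)$ and $$\big\|(\mathcal D_{k_1,\beta_1}w_1)\cdots(\mathcal D_{k_N,\beta_N}w_N)\,(\mathcal D_{k_{N+1},\beta_{N+1}}u)\big\|_{L^2(\mathbb A)}\le C\,\|u\|_{\mathcal H^{0,r}}\prod_{i=1}^N\|w_i\|_{\mathcal H^{1,r}} .$$ (2) Let $F(y,z)$, $y\in\mathbb B$, $z\in\mathbb R^N$, be of class $C^r$ in $z$ and $C^0_r$ in $y$, in the sense that $F$ is a $C^r$ function on $\mathbb B\times\mathbb R^N$ and, for each bounded set of $z$'s, the derivatives $\mathcal D_{k,\beta}\partial_z^\gamma(\chi F)$ with $k+|\beta|+|\gamma|\le r$ are bounded in $\mathbb A$ uniformly for $z$ in that set. Then for each $\Lambda\geq0$ there is a constant $C$ such that, for all $u\in\mathcal H^{0,r}$ and $w_1,\dots,w_N\in\mathcal H^{1,r}$ with $\sum_i\|w_i\|_{\mathcal H^{1,r}}\le\Lambda$, one has $F(\cdot,w_1,\dots,w_N)\,u\in\mathcal H^{0,r}$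 and $$\|F(\cdot,w_1,\dots,w_N)\,u\|_{\mathcal H^{0,r}}\le C\,\|u\|_{\mathcal H^{0,r}} .$$ -/

import Mathlib

open scoped ENNReal NNReal ContDiff
open Filter Topology MeasureTheory

noncomputable section

namespace AdaptedSobolev

/-- The fixed geometric data on the unit ball of `ℝⁿ`: a smooth boundary defining function `x`,
a radius `R` such that `(x, θ)`, with `θ = y / |y|`, are coordinates in (the closure of) the
annulus `{R < |y| < 1}`, a cutoff `χ` that equals `1` near the boundary and vanishes outside the
annulus, and smooth vector fields `X 0, …, X (M - 1)` on the unit sphere spanning every tangent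
space of the sphere (only the values of `X i` on the unit sphere matter). -/
structure BallData (n M : ℕ) where
  /-- the boundary defining function -/
  x : EuclideanSpace ℝ (Fin n) → ℝ
  x_smooth : ContDiff ℝ ∞ x
  x_pos : ∀ y, ‖y‖ < 1 → 0 < x y
  x_zero : ∀ y, ‖y‖ = 1 → x y = 0
  /-- the inner radius of the annulus -/
  R : ℝ
  R_pos : 0 < R
  R_lt_one : R < 1
  /-- `x` is strictly decreasing along rays in the closed annulus; at `‖y‖ = 1` this says that
  `x` vanishes exactly to first order on the boundary -/
  x_radial : ∀ y, R ≤ ‖y‖ → ‖y‖ ≤ 1 → fderiv ℝ x y y < 0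
  /-- the cutoff function -/
  χ : EuclideanSpace ℝ (Fin n) → ℝ
  χ_smooth : ContDiff ℝ ∞ χ
  χ_nonneg : ∀ y, 0 ≤ χ y
  χ_le_one : ∀ y, χ y ≤ 1
  χ_zero : ∀ y, ‖y‖ ≤ R → χ y = 0
  χ_one : ∃ R₁ : ℝ, R₁ < 1 ∧ ∀ y, R₁ ≤ ‖y‖ → ‖y‖ ≤ 1 → χ y = 1
  /-- the vector fields on the sphere -/
  X : Fin M → EuclideanSpace ℝ (Fin n) → EuclideanSpace ℝ (Fin n)
  X_smooth : ∀ i, ContDiff ℝ ∞ (X i)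
  X_tangent : ∀ i q, ‖q‖ = 1 → inner ℝ (X i q) q = 0
  X_span : ∀ q v, ‖q‖ = 1 → inner ℝ v q = 0 →
    v ∈ Submodule.span ℝ (Set.range fun i => X i q)

variable {n M : ℕ}

/-- The open unit ball. -/
def unitBall (n : ℕ) : Set (EuclideanSpace ℝ (Fin n)) := Metric.ball 0 1

namespace BallData

/-- The annulus `𝔸 = {R < |y| < 1}`. -/
def annulus (G : BallData n M) : Set (EuclideanSpace ℝ (Fin n)) :=
  {y | G.R < ‖y‖ ∧ ‖y‖ < 1}

/-- The measure `x dx dθ` on the annulus. In polar coordinates `y = ρ θ` one has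
`dy = ρ ^ (n - 1) dρ dθ`, and `dx = |∂_ρ x| dρ` with `∂_ρ x = (Dx(y) y) / ρ` for fixed `θ`. -/
def measA (G : BallData n M) : Measure (EuclideanSpace ℝ (Fin n)) :=
  (volume.restrict G.annulus).withDensity
    fun y => ENNReal.ofReal (G.x y * |fderiv ℝ G.x y y| / ‖y‖ ^ n)

/-- The coordinate derivative `∂_x` (at fixed `θ`) in the annulus. -/
def dx (G : BallData n M) (f : EuclideanSpace ℝ (Fin n) → ℝ) :
    EuclideanSpace ℝ (Fin n) → ℝ :=
  fun y => fderiv ℝ f y y / fderiv ℝ G.x y y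

/-- The derivative along the vector field `X i` of the sphere, acting on the variable `θ` at fixed
`x`, in the annulus: with `v = ρ X i (θ)`, the vector tangent to `{x = const}` with angular part
`v` is `v - (Dx(y) v) ∂_x`. -/
def dTheta (G : BallData n M) (i : Fin M) (f : EuclideanSpace ℝ (Fin n) → ℝ) :
    EuclideanSpace ℝ (Fin n) → ℝ :=
  fun y => fderiv ℝ f y (‖y‖ • G.X i (‖y‖⁻¹ • y)) -
    fderiv ℝ G.x y (‖y‖ • G.X i (‖y‖⁻¹ • y)) * G.dx f y

/-- `∂_θ^β f = X_1^{β_1} ⋯ X_M^{β_M} f`. -/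
def dThetaPow (G : BallData n M) (β : Fin M → ℕ) (f : EuclideanSpace ℝ (Fin n) → ℝ) :
    EuclideanSpace ℝ (Fin n) → ℝ :=
  (List.finRange M).foldr (fun i g => (G.dTheta i)^[β i] g) f

/-- The conormal derivative `𝒟_{k,β} f = (x ∂_x)^k ∂_θ^β f`. -/
def D (G : BallData n M) (k : ℕ) (β : Fin M → ℕ) (f : EuclideanSpace ℝ (Fin n) → ℝ) :
    EuclideanSpace ℝ (Fin n) → ℝ :=
  (fun g y => G.x y * G.dx g y)^[k] (G.dThetaPow β f)

end BallData

/-- The finite set of all `(j, β)` with `j + |β| ≤ m`. -/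
def multiIndices (M m : ℕ) : Finset (ℕ × (Fin M → ℕ)) :=
  (Finset.range (m + 1) ×ˢ Fintype.piFinset fun _ : Fin M => Finset.range (m + 1)).filter
    fun p => p.1 + ∑ i, p.2 i ≤ m

/-- `C_0^∞` of the open ball. -/
def IsTest (φ : EuclideanSpace ℝ (Fin n) → ℝ) : Prop :=
  ContDiff ℝ ∞ φ ∧ HasCompactSupport φ ∧ tsupport φ ⊆ unitBall n

/-- The usual Sobolev norm `H^k(𝔹)` of a smooth function. -/
def ballNorm (k : ℕ) (f : EuclideanSpace ℝ (Fin n) → ℝ) : ℝ≥0∞ :=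
  ∑ i ∈ Finset.range (k + 1),
    eLpNorm (fun y => iteratedFDeriv ℝ i f y) 2 (volume.restrict (unitBall n))

namespace BallData

/-- The norm `‖φ‖_{ℋ^m}` of a test function:
`∑_{j + |β| ≤ m} ‖x^{j-m} ∂_x^j ∂_θ^β (χ φ)‖_{𝐋²} + ‖(1 - χ) φ‖_{H^m(𝔹)}`. -/
def normH (G : BallData n M) (m : ℕ) (φ : EuclideanSpace ℝ (Fin n) → ℝ) : ℝ≥0∞ :=
  (∑ p ∈ multiIndices M m,
    eLpNorm (fun y => G.x y ^ ((p.1 : ℤ) - (m : ℤ)) *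
      (G.dx)^[p.1] (G.dThetaPow p.2 (fun z => G.χ z * φ z)) y) 2 G.measA) +
  ballNorm m (fun y => (1 - G.χ y) * φ y)

/-- The norm `‖φ‖_{ℋ^{m,r}} = ∑_{j ≤ r} ‖x^j φ‖_{ℋ^{m+j}}` of a test function. -/
def normHr (G : BallData n M) (m r : ℕ) (φ : EuclideanSpace ℝ (Fin n) → ℝ) : ℝ≥0∞ :=
  ∑ j ∈ Finset.range (r + 1), G.normH (m + j) (fun y => G.x y ^ j * φ y)

/-- The `𝐋²` norm on the ball, `‖χ f‖_{L²(𝔸, x dx dθ)} + ‖(1 - χ) f‖_{L²(𝔹)}`. -/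
def normL2 (G : BallData n M) (f : EuclideanSpace ℝ (Fin n) → ℝ) : ℝ≥0∞ :=
  eLpNorm (fun y => G.χ y * f y) 2 G.measA +
    eLpNorm (fun y => (1 - G.χ y) * f y) 2 (volume.restrict (unitBall n))

/-- `φ` is a sequence of test functions, Cauchy in the norm of `ℋ^{m,r}`, with `𝐋²` limit `u`. -/
def Approximates (G : BallData n M) (m r : ℕ) (φ : ℕ → EuclideanSpace ℝ (Fin n) → ℝ)
    (u : EuclideanSpace ℝ (Fin n) → ℝ) : Prop :=
  (∀ j, IsTest (φ j)) ∧
  (∀ ε : ℝ≥0∞, 0 < ε → ∃ j₀ : ℕ, ∀ i j, j₀ ≤ i → j₀ ≤ j →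
    G.normHr m r (fun y => φ i y - φ j y) < ε) ∧
  Tendsto (fun j => G.normL2 (fun y => φ j y - u y)) atTop (𝓝 0)

/-- `u ∈ ℋ^{m,r}`, the closure of the test functions in the norm `normHr`. -/
def MemHr (G : BallData n M) (m r : ℕ) (u : EuclideanSpace ℝ (Fin n) → ℝ) : Prop :=
  AEStronglyMeasurable u (volume.restrict (unitBall n)) ∧ ∃ φ, G.Approximates m r φ u

/-- The norm of `ℋ^{m,r}` on the closure: the limit of `‖φ j‖` along an approximating sequence
(all of them give the same limit, as the norm is closable in `𝐋²`). -/
def hNorm (G : BallData n M) (m r : ℕ) (u : EuclideanSpace ℝ (Fin n) → ℝ) : ℝ≥0∞ :=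
  ⨅ (φ : ℕ → EuclideanSpace ℝ (Fin n) → ℝ) (_ : G.Approximates m r φ u),
    liminf (fun j => G.normHr m r (φ j)) atTop

/-- `v = 𝒟_{k,β} w` in the annulus, where `𝒟_{k,β}` stands for the closure in `𝐋²` of the
classical operator on test functions. -/
def IsD (G : BallData n M) (k : ℕ) (β : Fin M → ℕ) (w v : EuclideanSpace ℝ (Fin n) → ℝ) : Prop :=
  AEStronglyMeasurable v G.measA ∧
  ∃ φ : ℕ → EuclideanSpace ℝ (Fin n) → ℝ, (∀ j, IsTest (φ j)) ∧
    Tendsto (fun j => G.normL2 (fun y => φ j y - w y)) atTop (𝓝 0) ∧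
    Tendsto (fun j => eLpNorm (fun y => G.D k β (φ j) y - v y) 2 G.measA) atTop (𝓝 0)

/-- `F(y, z)` is of class `C^r` in `z ∈ ℝ^N` and of class `C^0_r` in `y ∈ 𝔹`: all derivatives of
total order `≤ r` are continuous in the open ball, and the derivatives
`𝒟_{k,β} ∂_z^γ (χ F)` with `k + |β| + |γ| ≤ r` are bounded in the annulus, uniformly for
bounded `z`. (Derivatives of `(1 - χ) F` of order `≤ r` are then bounded for bounded `z`, since
`1 - χ` vanishes near the boundary.) -/
def IsCoeff (G : BallData n M) (r N : ℕ)
    (F : EuclideanSpace ℝ (Fin n) → (Fin N → ℝ) → ℝ) : Prop :=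
  ContDiffOn ℝ r (fun p : EuclideanSpace ℝ (Fin n) × (Fin N → ℝ) => F p.1 p.2)
    (unitBall n ×ˢ Set.univ) ∧
  ∀ K : ℝ, ∃ B : ℝ, ∀ (k : ℕ) (β : Fin M → ℕ) (l : ℕ) (e : Fin l → Fin N),
    k + ∑ i, β i + l ≤ r → ∀ y ∈ G.annulus, ∀ z : Fin N → ℝ, (∀ i, |z i| ≤ K) →
      |G.D k β (fun y' => G.χ y' *
        iteratedFDeriv ℝ l (F y') z (fun a => Pi.single (e a) 1)) y| ≤ B

end BallData

end AdaptedSobolev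

end

/-! The fields `x ∂_x` and `X_i` do not see a dilation of `x`. The map `blow l`, which sends the
point with coordinates `(x, θ)` to `l x θ`, carries them to the Euler field and to fields on the
punctured space that are homogeneous of degree one, the same ones for every `l`
(`fderiv_blow_field`). With `l = scale k` dyadic, the shell where `l x` lies in `[1, 2]` becomes one
fixed annulus of `ℝⁿ`, with one frame and one cutoff; what remains of the ball is a single compact
piece. In each piece conormal and ordinary derivatives are comparable, with constants independent of
the piece, so all local estimates reduce to classical Sobolev estimates on `ℝⁿ`.

Under the blow-down, `dY = (l x)^(n-2) l² (x dx dθ)`, so on a shell the measure `x dx dθ` is `l⁻²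
dY` up to constants. Hence the norm of `ℋ^{0,r}` dominates the `ℓ²` sum, with weights `l⁻²`, of the
`H^r` norms of the pieces (`exists_tsum_sobNorm_piece_le`). In `ℋ^{1,r}` the additional factor
`x⁻²`, comparable to `l²`, cancels the weight, and each single piece is bounded in `H^{r+1}`
(`exists_sobNorm_piece_le`). A product therefore has its `w` factors in `ℓ^∞(H^{r+1})` and its `u`
factor in a weighted `ℓ²(H^r)`, and the sum over the pieces closes as soon as the local estimate is
known: at most `r` derivatives, distributed over factors in `H^{r+1}` and one factor in `H^r`, give
a product in `L²` because `r + 1 > n / 2` (`exists_eLpNorm_prod_jetNorm_le`). That estimate is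
proved on the Fourier side with Young's inequality.

The first assertion passes from test functions to the closures by Fatou's lemma, along bounded
sequences whose derivatives converge almost everywhere; this uses that the closed operators are
single-valued (`isD_unique`), which follows by duality.

For the second assertion, Faà di Bruno's formula in each piece reduces the derivatives of `F(·, w)
u` to the same multilinear products (`exists_energy_coeff_mul_le`). Two difficulties are left. The
function is only `C^r`, so it is mollified (`exists_isTest_energy_le`). And for approximating
sequences only boundedness and `𝐋²` convergence are available, whereas the closure asks for Cauchy
sequences. The norm of `ℋ^{0,r}` is controlled by a quadratic form, `energy`; the parallelogram
identity then produces convex combinations that are Cauchy (`exists_convexHull_cauchy`), an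
elementary substitute for weak compactness (`exists_memHr_of_energy_le`). -/

noncomputable section

namespace AdaptedSobolev

section

/-! ### Iterated Lie derivatives of functions along words of vector fields -/

section LieWord

variable {E ι : Type*} [NormedAddCommGroup E] [NormedSpace ℝ E]

/-- The iterated derivative of a function along the vector fields `V a`, for the letters `a` of a
word; the last letter acts first. -/
def lieWord (V : ι → E → E) : List ι → (E → ℝ) → E → ℝ
  | [], f => f
  | a :: τ, f => fun y => fderiv ℝ (lieWord V τ f) y (V a y)

@[simp] lemma lieWord_nil (V : ι → E → E) (f : E → ℝ) : lieWord V [] f = f := rfl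

lemma lieWord_cons (V : ι → E → E) (a : ι) (τ : List ι) (f : E → ℝ) (y : E) :
    lieWord V (a :: τ) f y = fderiv ℝ (lieWord V τ f) y (V a y) := rfl

lemma lieWord_append (V : ι → E → E) (τ τ' : List ι) (f : E → ℝ) :
    lieWord V (τ ++ τ') f = lieWord V τ (lieWord V τ' f) := by
  induction τ with
  | nil => rfl
  | cons a τ ih => ext y; simp only [List.cons_append, lieWord_cons, ih]

variable {V : ι → E → E} {Ω : Set E}

lemma lieWord_congr (hΩ : IsOpen Ω) {f g : E → ℝ} (h : Set.EqOn f g Ω) (τ : List ι) :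
    Set.EqOn (lieWord V τ f) (lieWord V τ g) Ω := by
  induction τ with
  | nil => exact h
  | cons a τ ih =>
    intro y hy
    have : lieWord V τ f =ᶠ[𝓝 y] lieWord V τ g := by
      filter_upwards [hΩ.mem_nhds hy] with z hz using ih hz
    simp only [lieWord_cons, this.fderiv_eq]

lemma lieWord_congr_nhds {f g : E → ℝ} {y : E} (h : f =ᶠ[𝓝 y] g) (τ : List ι) :
    lieWord V τ f y = lieWord V τ g y := by
  obtain ⟨U, hU, hUo, hy⟩ := eventually_nhds_iff.1 h
  exact lieWord_congr (V := V) hUo (fun z hz => hU z hz) τ hy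

lemma contDiffOn_lieWord (hΩ : IsOpen Ω) (hV : ∀ a, ContDiffOn ℝ ∞ (V a) Ω) {f : E → ℝ}
    (τ : List ι) {m : ℕ∞} (hf : ContDiffOn ℝ ((m + (τ.length : ℕ∞) : ℕ∞)) f Ω) :
    ContDiffOn ℝ m (lieWord V τ f) Ω := by
  induction τ generalizing m with
  | nil => simpa using hf
  | cons a τ ih =>
    have h1 : ContDiffOn ℝ ((m + 1 : ℕ∞)) (lieWord V τ f) Ω := by
      apply ih
      convert hf using 2
      simp only [List.length_cons, Nat.cast_add, Nat.cast_one]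
      ring
    have h2 : ContDiffOn ℝ m (fderiv ℝ (lieWord V τ f)) Ω :=
      h1.fderiv_of_isOpen hΩ (by push_cast; exact le_rfl)
    exact h2.clm_apply ((hV a).of_le (mod_cast le_top))

lemma contDiffOn_lieWord_infty (hΩ : IsOpen Ω) (hV : ∀ a, ContDiffOn ℝ ∞ (V a) Ω) {f : E → ℝ}
    (τ : List ι) (hf : ContDiffOn ℝ ∞ f Ω) : ContDiffOn ℝ ∞ (lieWord V τ f) Ω :=
  contDiffOn_lieWord hΩ hV τ (m := ⊤) (by simpa using hf)

lemma contDiffOn_lieWord_nat (hΩ : IsOpen Ω) (hV : ∀ a, ContDiffOn ℝ ∞ (V a) Ω) {f : E → ℝ}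
    (τ : List ι) {m s : ℕ} (hf : ContDiffOn ℝ s f Ω) (hs : m + τ.length ≤ s) :
    ContDiffOn ℝ m (lieWord V τ f) Ω :=
  contDiffOn_lieWord hΩ hV τ (m := m) (hf.of_le (mod_cast hs))

lemma differentiableAt_lieWord (hΩ : IsOpen Ω) (hV : ∀ a, ContDiffOn ℝ ∞ (V a) Ω) {f : E → ℝ}
    {τ : List ι} {s : ℕ} (hf : ContDiffOn ℝ s f Ω) (hs : τ.length < s) {y : E} (hy : y ∈ Ω) :
    DifferentiableAt ℝ (lieWord V τ f) y :=
  ((contDiffOn_lieWord_nat hΩ hV τ (m := 1) hf (by omega)).differentiableOn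
    (by simp)).differentiableAt (hΩ.mem_nhds hy)

lemma continuousOn_lieWord (hΩ : IsOpen Ω) (hV : ∀ a, ContDiffOn ℝ ∞ (V a) Ω) {f : E → ℝ}
    {τ : List ι} {s : ℕ} (hf : ContDiffOn ℝ s f Ω) (hs : τ.length ≤ s) :
    ContinuousOn (lieWord V τ f) Ω :=
  (contDiffOn_lieWord_nat hΩ hV τ (m := 0) hf (by omega)).continuousOn

lemma lieWord_zero (τ : List ι) : lieWord V τ (fun _ => (0 : ℝ)) = fun _ => 0 := by
  induction τ with
  | nil => rfl
  | cons a τ ih => ext y; simp [lieWord_cons, ih]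

lemma lieWord_eq_zero_of_notMem_tsupport {f : E → ℝ} {y : E} (hy : y ∉ tsupport f)
    (τ : List ι) : lieWord V τ f y = 0 := by
  have : f =ᶠ[𝓝 y] fun _ => 0 := notMem_tsupport_iff_eventuallyEq.1 hy
  rw [lieWord_congr_nhds this, lieWord_zero]

lemma lieWord_add (hΩ : IsOpen Ω) (hV : ∀ a, ContDiffOn ℝ ∞ (V a) Ω) {f g : E → ℝ}
    (τ : List ι) (hf : ContDiffOn ℝ τ.length f Ω) (hg : ContDiffOn ℝ τ.length g Ω) :
    Set.EqOn (lieWord V τ (fun y => f y + g y))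
      (fun y => lieWord V τ f y + lieWord V τ g y) Ω := by
  induction τ with
  | nil => exact fun _ _ => rfl
  | cons a τ ih =>
    intro y hy
    have hle : ((τ.length : ℕ) : WithTop ℕ∞) ≤ ((a :: τ).length : ℕ) := by
      simp only [List.length_cons]; exact_mod_cast Nat.le_succ _
    have h := ih (hf.of_le hle) (hg.of_le hle)
    have : lieWord V τ (fun y => f y + g y) =ᶠ[𝓝 y]
        fun y => lieWord V τ f y + lieWord V τ g y := by
      filter_upwards [hΩ.mem_nhds hy] with z hz using h hz
    simp only [lieWord_cons, this.fderiv_eq]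
    rw [fderiv_fun_add (differentiableAt_lieWord hΩ hV hf (by simp) hy)
      (differentiableAt_lieWord hΩ hV hg (by simp) hy)]
    rfl

lemma lieWord_const_mul (c : ℝ) (τ : List ι) (f : E → ℝ) :
    lieWord V τ (fun y => c * f y) = fun y => c * lieWord V τ f y := by
  induction τ with
  | nil => rfl
  | cons a τ ih =>
    ext y
    simp only [lieWord_cons, ih]
    have : (fun y => c * lieWord V τ f y) = c • lieWord V τ f := by ext; rfl
    rw [this, fderiv_const_smul_field]
    rfl

lemma lieWord_sub (hΩ : IsOpen Ω) (hV : ∀ a, ContDiffOn ℝ ∞ (V a) Ω) {f g : E → ℝ}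
    (τ : List ι) (hf : ContDiffOn ℝ τ.length f Ω) (hg : ContDiffOn ℝ τ.length g Ω) :
    Set.EqOn (lieWord V τ (fun y => f y - g y))
      (fun y => lieWord V τ f y - lieWord V τ g y) Ω := by
  intro y hy
  have h := lieWord_add (V := V) hΩ hV τ (g := fun y => (-1) * g y) hf (contDiffOn_const.mul hg) hy
  simp only [lieWord_const_mul] at h
  simpa [sub_eq_add_neg] using h

/-- Naturality of iterated Lie derivatives under maps relating two families of fields. -/
lemma lieWord_comp {F : Type*} [NormedAddCommGroup F] [NormedSpace ℝ F] {W : ι → F → F}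
    {Ω' : Set F} {Φ : E → F} (hΩ : IsOpen Ω) (hΩ' : IsOpen Ω') (hΦ : ∀ y ∈ Ω, Φ y ∈ Ω')
    (hW : ∀ a, ContDiffOn ℝ ∞ (W a) Ω') (hΦd : ∀ y ∈ Ω, DifferentiableAt ℝ Φ y)
    (hrel : ∀ a, ∀ y ∈ Ω, fderiv ℝ Φ y (V a y) = W a (Φ y)) {g : F → ℝ}
    (τ : List ι) (hg : ContDiffOn ℝ τ.length g Ω') :
    Set.EqOn (lieWord V τ (fun y => g (Φ y))) (fun y => lieWord W τ g (Φ y)) Ω := by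
  induction τ with
  | nil => exact fun _ _ => rfl
  | cons a τ ih =>
    intro y hy
    have hle : ((τ.length : ℕ) : WithTop ℕ∞) ≤ ((a :: τ).length : ℕ) := by
      simp only [List.length_cons]; exact_mod_cast Nat.le_succ _
    have h := ih (hg.of_le hle)
    have : lieWord V τ (fun y => g (Φ y)) =ᶠ[𝓝 y] fun y => lieWord W τ g (Φ y) := by
      filter_upwards [hΩ.mem_nhds hy] with z hz using h hz
    simp only [lieWord_cons, this.fderiv_eq]
    have hd := differentiableAt_lieWord hΩ' hW hg (τ := τ) (by simp) (hΦ y hy)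
    have h2 : fderiv ℝ (fun y => lieWord W τ g (Φ y)) y
        = (fderiv ℝ (lieWord W τ g) (Φ y)).comp (fderiv ℝ Φ y) :=
      fderiv_comp y hd (hΦd y hy)
    rw [h2, ContinuousLinearMap.comp_apply, hrel a y hy]

/-- Words in constant fields compute the coefficients of the iterated Fréchet derivative. -/
lemma lieWord_const_ofFn {f : E → ℝ} (hΩ : IsOpen Ω) (v : ι → E) {s : ℕ}
    (hf : ContDiffOn ℝ s f Ω) (e : Fin s → ι) :
    Set.EqOn (lieWord (fun a _ => v a) (List.ofFn e) f)
      (fun y => iteratedFDeriv ℝ s f y (fun i => v (e i))) Ω := by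
  induction s with
  | zero => intro y _; simp
  | succ s ih =>
    intro y hy
    rw [List.ofFn_succ]
    have h := ih (hf.of_le (mod_cast Nat.le_succ s)) (fun i => e i.succ)
    have : lieWord (fun a _ => v a) (List.ofFn fun i => e i.succ) f =ᶠ[𝓝 y]
        fun y => iteratedFDeriv ℝ s f y (fun i => v (e i.succ)) := by
      filter_upwards [hΩ.mem_nhds hy] with z hz using h hz
    simp only [lieWord_cons, this.fderiv_eq]
    have hd : DifferentiableAt ℝ (iteratedFDeriv ℝ s f) y :=
      (hf.contDiffAt (hΩ.mem_nhds hy)).differentiableAt_iteratedFDeriv (mod_cast Nat.lt_succ_self s)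
    have h2 := (ContinuousMultilinearMap.apply ℝ (fun _ : Fin s => E) ℝ
      (fun i => v (e i.succ))).hasFDerivAt.comp y hd.hasFDerivAt
    have h3 : fderiv ℝ (fun y => iteratedFDeriv ℝ s f y (fun i => v (e i.succ))) y = _ := h2.fderiv
    rw [h3, iteratedFDeriv_succ_apply_left]
    rfl

/-- Constant fields commute, so words in them may be reordered. -/
lemma lieWord_const_perm {f : E → ℝ} (hΩ : IsOpen Ω) (v : ι → E)
    {τ τ' : List ι} (h : τ.Perm τ') (hf : ContDiffOn ℝ τ.length f Ω) :
    Set.EqOn (lieWord (fun a _ => v a) τ f) (lieWord (fun a _ => v a) τ' f) Ω := by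
  have hV : ∀ a, ContDiffOn ℝ ∞ ((fun a (_ : E) => v a) a) Ω := fun a => contDiffOn_const
  induction h with
  | nil => exact fun _ _ => rfl
  | cons a _ ih =>
    intro y hy
    have := ih (hf.of_le (by simp only [List.length_cons]; exact_mod_cast Nat.le_succ _))
    exact lieWord_congr (V := fun a (_ : E) => v a) hΩ this [a] hy
  -- Exchanging two adjacent letters is the symmetry of the second derivative of the function
  -- produced by the remaining word.
  | swap a b l =>
    intro y hy
    have hs := contDiffOn_lieWord_nat hΩ hV l (m := 2) hf (by simp only [List.length_cons]; omega)
    have hat : ContDiffAt ℝ 2 (lieWord (fun a _ => v a) l f) y := hs.contDiffAt (hΩ.mem_nhds hy)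
    have hsym := hat.isSymmSndFDerivAt (by simp)
    have hd : DifferentiableAt ℝ (fderiv ℝ (lieWord (fun a (_ : E) => v a) l f)) y :=
      (hat.fderiv_right (m := 1) (by norm_num)).differentiableAt (by simp)
    have key : ∀ a b : ι, lieWord (fun a (_ : E) => v a) (a :: b :: l) f y
        = fderiv ℝ (fderiv ℝ (lieWord (fun a (_ : E) => v a) l f)) y (v a) (v b) := by
      intro a b
      change fderiv ℝ (fun z => fderiv ℝ (lieWord (fun a (_ : E) => v a) l f) z (v b)) y (v a) = _
      rw [fderiv_clm_apply hd (by fun_prop)]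
      simp
    rw [key, key]
    exact hsym _ _
  | trans h1 _ ih1 ih2 => exact (ih1 hf).trans (ih2 (h1.length_eq ▸ hf))

/-- Expansion of an iterated Lie derivative in terms of iterated Fréchet derivatives; the top
order coefficient is the evaluation at the fields. -/
lemma exists_lieWord_expansion (hΩ : IsOpen Ω) (hV : ∀ a, ContDiffOn ℝ ∞ (V a) Ω) {s : ℕ}
    (e : Fin s → ι) :
    ∃ A : ∀ j : ℕ, E → ((E [×j]→L[ℝ] ℝ) →L[ℝ] ℝ),
      (∀ j, ContDiffOn ℝ ∞ (A j) Ω) ∧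
      (∀ y ∈ Ω, ∀ T : E [×s]→L[ℝ] ℝ, A s y T = T (fun i => V (e i) y)) ∧
      ∀ (f : E → ℝ) (U : Set E), IsOpen U → U ⊆ Ω → ContDiffOn ℝ s f U → ∀ y ∈ U, lieWord V (List.ofFn e) f y =
        ∑ j ∈ Finset.range (s + 1), A j y (iteratedFDeriv ℝ j f y) := by
  induction s with
  | zero =>
    refine ⟨fun j _ => ContinuousMultilinearMap.apply ℝ (fun _ : Fin j => E) ℝ 0,
      fun j => contDiffOn_const, fun y _ T => ?_, fun f _ _ _ _ y _ => by simp⟩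
    change T 0 = _
    congr 1
    exact Subsingleton.elim _ _
  | succ s ih =>
    obtain ⟨A, hA, htop, hexp⟩ := ih (fun i => e i.succ)
    -- the derivative of a multilinear map valued function along a vector
    let L : ∀ j : ℕ, E →L[ℝ] ((E [×(j + 1)]→L[ℝ] ℝ) →L[ℝ] (E [×j]→L[ℝ] ℝ)) := fun j =>
      ContinuousLinearMap.flip
        (continuousMultilinearCurryLeftEquiv ℝ (fun _ : Fin (j + 1) => E)
          ℝ).toContinuousLinearEquiv.toContinuousLinearMap
    -- The Leibniz rule along the new field: `A j` is differentiated, or it receives the next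
    -- derivative contracted with the field in its first slot. The test `j + 1 ≤ s` discards `A (s +
    -- 1)`, which the expansion of order `s` says nothing about; it also makes the new top
    -- coefficient a pure evaluation.
    let B : ∀ j : ℕ, E → ((E [×j]→L[ℝ] ℝ) →L[ℝ] ℝ) := fun j => match j with
      | 0 => fun y => fderiv ℝ (A 0) y (V (e 0) y)
      | j + 1 => fun y => (if j + 1 ≤ s then fderiv ℝ (A (j + 1)) y (V (e 0) y) else 0) +
          (A j y).comp (L j (V (e 0) y))
    have hdA : ∀ j, ContDiffOn ℝ ∞ (fun y => fderiv ℝ (A j) y (V (e 0) y)) Ω := fun j =>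
      ((hA j).fderiv_of_isOpen hΩ (m := ∞) (by simp)).clm_apply (hV (e 0))
    have hL : ∀ j, ContDiffOn ℝ ∞ (fun y => L j (V (e 0) y)) Ω := fun j =>
      contDiffOn_const.clm_apply (hV (e 0))
    have hcomp : ∀ j, ContDiffOn ℝ ∞ (fun y => (A j y).comp (L j (V (e 0) y))) Ω := fun j =>
      (hA j).clm_comp (hL j)
    refine ⟨B, ?_, ?_, ?_⟩
    · intro j
      cases j with
      | zero => exact hdA 0
      | succ j =>
        by_cases hj : j + 1 ≤ s
        · simp only [B, hj, if_true]
          exact (hdA (j + 1)).add (hcomp j)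
        · simp only [B, hj, if_false]
          exact contDiffOn_const.add (hcomp j)
    · intro y hy T
      have : ¬ (s + 1 ≤ s) := by omega
      simp only [B, this, if_false, zero_add, ContinuousLinearMap.comp_apply]
      rw [htop y hy]
      change T (Fin.cons (V (e 0) y) fun i => V (e i.succ) y) = _
      congr 1
      ext i
      refine Fin.cases ?_ (fun i => ?_) i <;> simp
    · intro f U hU hUΩ hf y hy
      rw [List.ofFn_succ]
      have hfs : ContDiffOn ℝ s f U := hf.of_le (mod_cast Nat.le_succ s)
      have : lieWord V (List.ofFn fun i => e i.succ) f =ᶠ[𝓝 y]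
          fun y => ∑ j ∈ Finset.range (s + 1), A j y (iteratedFDeriv ℝ j f y) := by
        filter_upwards [hU.mem_nhds hy] with z hz using hexp f U hU hUΩ hfs z hz
      simp only [lieWord_cons, this.fderiv_eq]
      have hdj : ∀ j ∈ Finset.range (s + 1), DifferentiableAt ℝ (iteratedFDeriv ℝ j f) y := by
        intro j hj
        refine (hf.contDiffAt (hU.mem_nhds hy)).differentiableAt_iteratedFDeriv ?_
        exact_mod_cast Finset.mem_range.1 hj
      have hAj : ∀ j, DifferentiableAt ℝ (A j) y := fun j =>
        ((hA j).contDiffAt (hΩ.mem_nhds (hUΩ hy))).differentiableAt (by simp)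
      rw [fderiv_fun_sum (fun j hj => (hAj j).clm_apply (hdj j hj))]
      rw [_root_.sum_apply]
      have hterm : ∀ j ∈ Finset.range (s + 1),
          fderiv ℝ (fun z => A j z (iteratedFDeriv ℝ j f z)) y (V (e 0) y) =
          fderiv ℝ (A j) y (V (e 0) y) (iteratedFDeriv ℝ j f y) +
          (A j y).comp (L j (V (e 0) y)) (iteratedFDeriv ℝ (j + 1) f y) := by
        intro j hj
        rw [fderiv_clm_apply (hAj j) (hdj j hj)]
        simp only [_root_.add_apply, ContinuousLinearMap.comp_apply,
          ContinuousLinearMap.flip_apply]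
        rw [add_comm]
        congr 2
      rw [Finset.sum_congr rfl hterm, Finset.sum_add_distrib,
        Finset.sum_range_succ' _ (s + 1), Finset.sum_range_succ' _ s]
      have hB : ∀ j ∈ Finset.range (s + 1), B (j + 1) y (iteratedFDeriv ℝ (j + 1) f y) =
          (if j + 1 ≤ s then fderiv ℝ (A (j + 1)) y (V (e 0) y)
            (iteratedFDeriv ℝ (j + 1) f y) else 0) +
          (A j y).comp (L j (V (e 0) y)) (iteratedFDeriv ℝ (j + 1) f y) := by
        intro j _
        by_cases hj : j + 1 ≤ s <;> simp only [B, hj, if_true, if_false] <;> simp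
      rw [Finset.sum_congr rfl hB, Finset.sum_add_distrib,
        Finset.sum_range_succ (fun j => if j + 1 ≤ s then _ else (0 : ℝ)) s]
      have h0 : ∑ j ∈ Finset.range s, (if j + 1 ≤ s then fderiv ℝ (A (j + 1)) y (V (e 0) y)
            (iteratedFDeriv ℝ (j + 1) f y) else 0) =
          ∑ j ∈ Finset.range s, fderiv ℝ (A (j + 1)) y (V (e 0) y)
            (iteratedFDeriv ℝ (j + 1) f y) :=
        Finset.sum_congr rfl fun j hj => if_pos (Finset.mem_range.1 hj)
      rw [h0]
      simp only [B, Nat.not_succ_le_self, if_false, add_zero]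
      ring

end LieWord

end

section

/-! ### Comparison of Lie derivatives along a frame with Fréchet derivatives -/

section Frame

variable {E ι : Type*} [NormedAddCommGroup E] [NormedSpace ℝ E] {V : ι → E → E} {Ω K : Set E}

/-- For finite order, regularity at a point spreads to a neighborhood. The expansion of Lie
derivatives is stated on open sets, and this makes it available pointwise. -/
lemma _root_.ContDiffAt.exists_isOpen_contDiffOn {f : E → ℝ} {y : E} {s : ℕ}
    (hf : ContDiffAt ℝ s f y) (hΩ : IsOpen Ω) (hy : y ∈ Ω) :
    ∃ U, IsOpen U ∧ U ⊆ Ω ∧ y ∈ U ∧ ContDiffOn ℝ s f U := by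
  obtain ⟨u, hu, h⟩ := hf.contDiffOn le_rfl (by simp)
  obtain ⟨U, hUs, hUo, hyU⟩ := mem_nhds_iff.1 (inter_mem hu (hΩ.mem_nhds hy))
  exact ⟨U, hUo, fun z hz => (hUs hz).2, hyU, h.mono fun z hz => (hUs hz).1⟩

lemma _root_.IsCompact.exists_norm_le {X F : Type*} [TopologicalSpace X] [NormedAddCommGroup F]
    {K : Set X} (hK : IsCompact K) {f : X → F} (hf : ContinuousOn f K) :
    ∃ C, ∀ y ∈ K, ‖f y‖ ≤ C :=
  hK.exists_bound_of_continuousOn hf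

/-- Iterated Lie derivatives are bounded by Fréchet derivatives on compact sets. -/
lemma exists_abs_lieWord_le [Finite ι] (hΩ : IsOpen Ω) (hV : ∀ a, ContDiffOn ℝ ∞ (V a) Ω)
    (hK : IsCompact K) (hKΩ : K ⊆ Ω) (s : ℕ) :
    ∃ C : ℝ, 0 ≤ C ∧ ∀ τ : List ι, τ.length ≤ s → ∀ (f : E → ℝ), ∀ y ∈ K,
      ContDiffAt ℝ τ.length f y →
      |lieWord V τ f y| ≤ C * ∑ j ∈ Finset.range (τ.length + 1), ‖iteratedFDeriv ℝ j f y‖ := by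
  have h1 : ∀ τ : List ι, ∃ C : ℝ, 0 ≤ C ∧ ∀ (f : E → ℝ), ∀ y ∈ K,
      ContDiffAt ℝ τ.length f y →
      |lieWord V τ f y| ≤ C * ∑ j ∈ Finset.range (τ.length + 1), ‖iteratedFDeriv ℝ j f y‖ := by
    intro τ
    obtain ⟨A, hA, -, hexp⟩ := exists_lieWord_expansion hΩ hV τ.get
    rw [List.ofFn_get] at hexp
    have hb : ∀ j, ∃ C, ∀ y ∈ K, ‖A j y‖ ≤ C := fun j =>
      hK.exists_norm_le ((hA j).continuousOn.mono hKΩ)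
    choose c hc using hb
    refine ⟨∑ j ∈ Finset.range (τ.length + 1), |c j|, by positivity, fun f y hy hf => ?_⟩
    obtain ⟨U, hU, hUΩ, hyU, hfU⟩ := hf.exists_isOpen_contDiffOn hΩ (hKΩ hy)
    rw [hexp f U hU hUΩ hfU y hyU, Finset.mul_sum]
    refine (Finset.abs_sum_le_sum_abs _ _).trans (Finset.sum_le_sum fun j hj => ?_)
    rw [← Real.norm_eq_abs]
    refine ((A j y).le_opNorm _).trans (mul_le_mul_of_nonneg_right ?_ (norm_nonneg _))
    exact ((hc j y hy).trans (le_abs_self _)).trans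
      (Finset.single_le_sum (f := fun j => |c j|) (fun _ _ => abs_nonneg _) hj)
  choose c hc0 hc using h1
  have hfin : {τ : List ι | τ.length ≤ s}.Finite := List.finite_length_le ι s
  refine ⟨∑ τ ∈ hfin.toFinset, c τ, Finset.sum_nonneg fun τ _ => hc0 τ, fun τ hτ f y hy hf => ?_⟩
  refine (hc τ f y hy hf).trans (mul_le_mul_of_nonneg_right ?_ (by positivity))
  exact Finset.single_le_sum (f := c) (fun τ _ => hc0 τ) (by simpa using hτ)

variable [Fintype ι]

/-- A spanning family of continuous fields is a frame, uniformly on compact sets. -/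
lemma exists_norm_le_sum_frame [FiniteDimensional ℝ E] (hK : IsCompact K)
    (hV : ∀ a, ContinuousOn (V a) K)
    (hspan : ∀ y ∈ K, Submodule.span ℝ (Set.range fun a => V a y) = ⊤) :
    ∃ C : ℝ, 0 ≤ C ∧ ∀ y ∈ K, ∀ l : E →L[ℝ] ℝ, ‖l‖ ≤ C * ∑ a, |l (V a y)| := by
  have hcomp : IsCompact (K ×ˢ Metric.sphere (0 : E →L[ℝ] ℝ) 1) :=
    hK.prod (isCompact_sphere _ _)
  have hcont : ContinuousOn (fun p : E × (E →L[ℝ] ℝ) => ∑ a, |p.2 (V a p.1)|)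
      (K ×ˢ Metric.sphere (0 : E →L[ℝ] ℝ) 1) := by
    refine continuousOn_finsetSum _ fun a _ => ContinuousOn.abs ?_
    refine ContinuousOn.clm_apply continuousOn_snd ?_
    exact (hV a).comp continuousOn_fst fun p hp => hp.1
  -- A unit functional cannot annihilate a spanning family, so the sum is positive on the compact
  -- product of `K` with the dual unit sphere; its minimum gives the constant.
  have hpos : ∀ p ∈ K ×ˢ Metric.sphere (0 : E →L[ℝ] ℝ) 1, (0 : ℝ) < ∑ a, |p.2 (V a p.1)| := by
    rintro ⟨y, l⟩ ⟨hy, hl⟩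
    refine lt_of_le_of_ne (by positivity) fun h0 => ?_
    have hz : ∀ a, l (V a y) = 0 := fun a => by
      have := (Finset.sum_eq_zero_iff_of_nonneg (fun a _ => abs_nonneg _)).1 h0.symm a
        (Finset.mem_univ a)
      simpa using this
    have : l = 0 := by
      have hker : (⊤ : Submodule ℝ E) ≤ LinearMap.ker (l : E →ₗ[ℝ] ℝ) := by
        rw [← hspan y hy, Submodule.span_le]
        rintro _ ⟨a, rfl⟩
        simpa using hz a
      ext v
      simpa using hker (Submodule.mem_top (x := v))
    simp [this] at hl
  obtain ⟨c, hc, hmin⟩ := hcomp.exists_forall_le' hcont hpos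
  refine ⟨c⁻¹, by positivity, fun y hy l => ?_⟩
  rcases eq_or_ne l 0 with rfl | hl
  · simp
  have hn : 0 < ‖l‖ := norm_pos_iff.2 hl
  have := hmin (y, ‖l‖⁻¹ • l) ⟨hy, by simp [norm_smul, hn.ne']⟩
  simp only [FunLike.coe_smul, Pi.smul_apply, smul_eq_mul, abs_mul, abs_inv,
    abs_norm, ← Finset.mul_sum] at this
  rw [inv_mul_eq_div, le_div_iff₀ hc]
  rw [inv_mul_eq_div, le_div_iff₀ hn] at this
  linarith

/-- The bound for functionals is used in one slot at a time: currying the first argument lowers the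
number of slots by one, and each slot costs a factor `C`. -/
lemma norm_multilinear_le_sum_frame {v : ι → E} {C : ℝ} (hC : 0 ≤ C)
    (h : ∀ l : E →L[ℝ] ℝ, ‖l‖ ≤ C * ∑ a, |l (v a)|) {s : ℕ} (T : E [×s]→L[ℝ] ℝ) :
    ‖T‖ ≤ C ^ s * ∑ e : Fin s → ι, |T (fun i => v (e i))| := by
  have key : ∀ (s : ℕ) (T : E [×s]→L[ℝ] ℝ) (m : Fin s → E),
      |T m| ≤ (C ^ s * ∑ e : Fin s → ι, |T (fun i => v (e i))|) * ∏ i, ‖m i‖ := by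
    intro s
    induction s with
    | zero =>
      intro T m
      have : ∀ e : Fin 0 → ι, (fun i => v (e i)) = m := fun e => Subsingleton.elim _ _
      simp [this]
    | succ s ih =>
      intro T m
      have h1 := ih (T.curryLeft (m 0)) (Fin.tail m)
      have h2 : (T.curryLeft (m 0)) (Fin.tail m) = T m := by
        simp [ContinuousMultilinearMap.curryLeft_apply]
      rw [h2] at h1
      refine h1.trans ?_
      have h3 : ∀ e : Fin s → ι, |T.curryLeft (m 0) (fun i => v (e i))| ≤
          C * (∑ a, |T (Fin.cons (v a) fun i => v (e i))|) * ‖m 0‖ := by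
        intro e
        have h4 := h ((ContinuousMultilinearMap.apply ℝ (fun _ : Fin s => E) ℝ
          (fun i => v (e i))).comp T.curryLeft)
        have h5 := ((ContinuousMultilinearMap.apply ℝ (fun _ : Fin s => E) ℝ
          (fun i => v (e i))).comp T.curryLeft).le_opNorm (m 0)
        exact h5.trans (mul_le_mul_of_nonneg_right h4 (norm_nonneg _))
      have h6 : ∑ e : Fin (s + 1) → ι, |T (fun i => v (e i))| =
          ∑ e : Fin s → ι, ∑ a, |T (Fin.cons (v a) fun i => v (e i))| := by
        rw [← (Fin.consEquiv fun _ => ι).sum_comp, Fintype.sum_prod_type, Finset.sum_comm]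
        refine Finset.sum_congr rfl fun e _ => Finset.sum_congr rfl fun a _ => ?_
        congr 2
        ext i
        refine Fin.cases ?_ (fun i => ?_) i <;> simp [Fin.consEquiv]
      rw [h6, Fin.prod_univ_succ]
      calc _ ≤ (C ^ s * ∑ e : Fin s → ι, C * (∑ a, |T (Fin.cons (v a) fun i => v (e i))|) * ‖m 0‖)
            * ∏ i, ‖Fin.tail m i‖ := by
            gcongr with e
            exact h3 e
        _ = _ := by
            rw [← Finset.sum_mul, ← Finset.mul_sum]
            simp only [Fin.tail]
            ring
  refine T.opNorm_le_bound (by positivity) fun m => ?_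
  exact key s T m

/-- On a compact set where the fields span, Fréchet derivatives are bounded by iterated Lie
derivatives, and it suffices to use the words of a set that represents all words up to order. -/
lemma exists_norm_iteratedFDeriv_le [FiniteDimensional ℝ E] (hΩ : IsOpen Ω)
    (hV : ∀ a, ContDiffOn ℝ ∞ (V a) Ω) (hK : IsCompact K) (hKΩ : K ⊆ Ω)
    (hspan : ∀ y ∈ K, Submodule.span ℝ (Set.range fun a => V a y) = ⊤) (s : ℕ)
    (W : Finset (List ι)) (hW : ∀ τ : List ι, τ.length ≤ s → ∃ τ' ∈ W, τ.Perm τ') :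
    ∃ C : ℝ, 0 ≤ C ∧ ∀ f : E → ℝ, ∀ y ∈ K, ContDiffAt ℝ s f y →
      ∀ j ≤ s, ‖iteratedFDeriv ℝ j f y‖ ≤ C * ∑ τ ∈ W, |lieWord V τ f y| := by
  obtain ⟨c, hc0, hc⟩ := exists_norm_le_sum_frame hK (fun a => (hV a).continuousOn.mono hKΩ) hspan
  induction s with
  | zero =>
    obtain ⟨τ, hτ, hp⟩ := hW [] (by simp)
    have hτ0 : τ = [] := by simpa using hp.symm
    subst hτ0
    refine ⟨1, by norm_num, fun f y _ _ j hj => ?_⟩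
    obtain rfl : j = 0 := by omega
    rw [norm_iteratedFDeriv_zero, one_mul]
    exact Finset.single_le_sum (f := fun τ => |lieWord V τ f y|) (fun _ _ => abs_nonneg _) hτ
  | succ s ih =>
    obtain ⟨C, hC0, hC⟩ := ih fun τ hτ => hW τ (by omega)
    have hA : ∀ e : Fin (s + 1) → ι, ∃ D : ℝ, 0 ≤ D ∧ ∀ f : E → ℝ, ∀ y ∈ K,
        ContDiffAt ℝ (s + 1 : ℕ) f y → |iteratedFDeriv ℝ (s + 1) f y (fun i => V (e i) y)| ≤
          D * ∑ τ ∈ W, |lieWord V τ f y| := by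
      intro e
      obtain ⟨τ, hτ, hp⟩ := hW (List.ofFn e) (by simp)
      obtain ⟨e', he'⟩ : ∃ e' : Fin (s + 1) → ι, List.ofFn e' = τ := by
        have hl : τ.length = s + 1 := by rw [← hp.length_eq]; simp
        exact ⟨fun i => τ.get (i.cast hl.symm), by
          rw [← List.ofFn_congr hl τ.get]; exact List.ofFn_get τ⟩
      obtain ⟨A, hA, htop, hexp⟩ := exists_lieWord_expansion hΩ hV e'
      have hb : ∀ j, ∃ C, ∀ y ∈ K, ‖A j y‖ ≤ C := fun j =>
        hK.exists_norm_le ((hA j).continuousOn.mono hKΩ)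
      choose d hd using hb
      refine ⟨1 + ∑ j ∈ Finset.range (s + 1), |d j| * C, by positivity, fun f y hy hf => ?_⟩
      obtain ⟨U, hU, hUΩ, hyU, hfU⟩ := hf.exists_isOpen_contDiffOn hΩ (hKΩ hy)
      have e1 := hexp f U hU hUΩ hfU y hyU
      rw [Finset.sum_range_succ, htop y (hKΩ hy), he'] at e1
      -- Once the fields are frozen at `y` they commute, so the top derivative evaluated along `e`
      -- equals the one along the reordered word `e'`. The latter is the Lie derivative along `τ ∈
      -- W` minus terms of lower order, which the induction hypothesis bounds. The commutators of
      -- the true fields never have to be computed.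
      have e2 := lieWord_const_ofFn hU (fun a => V a y) hfU e hyU
      have e3 := lieWord_const_ofFn hU (fun a => V a y) hfU e' hyU
      have e4 := lieWord_const_perm hU (fun a => V a y) (show (List.ofFn e).Perm (List.ofFn e') by rw [he']; exact hp)
        (f := f) (by simpa using hfU) hyU
      simp only at e2 e3
      rw [← e2, e4, e3]
      have e5 : iteratedFDeriv ℝ (s + 1) f y (fun i => V (e' i) y) = lieWord V τ f y -
          ∑ j ∈ Finset.range (s + 1), A j y (iteratedFDeriv ℝ j f y) := by
        rw [e1]; ring
      rw [e5, add_mul, one_mul, Finset.sum_mul]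
      refine (abs_sub _ _).trans (add_le_add ?_ ?_)
      · exact Finset.single_le_sum (f := fun τ => |lieWord V τ f y|) (fun _ _ => abs_nonneg _) hτ
      · refine (Finset.abs_sum_le_sum_abs _ _).trans (Finset.sum_le_sum fun j hj => ?_)
        rw [← Real.norm_eq_abs, mul_assoc]
        refine ((A j y).le_opNorm _).trans ?_
        have := hC f y hy (hf.of_le (mod_cast Nat.le_succ s)) j
          (by have := Finset.mem_range.1 hj; omega)
        have h2 := (hd j y hy).trans (le_abs_self _)
        gcongr
    choose D hD0 hD using hA
    refine ⟨C + c ^ (s + 1) * ∑ e, D e, ?_, fun f y hy hf j hj => ?_⟩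
    · have := Finset.sum_nonneg fun e (_ : e ∈ Finset.univ) => hD0 e
      positivity
    · have hs : 0 ≤ ∑ τ ∈ W, |lieWord V τ f y| := by positivity
      have hDs := Finset.sum_nonneg fun e (_ : e ∈ Finset.univ) => hD0 e
      rcases Nat.lt_or_ge j (s + 1) with h | h
      · have := hC f y hy (hf.of_le (mod_cast Nat.le_succ s)) j (by omega)
        refine this.trans (mul_le_mul_of_nonneg_right ?_ hs)
        have : 0 ≤ c ^ (s + 1) * ∑ e, D e := by positivity
        linarith
      · obtain rfl : j = s + 1 := by omega
        refine (norm_multilinear_le_sum_frame hc0 (fun l => hc y hy l) _).trans ?_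
        calc _ ≤ c ^ (s + 1) * ∑ e, D e * ∑ τ ∈ W, |lieWord V τ f y| := by
              gcongr with e
              exact hD e f y hy hf
          _ = (c ^ (s + 1) * ∑ e, D e) * ∑ τ ∈ W, |lieWord V τ f y| := by
              rw [← Finset.sum_mul]; ring
          _ ≤ _ := by
              refine mul_le_mul_of_nonneg_right ?_ hs
              linarith

end Frame

end

section

/-! ### Square integrals, Young's inequality, and the Fourier side of Sobolev norms -/

section LTwo

variable {α F : Type*} [MeasurableSpace α] [NormedAddCommGroup F] {μ : Measure α}

lemma eLpNorm_two_sq (f : α → F) : eLpNorm f 2 μ ^ 2 = ∫⁻ y, ‖f y‖ₑ ^ 2 ∂μ := by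
  rw [eLpNorm_eq_lintegral_rpow_enorm_toReal (by norm_num) (by norm_num)]
  rw [← ENNReal.rpow_natCast, ← ENNReal.rpow_mul]
  norm_num

lemma eLpNorm_two_le_iff {f : α → F} {C : ℝ≥0∞} :
    eLpNorm f 2 μ ≤ C ↔ ∫⁻ y, ‖f y‖ₑ ^ 2 ∂μ ≤ C ^ 2 := by
  rw [← eLpNorm_two_sq, ENNReal.pow_le_pow_left_iff (by norm_num)]

lemma lintegral_mul_sq_le {f g : α → ℝ≥0∞} (hf : AEMeasurable f μ) (hg : AEMeasurable g μ) :
    (∫⁻ y, f y * g y ∂μ) ^ 2 ≤ (∫⁻ y, f y ^ 2 ∂μ) * ∫⁻ y, g y ^ 2 ∂μ := by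
  have h := ENNReal.lintegral_mul_le_Lp_mul_Lq μ Real.HolderConjugate.two_two hf hg
  refine (pow_le_pow_left' h 2).trans ?_
  rw [mul_pow]
  simp only [← ENNReal.rpow_natCast, ← ENNReal.rpow_mul]
  norm_num

end LTwo

section Convolution

variable {G : Type*} [AddCommGroup G] [MeasurableSpace G] [MeasurableAdd₂ G] [MeasurableNeg G]
  {μ : Measure G} [SFinite μ] [μ.IsAddLeftInvariant] [μ.IsNegInvariant]

/-- Young's inequality `L¹ * L² ⊆ L²`. -/
lemma lintegral_convolution_sq_le {a b : G → ℝ≥0∞} (ha : Measurable a) (hb : Measurable b) :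
    ∫⁻ x, (∫⁻ t, a (x - t) * b t ∂μ) ^ 2 ∂μ ≤ (∫⁻ t, a t ∂μ) ^ 2 * ∫⁻ t, b t ^ 2 ∂μ := by
  have hinv : ∀ (c : G → ℝ≥0∞) x, ∫⁻ t, c (x - t) ∂μ = ∫⁻ t, c t ∂μ := fun c x =>
    lintegral_sub_left_eq_self c x
  have hsub : ∀ x, Measurable fun t => a (x - t) := fun x => ha.comp (measurable_const.sub measurable_id)
  have h1 : ∀ x, (∫⁻ t, a (x - t) * b t ∂μ) ^ 2 ≤
      (∫⁻ t, a t ∂μ) * ∫⁻ t, a (x - t) * b t ^ 2 ∂μ := by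
    intro x
    -- One square root of `a` is kept with each factor, so that Cauchy–Schwarz yields the total mass
    -- of `a` times the convolution of `a` with `b²`.
    have e1 : ∀ t, a (x - t) * b t =
        a (x - t) ^ (1 / 2 : ℝ) * (a (x - t) ^ (1 / 2 : ℝ) * b t) := by
      intro t
      rw [← mul_assoc, ← ENNReal.rpow_add_of_nonneg _ _ (by norm_num) (by norm_num)]
      norm_num
    have e2 : ∀ t, (a (x - t) ^ (1 / 2 : ℝ)) ^ 2 = a (x - t) := by
      intro t
      rw [← ENNReal.rpow_natCast, ← ENNReal.rpow_mul]
      norm_num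
    rw [lintegral_congr e1]
    refine (lintegral_mul_sq_le ((hsub x).pow_const _).aemeasurable
      (((hsub x).pow_const _).mul hb).aemeasurable).trans_eq ?_
    simp only [Pi.mul_apply, mul_pow, e2]
    rw [hinv]
  calc _ ≤ ∫⁻ x, (∫⁻ t, a t ∂μ) * ∫⁻ t, a (x - t) * b t ^ 2 ∂μ ∂μ := lintegral_mono h1
    _ = (∫⁻ t, a t ∂μ) * ∫⁻ t, ∫⁻ x, a (x - t) * b t ^ 2 ∂μ ∂μ := by
      have hm : Measurable (Function.uncurry fun x t => a (x - t) * b t ^ 2) :=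
        (ha.comp (measurable_fst.sub measurable_snd)).mul ((hb.comp measurable_snd).pow_const 2)
      have hm' : Measurable fun x => ∫⁻ t, a (x - t) * b t ^ 2 ∂μ := hm.lintegral_prod_right'
      rw [lintegral_const_mul _ hm', lintegral_lintegral_swap hm.aemeasurable]
    _ = _ := by
      have : ∀ t, ∫⁻ x, a (x - t) * b t ^ 2 ∂μ = (∫⁻ x, a x ∂μ) * b t ^ 2 := by
        intro t
        have hm : Measurable fun x => a (x - t) := ha.comp (measurable_id.sub_const t)
        rw [lintegral_mul_const _ hm, lintegral_sub_right_eq_self a t]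
      simp_rw [this]
      rw [lintegral_const_mul _ (hb.pow_const 2), sq, mul_assoc]

end Convolution

section Fourier

open SchwartzMap FourierTransform LineDeriv
open scoped LineDeriv

variable {n : ℕ}

local notation "𝔼" => EuclideanSpace ℝ (Fin n)

/-- The Sobolev norm of order `s` on the whole space. -/
def sobNorm (s : ℕ) (f : 𝔼 → ℝ) : ℝ≥0∞ :=
  ∑ j ∈ Finset.range (s + 1), eLpNorm (iteratedFDeriv ℝ j f) 2 volume

/-- The weight `1 + |ξ|`. -/
def bracket (ξ : 𝔼) : ℝ≥0∞ := ENNReal.ofReal (1 + ‖ξ‖)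

lemma measurable_bracket : Measurable (bracket : 𝔼 → ℝ≥0∞) := by
  unfold bracket; fun_prop

lemma one_le_bracket (ξ : 𝔼) : 1 ≤ bracket ξ := by
  rw [bracket, ← ENNReal.ofReal_one]
  exact ENNReal.ofReal_le_ofReal (by linarith [norm_nonneg ξ])

lemma bracket_ne_top (ξ : 𝔼) : bracket ξ ≠ ⊤ := ENNReal.ofReal_ne_top

lemma bracket_ne_zero (ξ : 𝔼) : bracket ξ ≠ 0 :=
  (zero_lt_one.trans_le (one_le_bracket ξ)).ne'

/-- The exponent of decay is `2σ`, which must exceed the dimension. Every later condition comparing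
the dimension with twice a Sobolev order comes from here. -/
lemma lintegral_bracket_lt_top {σ : ℕ} (hσ : n < 2 * σ) :
    ∫⁻ ξ : 𝔼, ((bracket ξ ^ σ)⁻¹) ^ 2 < ⊤ := by
  have h := finite_integral_one_add_norm (E := 𝔼) (μ := volume) (r := (2 * σ : ℕ))
    (by rw [finrank_euclideanSpace_fin]; exact_mod_cast hσ)
  refine lt_of_le_of_lt (lintegral_mono fun ξ => ?_) h
  have hp : (0 : ℝ) < 1 + ‖ξ‖ := by positivity
  rw [Real.rpow_neg hp.le, Real.rpow_natCast, ENNReal.ofReal_inv_of_pos (by positivity),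
    ENNReal.ofReal_pow hp.le, ← ENNReal.inv_pow, ← pow_mul, mul_comm σ 2]
  rfl

/-- Only pure powers of the coordinates occur on the right, so the weighted bound needs only the
pure derivatives `∂_i^s`. With `b` the maximum of `1` and the `|ξ i|`, one has `1 + ‖ξ‖ ≤ (1 + n)
b`, which explains the constant. -/
lemma bracket_pow_le (s : ℕ) : ∃ C : ℝ, 0 ≤ C ∧ ∀ ξ : 𝔼,
    (1 + ‖ξ‖) ^ (2 * s) ≤ C * (1 + ∑ i, |ξ i| ^ (2 * s)) := by
  refine ⟨(1 + n : ℝ) ^ (2 * s), by positivity, fun ξ => ?_⟩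
  have h1 : ‖ξ‖ ≤ ∑ i, |ξ i| := by
    rw [EuclideanSpace.norm_eq]
    apply Real.sqrt_le_iff.2 ⟨by positivity, ?_⟩
    simp only [Real.norm_eq_abs]
    exact Finset.sum_sq_le_sq_sum_of_nonneg fun i _ => abs_nonneg _
  obtain ⟨b, hb1, hb2, hb3⟩ : ∃ b : ℝ, 1 ≤ b ∧ (∀ i, |ξ i| ≤ b) ∧
      b ^ (2 * s) ≤ 1 + ∑ i, |ξ i| ^ (2 * s) := by
    rcases isEmpty_or_nonempty (Fin n) with hE | hE
    · exact ⟨1, le_rfl, fun i => hE.elim i, by simp⟩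
    · obtain ⟨i0, hi0⟩ := Finite.exists_max fun i => |ξ i|
      have hs := Finset.single_le_sum (f := fun i => |ξ i| ^ (2 * s)) (fun _ _ => by positivity)
        (Finset.mem_univ i0)
      rcases le_total |ξ i0| 1 with h | h
      · refine ⟨1, le_rfl, fun i => (hi0 i).trans h, ?_⟩
        rw [one_pow]
        have : 0 ≤ ∑ i, |ξ i| ^ (2 * s) := by positivity
        linarith
      · exact ⟨|ξ i0|, h, hi0, by simp only at hs; linarith⟩
  have h2 : 1 + ‖ξ‖ ≤ (1 + n) * b := by
    have : ∑ i, |ξ i| ≤ n * b := by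
      refine (Finset.sum_le_sum fun i _ => hb2 i).trans ?_
      simp
    linarith
  calc _ ≤ ((1 + n) * b) ^ (2 * s) := by gcongr
    _ = (1 + n : ℝ) ^ (2 * s) * b ^ (2 * s) := mul_pow _ _ _
    _ ≤ _ := by gcongr

/-- The inverse transform is used rather than the transform, so that a function is the Fourier
transform of its own frequency function and a product is the transform of a convolution. -/
lemma fourierInv_iterated (f : 𝓢(𝔼, ℂ)) (v : 𝔼) (s : ℕ) (ξ : 𝔼) :
    𝓕⁻ (∂^{fun _ : Fin s => v} f) ξ =
      (-(2 * Real.pi * Complex.I) * (inner ℝ ξ v : ℝ)) ^ s * 𝓕⁻ f ξ := by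
  induction s with
  | zero => simp
  | succ s ih =>
    have hg : (inner ℝ · v : 𝔼 → ℝ).HasTemperateGrowth := ((innerSL ℝ).flip v).hasTemperateGrowth
    rw [iteratedLineDerivOp_succ_left, fourierInv_lineDerivOp_eq]
    have : Fin.tail (fun _ : Fin (s + 1) => v) = fun _ : Fin s => v := rfl
    rw [this]
    simp only [smul_apply, smulLeftCLM_apply_apply hg, ih, Complex.real_smul, smul_eq_mul]
    ring

lemma lintegral_sq_fourier (f : 𝓢(𝔼, ℂ)) : ∫⁻ ξ, ‖𝓕 f ξ‖ₑ ^ 2 = ∫⁻ ξ, ‖f ξ‖ₑ ^ 2 := by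
  have h := norm_fourier_toL2_eq f
  simp only [SchwartzMap.norm_toLp] at h
  rw [ENNReal.toReal_eq_toReal_iff' (SchwartzMap.memLp _ _ _).eLpNorm_ne_top
    (SchwartzMap.memLp _ _ _).eLpNorm_ne_top] at h
  rw [← eLpNorm_two_sq, ← eLpNorm_two_sq, h]

lemma lintegral_sq_fourierInv (f : 𝓢(𝔼, ℂ)) : ∫⁻ ξ, ‖𝓕⁻ f ξ‖ₑ ^ 2 = ∫⁻ ξ, ‖f ξ‖ₑ ^ 2 := by
  rw [← lintegral_sq_fourier (𝓕⁻ f)]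
  simp

/-- The complexification of a test function as a Schwartz function. -/
def toSchwartzC (f : 𝔼 → ℝ) (h : HasCompactSupport f) (hf : ContDiff ℝ ∞ f) : 𝓢(𝔼, ℂ) :=
  HasCompactSupport.toSchwartzMap (f := fun y => (f y : ℂ))
    (h.comp_left (g := fun t : ℝ => (t : ℂ)) (by simp)) (Complex.ofRealCLM.contDiff.comp hf)

@[simp] lemma toSchwartzC_apply (f : 𝔼 → ℝ) (h : HasCompactSupport f) (hf : ContDiff ℝ ∞ f)
    (y : 𝔼) : toSchwartzC f h hf y = (f y : ℂ) := rfl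

lemma norm_iteratedFDeriv_toSchwartzC (f : 𝔼 → ℝ) (h : HasCompactSupport f) (hf : ContDiff ℝ ∞ f)
    (s : ℕ) (y : 𝔼) : ‖iteratedFDeriv ℝ s (toSchwartzC f h hf) y‖ = ‖iteratedFDeriv ℝ s f y‖ := by
  have : (toSchwartzC f h hf : 𝔼 → ℂ) = Complex.ofRealLI ∘ f := rfl
  rw [this]
  exact LinearIsometry.norm_iteratedFDeriv_comp_left _ (hf.contDiffAt (x := y))
    (mod_cast le_top)

/-- Weighted bound of the Fourier transform by the Sobolev norm. -/
lemma exists_lintegral_weighted_le (s : ℕ) : ∃ C : ℝ≥0, ∀ (f : 𝔼 → ℝ)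
    (h : HasCompactSupport f) (hf : ContDiff ℝ ∞ f),
    ∫⁻ ξ, (bracket ξ ^ s * ‖𝓕⁻ (toSchwartzC f h hf) ξ‖ₑ) ^ 2 ≤ C * sobNorm s f ^ 2 := by
  obtain ⟨C, hC0, hC⟩ := bracket_pow_le (n := n) s
  refine ⟨(C * (1 + n)).toNNReal, fun f h hf => ?_⟩
  set g := toSchwartzC f h hf
  have hterm : ∀ j ≤ s, eLpNorm (iteratedFDeriv ℝ j f) 2 volume ≤ sobNorm s f := fun j hj =>
    Finset.single_le_sum (f := fun j => eLpNorm (iteratedFDeriv ℝ j f) 2 volume)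
      (fun _ _ => zero_le) (Finset.mem_range.2 (by omega))
  have hder : ∀ i : Fin n, ∫⁻ ξ, ‖𝓕⁻ (∂^{fun _ : Fin s => EuclideanSpace.single i (1 : ℝ)} g) ξ‖ₑ ^ 2 ≤
      sobNorm s f ^ 2 := by
    intro i
    rw [lintegral_sq_fourierInv]
    refine le_trans ?_ (pow_le_pow_left' (hterm s le_rfl) 2)
    rw [eLpNorm_two_sq]
    refine lintegral_mono fun y => ?_
    gcongr
    rw [iteratedLineDerivOp_eq_iteratedFDeriv, enorm_le_iff_norm_le,
      ← norm_iteratedFDeriv_toSchwartzC f h hf]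
    refine (ContinuousMultilinearMap.le_opNorm _ _).trans ?_
    simp [g]
  have hzero : ∫⁻ ξ, ‖𝓕⁻ g ξ‖ₑ ^ 2 ≤ sobNorm s f ^ 2 := by
    rw [lintegral_sq_fourierInv]
    refine le_trans ?_ (pow_le_pow_left' (hterm 0 (Nat.zero_le _)) 2)
    rw [eLpNorm_two_sq]
    refine lintegral_mono fun y => ?_
    gcongr
    rw [enorm_le_iff_norm_le]
    simp [g]
  have hpt : ∀ ξ, (bracket ξ ^ s * ‖𝓕⁻ g ξ‖ₑ) ^ 2 ≤ ENNReal.ofReal C * (‖𝓕⁻ g ξ‖ₑ ^ 2 +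
      ∑ i : Fin n, ‖𝓕⁻ (∂^{fun _ : Fin s => EuclideanSpace.single i (1 : ℝ)} g) ξ‖ₑ ^ 2) := by
    intro ξ
    have e1 : ∀ i : Fin n, |ξ i| ^ (2 * s) * ‖𝓕⁻ g ξ‖ ^ 2 ≤
        ‖𝓕⁻ (∂^{fun _ : Fin s => EuclideanSpace.single i (1 : ℝ)} g) ξ‖ ^ 2 := by
      intro i
      rw [fourierInv_iterated, norm_mul, norm_pow, norm_mul, mul_pow, ← pow_mul, mul_comm s 2]
      gcongr
      simp only [norm_neg, norm_mul, Complex.norm_I, Complex.norm_real, Real.norm_eq_abs,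
        EuclideanSpace.inner_single_right, mul_one, one_mul, Complex.norm_ofNat]
      -- Each derivative brings a factor `2π`, which is at least `1` and is dropped.
      have : (1 : ℝ) ≤ 2 * |Real.pi| := by
        rw [abs_of_pos Real.pi_pos]; linarith [Real.pi_gt_three]
      have h2 : |(starRingEnd ℝ) (ξ i)| = |ξ i| := by simp
      nlinarith [abs_nonneg (ξ i)]
    have e2 : (1 + ‖ξ‖) ^ (2 * s) * ‖𝓕⁻ g ξ‖ ^ 2 ≤ C * (‖𝓕⁻ g ξ‖ ^ 2 +
        ∑ i : Fin n, ‖𝓕⁻ (∂^{fun _ : Fin s => EuclideanSpace.single i (1 : ℝ)} g) ξ‖ ^ 2) := by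
      calc _ ≤ (C * (1 + ∑ i, |ξ i| ^ (2 * s))) * ‖𝓕⁻ g ξ‖ ^ 2 := by gcongr; exact hC ξ
        _ = C * (‖𝓕⁻ g ξ‖ ^ 2 + ∑ i, |ξ i| ^ (2 * s) * ‖𝓕⁻ g ξ‖ ^ 2) := by
          rw [mul_assoc, add_mul, one_mul, Finset.sum_mul]
        _ ≤ _ := by gcongr with i; exact e1 i
    have e3 := ENNReal.ofReal_le_ofReal e2
    rw [ENNReal.ofReal_mul hC0, ENNReal.ofReal_add (by positivity) (by positivity),
      ENNReal.ofReal_sum_of_nonneg (fun _ _ => by positivity),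
      ENNReal.ofReal_mul (by positivity)] at e3
    simp only [ENNReal.ofReal_pow (norm_nonneg _), ofReal_norm] at e3
    rw [ENNReal.ofReal_pow (by positivity)] at e3
    rw [mul_pow, ← pow_mul, mul_comm s 2]
    exact e3
  have hm : ∀ k : 𝓢(𝔼, ℂ), Measurable fun ξ => ‖𝓕⁻ k ξ‖ₑ ^ 2 := fun k =>
    ((𝓕⁻ k).continuous.measurable.enorm).pow_const 2
  calc _ ≤ ∫⁻ ξ, ENNReal.ofReal C * (‖𝓕⁻ g ξ‖ₑ ^ 2 +
      ∑ i : Fin n, ‖𝓕⁻ (∂^{fun _ : Fin s => EuclideanSpace.single i (1 : ℝ)} g) ξ‖ₑ ^ 2) :=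
        lintegral_mono hpt
    _ = ENNReal.ofReal C * ((∫⁻ ξ, ‖𝓕⁻ g ξ‖ₑ ^ 2) + ∑ i : Fin n,
        ∫⁻ ξ, ‖𝓕⁻ (∂^{fun _ : Fin s => EuclideanSpace.single i (1 : ℝ)} g) ξ‖ₑ ^ 2) := by
      rw [lintegral_const_mul' _ _ ENNReal.ofReal_ne_top, lintegral_add_left (hm g),
        lintegral_finsetSum _ fun i _ => hm _]
    _ ≤ ENNReal.ofReal C * (sobNorm s f ^ 2 + ∑ _i : Fin n, sobNorm s f ^ 2) := by
      gcongr with i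
      exact hder i
    _ = _ := by
      simp only [Finset.sum_const, Finset.card_univ, Fintype.card_fin, nsmul_eq_mul]
      rw [show (((C * (1 + n)).toNNReal : ℝ≥0) : ℝ≥0∞) = ENNReal.ofReal C * (1 + n) by
        change ENNReal.ofReal (C * (1 + n)) = _
        rw [ENNReal.ofReal_mul hC0, ENNReal.ofReal_add (by norm_num) (by positivity)]
        simp]
      ring

end Fourier

end

section

/-! ### Products of two Sobolev functions on the whole space -/

section SobolevProduct

open SchwartzMap FourierTransform

variable {n : ℕ}

local notation "𝔼" => EuclideanSpace ℝ (Fin n)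

/-- Smooth functions with compact support. -/
structure IsCcInfty (f : 𝔼 → ℝ) : Prop where
  contDiff : ContDiff ℝ ∞ f
  hasCompactSupport : HasCompactSupport f

/-- Cauchy–Schwarz after inserting the weight and its inverse, the inverse being square integrable.
-/
lemma exists_lintegral_fourierInv_le {σ : ℕ} (hσ : n < 2 * σ) : ∃ C : ℝ≥0, ∀ F : 𝓢(𝔼, ℂ),
    (∫⁻ ξ, ‖F ξ‖ₑ) ^ 2 ≤ C * ∫⁻ ξ, (bracket ξ ^ σ * ‖F ξ‖ₑ) ^ 2 := by
  refine ⟨(∫⁻ ξ : 𝔼, ((bracket ξ ^ σ)⁻¹) ^ 2).toNNReal, fun F => ?_⟩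
  rw [ENNReal.coe_toNNReal (lintegral_bracket_lt_top hσ).ne]
  have hm := (measurable_bracket (n := n)).pow_const σ
  refine le_trans (le_of_eq ?_) (lintegral_mul_sq_le (μ := volume) hm.inv.aemeasurable
    (hm.mul F.continuous.measurable.enorm).aemeasurable)
  congr 1
  refine lintegral_congr fun ξ => ?_
  rw [← mul_assoc, ENNReal.inv_mul_cancel (pow_ne_zero _ (bracket_ne_zero ξ))
    (ENNReal.pow_ne_top (bracket_ne_top ξ)), one_mul]

/-- The convolution of two functions with weighted square integrability of total order `σ > n / 2`
is square integrable. -/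
lemma exists_lintegral_convolution_le {s t : ℕ} (hst : n < 2 * (s + t)) :
    ∃ C : ℝ≥0, ∀ F G : 𝓢(𝔼, ℂ), ∫⁻ ξ, (∫⁻ η, ‖F (ξ - η)‖ₑ * ‖G η‖ₑ) ^ 2 ≤
      C * (∫⁻ ξ, (bracket ξ ^ s * ‖F ξ‖ₑ) ^ 2) * ∫⁻ ξ, (bracket ξ ^ t * ‖G ξ‖ₑ) ^ 2 := by
  set I := ∫⁻ ξ : 𝔼, ((bracket ξ ^ (s + t))⁻¹) ^ 2 with hI
  have hItop := lintegral_bracket_lt_top hst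
  refine ⟨(4 * I).toNNReal, fun F G => ?_⟩
  rw [ENNReal.coe_toNNReal (ENNReal.mul_ne_top (by norm_num) hItop.ne)]
  have hm := fun k => (measurable_bracket (n := n)).pow_const k
  set A : 𝔼 → ℝ≥0∞ := fun ξ => bracket ξ ^ s * ‖F ξ‖ₑ with hA
  set B : 𝔼 → ℝ≥0∞ := fun ξ => bracket ξ ^ t * ‖G ξ‖ₑ with hB
  have hAm : Measurable A := (hm s).mul F.continuous.measurable.enorm
  have hBm : Measurable B := (hm t).mul G.continuous.measurable.enorm
  set A' : 𝔼 → ℝ≥0∞ := fun ξ => (bracket ξ ^ (s + t))⁻¹ * A ξ with hA'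
  set B' : 𝔼 → ℝ≥0∞ := fun ξ => (bracket ξ ^ (s + t))⁻¹ * B ξ with hB'
  have hA'm : Measurable A' := (hm _).inv.mul hAm
  have hB'm : Measurable B' := (hm _).inv.mul hBm
  have hle : ∀ ξ η, ‖F (ξ - η)‖ₑ * ‖G η‖ₑ ≤ A' (ξ - η) * B η + A (ξ - η) * B' η := by
    intro ξ η
    set p := bracket (ξ - η)
    set q := bracket η
    have hp := one_le_bracket (ξ - η)
    have hq := one_le_bracket η
    have hp0 := bracket_ne_zero (ξ - η)
    have hq0 := bracket_ne_zero η
    have hpt := bracket_ne_top (ξ - η)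
    have hqt := bracket_ne_top η
    -- The whole decay of order `s + t` is placed on the factor with the smaller frequency: if `p ≤
    -- q` then `p ^ (s + t) ≤ p ^ s * q ^ t`. That factor becomes integrable while the other stays
    -- in `L²`, which is what Young's inequality asks for.
    rcases le_total p q with h | h
    · refine le_trans ?_ le_self_add
      have e : A' (ξ - η) * B η = ((p ^ (s + t))⁻¹ * (p ^ s * q ^ t)) *
          (‖F (ξ - η)‖ₑ * ‖G η‖ₑ) := by simp only [hA', hA, hB, p, q]; ring
      rw [e]
      refine le_mul_of_one_le_left zero_le ?_
      have : p ^ (s + t) ≤ p ^ s * q ^ t := by rw [pow_add]; gcongr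
      calc (1 : ℝ≥0∞) = (p ^ (s + t))⁻¹ * p ^ (s + t) :=
            (ENNReal.inv_mul_cancel (pow_ne_zero _ hp0) (ENNReal.pow_ne_top hpt)).symm
        _ ≤ _ := by gcongr
    · refine le_trans ?_ le_add_self
      have e : A (ξ - η) * B' η = ((q ^ (s + t))⁻¹ * (p ^ s * q ^ t)) *
          (‖F (ξ - η)‖ₑ * ‖G η‖ₑ) := by simp only [hB', hA, hB, p, q]; ring
      rw [e]
      refine le_mul_of_one_le_left zero_le ?_
      have : q ^ (s + t) ≤ p ^ s * q ^ t := by rw [pow_add]; gcongr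
      calc (1 : ℝ≥0∞) = (q ^ (s + t))⁻¹ * q ^ (s + t) :=
            (ENNReal.inv_mul_cancel (pow_ne_zero _ hq0) (ENNReal.pow_ne_top hqt)).symm
        _ ≤ _ := by gcongr
  have hL1 : ∀ K : 𝔼 → ℝ≥0∞, Measurable K →
      (∫⁻ ξ, (bracket ξ ^ (s + t))⁻¹ * K ξ) ^ 2 ≤ I * ∫⁻ ξ, K ξ ^ 2 := fun K hK =>
    lintegral_mul_sq_le (hm _).inv.aemeasurable hK.aemeasurable
  have hsq : ∀ a b : ℝ≥0∞, (a + b) ^ 2 ≤ 2 * (a ^ 2 + b ^ 2) := by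
    intro a b
    have := ENNReal.rpow_add_le_mul_rpow_add_rpow a b (p := 2) (by norm_num)
    norm_num at this
    simpa only [← ENNReal.rpow_natCast, Nat.cast_ofNat] using this
  -- Young's inequality with the roles exchanged: here the second factor is the integrable one, so
  -- the inner integral is reflected first.
  have hY2 : ∫⁻ ξ, (∫⁻ η, A (ξ - η) * B' η) ^ 2 ≤ (∫⁻ ξ, A ξ ^ 2) * (∫⁻ ξ, B' ξ) ^ 2 := by
    have h := lintegral_convolution_sq_le (μ := (volume : Measure 𝔼)) hB'm hAm
    rw [mul_comm] at h
    refine le_trans (le_of_eq ?_) h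
    refine lintegral_congr fun ξ => ?_
    congr 1
    rw [← lintegral_sub_left_eq_self _ ξ]
    refine lintegral_congr fun η => ?_
    rw [sub_sub_cancel, mul_comm]
  have hAs : ∀ ξ, Measurable fun η => A' (ξ - η) * B η := fun ξ =>
    (hA'm.comp (measurable_const.sub measurable_id)).mul hBm
  have hmeas : Measurable fun ξ => ∫⁻ η, A' (ξ - η) * B η := by
    have : Measurable (Function.uncurry fun ξ η => A' (ξ - η) * B η) :=
      (hA'm.comp (measurable_fst.sub measurable_snd)).mul (hBm.comp measurable_snd)
    exact this.lintegral_prod_right'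
  calc ∫⁻ ξ, (∫⁻ η, ‖F (ξ - η)‖ₑ * ‖G η‖ₑ) ^ 2
      ≤ ∫⁻ ξ, 2 * ((∫⁻ η, A' (ξ - η) * B η) ^ 2 + (∫⁻ η, A (ξ - η) * B' η) ^ 2) := by
        refine lintegral_mono fun ξ => ?_
        refine le_trans (pow_le_pow_left' (lintegral_mono (hle ξ)) 2) ?_
        rw [lintegral_add_left (hAs ξ)]
        exact hsq _ _
    _ = 2 * ((∫⁻ ξ, (∫⁻ η, A' (ξ - η) * B η) ^ 2) + ∫⁻ ξ, (∫⁻ η, A (ξ - η) * B' η) ^ 2) := by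
        rw [lintegral_const_mul' _ _ (by norm_num), lintegral_add_left (hmeas.pow_const 2)]
    _ ≤ 2 * ((I * ∫⁻ ξ, A ξ ^ 2) * (∫⁻ ξ, B ξ ^ 2) +
          (∫⁻ ξ, A ξ ^ 2) * (I * ∫⁻ ξ, B ξ ^ 2)) := by
        gcongr
        · exact (lintegral_convolution_sq_le hA'm hBm).trans (by gcongr; exact hL1 A hAm)
        · exact hY2.trans (by gcongr; exact hL1 B hBm)
    _ = _ := by ring

/-- Products in the Sobolev scale: `H^s * H^t ⊆ L²` if `s + t > n / 2`. -/
lemma exists_eLpNorm_mul_le {s t : ℕ} (hst : n < 2 * (s + t)) :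
    ∃ C : ℝ≥0, ∀ f g : 𝔼 → ℝ, IsCcInfty f → IsCcInfty g →
      eLpNorm (fun y => f y * g y) 2 volume ≤ C * sobNorm s f * sobNorm t g := by
  obtain ⟨C₁, h₁⟩ := exists_lintegral_convolution_le hst
  obtain ⟨C₂, h₂⟩ := exists_lintegral_weighted_le (n := n) s
  obtain ⟨C₃, h₃⟩ := exists_lintegral_weighted_le (n := n) t
  refine ⟨NNReal.sqrt (C₁ * C₂ * C₃), fun f g hf hg => ?_⟩
  set F := 𝓕⁻ (toSchwartzC f hf.2 hf.1) with hF
  set G := 𝓕⁻ (toSchwartzC g hg.2 hg.1) with hG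
  rw [eLpNorm_two_le_iff]
  have e1 : ∀ y, ‖f y * g y‖ₑ ^ 2 =
      ‖𝓕 (SchwartzMap.convolution (ContinuousLinearMap.mul ℂ ℂ) F G) y‖ₑ ^ 2 := by
    intro y
    rw [SchwartzMap.fourier_convolution]
    simp only [hF, hG, FourierTransform.fourier_fourierInv_eq, pairing_apply_apply,
      ContinuousLinearMap.mul_apply', toSchwartzC_apply]
    rw [← Complex.ofReal_mul]
    congr 1
    rw [← ofReal_norm, ← ofReal_norm, Complex.norm_real]
  have e2 : ∀ ξ, ‖SchwartzMap.convolution (ContinuousLinearMap.mul ℂ ℂ) F G ξ‖ₑ ≤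
      ∫⁻ η, ‖F (ξ - η)‖ₑ * ‖G η‖ₑ := by
    intro ξ
    rw [SchwartzMap.convolution_apply, MeasureTheory.convolution]
    refine (enorm_integral_le_lintegral_enorm _).trans ?_
    rw [← lintegral_sub_left_eq_self _ ξ]
    refine lintegral_mono fun η => ?_
    simp [sub_sub_cancel, enorm_mul]
  calc ∫⁻ y, ‖f y * g y‖ₑ ^ 2 = ∫⁻ ξ, ‖SchwartzMap.convolution (ContinuousLinearMap.mul ℂ ℂ) F G ξ‖ₑ ^ 2 := by
        rw [lintegral_congr e1, lintegral_sq_fourier]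
    _ ≤ ∫⁻ ξ, (∫⁻ η, ‖F (ξ - η)‖ₑ * ‖G η‖ₑ) ^ 2 :=
        lintegral_mono fun ξ => pow_le_pow_left' (e2 ξ) 2
    _ ≤ C₁ * (C₂ * sobNorm s f ^ 2) * (C₃ * sobNorm t g ^ 2) :=
        (h₁ F G).trans (by gcongr; exacts [h₂ f hf.2 hf.1, h₃ g hg.2 hg.1])
    _ = ((NNReal.sqrt (C₁ * C₂ * C₃) ^ 2 : ℝ≥0) : ℝ≥0∞) * sobNorm s f ^ 2 * sobNorm t g ^ 2 := by
        rw [NNReal.sq_sqrt]; push_cast; ring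
    _ = _ := by push_cast; ring

/-- The Sobolev embedding into bounded functions. -/
lemma exists_enorm_le_sobNorm {σ : ℕ} (hσ : n < 2 * σ) : ∃ C : ℝ≥0, ∀ f : 𝔼 → ℝ, IsCcInfty f →
    ∀ y, ‖f y‖ₑ ≤ C * sobNorm σ f := by
  obtain ⟨C₁, h₁⟩ := exists_lintegral_fourierInv_le hσ
  obtain ⟨C₂, h₂⟩ := exists_lintegral_weighted_le (n := n) σ
  refine ⟨NNReal.sqrt (C₁ * C₂), fun f hf y => ?_⟩
  set F := 𝓕⁻ (toSchwartzC f hf.2 hf.1) with hF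
  have e0 : ((f y : ℝ) : ℂ) = 𝓕 F y := by simp [hF]
  have e1 : ‖f y‖ₑ ≤ ∫⁻ ξ, ‖F ξ‖ₑ := by
    have : ‖f y‖ₑ = ‖𝓕 F y‖ₑ := by
      rw [← e0, ← ofReal_norm, ← ofReal_norm, Complex.norm_real]
    rw [this, SchwartzMap.fourier_coe, Real.fourier_eq]
    refine (enorm_integral_le_lintegral_enorm _).trans (lintegral_mono fun ξ => ?_)
    rw [← ofReal_norm, ← ofReal_norm, Circle.norm_smul]
  rw [← ENNReal.pow_le_pow_left_iff (two_ne_zero)]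
  calc _ ≤ (∫⁻ ξ, ‖F ξ‖ₑ) ^ 2 := pow_le_pow_left' e1 2
    _ ≤ C₁ * (C₂ * sobNorm σ f ^ 2) := (h₁ F).trans (by gcongr; exact h₂ f hf.2 hf.1)
    _ = ((NNReal.sqrt (C₁ * C₂) ^ 2 : ℝ≥0) : ℝ≥0∞) * sobNorm σ f ^ 2 := by
        rw [NNReal.sq_sqrt]; push_cast; ring
    _ = _ := by push_cast; ring

end SobolevProduct

end

section

/-! ### Multilinear estimates on the whole space -/

section FlatProduct

variable {n : ℕ}

local notation "𝔼" => EuclideanSpace ℝ (Fin n)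

lemma natCast_le_infty (k : ℕ) : ((k : ℕ) : WithTop ℕ∞) ≤ (∞ : WithTop ℕ∞) := by
  exact_mod_cast (le_top : ((k : ℕ) : ℕ∞) ≤ ⊤)

lemma _root_.ContDiff.of_infty {F : Type*} [NormedAddCommGroup F] [NormedSpace ℝ F] {f : 𝔼 → F}
    (hf : ContDiff ℝ ∞ f) (k : ℕ) : ContDiff ℝ k f := hf.of_le (natCast_le_infty k)

namespace IsCcInfty

variable {f g : EuclideanSpace ℝ (Fin n) → ℝ}

lemma mul (hf : IsCcInfty f) (hg : ContDiff ℝ ∞ g) : IsCcInfty (fun y => g y * f y) :=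
  ⟨hg.mul hf.1, hf.2.mul_left⟩

lemma fderiv_apply (hf : IsCcInfty f) (v : 𝔼) : IsCcInfty (fun y => fderiv ℝ f y v) :=
  ⟨((hf.1.fderiv_right (m := ∞) (by simp)).clm_apply contDiff_const), hf.2.fderiv_apply ℝ v⟩

lemma lieWord_const {ι : Type*} (hf : IsCcInfty f) (v : ι → 𝔼) (τ : List ι) :
    IsCcInfty (lieWord (fun a _ => v a) τ f) := by
  induction τ with
  | nil => exact hf
  | cons a τ ih => exact ih.fderiv_apply (v a)

lemma aestronglyMeasurable_iteratedFDeriv (hf : IsCcInfty f) (j : ℕ) (μ : Measure 𝔼) :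
    AEStronglyMeasurable (iteratedFDeriv ℝ j f) μ :=
  ((hf.1.of_infty j).continuous_iteratedFDeriv le_rfl).aestronglyMeasurable

end IsCcInfty

lemma sobNorm_mono {s t : ℕ} (h : s ≤ t) (f : 𝔼 → ℝ) : sobNorm s f ≤ sobNorm t f :=
  Finset.sum_le_sum_of_subset (Finset.range_mono (by omega))

lemma sobNorm_zero (f : 𝔼 → ℝ) : sobNorm 0 f = eLpNorm f 2 volume := by
  simp only [sobNorm, zero_add, Finset.sum_range_one]
  exact eLpNorm_congr_norm_ae (Eventually.of_forall fun y => by simp)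

lemma sobNorm_add_le (s : ℕ) {f g : 𝔼 → ℝ} (hf : IsCcInfty f) (hg : IsCcInfty g) :
    sobNorm s (fun y => f y + g y) ≤ sobNorm s f + sobNorm s g := by
  rw [sobNorm, sobNorm, sobNorm, ← Finset.sum_add_distrib]
  refine Finset.sum_le_sum fun j _ => ?_
  have : iteratedFDeriv ℝ j (fun y => f y + g y) = iteratedFDeriv ℝ j f + iteratedFDeriv ℝ j g :=
    iteratedFDeriv_add (hf.1.of_infty j) (hg.1.of_infty j)
  rw [this]
  exact eLpNorm_add_le (hf.aestronglyMeasurable_iteratedFDeriv j _)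
    (hg.aestronglyMeasurable_iteratedFDeriv j _) (by norm_num)

lemma sobNorm_fderiv_apply_le (s : ℕ) {f : 𝔼 → ℝ} (hf : IsCcInfty f) {v : 𝔼} (hv : ‖v‖ ≤ 1) :
    sobNorm s (fun y => fderiv ℝ f y v) ≤ sobNorm (s + 1) f := by
  have h : ∀ j, eLpNorm (iteratedFDeriv ℝ j fun y => fderiv ℝ f y v) 2 volume ≤
      eLpNorm (iteratedFDeriv ℝ (j + 1) f) 2 volume := by
    intro j
    refine eLpNorm_mono fun y => ?_
    have h1 := (ContinuousLinearMap.apply ℝ ℝ v).norm_iteratedFDeriv_comp_left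
      (f := fderiv ℝ f) (x := y)
      (hf.1.fderiv_right (m := ∞) (by simp)).contDiffAt (natCast_le_infty j)
    rw [norm_iteratedFDeriv_fderiv] at h1
    refine h1.trans (mul_le_of_le_one_left (norm_nonneg _) ?_)
    refine ContinuousLinearMap.opNorm_le_bound _ zero_le_one fun l => ?_
    rw [one_mul]
    exact (l.le_opNorm v).trans (mul_le_of_le_one_right (norm_nonneg _) hv)
  rw [sobNorm, sobNorm, Finset.sum_range_succ' _ (s + 1)]
  exact (Finset.sum_le_sum fun j _ => h j).trans le_self_add

/-- The derivative is written as the sum of the partial derivatives times the coordinate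
functionals, which have norm at most one. -/
lemma norm_iteratedFDeriv_succ_le_sum {f : 𝔼 → ℝ} {y : 𝔼} {j : ℕ}
    (hf : ContDiffAt ℝ (j + 1 : ℕ) f y) :
    ‖iteratedFDeriv ℝ (j + 1) f y‖ ≤
      ∑ i, ‖iteratedFDeriv ℝ j (fun y => fderiv ℝ f y (EuclideanSpace.single i 1)) y‖ := by
  rw [← norm_iteratedFDeriv_fderiv]
  set L : Fin n → (ℝ →L[ℝ] (𝔼 →L[ℝ] ℝ)) := fun i =>
    ContinuousLinearMap.toSpanSingleton ℝ (EuclideanSpace.proj i : 𝔼 →L[ℝ] ℝ)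
  have hd : ContDiffAt ℝ j (fderiv ℝ f) y := hf.fderiv_right (by push_cast; exact le_rfl)
  have hdi : ∀ i, ContDiffAt ℝ j (fun y => fderiv ℝ f y (EuclideanSpace.single i 1)) y :=
    fun i => hd.clm_apply contDiffAt_const
  have hsum : fderiv ℝ f = fun y => ∑ i,
      (L i ∘ fun y => fderiv ℝ f y (EuclideanSpace.single i 1)) y := by
    ext z v
    have hv : v = ∑ i, v i • (EuclideanSpace.single i (1 : ℝ) : 𝔼) := by
      have := (EuclideanSpace.basisFun (Fin n) ℝ).sum_repr v
      simpa using this.symm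
    conv_lhs => rw [hv]
    simp [L, map_sum, mul_comm]
  have hfun : (fun y => ∑ i, (L i ∘ fun y => fderiv ℝ f y (EuclideanSpace.single i 1)) y) =
      ∑ i, (L i ∘ fun y => fderiv ℝ f y (EuclideanSpace.single i 1)) := by
    ext; simp
  rw [hfun] at hsum
  conv_lhs => rw [hsum]
  rw [iteratedFDeriv_sum_apply (fun i _ => (L i).contDiff.contDiffAt.comp y (hdi i))]
  refine (norm_sum_le _ _).trans (Finset.sum_le_sum fun i _ => ?_)
  refine ((L i).norm_iteratedFDeriv_comp_left (hdi i) le_rfl).trans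
    (mul_le_of_le_one_left (norm_nonneg _) ?_)
  simp only [L, ContinuousLinearMap.norm_toSpanSingleton]
  refine ContinuousLinearMap.opNorm_le_bound _ zero_le_one fun v => ?_
  rw [one_mul]
  exact PiLp.norm_apply_le v i

lemma sobNorm_succ_le (s : ℕ) {f : 𝔼 → ℝ} (hf : IsCcInfty f) :
    sobNorm (s + 1) f ≤
      sobNorm 0 f + ∑ i, sobNorm s (fun y => fderiv ℝ f y (EuclideanSpace.single i 1)) := by
  have h : ∀ j, eLpNorm (iteratedFDeriv ℝ (j + 1) f) 2 volume ≤
      ∑ i, eLpNorm (iteratedFDeriv ℝ j fun y => fderiv ℝ f y (EuclideanSpace.single i 1)) 2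
        volume := by
    intro j
    have h1 : ∀ i : Fin n, AEStronglyMeasurable (fun y => ‖iteratedFDeriv ℝ j
        (fun y => fderiv ℝ f y (EuclideanSpace.single i 1)) y‖) (volume : Measure 𝔼) := fun i =>
      ((hf.fderiv_apply _).aestronglyMeasurable_iteratedFDeriv j _).norm
    calc _ ≤ eLpNorm (∑ i, fun y => ‖iteratedFDeriv ℝ j
        (fun y => fderiv ℝ f y (EuclideanSpace.single i 1)) y‖) 2 volume := by
          refine eLpNorm_mono_real fun y => ?_
          rw [Finset.sum_apply]
          exact norm_iteratedFDeriv_succ_le_sum (hf.1.of_infty _).contDiffAt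
      _ ≤ ∑ i, eLpNorm (fun y => ‖iteratedFDeriv ℝ j
        (fun y => fderiv ℝ f y (EuclideanSpace.single i 1)) y‖) 2 volume :=
          eLpNorm_sum_le (fun i _ => h1 i) (by norm_num)
      _ = _ := by simp only [eLpNorm_norm]
  rw [sobNorm, Finset.sum_range_succ', add_comm]
  simp only [sobNorm, zero_add, Finset.sum_range_one]
  rw [Finset.sum_comm]
  exact add_le_add le_rfl (Finset.sum_le_sum fun j _ => h j)

/-- Multiplication in the Sobolev scale. -/
lemma exists_sobNorm_mul_le {σ : ℕ} (hσ : n < 2 * σ) (m : ℕ) : ∀ a b : ℕ, a + b + m ≤ σ →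
    ∃ C : ℝ≥0, ∀ f g : 𝔼 → ℝ, IsCcInfty f → IsCcInfty g →
      sobNorm m (fun y => f y * g y) ≤ C * sobNorm (σ - a) f * sobNorm (σ - b) g := by
  induction m with
  | zero =>
    intro a b hab
    -- The first factor is used in full, with order `σ - a`. The second then needs only order `a`,
    -- and it has at least that much since `a ≤ σ - b`.
    obtain ⟨C, hC⟩ := exists_eLpNorm_mul_le (n := n) (s := σ - a) (t := a) (by omega)
    refine ⟨C, fun f g hf hg => ?_⟩
    rw [sobNorm_zero]
    refine (hC f g hf hg).trans ?_
    gcongr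
    exact sobNorm_mono (by omega) g
  | succ m ih =>
    intro a b hab
    obtain ⟨C₀, h₀⟩ := exists_eLpNorm_mul_le (n := n) (s := σ - a) (t := a) (by omega)
    -- A derivative of the product falls on one of the factors and is charged to its loss index, `a`
    -- or `b`; the budget `a + b + m ≤ σ` is unchanged.
    obtain ⟨C₁, h₁⟩ := ih (a + 1) b (by omega)
    obtain ⟨C₂, h₂⟩ := ih a (b + 1) (by omega)
    refine ⟨C₀ + n * (C₁ + C₂), fun f g hf hg => ?_⟩
    have hfg : IsCcInfty (fun y => f y * g y) := hg.mul hf.1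
    refine (sobNorm_succ_le m hfg).trans ?_
    have e0 : sobNorm 0 (fun y => f y * g y) ≤ C₀ * sobNorm (σ - a) f * sobNorm (σ - b) g := by
      rw [sobNorm_zero]
      refine (h₀ f g hf hg).trans ?_
      gcongr
      exact sobNorm_mono (by omega) g
    have ei : ∀ i : Fin n, sobNorm m (fun y => fderiv ℝ (fun y => f y * g y) y
        (EuclideanSpace.single i 1)) ≤
        (C₁ + C₂) * (sobNorm (σ - a) f * sobNorm (σ - b) g) := by
      intro i
      set v : 𝔼 := EuclideanSpace.single i 1
      have hv : ‖v‖ ≤ 1 := by simp [v]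
      have e1 : (fun y => fderiv ℝ (fun y => f y * g y) y v) =
          fun y => fderiv ℝ f y v * g y + f y * fderiv ℝ g y v := by
        ext y
        rw [fderiv_fun_mul (hf.1.differentiable (by simp) y) (hg.1.differentiable (by simp) y)]
        simp only [_root_.add_apply, _root_.smul_apply, smul_eq_mul]
        ring
      rw [e1]
      have hf' := hf.fderiv_apply v
      have hg' := hg.fderiv_apply v
      refine (sobNorm_add_le m (hg.mul hf'.1) (hg'.mul hf.1)).trans ?_
      have p1 := h₁ _ g hf' hg
      have p2 := h₂ f _ hf hg'
      have q1 := sobNorm_fderiv_apply_le (σ - (a + 1)) hf hv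
      have q2 := sobNorm_fderiv_apply_le (σ - (b + 1)) hg hv
      rw [show σ - (a + 1) + 1 = σ - a by omega] at q1
      rw [show σ - (b + 1) + 1 = σ - b by omega] at q2
      calc _ ≤ C₁ * sobNorm (σ - a) f * sobNorm (σ - b) g +
          C₂ * sobNorm (σ - a) f * sobNorm (σ - b) g :=
            add_le_add (p1.trans (by gcongr)) (p2.trans (by gcongr))
        _ = _ := by ring
    refine (add_le_add e0 (Finset.sum_le_sum fun i _ => ei i)).trans (le_of_eq ?_)
    simp only [Finset.sum_const, Finset.card_univ, Fintype.card_fin, nsmul_eq_mul]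
    push_cast
    ring

lemma exists_sobNorm_mul_le_uniform {σ : ℕ} (hσ : n < 2 * σ) :
    ∃ C : ℝ≥0, ∀ m a b : ℕ, a + b + m ≤ σ → ∀ f g : 𝔼 → ℝ, IsCcInfty f → IsCcInfty g →
      sobNorm m (fun y => f y * g y) ≤ C * sobNorm (σ - a) f * sobNorm (σ - b) g := by
  choose! c hc using fun m a b => fun h => exists_sobNorm_mul_le hσ m a b h
  let S := Finset.range (σ + 1) ×ˢ Finset.range (σ + 1) ×ˢ Finset.range (σ + 1)
  refine ⟨∑ p ∈ S, c p.1 p.2.1 p.2.2, fun m a b h f g hf hg => (hc m a b h f g hf hg).trans ?_⟩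
  have : c m a b ≤ ∑ p ∈ S, c p.1 p.2.1 p.2.2 :=
    Finset.single_le_sum (f := fun p : ℕ × ℕ × ℕ => c p.1 p.2.1 p.2.2) (fun _ _ => zero_le)
      (a := (m, a, b)) (by simp only [S, Finset.mem_product, Finset.mem_range]; omega)
  gcongr

/-- Losses add up: the product of the factors already treated behaves like one function whose loss
is the sum of theirs, so factors can be attached one at a time. -/
lemma exists_sobNorm_prod_le {σ : ℕ} (hσ : n < 2 * σ) (N : ℕ) :
    ∃ C : ℝ≥0, ∀ (k : Fin N → ℕ) (k' : ℕ), ∑ i, k i + k' ≤ σ →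
      ∀ (f : Fin N → 𝔼 → ℝ) (u : 𝔼 → ℝ), (∀ i, IsCcInfty (f i)) → IsCcInfty u →
      IsCcInfty (fun y => (∏ i, f i y) * u y) ∧
      sobNorm (σ - (∑ i, k i + k')) (fun y => (∏ i, f i y) * u y) ≤
        C * (∏ i, sobNorm (σ - k i) (f i)) * sobNorm (σ - k') u := by
  obtain ⟨C₀, h₀⟩ := exists_sobNorm_mul_le_uniform (n := n) hσ
  induction N with
  | zero => exact ⟨1, fun k k' _ f u _ hu => by simpa using hu⟩
  | succ N ih =>
    obtain ⟨C, hC⟩ := ih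
    refine ⟨C₀ * C, fun k k' hk f u hf hu => ?_⟩
    simp only [Fin.prod_univ_succ, Fin.sum_univ_succ] at hk ⊢
    obtain ⟨h1, h2⟩ := hC (fun i => k i.succ) k' (by omega) (fun i => f i.succ) u
      (fun i => hf i.succ) hu
    have e : (fun y => (f 0 y * ∏ i : Fin N, f i.succ y) * u y) =
        fun y => f 0 y * ((∏ i : Fin N, f i.succ y) * u y) := by
      ext y; ring
    rw [e]
    refine ⟨h1.mul (hf 0).1, ?_⟩
    refine (h₀ _ (k 0) (∑ i : Fin N, k i.succ + k') (by omega) _ _ (hf 0) h1).trans ?_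
    calc _ ≤ C₀ * sobNorm (σ - k 0) (f 0) *
        (C * (∏ i : Fin N, sobNorm (σ - k i.succ) (f i.succ)) * sobNorm (σ - k') u) := by gcongr
      _ = _ := by push_cast; ring

/-- The directional derivative of a word in the standard basis. -/
abbrev flatWord (τ : List (Fin n)) (f : 𝔼 → ℝ) : 𝔼 → ℝ :=
  lieWord (fun i _ => EuclideanSpace.single i (1 : ℝ)) τ f

lemma sobNorm_flatWord_le (τ : List (Fin n)) : ∀ (s : ℕ) {f : 𝔼 → ℝ}, IsCcInfty f →
    sobNorm s (flatWord τ f) ≤ sobNorm (s + τ.length) f := by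
  induction τ with
  | nil => intro s f _; exact le_rfl
  | cons i τ ih =>
    intro s f hf
    have h := sobNorm_fderiv_apply_le s (hf.lieWord_const (fun i => EuclideanSpace.single i (1 : ℝ)) τ)
      (v := EuclideanSpace.single i 1) (by simp)
    refine h.trans ((ih (s + 1) hf).trans (le_of_eq ?_))
    rw [List.length_cons]
    congr 1
    omega

lemma finite_words (n k : ℕ) : {τ : List (Fin n) | τ.length ≤ k}.Finite :=
  List.finite_length_le _ k

/-- The finite set of words of length at most `k`. -/
def words (n k : ℕ) : Finset (List (Fin n)) := (finite_words n k).toFinset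

@[simp] lemma mem_words {k : ℕ} {τ : List (Fin n)} : τ ∈ words n k ↔ τ.length ≤ k := by
  simp [words]

lemma span_single_eq_top :
    Submodule.span ℝ (Set.range fun i : Fin n => (EuclideanSpace.single i (1 : ℝ) : 𝔼)) = ⊤ := by
  have := (EuclideanSpace.basisFun (Fin n) ℝ).toBasis.span_eq
  rw [OrthonormalBasis.coe_toBasis] at this
  have h : (fun i : Fin n => (EuclideanSpace.single i (1 : ℝ) : 𝔼)) =
      EuclideanSpace.basisFun (Fin n) ℝ := by ext1 i; simp
  rw [h]
  exact this

/-- Fréchet derivatives are controlled by the partial derivatives. -/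
lemma exists_norm_iteratedFDeriv_le_flatWord (s : ℕ) :
    ∃ C : ℝ, 0 ≤ C ∧ ∀ (f : 𝔼 → ℝ) (y : 𝔼), ContDiffAt ℝ s f y →
      ∀ j ≤ s, ‖iteratedFDeriv ℝ j f y‖ ≤ C * ∑ τ ∈ words n j, |flatWord τ f y| := by
  -- The frame is constant, so the compact set may be a single point and the constant it gives is
  -- valid everywhere.
  obtain ⟨c, hc0, hc⟩ := exists_norm_le_sum_frame (isCompact_singleton (x := (0 : 𝔼)))
    (V := fun i _ => (EuclideanSpace.single i (1 : ℝ) : 𝔼)) (fun _ => continuousOn_const)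
    (fun _ _ => span_single_eq_top)
  refine ⟨∑ j ∈ Finset.range (s + 1), c ^ j, by positivity, fun f y hf j hj => ?_⟩
  have h1 := norm_multilinear_le_sum_frame hc0 (hc 0 rfl) (iteratedFDeriv ℝ j f y)
  refine h1.trans (mul_le_mul ?_ ?_ (by positivity) (by positivity))
  · exact Finset.single_le_sum (f := fun j => c ^ j) (fun _ _ => by positivity)
      (Finset.mem_range.2 (by omega))
  · obtain ⟨U, hU, -, hyU, hfU⟩ := (hf.of_le (m := j)
      (mod_cast hj)).exists_isOpen_contDiffOn isOpen_univ (Set.mem_univ y)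
    have h2 : ∀ e : Fin j → Fin n, |iteratedFDeriv ℝ j f y fun i => EuclideanSpace.single (e i) 1| =
        |flatWord (List.ofFn e) f y| := fun e => by
      rw [flatWord, lieWord_const_ofFn hU (fun i => EuclideanSpace.single i (1 : ℝ)) hfU e hyU]
    rw [Finset.sum_congr rfl fun e _ => h2 e]
    rw [← Finset.sum_image (f := fun τ => |flatWord τ f y|) (g := List.ofFn)
      (fun a _ b _ h => List.ofFn_injective h)]
    refine Finset.sum_le_sum_of_subset_of_nonneg ?_ fun _ _ _ => abs_nonneg _
    intro τ hτ
    obtain ⟨e, -, rfl⟩ := Finset.mem_image.1 hτ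
    simp

/-- The sum of the norms of the derivatives up to order `k`. -/
def jetNorm (k : ℕ) (f : 𝔼 → ℝ) (y : 𝔼) : ℝ :=
  ∑ j ∈ Finset.range (k + 1), ‖iteratedFDeriv ℝ j f y‖

lemma jetNorm_nonneg (k : ℕ) (f : 𝔼 → ℝ) (y : 𝔼) : 0 ≤ jetNorm k f y :=
  Finset.sum_nonneg fun _ _ => norm_nonneg _

lemma jetNorm_mono {k l : ℕ} (h : k ≤ l) (f : 𝔼 → ℝ) (y : 𝔼) : jetNorm k f y ≤ jetNorm l f y :=
  Finset.sum_le_sum_of_subset_of_nonneg (Finset.range_mono (by omega)) fun _ _ _ => norm_nonneg _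

lemma exists_jetNorm_le_flatWord (s : ℕ) :
    ∃ C : ℝ, 0 ≤ C ∧ ∀ (f : 𝔼 → ℝ) (y : 𝔼), ∀ k ≤ s, ContDiffAt ℝ k f y →
      jetNorm k f y ≤ C * ∑ τ ∈ words n k, |flatWord τ f y| := by
  choose c hc0 hc using exists_norm_iteratedFDeriv_le_flatWord (n := n)
  refine ⟨∑ k ∈ Finset.range (s + 1), (k + 1) * c k,
    Finset.sum_nonneg fun k _ => mul_nonneg (by positivity) (hc0 k), fun f y k hk hf => ?_⟩
  have h1 : jetNorm k f y ≤ ((k + 1) * c k) * ∑ τ ∈ words n k, |flatWord τ f y| := by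
    have : ∀ j ∈ Finset.range (k + 1), ‖iteratedFDeriv ℝ j f y‖ ≤
        c k * ∑ τ ∈ words n k, |flatWord τ f y| := by
      intro j hj
      have hj' : j ≤ k := by have := Finset.mem_range.1 hj; omega
      refine (hc k f y hf j hj').trans (mul_le_mul_of_nonneg_left ?_ (hc0 k))
      refine Finset.sum_le_sum_of_subset_of_nonneg (fun τ hτ => ?_) fun _ _ _ => abs_nonneg _
      rw [mem_words] at hτ ⊢
      omega
    refine (Finset.sum_le_card_nsmul _ _ _ this).trans (le_of_eq ?_)
    simp only [Finset.card_range, nsmul_eq_mul]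
    push_cast
    ring
  refine h1.trans (mul_le_mul_of_nonneg_right ?_ (by positivity))
  exact Finset.single_le_sum (f := fun k : ℕ => ((k : ℝ) + 1) * c k)
    (fun k _ => mul_nonneg (by positivity) (hc0 k)) (Finset.mem_range.2 (by omega))

/-- The multilinear product estimate on the whole space. -/
lemma exists_eLpNorm_prod_jetNorm_le {r : ℕ} (hr : n < 2 * (r + 1)) (N : ℕ) :
    ∃ C : ℝ≥0, ∀ (k : Fin N → ℕ) (k' : ℕ), ∑ i, k i + k' ≤ r →
      ∀ (f : Fin N → 𝔼 → ℝ) (u : 𝔼 → ℝ), (∀ i, IsCcInfty (f i)) → IsCcInfty u →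
      eLpNorm (fun y => (∏ i, jetNorm (k i) (f i) y) * jetNorm k' u y) 2 volume ≤
        C * (∏ i, sobNorm (r + 1) (f i)) * sobNorm r u := by
  obtain ⟨C₀, hC₀⟩ := exists_sobNorm_prod_le (n := n) hr N
  obtain ⟨c, hc0, hc⟩ := exists_jetNorm_le_flatWord (n := n) r
  let W := words n r
  refine ⟨(c ^ N * c).toNNReal * ((W.card ^ N * W.card : ℕ) * C₀), fun k k' hk f u hf hu => ?_⟩
  have hki : ∀ i, k i ≤ r := fun i =>
    (Finset.single_le_sum (f := k) (fun _ _ => Nat.zero_le _) (Finset.mem_univ i)).trans (by omega)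
  let P := Fintype.piFinset fun i => words n (k i)
  have hpt : ∀ y, ‖(∏ i, jetNorm (k i) (f i) y) * jetNorm k' u y‖ ≤ (c ^ N * c) *
      ∑ p ∈ P ×ˢ words n k', |(∏ i, flatWord (p.1 i) (f i) y) * flatWord p.2 u y| := by
    intro y
    have h1 : ∀ i, jetNorm (k i) (f i) y ≤ c * ∑ τ ∈ words n (k i), |flatWord τ (f i) y| :=
      fun i => hc _ _ _ (hki i) ((hf i).1.of_infty _).contDiffAt
    have h2 := hc u y k' (by omega) (hu.1.of_infty _).contDiffAt
    rw [Real.norm_of_nonneg (mul_nonneg (Finset.prod_nonneg fun i _ => jetNorm_nonneg _ _ _)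
      (jetNorm_nonneg _ _ _))]
    calc _ ≤ (∏ i, (c * ∑ τ ∈ words n (k i), |flatWord τ (f i) y|)) *
          (c * ∑ τ ∈ words n k', |flatWord τ u y|) := by
          refine mul_le_mul (Finset.prod_le_prod (fun i _ => jetNorm_nonneg _ _ _)
            fun i _ => h1 i) h2 (jetNorm_nonneg _ _ _) (Finset.prod_nonneg fun i _ => ?_)
          positivity
      _ = (c ^ N * c) * ((∑ p ∈ P, ∏ i, |flatWord (p i) (f i) y|) *
          ∑ τ ∈ words n k', |flatWord τ u y|) := by
          rw [Finset.prod_mul_distrib, Finset.prod_const, Finset.card_univ, Fintype.card_fin,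
            Finset.prod_univ_sum]
          ring
      _ = _ := by
          rw [Finset.sum_mul_sum, Finset.sum_product]
          simp only [abs_mul, Finset.abs_prod]
  have hterm : ∀ p ∈ P ×ˢ words n k',
      eLpNorm (fun y => (∏ i, flatWord (p.1 i) (f i) y) * flatWord p.2 u y) 2 volume ≤
        C₀ * (∏ i, sobNorm (r + 1) (f i)) * sobNorm r u := by
    rintro ⟨p, q⟩ hp
    simp only [Finset.mem_product, mem_words, Fintype.mem_piFinset, P] at hp
    obtain ⟨hp1, hp2⟩ := hp
    have hsum : ∑ i, (p i).length ≤ ∑ i, k i := Finset.sum_le_sum fun i _ => hp1 i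
    have hb := fun i => (hf i).lieWord_const (fun i => EuclideanSpace.single i (1 : ℝ)) (p i)
    have hbu := hu.lieWord_const (fun i => EuclideanSpace.single i (1 : ℝ)) q
    -- With `σ = r + 1`, the factor `u` in `H^r` starts with a loss of one, hence `q.length + 1`.
    -- The total loss is then at most `r + 1`, exactly the budget.
    have h := (hC₀ (fun i => (p i).length) (q.length + 1) (by omega)
      (fun i => flatWord (p i) (f i)) (flatWord q u) hb hbu).2
    rw [← sobNorm_zero]
    refine (sobNorm_mono (Nat.zero_le _) _).trans (h.trans ?_)
    gcongr with i
    · refine (sobNorm_flatWord_le (p i) _ (hf i)).trans (sobNorm_mono ?_ _)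
      have := hp1 i; have := hki i
      omega
    · refine (sobNorm_flatWord_le q _ hu).trans (sobNorm_mono ?_ _)
      omega
  have hmeas : ∀ p : (Fin N → List (Fin n)) × List (Fin n),
      AEStronglyMeasurable (fun y => |(∏ i, flatWord (p.1 i) (f i) y) * flatWord p.2 u y|)
        (volume : Measure 𝔼) := by
    intro p
    refine Continuous.aestronglyMeasurable ?_
    have hb := fun i => ((hf i).lieWord_const (fun i => EuclideanSpace.single i (1 : ℝ))
      (p.1 i)).1.continuous
    have hbu := (hu.lieWord_const (fun i => EuclideanSpace.single i (1 : ℝ)) p.2).1.continuous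
    exact ((continuous_finsetProd _ fun i _ => hb i).mul hbu).abs
  have hcard : (P ×ˢ words n k').card ≤ W.card ^ N * W.card := by
    rw [Finset.card_product, Fintype.card_piFinset]
    have hW : ∀ l ≤ r, (words n l).card ≤ W.card := fun l hl =>
      Finset.card_le_card fun τ hτ => by
        simp only [W, mem_words] at hτ ⊢
        omega
    refine Nat.mul_le_mul ?_ (hW _ (by omega))
    refine (Finset.prod_le_prod' fun i _ => hW _ (hki i)).trans (le_of_eq ?_)
    simp
  calc _ ≤ eLpNorm ((c ^ N * c) • ∑ p ∈ P ×ˢ words n k',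
        fun y => |(∏ i, flatWord (p.1 i) (f i) y) * flatWord p.2 u y|) 2 volume := by
        refine eLpNorm_mono_real fun y => ?_
        simpa only [Pi.smul_apply, Finset.sum_apply, smul_eq_mul] using hpt y
    _ ≤ ENNReal.ofReal (c ^ N * c) * ∑ p ∈ P ×ˢ words n k',
        eLpNorm (fun y => |(∏ i, flatWord (p.1 i) (f i) y) * flatWord p.2 u y|) 2 volume := by
        rw [eLpNorm_const_smul]
        gcongr
        · rw [Real.enorm_eq_ofReal (by positivity)]
        · exact eLpNorm_sum_le (fun p _ => hmeas p) (by norm_num)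
    _ ≤ ENNReal.ofReal (c ^ N * c) * ((W.card ^ N * W.card : ℕ) *
          (C₀ * (∏ i, sobNorm (r + 1) (f i)) * sobNorm r u)) := by
        gcongr
        refine (Finset.sum_le_card_nsmul _ _ (C₀ * (∏ i, sobNorm (r + 1) (f i)) * sobNorm r u)
          fun p hp => ?_).trans ?_
        · refine le_trans (le_of_eq ?_) (hterm p hp)
          exact eLpNorm_norm (fun y => (∏ i, flatWord (p.1 i) (f i) y) * flatWord p.2 u y)
        · rw [nsmul_eq_mul]
          gcongr
    _ = _ := by
        rw [ENNReal.ofReal]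
        push_cast
        ring

end FlatProduct

end

section

/-! ### The coordinate fields and the blow-down map -/

/-- The word of the ordered derivative `(x ∂_x)^k ∂_θ^β`. -/
def sortedWord {M : ℕ} (k : ℕ) (β : Fin M → ℕ) : List (Option (Fin M)) :=
  List.replicate k none ++ (List.finRange M).flatMap fun i => List.replicate (β i) (some i)

lemma length_sortedWord {M : ℕ} (k : ℕ) (β : Fin M → ℕ) :
    (sortedWord k β).length = k + ∑ i, β i := by
  simp only [sortedWord, List.length_append, List.length_replicate, List.length_flatMap]
  rw [Fin.sum_univ_def]

lemma count_none_sortedWord {M : ℕ} (k : ℕ) (β : Fin M → ℕ) :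
    (sortedWord k β).count none = k := by
  simp only [sortedWord, List.count_append, List.count_replicate_self, List.count_flatMap]
  simp [Function.comp_def, List.count_replicate]

lemma count_some_sortedWord {M : ℕ} (k : ℕ) (β : Fin M → ℕ) (i : Fin M) :
    (sortedWord k β).count (some i) = β i := by
  simp only [sortedWord, List.count_append, List.count_flatMap]
  simp only [Function.comp_def, List.count_replicate]
  rw [← Fin.sum_univ_def]
  simp

/-- The statement only speaks of ordered derivatives. Together with the fact that frame estimates
need words only up to permutation, this is why the ordered ones suffice. -/
lemma exists_perm_sortedWord {M : ℕ} (τ : List (Option (Fin M))) :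
    ∃ k β, τ.Perm (sortedWord k β) := by
  refine ⟨τ.count none, fun i => τ.count (some i), List.perm_iff_count.2 fun a => ?_⟩
  cases a with
  | none => rw [count_none_sortedWord]
  | some i => rw [count_some_sortedWord]

lemma mem_multiIndices {M m : ℕ} {p : ℕ × (Fin M → ℕ)} :
    p ∈ multiIndices M m ↔ p.1 + ∑ i, p.2 i ≤ m := by
  simp only [multiIndices, Finset.mem_filter, Finset.mem_product, Finset.mem_range,
    Fintype.mem_piFinset, and_iff_right_iff_imp]
  intro h
  refine ⟨by omega, fun i => ?_⟩
  have := Finset.single_le_sum (f := p.2) (fun _ _ => Nat.zero_le _) (Finset.mem_univ i)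
  omega

/-- The words of the ordered derivatives of order at most `m`. -/
def sortedWords (M m : ℕ) : Finset (List (Option (Fin M))) :=
  (multiIndices M m).image fun p => sortedWord p.1 p.2

lemma mem_sortedWords {M m : ℕ} {τ : List (Option (Fin M))} :
    τ ∈ sortedWords M m ↔ ∃ k β, k + ∑ i, β i ≤ m ∧ sortedWord k β = τ := by
  simp only [sortedWords, Finset.mem_image, mem_multiIndices, Prod.exists]

lemma exists_perm_mem_sortedWords {M m : ℕ} (τ : List (Option (Fin M))) (h : τ.length ≤ m) :
    ∃ τ' ∈ sortedWords M m, τ.Perm τ' := by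
  obtain ⟨k, β, hp⟩ := exists_perm_sortedWord τ
  refine ⟨_, mem_sortedWords.2 ⟨k, β, ?_, rfl⟩, hp⟩
  rw [← length_sortedWord, ← hp.length_eq]
  exact h

lemma length_le_of_mem_sortedWords {M m : ℕ} {τ : List (Option (Fin M))}
    (h : τ ∈ sortedWords M m) : τ.length ≤ m := by
  obtain ⟨k, β, hk, rfl⟩ := mem_sortedWords.1 h
  rwa [length_sortedWord]

namespace BallData

variable {n M : ℕ} (G : BallData n M)

local notation "𝔼" => EuclideanSpace ℝ (Fin n)

/-- The fields `x ∂_x` and `X_i`, in the coordinates `(x, θ)`. -/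
def field : Option (Fin M) → EuclideanSpace ℝ (Fin n) → EuclideanSpace ℝ (Fin n)
  | none => fun y => (G.x y / fderiv ℝ G.x y y) • y
  | some i => fun y => ‖y‖ • G.X i (‖y‖⁻¹ • y) -
      (fderiv ℝ G.x y (‖y‖ • G.X i (‖y‖⁻¹ • y)) / fderiv ℝ G.x y y) • y

/-- The scale invariant fields on the punctured space that correspond to `x ∂_x` and `X_i`. -/
def coneField : Option (Fin M) → EuclideanSpace ℝ (Fin n) → EuclideanSpace ℝ (Fin n)
  | none => fun Y => Y
  | some i => fun Y => ‖Y‖ • G.X i (‖Y‖⁻¹ • Y)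

lemma dTheta_eq (i : Fin M) (f : 𝔼 → ℝ) :
    G.dTheta i f = lieWord G.field [some i] f := by
  ext y
  simp only [dTheta, dx, lieWord_cons, lieWord_nil, field, map_sub, map_smul, smul_eq_mul]
  ring

lemma iterate_dTheta_eq (i : Fin M) (b : ℕ) (f : 𝔼 → ℝ) :
    (G.dTheta i)^[b] f = lieWord G.field (List.replicate b (some i)) f := by
  induction b with
  | zero => rfl
  | succ b ih =>
    rw [Function.iterate_succ_apply', ih, dTheta_eq, ← lieWord_append]
    rfl

lemma dThetaPow_eq (β : Fin M → ℕ) (f : 𝔼 → ℝ) :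
    G.dThetaPow β f = lieWord G.field (sortedWord 0 β) f := by
  have : ∀ l : List (Fin M), l.foldr (fun i g => (G.dTheta i)^[β i] g) f =
      lieWord G.field (l.flatMap fun i => List.replicate (β i) (some i)) f := by
    intro l
    induction l with
    | nil => rfl
    | cons a l ih =>
      rw [List.foldr_cons, ih, iterate_dTheta_eq, ← lieWord_append]
      rfl
  exact this _

lemma lieWord_sortedWord (k : ℕ) (β : Fin M → ℕ) (f : 𝔼 → ℝ) :
    lieWord G.field (sortedWord k β) f =
      lieWord G.field (List.replicate k none) (G.dThetaPow β f) := by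
  rw [dThetaPow_eq, ← lieWord_append]
  rfl

/-- From here on the operators of the statement are handled as words in the two kinds of fields,
which makes naturality under the blow-down map applicable to all of them at once. -/
lemma D_eq (k : ℕ) (β : Fin M → ℕ) (f : 𝔼 → ℝ) :
    G.D k β f = lieWord G.field (sortedWord k β) f := by
  rw [lieWord_sortedWord, D]
  induction k with
  | zero => rfl
  | succ k ih =>
    rw [Function.iterate_succ_apply', ih]
    ext y
    simp only [List.replicate_succ, lieWord_cons, field, map_smul, smul_eq_mul, dx]
    ring

/-- The open set where `(x, θ)` are local coordinates. -/
def coordDomain : Set (EuclideanSpace ℝ (Fin n)) := {y | y ≠ 0 ∧ fderiv ℝ G.x y y < 0}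

lemma continuous_fderiv_x : Continuous fun y => fderiv ℝ G.x y y :=
  (G.x_smooth.continuous_fderiv (by simp)).clm_apply continuous_id

lemma isOpen_coordDomain : IsOpen G.coordDomain :=
  isOpen_ne.inter (isOpen_lt G.continuous_fderiv_x continuous_const)

lemma mem_coordDomain {y : 𝔼} (h1 : G.R ≤ ‖y‖) (h2 : ‖y‖ ≤ 1) : y ∈ G.coordDomain :=
  ⟨norm_pos_iff.1 (G.R_pos.trans_le h1), G.x_radial y h1 h2⟩

lemma annulus_subset : G.annulus ⊆ G.coordDomain := fun _ hy => G.mem_coordDomain hy.1.le hy.2.le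

lemma isOpen_annulus : IsOpen G.annulus :=
  (isOpen_lt continuous_const continuous_norm).inter (isOpen_lt continuous_norm continuous_const)

lemma contDiffOn_coneField (a : Option (Fin M)) :
    ContDiffOn ℝ ∞ (G.coneField a) ({0}ᶜ : Set 𝔼) := by
  cases a with
  | none => exact contDiffOn_id
  | some i =>
    intro y hy
    have hn : ContDiffAt ℝ ∞ (fun y : 𝔼 => ‖y‖) y := contDiffAt_norm ℝ hy
    have hq : ContDiffAt ℝ ∞ (fun y : 𝔼 => ‖y‖⁻¹ • y) y :=
      (hn.inv (norm_ne_zero_iff.2 hy)).smul contDiffAt_id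
    exact (hn.smul ((G.X_smooth i).contDiffAt.comp y hq)).contDiffWithinAt

lemma field_some (i : Fin M) : G.field (some i) = fun y => G.coneField (some i) y -
    (fderiv ℝ G.x y (G.coneField (some i) y) / fderiv ℝ G.x y y) • y := rfl

lemma contDiffOn_field (a : Option (Fin M)) : ContDiffOn ℝ ∞ (G.field a) G.coordDomain := by
  have hx : ContDiff ℝ ∞ (fderiv ℝ G.x) := G.x_smooth.fderiv_right (by simp)
  have hD : ContDiffOn ℝ ∞ (fun y => fderiv ℝ G.x y y) G.coordDomain :=
    (hx.clm_apply contDiff_id).contDiffOn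
  have hne : ∀ y ∈ G.coordDomain, fderiv ℝ G.x y y ≠ 0 := fun y hy => hy.2.ne
  cases a with
  | none => exact (G.x_smooth.contDiffOn.div hD hne).smul contDiffOn_id
  | some i =>
    rw [field_some]
    have hc : ContDiffOn ℝ ∞ (G.coneField (some i)) G.coordDomain :=
      (G.contDiffOn_coneField _).mono fun y hy => hy.1
    exact hc.sub (((hx.contDiffOn.clm_apply hc).div hD hne).smul contDiffOn_id)

/-- The Euler field gives the radial direction and the `X i` give the tangent space of the sphere
through the point. -/
lemma span_coneField {y : 𝔼} (hy : y ≠ 0) :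
    Submodule.span ℝ (Set.range fun a => G.coneField a y) = ⊤ := by
  rw [eq_top_iff]
  intro v _
  set S := Submodule.span ℝ (Set.range fun a => G.coneField a y)
  have hn : ‖y‖ ≠ 0 := norm_ne_zero_iff.2 hy
  have hy' : y ∈ S := Submodule.subset_span ⟨none, rfl⟩
  set q := ‖y‖⁻¹ • y
  have hq : ‖q‖ = 1 := by simp [q, norm_smul, hn]
  have hX : Submodule.span ℝ (Set.range fun i => G.X i q) ≤ S := by
    rw [Submodule.span_le]
    rintro _ ⟨i, rfl⟩
    have : ‖y‖ • G.X i q ∈ S := Submodule.subset_span ⟨some i, rfl⟩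
    have h2 := S.smul_mem ‖y‖⁻¹ this
    rwa [smul_smul, inv_mul_cancel₀ hn, one_smul] at h2
  have hw : v - (inner ℝ v q) • q ∈ S := by
    refine hX (G.X_span q _ hq ?_)
    rw [inner_sub_left, inner_smul_left, real_inner_self_eq_norm_sq, hq]
    simp
  have hq' : q ∈ S := S.smul_mem _ hy'
  have := S.add_mem hw (S.smul_mem (inner ℝ v q) hq')
  simpa using this

/-- The condition `x ≠ 0` is essential: `x ∂_x` degenerates at the boundary. Where it does not, both
families differ by multiples of the radial direction only. -/
lemma span_field {y : 𝔼} (hy : y ∈ G.coordDomain) (hx : G.x y ≠ 0) :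
    Submodule.span ℝ (Set.range fun a => G.field a y) = ⊤ := by
  rw [eq_top_iff, ← G.span_coneField hy.1, Submodule.span_le]
  set S := Submodule.span ℝ (Set.range fun a => G.field a y)
  have hy' : y ∈ S := by
    have h1 : (G.x y / fderiv ℝ G.x y y) • y ∈ S := Submodule.subset_span ⟨none, rfl⟩
    have h2 := S.smul_mem (G.x y / fderiv ℝ G.x y y)⁻¹ h1
    rwa [smul_smul, inv_mul_cancel₀ (div_ne_zero hx hy.2.ne), one_smul] at h2
  rintro _ ⟨a, rfl⟩
  cases a with
  | none => exact hy'
  | some i =>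
    have h1 : G.field (some i) y ∈ S := Submodule.subset_span ⟨some i, rfl⟩
    rw [field_some] at h1
    have h2 := S.add_mem h1 (S.smul_mem
      (fderiv ℝ G.x y (G.coneField (some i) y) / fderiv ℝ G.x y y) hy')
    simpa using h2

/-- The map that blows the boundary of the ball down to the origin, followed by a dilation: the
point with coordinates `(x, θ)` is sent to `l x θ`. -/
def blow (l : ℝ) (y : EuclideanSpace ℝ (Fin n)) : EuclideanSpace ℝ (Fin n) :=
  (l * G.x y / ‖y‖) • y

lemma norm_blow {l : ℝ} (hl : 0 < l) {y : 𝔼} (hy : y ≠ 0) (hx : 0 ≤ G.x y) :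
    ‖G.blow l y‖ = l * G.x y := by
  have hn : 0 < ‖y‖ := norm_pos_iff.2 hy
  rw [blow, norm_smul, Real.norm_of_nonneg (by positivity)]
  field_simp

lemma hasFDerivAt_norm_of_ne_zero {y : 𝔼} (hy : y ≠ 0) :
    HasFDerivAt (fun y : 𝔼 => ‖y‖) (‖y‖⁻¹ • innerSL ℝ y) y := by
  have hn : 0 < ‖y‖ := norm_pos_iff.2 hy
  have h := (hasStrictFDerivAt_norm_sq y).hasFDerivAt.sqrt (by positivity)
  have e : (fun y : 𝔼 => √(‖y‖ ^ 2)) = fun y => ‖y‖ := by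
    ext z; rw [Real.sqrt_sq (norm_nonneg z)]
  rw [e, Real.sqrt_sq hn.le] at h
  convert! h using 1
  ext v
  simp
  field_simp

lemma hasFDerivAt_blow (l : ℝ) {y : 𝔼} (hy : y ≠ 0) :
    HasFDerivAt (G.blow l) ((l * G.x y / ‖y‖) • ContinuousLinearMap.id ℝ 𝔼 +
      ((l / ‖y‖) • fderiv ℝ G.x y - (l * G.x y / ‖y‖ ^ 3) • innerSL ℝ y).smulRight y) y := by
  have hn : 0 < ‖y‖ := norm_pos_iff.2 hy
  have hx : HasFDerivAt G.x (fderiv ℝ G.x y) y :=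
    (G.x_smooth.differentiable (by simp) y).hasFDerivAt
  have hinv := (hasDerivAt_inv hn.ne').comp_hasFDerivAt y (hasFDerivAt_norm_of_ne_zero hy)
  have hc := (hx.const_mul l).mul hinv
  have h := hc.smul (hasFDerivAt_id y)
  have e : G.blow l = fun y => (((fun y => l * G.x y) * (Inv.inv ∘ fun y : 𝔼 => ‖y‖)) y) • id y := by
    ext1 z; simp [blow, div_eq_mul_inv]
  rw [e]
  convert! h using 1
  ext1 v
  simp only [_root_.add_apply, _root_.smul_apply, ContinuousLinearMap.id_apply,
    ContinuousLinearMap.smulRight_apply, _root_.sub_apply, smul_eq_mul, innerSL_apply_apply, id,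
    Pi.mul_apply, Function.comp_apply]
  congr 1
  congr 1
  field_simp
  ring

lemma contDiffAt_blow (l : ℝ) {y : 𝔼} (hy : y ≠ 0) : ContDiffAt ℝ ∞ (G.blow l) y := by
  have hn : ContDiffAt ℝ ∞ (fun y : 𝔼 => ‖y‖) y := contDiffAt_norm ℝ hy
  exact ((contDiffAt_const.mul G.x_smooth.contDiffAt).div hn (norm_ne_zero_iff.2 hy)).smul
    contDiffAt_id

lemma fderiv_blow_apply (l : ℝ) {y : 𝔼} (hy : y ≠ 0) (v : 𝔼) :
    fderiv ℝ (G.blow l) y v = (l * G.x y / ‖y‖) • v +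
      (l / ‖y‖ * fderiv ℝ G.x y v - l * G.x y / ‖y‖ ^ 3 * inner ℝ y v) • y := by
  rw [(G.hasFDerivAt_blow l hy).fderiv]
  simp

lemma coneField_blow {l : ℝ} (hl : 0 < l) {y : 𝔼} (hy : y ≠ 0) (hx : 0 < G.x y) (i : Fin M) :
    G.coneField (some i) (G.blow l y) = (l * G.x y) • G.X i (‖y‖⁻¹ • y) := by
  have hn : 0 < ‖y‖ := norm_pos_iff.2 hy
  simp only [coneField]
  rw [G.norm_blow hl hy hx.le]
  congr 2
  rw [blow, smul_smul]
  congr 1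
  field_simp

/-- The blow-down map relates the coordinate fields to the scale invariant fields. -/
lemma fderiv_blow_field {l : ℝ} (hl : 0 < l) {y : 𝔼} (hy : y ∈ G.coordDomain) (hx : 0 < G.x y)
    (a : Option (Fin M)) :
    fderiv ℝ (G.blow l) y (G.field a y) = G.coneField a (G.blow l y) := by
  have hn : 0 < ‖y‖ := norm_pos_iff.2 hy.1
  have hD := hy.2.ne
  rw [G.fderiv_blow_apply l hy.1]
  cases a with
  | none =>
    simp only [field, coneField, blow, map_smul, inner_smul_right, real_inner_self_eq_norm_sq,
      smul_eq_mul, smul_smul, ← add_smul]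
    congr 1
    field_simp
    ring
  | some i =>
    rw [G.coneField_blow hl hy.1 hx, field_some]
    -- `X i` is tangent to the sphere, hence orthogonal to the position vector; the radial
    -- correction in `field` keeps `x` constant, and these two facts leave no radial component in
    -- the image.
    have ho : inner ℝ y (G.coneField (some i) y) = 0 := by
      have hq : ‖‖y‖⁻¹ • y‖ = 1 := by simp [norm_smul, hn.ne']
      have := G.X_tangent i _ hq
      rw [inner_smul_right, mul_eq_zero] at this
      rw [coneField, inner_smul_right, real_inner_comm]
      rcases this with h | h
      · simp [hn.ne'] at h
      · rw [h, mul_zero]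
    simp only [map_sub, inner_sub_right, map_smul, smul_eq_mul, inner_smul_right, ho,
      real_inner_self_eq_norm_sq]
    rw [show G.coneField (some i) y = ‖y‖ • G.X i (‖y‖⁻¹ • y) from rfl]
    set w := G.X i (‖y‖⁻¹ • y)
    rw [smul_sub, smul_smul, smul_smul, sub_add, ← sub_smul]
    have e1 : l * G.x y / ‖y‖ * ‖y‖ = l * G.x y := by field_simp
    rw [e1, sub_eq_self]
    refine smul_eq_zero_of_left ?_ y
    field_simp
    ring

/-- The derivative is a scalar times the identity plus a rank one map `φ ⊗ y`, that is, a multiple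
of a transvection in the general sense, whose determinant is `1 + φ y`. Here `φ y = Dx(y) y / x -
1`. -/
lemma det_fderiv_blow (l : ℝ) {y : 𝔼} (hy : y ≠ 0) (hx : G.x y ≠ 0) :
    (fderiv ℝ (G.blow l) y).det = (l * G.x y / ‖y‖) ^ n * (fderiv ℝ G.x y y / G.x y) := by
  have hn : 0 < ‖y‖ := norm_pos_iff.2 hy
  set φ : Module.Dual ℝ 𝔼 :=
    (((G.x y)⁻¹ • fderiv ℝ G.x y - (‖y‖ ^ 2)⁻¹ • innerSL ℝ y : 𝔼 →L[ℝ] ℝ) : 𝔼 →ₗ[ℝ] ℝ)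
  have e : ((fderiv ℝ (G.blow l) y : 𝔼 →L[ℝ] 𝔼) : 𝔼 →ₗ[ℝ] 𝔼) =
      (l * G.x y / ‖y‖) • LinearMap.transvection φ y := by
    ext1 v
    simp only [ContinuousLinearMap.coe_coe, G.fderiv_blow_apply l hy, LinearMap.smul_apply,
      LinearMap.transvection.apply, φ, smul_add, smul_smul]
    congr 2
    simp
    field_simp
  rw [ContinuousLinearMap.det, e, LinearMap.det_smul, LinearMap.transvection.det,
    finrank_euclideanSpace_fin]
  congr 1
  simp [φ]
  field_simp
  ring

/-- The norm of the image determines `x` and its direction determines `θ`; on a ray in the annulus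
`x` is strictly decreasing, so these determine the point. -/
lemma injOn_blow {l : ℝ} (hl : 0 < l) : Set.InjOn (G.blow l) G.annulus := by
  intro y hy z hz h
  have hy0 := (G.annulus_subset hy).1
  have hz0 := (G.annulus_subset hz).1
  have hny : 0 < ‖y‖ := norm_pos_iff.2 hy0
  have hnz : 0 < ‖z‖ := norm_pos_iff.2 hz0
  have hxy := G.x_pos y hy.2
  have hxz := G.x_pos z hz.2
  have hxx : G.x y = G.x z := by
    have := congrArg norm h
    rw [G.norm_blow hl hy0 hxy.le, G.norm_blow hl hz0 hxz.le] at this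
    exact mul_left_cancel₀ hl.ne' this
  have hdir : ‖y‖⁻¹ • y = ‖z‖⁻¹ • z := by
    have h2 := congrArg (fun w => (l * G.x y)⁻¹ • w) h
    simp only [blow, smul_smul] at h2
    rw [← hxx] at h2
    convert h2 using 2
    · field_simp
    · field_simp
  set q := ‖y‖⁻¹ • y with hq
  have hqn : ‖q‖ = 1 := by simp [hq, norm_smul, hny.ne']
  have ey : ‖y‖ • q = y := by rw [hq, smul_smul, mul_inv_cancel₀ hny.ne', one_smul]
  have ez : ‖z‖ • q = z := by rw [hdir, smul_smul, mul_inv_cancel₀ hnz.ne', one_smul]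
  have hanti : StrictAntiOn (fun t : ℝ => G.x (t • q)) (Set.Icc G.R 1) := by
    refine strictAntiOn_of_deriv_neg (convex_Icc _ _) ?_ ?_
    · exact (G.x_smooth.continuous.comp (continuous_id.smul continuous_const)).continuousOn
    · intro t ht
      rw [interior_Icc] at ht
      have ht0 : 0 < t := G.R_pos.trans ht.1
      have hd : HasDerivAt (fun t : ℝ => G.x (t • q)) (fderiv ℝ G.x (t • q) q) t := by
        have h1 : HasDerivAt (fun t : ℝ => t • q) q t := by
          simpa using (hasDerivAt_id t).smul_const q
        exact (G.x_smooth.differentiable (by simp) (t • q)).hasFDerivAt.comp_hasDerivAt t h1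
      rw [hd.deriv]
      have h2 := G.x_radial (t • q) (by rw [norm_smul, hqn, Real.norm_of_nonneg ht0.le]; linarith [ht.1])
        (by rw [norm_smul, hqn, Real.norm_of_nonneg ht0.le]; linarith [ht.2])
      rw [map_smul, smul_eq_mul] at h2
      exact (mul_neg_iff.1 h2).elim (fun h => h.2) (fun h => absurd h.1 (by linarith))
  have hn : ‖y‖ = ‖z‖ := by
    refine hanti.injOn ⟨hy.1.le, hy.2.le⟩ ⟨hz.1.le, hz.2.le⟩ ?_
    simp only [ey, ez, hxx]
  rw [← ey, ← ez, hn]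

end BallData

end

section

namespace BallData

variable {n M : ℕ} (G : BallData n M)

local notation "𝔼" => EuclideanSpace ℝ (Fin n)

/-! ### Inverting the blow-down map near the boundary -/

/-- Taking the maximum with `(R + 1) / 2` pushes the radius strictly beyond `R`, so that the collar
lies inside the annulus. -/
lemma exists_innerRadius :
    ∃ R₁ : ℝ, G.R < R₁ ∧ R₁ < 1 ∧ ∀ y, R₁ ≤ ‖y‖ → ‖y‖ ≤ 1 → G.χ y = 1 := by
  obtain ⟨R', h1, h2⟩ := G.χ_one
  refine ⟨max R' ((G.R + 1) / 2), ?_, ?_, fun y hy => h2 y ((le_max_left _ _).trans hy)⟩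
  · exact lt_max_of_lt_right (by linarith [G.R_lt_one])
  · exact max_lt h1 (by linarith [G.R_lt_one])

/-- A radius beyond which the cutoff `χ` equals `1`. -/
def innerRadius : ℝ := G.exists_innerRadius.choose

lemma R_lt_innerRadius : G.R < G.innerRadius := G.exists_innerRadius.choose_spec.1

lemma innerRadius_pos : 0 < G.innerRadius := G.R_pos.trans G.R_lt_innerRadius

lemma innerRadius_lt_one : G.innerRadius < 1 := G.exists_innerRadius.choose_spec.2.1

lemma χ_eq_one {y : 𝔼} (h1 : G.innerRadius ≤ ‖y‖) (h2 : ‖y‖ ≤ 1) : G.χ y = 1 :=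
  G.exists_innerRadius.choose_spec.2.2 y h1 h2

lemma exists_pos_le_x {ρ : ℝ} (hρ : ρ < 1) : ∃ δ : ℝ, 0 < δ ∧ ∀ y, ‖y‖ ≤ ρ → δ ≤ G.x y := by
  rcases (Metric.closedBall (0 : 𝔼) ρ).eq_empty_or_nonempty with h | h
  · refine ⟨1, one_pos, fun y hy => ?_⟩
    have : y ∈ Metric.closedBall (0 : 𝔼) ρ := by simpa using hy
    simp [h] at this
  · obtain ⟨y₀, hy₀, hmin⟩ := (isCompact_closedBall (0 : 𝔼) ρ).exists_isMinOn h
      G.x_smooth.continuous.continuousOn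
    exact ⟨G.x y₀, G.x_pos y₀ (by simp at hy₀; linarith), fun y hy => hmin (by simpa using hy)⟩

/-- A lower bound of `x` on the ball of radius `innerRadius`. -/
def depth : ℝ := (G.exists_pos_le_x G.innerRadius_lt_one).choose

lemma depth_pos : 0 < G.depth := (G.exists_pos_le_x G.innerRadius_lt_one).choose_spec.1

lemma depth_le {y : 𝔼} (hy : ‖y‖ ≤ G.innerRadius) : G.depth ≤ G.x y :=
  (G.exists_pos_le_x G.innerRadius_lt_one).choose_spec.2 y hy

/-- The outer part of the annulus, in which `χ = 1`. -/
def collar : Set (EuclideanSpace ℝ (Fin n)) := {y | G.innerRadius < ‖y‖ ∧ ‖y‖ < 1}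

lemma isOpen_collar : IsOpen G.collar :=
  (isOpen_lt continuous_const continuous_norm).inter (isOpen_lt continuous_norm continuous_const)

lemma collar_subset : G.collar ⊆ G.annulus := fun _ hy => ⟨G.R_lt_innerRadius.trans hy.1, hy.2⟩

lemma collar_subset_ball : G.collar ⊆ unitBall n := fun _ hy => by simpa [unitBall] using hy.2

lemma annulus_subset_ball : G.annulus ⊆ unitBall n := fun _ hy => by simpa [unitBall] using hy.2

lemma x_pos_of_mem {y : 𝔼} (hy : y ∈ G.annulus) : 0 < G.x y := G.x_pos y hy.2

/-- Intermediate values along the ray of `Y`: `x` is zero on the unit sphere and at least `depth` on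
the inner sphere, so it takes the value `‖Y‖ / l` in between. -/
lemma exists_blow_eq {l : ℝ} (hl : 0 < l) {Y : 𝔼} (hY : Y ≠ 0) (hlt : ‖Y‖ < l * G.depth) :
    ∃ y ∈ G.collar, G.blow l y = Y := by
  have hn : 0 < ‖Y‖ := norm_pos_iff.2 hY
  set q := ‖Y‖⁻¹ • Y with hq
  have hqn : ‖q‖ = 1 := by simp [hq, norm_smul, hn.ne']
  have hnorm : ∀ t : ℝ, 0 < t → ‖t • q‖ = t := fun t ht => by
    rw [norm_smul, hqn, Real.norm_of_nonneg ht.le, mul_one]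
  have hc : Continuous fun t : ℝ => G.x (t • q) :=
    G.x_smooth.continuous.comp (continuous_id.smul continuous_const)
  have hmem : ‖Y‖ / l ∈ Set.Ioo (G.x ((1 : ℝ) • q)) (G.x (G.innerRadius • q)) := by
    constructor
    · rw [G.x_zero _ (hnorm 1 one_pos)]; positivity
    · refine lt_of_lt_of_le ?_ (G.depth_le (hnorm _ G.innerRadius_pos).le)
      rwa [div_lt_iff₀' hl]
  obtain ⟨t, ht, hxt⟩ := intermediate_value_Ioo' G.innerRadius_lt_one.le hc.continuousOn hmem
  have ht0 : 0 < t := G.innerRadius_pos.trans ht.1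
  refine ⟨t • q, ⟨by rw [hnorm t ht0]; exact ht.1, by rw [hnorm t ht0]; exact ht.2⟩, ?_⟩
  simp only at hxt
  rw [blow, hxt, hnorm t ht0, hq, smul_smul, smul_smul]
  have : l * (‖Y‖ / l) / t * t * ‖Y‖⁻¹ = 1 := by field_simp
  rw [this, one_smul]

/-- The inverse of the blow-down map. -/
def unblow (l : ℝ) : EuclideanSpace ℝ (Fin n) → EuclideanSpace ℝ (Fin n) :=
  Function.invFunOn (G.blow l) G.annulus

lemma unblow_blow {l : ℝ} (hl : 0 < l) {y : 𝔼} (hy : y ∈ G.annulus) :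
    G.unblow l (G.blow l y) = y := (G.injOn_blow hl).leftInvOn_invFunOn hy

lemma unblow_spec {l : ℝ} (hl : 0 < l) {Y : 𝔼} (hY : Y ≠ 0) (hlt : ‖Y‖ < l * G.depth) :
    G.unblow l Y ∈ G.collar ∧ G.blow l (G.unblow l Y) = Y := by
  obtain ⟨y, hy, rfl⟩ := G.exists_blow_eq hl hY hlt
  rw [G.unblow_blow hl (G.collar_subset hy)]
  exact ⟨hy, rfl⟩

lemma det_fderiv_blow_ne_zero {l : ℝ} (hl : 0 < l) {y : 𝔼} (hy : y ∈ G.annulus) :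
    (fderiv ℝ (G.blow l) y).det ≠ 0 := by
  have hc := G.annulus_subset hy
  have hx := G.x_pos_of_mem hy
  have hn : 0 < ‖y‖ := norm_pos_iff.2 hc.1
  rw [G.det_fderiv_blow l hc.1 hx.ne']
  exact mul_ne_zero (by positivity) (div_ne_zero hc.2.ne hx.ne')

/-- `unblow` is defined by choice, so its smoothness is not automatic. Injectivity of `blow` on the
annulus identifies it, near the image point, with the smooth local inverse of the inverse function
theorem. -/
lemma contDiffAt_unblow_blow {l : ℝ} (hl : 0 < l) {y : 𝔼} (hy : y ∈ G.annulus) :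
    ContDiffAt ℝ ∞ (G.unblow l) (G.blow l y) := by
  have hc := G.annulus_subset hy
  have hf := G.contDiffAt_blow l hc.1
  let L : 𝔼 ≃L[ℝ] 𝔼 := (LinearMap.equivOfDetNeZero (fderiv ℝ (G.blow l) y : 𝔼 →ₗ[ℝ] 𝔼)
    (G.det_fderiv_blow_ne_zero hl hy)).toContinuousLinearEquiv
  have hL : HasFDerivAt (G.blow l) (L : 𝔼 →L[ℝ] 𝔼) y := by
    have : (L : 𝔼 →L[ℝ] 𝔼) = fderiv ℝ (G.blow l) y := by ext1 v; rfl
    rw [this]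
    exact (hf.differentiableAt (by simp)).hasFDerivAt
  have hne : (∞ : WithTop ℕ∞) ≠ 0 := by simp
  have hs := hf.hasStrictFDerivAt' hL hne
  have h1 := hf.to_localInverse hL hne
  refine h1.congr_of_eventuallyEq ?_
  have h2 : ∀ᶠ Y in 𝓝 (G.blow l y), hs.localInverse (G.blow l) L y Y ∈ G.annulus := by
    refine hs.localInverse_continuousAt.eventually_mem ?_
    rw [hs.localInverse_apply_image]
    exact G.isOpen_annulus.mem_nhds hy
  filter_upwards [h2, hs.eventually_right_inverse] with Y hY1 hY2
  conv_lhs => rw [← hY2]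
  exact G.unblow_blow hl hY1

lemma contDiffAt_unblow {l : ℝ} (hl : 0 < l) {Y : 𝔼} (hY : Y ≠ 0) (hlt : ‖Y‖ < l * G.depth) :
    ContDiffAt ℝ ∞ (G.unblow l) Y := by
  obtain ⟨y, hy, rfl⟩ := G.exists_blow_eq hl hY hlt
  exact G.contDiffAt_unblow_blow hl (G.collar_subset hy)

/-- Differentiating `unblow ∘ blow = id` along a coordinate field reverses the relation between the
two families of fields. -/
lemma fderiv_unblow_coneField {l : ℝ} (hl : 0 < l) {Y : 𝔼} (hY : Y ≠ 0)
    (hlt : ‖Y‖ < l * G.depth) (a : Option (Fin M)) :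
    fderiv ℝ (G.unblow l) Y (G.coneField a Y) = G.field a (G.unblow l Y) := by
  obtain ⟨y, hy, rfl⟩ := G.exists_blow_eq hl hY hlt
  have hyA := G.collar_subset hy
  have hc := G.annulus_subset hyA
  rw [G.unblow_blow hl hyA, ← G.fderiv_blow_field hl hc (G.x_pos_of_mem hyA)]
  have h1 : HasFDerivAt (fun z => G.unblow l (G.blow l z))
      ((fderiv ℝ (G.unblow l) (G.blow l y)).comp (fderiv ℝ (G.blow l) y)) y :=
    HasFDerivAt.comp y ((G.contDiffAt_unblow_blow hl hyA).differentiableAt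
      (by simp)).hasFDerivAt ((G.contDiffAt_blow l hc.1).differentiableAt (by simp)).hasFDerivAt
  have h2 : HasFDerivAt (fun z => G.unblow l (G.blow l z)) (ContinuousLinearMap.id ℝ 𝔼) y := by
    refine (hasFDerivAt_id y).congr_of_eventuallyEq ?_
    filter_upwards [G.isOpen_annulus.mem_nhds hyA] with z hz using G.unblow_blow hl hz
  have := congrArg (fun T => T (G.field a y)) (h1.unique h2)
  simpa using this

/-! ### The measure in the blown-down picture -/

/-- The density of the measure `x dx dθ` in the annulus. -/
def density (y : EuclideanSpace ℝ (Fin n)) : ℝ := G.x y * |fderiv ℝ G.x y y| / ‖y‖ ^ n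

lemma measurable_density : Measurable G.density :=
  (G.x_smooth.continuous.measurable.mul
    (continuous_abs.comp G.continuous_fderiv_x).measurable).div (continuous_norm.pow n).measurable

lemma measurableSet_annulus : MeasurableSet G.annulus := G.isOpen_annulus.measurableSet

lemma setLIntegral_measA {S : Set 𝔼} (hS : MeasurableSet S) (hSA : S ⊆ G.annulus)
    (h : 𝔼 → ℝ≥0∞) :
    ∫⁻ y in S, h y ∂G.measA = ∫⁻ y in S, ENNReal.ofReal (G.density y) * h y := by
  rw [show G.measA = (volume.restrict G.annulus).withDensity
    fun y => ENNReal.ofReal (G.density y) from rfl, setLIntegral_withDensity_eq_setLIntegral_mul_non_measurable _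
    (f := fun y => ENNReal.ofReal (G.density y)) G.measurable_density.ennreal_ofReal h hS
    (ae_of_all _ fun _ => ENNReal.ofReal_lt_top), Measure.restrict_restrict hS,
    Set.inter_eq_left.2 hSA]
  rfl

/-- The Jacobian is `l^n x^(n-1) |Dx(y) y| / ‖y‖^n`. The density of `x dx dθ` absorbs everything
except `l^n x^(n-2)`; since `2 ≤ n`, the subtraction in the exponent is genuine. -/
lemma setLIntegral_image_blow (hn : 2 ≤ n) {l : ℝ} (hl : 0 < l) {S : Set 𝔼} (hS : MeasurableSet S)
    (hSA : S ⊆ G.annulus) (h : 𝔼 → ℝ≥0∞) :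
    ∫⁻ Y in G.blow l '' S, h Y =
      ∫⁻ y in S, ENNReal.ofReal (l ^ n * G.x y ^ (n - 2)) * h (G.blow l y) ∂G.measA := by
  rw [G.setLIntegral_measA hS hSA, lintegral_image_eq_lintegral_abs_det_fderiv_mul volume hS
    (fun y hy => ((G.contDiffAt_blow l (G.annulus_subset (hSA hy)).1).differentiableAt
      (by simp)).hasFDerivAt.hasFDerivWithinAt) ((G.injOn_blow hl).mono hSA)]
  refine setLIntegral_congr_fun hS fun y hy => ?_
  have hc := G.annulus_subset (hSA hy)
  have hx := G.x_pos_of_mem (hSA hy)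
  have hny : 0 < ‖y‖ := norm_pos_iff.2 hc.1
  rw [← mul_assoc, ← ENNReal.ofReal_mul (by unfold density; positivity)]
  congr 2
  rw [G.det_fderiv_blow l hc.1 hx.ne', abs_mul, abs_div, abs_of_pos hx, abs_of_pos (by positivity),
    density]
  obtain ⟨m, rfl⟩ := Nat.exists_eq_add_of_le hn
  rw [Nat.add_sub_cancel_left, div_pow, mul_pow]
  field_simp
  ring

/-- One has `l^n x^(n-2) = (l x)^(n-2) l²`, so a bound on `l x` from one side turns the factor of
the change of variables into the constant `l²`. The next inequality uses the bound from the other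
side. -/
lemma setLIntegral_le_unblow (hn : 2 ≤ n) {l : ℝ} (hl : 0 < l) {S : Set 𝔼} (hS : MeasurableSet S)
    (hSA : S ⊆ G.annulus) (hx : ∀ y ∈ S, 1 ≤ l * G.x y) (h : 𝔼 → ℝ≥0∞) :
    ENNReal.ofReal (l ^ 2) * ∫⁻ y in S, h y ∂G.measA ≤
      ∫⁻ Y in G.blow l '' S, h (G.unblow l Y) := by
  rw [G.setLIntegral_image_blow hn hl hS hSA, ← lintegral_const_mul' _ _ ENNReal.ofReal_ne_top]
  refine setLIntegral_mono' hS fun y hy => ?_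
  rw [G.unblow_blow hl (hSA hy)]
  gcongr
  obtain ⟨m, rfl⟩ := Nat.exists_eq_add_of_le hn
  rw [Nat.add_sub_cancel_left, pow_add, mul_assoc, ← mul_pow]
  exact le_mul_of_one_le_right (by positivity) (one_le_pow₀ (hx y hy))

lemma setLIntegral_unblow_le (hn : 2 ≤ n) {l : ℝ} (hl : 0 < l) {S : Set 𝔼} (hS : MeasurableSet S)
    (hSA : S ⊆ G.annulus) {c : ℝ} (hx : ∀ y ∈ S, l * G.x y ≤ c) (h : 𝔼 → ℝ≥0∞) :
    ∫⁻ Y in G.blow l '' S, h (G.unblow l Y) ≤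
      ENNReal.ofReal (c ^ (n - 2) * l ^ 2) * ∫⁻ y in S, h y ∂G.measA := by
  rw [G.setLIntegral_image_blow hn hl hS hSA, ← lintegral_const_mul' _ _ ENNReal.ofReal_ne_top]
  refine setLIntegral_mono' hS fun y hy => ?_
  rw [G.unblow_blow hl (hSA hy)]
  have := G.x_pos_of_mem (hSA hy)
  refine mul_le_mul_left (ENNReal.ofReal_le_ofReal ?_) _
  obtain ⟨m, rfl⟩ := Nat.exists_eq_add_of_le hn
  rw [Nat.add_sub_cancel_left, show l ^ (2 + m) * G.x y ^ m = (l * G.x y) ^ m * l ^ 2 by ring]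
  gcongr
  exact hx y hy

/-- The part of the collar where `l x` lies in `T`. -/
def shell (l : ℝ) (T : Set ℝ) : Set (EuclideanSpace ℝ (Fin n)) := G.collar ∩ {y | l * G.x y ∈ T}

lemma measurableSet_shell (l : ℝ) {T : Set ℝ} (hT : MeasurableSet T) :
    MeasurableSet (G.shell l T) :=
  G.isOpen_collar.measurableSet.inter
    ((continuous_const.mul G.x_smooth.continuous).measurable hT)

lemma blow_image_shell {l : ℝ} (hl : 0 < l) {T : Set ℝ} (hT : T ⊆ Set.Ioo 0 (l * G.depth)) :
    G.blow l '' G.shell l T = {Y | ‖Y‖ ∈ T} := by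
  ext Y
  constructor
  · rintro ⟨y, ⟨hy, hyT⟩, rfl⟩
    have hA := G.collar_subset hy
    simp only [Set.mem_ofPred_eq]
    rwa [G.norm_blow hl (G.annulus_subset hA).1 (G.x_pos_of_mem hA).le]
  · intro hY
    have h := hT hY
    obtain ⟨y, hy, rfl⟩ := G.exists_blow_eq hl (norm_pos_iff.1 h.1) h.2
    refine ⟨y, ⟨hy, ?_⟩, rfl⟩
    have hA := G.collar_subset hy
    simp only [Set.mem_ofPred_eq] at hY ⊢
    rwa [G.norm_blow hl (G.annulus_subset hA).1 (G.x_pos_of_mem hA).le] at hY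

end BallData

end

section

open scoped Manifold in
/-- Smooth cutoff functions. -/
lemma exists_cutoff {E : Type*} [NormedAddCommGroup E] [NormedSpace ℝ E] [FiniteDimensional ℝ E]
    {K U : Set E} (hK : IsCompact K) (hU : IsOpen U) (hKU : K ⊆ U) :
    ∃ ψ : E → ℝ, ContDiff ℝ ∞ ψ ∧ HasCompactSupport ψ ∧ tsupport ψ ⊆ U ∧
      ∀ y ∈ K, ψ =ᶠ[𝓝 y] fun _ => 1 := by
  obtain ⟨K', hK', h1, h2⟩ := exists_compact_between hK hU hKU
  obtain ⟨f, hf1, hf2, -⟩ := exists_contMDiffMap_one_nhds_of_subset_interior (n := ⊤) 𝓘(ℝ, E)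
    hK.isClosed h1
  have hs : Function.support f ⊆ K' := fun y hy => by
    by_contra h
    exact hy (hf2 y h)
  refine ⟨f, f.contMDiff.contDiff, HasCompactSupport.of_support_subset_isCompact hK' hs,
    (closure_minimal hs hK'.isClosed).trans h2, fun y hy => ?_⟩
  exact Filter.eventually_of_mem ((mem_nhdsSet_iff_forall.1 hf1) y hy) fun z hz => hz

namespace BallData

variable {n M : ℕ} (G : BallData n M)

local notation "𝔼" => EuclideanSpace ℝ (Fin n)

/-! ### The dyadic decomposition of the ball -/

/-- The value `4` is the outer radius of the enlarged annuli that carry the cutoffs. Starting at a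
sufficiently large scale puts these annuli inside the image of the collar for every `k`. -/
lemma exists_baseScale : ∃ k : ℕ, 4 < 2 ^ k * G.depth := by
  obtain ⟨k, hk⟩ := pow_unbounded_of_one_lt (4 / G.depth) (one_lt_two)
  exact ⟨k, by rwa [div_lt_iff₀ G.depth_pos] at hk⟩

/-- The dilation factors of the dyadic decomposition. -/
def scale (k : ℕ) : ℝ := 2 ^ (G.exists_baseScale.choose + k)

lemma scale_pos (k : ℕ) : 0 < G.scale k := by unfold scale; positivity

lemma scale_succ (k : ℕ) : G.scale (k + 1) = 2 * G.scale k := by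
  simp only [scale]; ring

lemma scale_add (j k : ℕ) : G.scale (j + k) = 2 ^ k * G.scale j := by
  simp only [scale]; ring

lemma one_le_scale (k : ℕ) : 1 ≤ G.scale k := one_le_pow₀ one_le_two

lemma four_lt_scale_mul_depth (k : ℕ) : 4 < G.scale k * G.depth := by
  have h := G.exists_baseScale.choose_spec
  refine h.trans_le (mul_le_mul_of_nonneg_right ?_ G.depth_pos.le)
  exact pow_le_pow_right₀ one_le_two (Nat.le_add_right _ _)

lemma exists_x_lt {ε : ℝ} (hε : 0 < ε) :
    ∃ ρ : ℝ, ρ < 1 ∧ ∀ y, ρ < ‖y‖ → ‖y‖ ≤ 1 → G.x y < ε := by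
  set K := Metric.closedBall (0 : 𝔼) 1 ∩ {y | ε ≤ G.x y}
  have hK : IsCompact K := (isCompact_closedBall _ _).inter_right
    (isClosed_le continuous_const G.x_smooth.continuous)
  rcases K.eq_empty_or_nonempty with h | h
  · refine ⟨0, one_pos, fun y _ hy => ?_⟩
    by_contra hc
    have : y ∈ K := ⟨by simpa using hy, not_lt.1 hc⟩
    simp [h] at this
  · obtain ⟨y₀, hy₀, hmax⟩ := hK.exists_isMaxOn h continuous_norm.continuousOn
    refine ⟨‖y₀‖, ?_, fun y h1 h2 => ?_⟩
    · refine lt_of_le_of_ne (by simpa using hy₀.1) fun h1 => ?_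
      have := hy₀.2
      simp only [Set.mem_ofPred_eq, G.x_zero y₀ h1] at this
      linarith
    · by_contra hc
      exact absurd (hmax ⟨by simpa using h2, not_lt.1 hc⟩ : ‖y‖ ≤ ‖y₀‖) (not_le.2 h1)

lemma exists_outerRadius : ∃ ρ : ℝ, G.innerRadius ≤ ρ ∧ ρ < 1 ∧
    ∀ y, ρ < ‖y‖ → ‖y‖ ≤ 1 → G.scale 0 * G.x y ≤ 2 := by
  obtain ⟨ρ, h1, h2⟩ := G.exists_x_lt (ε := 2 / G.scale 0) (div_pos two_pos (G.scale_pos 0))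
  refine ⟨max ρ G.innerRadius, le_max_right _ _, max_lt h1 G.innerRadius_lt_one, fun y hy hy1 => ?_⟩
  have := h2 y ((le_max_left _ _).trans_lt hy) hy1
  rw [lt_div_iff₀' (G.scale_pos 0)] at this
  exact this.le

/-- The radius beyond which the dyadic shells cover the ball. -/
def outerRadius : ℝ := G.exists_outerRadius.choose

lemma innerRadius_le_outerRadius : G.innerRadius ≤ G.outerRadius :=
  G.exists_outerRadius.choose_spec.1

lemma outerRadius_lt_one : G.outerRadius < 1 := G.exists_outerRadius.choose_spec.2.1

lemma scale_zero_mul_le {y : 𝔼} (h1 : G.outerRadius < ‖y‖) (h2 : ‖y‖ ≤ 1) :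
    G.scale 0 * G.x y ≤ 2 := G.exists_outerRadius.choose_spec.2.2 y h1 h2

/-- The least `k` with `1 ≤ scale k * x` works. If `k > 0`, minimality at `k - 1` gives the upper
bound `2` by doubling; if `k = 0`, it is the choice of `outerRadius`. -/
lemma exists_mem_shell {y : 𝔼} (h1 : G.outerRadius < ‖y‖) (h2 : ‖y‖ < 1) :
    ∃ k, y ∈ G.shell (G.scale k) (Set.Icc 1 2) := by
  have hy : y ∈ G.collar := ⟨G.innerRadius_le_outerRadius.trans_lt h1, h2⟩
  have hx := G.x_pos y h2
  have hex : ∃ k, 1 ≤ G.scale k * G.x y := by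
    obtain ⟨k, hk⟩ := pow_unbounded_of_one_lt (1 / G.x y) (one_lt_two (α := ℝ))
    refine ⟨k, ?_⟩
    rw [div_lt_iff₀ hx] at hk
    have h0 := G.scale_add 0 k
    rw [zero_add] at h0
    have h3 := G.one_le_scale 0
    rw [h0, mul_assoc]
    nlinarith [pow_pos (two_pos (α := ℝ)) k, mul_pos (pow_pos (two_pos (α := ℝ)) k) hx]
  classical
  refine ⟨Nat.find hex, hy, Nat.find_spec hex, ?_⟩
  rcases hk : Nat.find hex with _ | k
  · exact G.scale_zero_mul_le h1 h2.le
  · have := Nat.find_min hex (m := k) (by omega)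
    rw [scale_succ]
    linarith

/-- The collection of cutoffs of the decomposition. -/
lemma exists_bump (p : Option ℕ) : ∃ ψ : 𝔼 → ℝ, ContDiff ℝ ∞ ψ ∧ HasCompactSupport ψ ∧
    tsupport ψ ⊆ p.elim (unitBall n) (fun _ => {Y | ‖Y‖ ∈ Set.Ioo (1 / 2) 4}) ∧
    ∀ y ∈ p.elim (Metric.closedBall (0 : 𝔼) G.outerRadius) (fun _ => {Y | ‖Y‖ ∈ Set.Icc 1 2}),
      ψ =ᶠ[𝓝 y] fun _ => 1 := by
  cases p with
  | none =>
    exact exists_cutoff (isCompact_closedBall (0 : 𝔼) G.outerRadius) (U := unitBall n)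
      Metric.isOpen_ball (Metric.closedBall_subset_ball G.outerRadius_lt_one)
  | some k =>
    refine exists_cutoff ?_ (isOpen_Ioo.preimage continuous_norm) ?_
    · refine (isCompact_closedBall (0 : 𝔼) 2).of_isClosed_subset
        (isClosed_Icc.preimage continuous_norm) fun Y hY => ?_
      simpa using hY.2
    · exact fun Y hY => ⟨by linarith [hY.1], by linarith [hY.2]⟩

/-- The cutoffs of the dyadic decomposition. All the shells share the same cutoff. -/
def bump (p : Option ℕ) : EuclideanSpace ℝ (Fin n) → ℝ :=
  (G.exists_bump (p.map fun _ => 0)).choose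

/-- The domains of the parametrizations of the pieces. -/
def dom : Option ℕ → Set (EuclideanSpace ℝ (Fin n))
  | none => unitBall n
  | some _ => {Y | ‖Y‖ ∈ Set.Ioo (1 / 2) 4}

/-- The sets on which the cutoffs equal `1`. -/
def core : Option ℕ → Set (EuclideanSpace ℝ (Fin n))
  | none => Metric.closedBall 0 G.outerRadius
  | some _ => {Y | ‖Y‖ ∈ Set.Icc 1 2}

/-- The parametrizations of the pieces of the ball. -/
def chart : Option ℕ → EuclideanSpace ℝ (Fin n) → EuclideanSpace ℝ (Fin n)
  | none => id
  | some k => G.unblow (G.scale k)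

/-- The weights of the pieces. -/
def weight : Option ℕ → ℝ
  | none => 1
  | some k => (G.scale k ^ 2)⁻¹

/-- The localization of a function to a piece of the decomposition. -/
def piece (p : Option ℕ) (f : EuclideanSpace ℝ (Fin n) → ℝ) : EuclideanSpace ℝ (Fin n) → ℝ :=
  fun Y => G.bump p Y * f (G.chart p Y)

lemma contDiff_bump (p : Option ℕ) : ContDiff ℝ ∞ (G.bump p) :=
  (G.exists_bump (p.map fun _ => 0)).choose_spec.1

lemma hasCompactSupport_bump (p : Option ℕ) : HasCompactSupport (G.bump p) :=
  (G.exists_bump (p.map fun _ => 0)).choose_spec.2.1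

lemma tsupport_bump (p : Option ℕ) : tsupport (G.bump p) ⊆ dom p := by
  have := (G.exists_bump (p.map fun _ => 0)).choose_spec.2.2.1
  cases p <;> exact this

lemma bump_eventuallyEq_one {p : Option ℕ} {Y : 𝔼} (hY : Y ∈ G.core p) :
    G.bump p =ᶠ[𝓝 Y] fun _ => 1 := by
  have := (G.exists_bump (p.map fun _ => 0)).choose_spec.2.2.2 Y
  cases p <;> exact this hY

lemma isOpen_dom (p : Option ℕ) : IsOpen (dom p : Set 𝔼) := by
  cases p with
  | none => exact Metric.isOpen_ball
  | some k => exact isOpen_Ioo.preimage continuous_norm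

lemma core_subset_dom (p : Option ℕ) : G.core p ⊆ dom p := by
  cases p with
  | none => exact Metric.closedBall_subset_ball G.outerRadius_lt_one
  | some k => exact fun Y hY => ⟨by linarith [hY.1], by linarith [hY.2]⟩

lemma isCompact_core (p : Option ℕ) : IsCompact (G.core p) := by
  cases p with
  | none => exact isCompact_closedBall _ _
  | some k =>
    refine (isCompact_closedBall (0 : 𝔼) 2).of_isClosed_subset
      (isClosed_Icc.preimage continuous_norm) fun Y hY => ?_
    simpa using hY.2

lemma dom_some_spec {k : ℕ} {Y : 𝔼} (hY : Y ∈ dom (some k)) :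
    Y ≠ 0 ∧ ‖Y‖ < G.scale k * G.depth :=
  ⟨norm_pos_iff.1 (one_half_pos.trans hY.1), hY.2.trans (G.four_lt_scale_mul_depth k)⟩

lemma chart_some_mem_collar {k : ℕ} {Y : 𝔼} (hY : Y ∈ dom (some k)) :
    G.chart (some k) Y ∈ G.collar :=
  (G.unblow_spec (G.scale_pos k) (G.dom_some_spec hY).1 (G.dom_some_spec hY).2).1

lemma chart_mem_ball {p : Option ℕ} {Y : 𝔼} (hY : Y ∈ dom p) : G.chart p Y ∈ unitBall n := by
  cases p with
  | none => exact hY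
  | some k => exact G.collar_subset_ball (G.chart_some_mem_collar hY)

lemma contDiffAt_chart {p : Option ℕ} {Y : 𝔼} (hY : Y ∈ dom p) :
    ContDiffAt ℝ ∞ (G.chart p) Y := by
  cases p with
  | none => exact contDiffAt_id
  | some k =>
    exact G.contDiffAt_unblow (G.scale_pos k) (G.dom_some_spec hY).1 (G.dom_some_spec hY).2

lemma contDiffAt_comp_chart {s : WithTop ℕ∞} (hs : s ≤ (∞ : WithTop ℕ∞)) {f : 𝔼 → ℝ}
    (hf : ContDiffOn ℝ s f (unitBall n)) {p : Option ℕ} {Y : 𝔼} (hY : Y ∈ dom p) :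
    ContDiffAt ℝ s (fun Y => f (G.chart p Y)) Y :=
  ContDiffAt.comp Y (hf.contDiffAt (Metric.isOpen_ball.mem_nhds (G.chart_mem_ball hY)))
    ((G.contDiffAt_chart hY).of_le hs)

lemma _root_.contDiff_of_forall_mem_tsupport {E F : Type*} [NormedAddCommGroup E]
    [NormedSpace ℝ E] [NormedAddCommGroup F] [NormedSpace ℝ F] {s : WithTop ℕ∞} {f : E → F}
    (h : ∀ y ∈ tsupport f, ContDiffAt ℝ s f y) : ContDiff ℝ s f := by
  refine contDiff_iff_contDiffAt.2 fun y => ?_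
  by_cases hy : y ∈ tsupport f
  · exact h y hy
  · exact contDiffAt_const.congr_of_eventuallyEq (notMem_tsupport_iff_eventuallyEq.1 hy)

lemma isCcInfty_piece {f : 𝔼 → ℝ} (hf : ContDiffOn ℝ ∞ f (unitBall n)) (p : Option ℕ) :
    IsCcInfty (G.piece p f) := by
  refine ⟨contDiff_of_forall_mem_tsupport fun Y hY => ?_, (G.hasCompactSupport_bump p).mul_right⟩
  have h := G.tsupport_bump p (tsupport_mul_subset_left hY)
  exact (G.contDiff_bump p).contDiffAt.mul (G.contDiffAt_comp_chart le_rfl hf h)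

lemma piece_eventuallyEq (f : 𝔼 → ℝ) {p : Option ℕ} {Y : 𝔼} (hY : Y ∈ G.core p) :
    G.piece p f =ᶠ[𝓝 Y] fun Y => f (G.chart p Y) := by
  filter_upwards [G.bump_eventuallyEq_one hY] with z hz
  rw [piece, hz, one_mul]

lemma jetNorm_congr {f g : 𝔼 → ℝ} {Y : 𝔼} (h : f =ᶠ[𝓝 Y] g) (k : ℕ) :
    jetNorm k f Y = jetNorm k g Y :=
  Finset.sum_congr rfl fun j _ => by rw [(h.iteratedFDeriv ℝ j).eq_of_nhds]

lemma jetNorm_piece (f : 𝔼 → ℝ) {p : Option ℕ} {Y : 𝔼} (hY : Y ∈ G.core p) (k : ℕ) :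
    jetNorm k (G.piece p f) Y = jetNorm k (fun Y => f (G.chart p Y)) Y :=
  jetNorm_congr (G.piece_eventuallyEq f hY) k

/-- An identity without any constant depending on `k`: naturality of Lie derivatives under the
inverse of the blow-down map. This is the source of the uniformity over the shells. -/
lemma lieWord_comp_chart {k : ℕ} (τ : List (Option (Fin M))) {f : 𝔼 → ℝ}
    (hf : ContDiffOn ℝ τ.length f (unitBall n)) {Y : 𝔼} (hY : Y ∈ dom (some k)) :
    lieWord G.coneField τ (fun Y => f (G.chart (some k) Y)) Y =
      lieWord G.field τ f (G.chart (some k) Y) :=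
  lieWord_comp (V := G.coneField) (W := G.field) (isOpen_dom (some k)) G.isOpen_collar
    (fun Y hY => G.chart_some_mem_collar hY)
    (fun a => (G.contDiffOn_field a).mono (G.collar_subset.trans G.annulus_subset))
    (fun Y hY => (G.contDiffAt_chart hY).differentiableAt (by simp))
    (fun a Y hY => G.fderiv_unblow_coneField (G.scale_pos k) (G.dom_some_spec hY).1
      (G.dom_some_spec hY).2 a) τ (hf.mono G.collar_subset_ball) hY

/-- The coordinate derivatives are controlled by the Fréchet derivatives in the pieces. -/
lemma exists_abs_lieWord_le_jetNorm (s : ℕ) : ∃ C : ℝ, 0 ≤ C ∧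
    ∀ (τ : List (Option (Fin M))) (f : 𝔼 → ℝ) (p : Option ℕ), τ.length ≤ s →
      ContDiffOn ℝ τ.length f (unitBall n) → ∀ Y ∈ G.core p, G.chart p Y ∈ G.annulus →
      |lieWord G.field τ f (G.chart p Y)| ≤
        C * jetNorm τ.length (fun Y => f (G.chart p Y)) Y := by
  have hK0 : IsCompact {y : 𝔼 | G.R ≤ ‖y‖ ∧ ‖y‖ ≤ G.outerRadius} :=
    (isCompact_closedBall (0 : 𝔼) G.outerRadius).of_isClosed_subset
      ((isClosed_le continuous_const continuous_norm).inter
        (isClosed_le continuous_norm continuous_const)) fun y hy => by simpa using hy.2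
  obtain ⟨C₁, h1, hC₁⟩ := exists_abs_lieWord_le G.isOpen_coordDomain G.contDiffOn_field hK0
    (fun y hy => G.mem_coordDomain hy.1 (hy.2.trans G.outerRadius_lt_one.le)) s
  -- The cores of all shells are the same set and the cone fields do not depend on the scale, so the
  -- constant found for `k = 0` serves every `k`.
  obtain ⟨C₂, h2, hC₂⟩ := exists_abs_lieWord_le (isOpen_compl_singleton (x := (0 : 𝔼)))
    G.contDiffOn_coneField (G.isCompact_core (some 0))
    (fun Y hY => (G.dom_some_spec (k := 0) (G.core_subset_dom _ hY)).1) s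
  refine ⟨max C₁ C₂, le_max_of_le_left h1, fun τ f p hτ hf Y hY hA => ?_⟩
  have hj := jetNorm_nonneg τ.length (fun Y => f (G.chart p Y)) Y
  have hfc := G.contDiffAt_comp_chart (natCast_le_infty _) hf (G.core_subset_dom p hY)
  cases p with
  | none =>
    refine (hC₁ τ hτ f Y ⟨hA.1.le, by simpa [core] using hY⟩ hfc).trans ?_
    exact mul_le_mul_of_nonneg_right (le_max_left _ _) hj
  | some k =>
    rw [← G.lieWord_comp_chart τ hf (G.core_subset_dom _ hY)]
    refine (hC₂ τ hτ _ Y hY hfc).trans ?_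
    exact mul_le_mul_of_nonneg_right (le_max_right _ _) hj

/-! ### Summing over the pieces -/

lemma exists_density_le : ∃ C : ℝ≥0, ∀ y ∈ G.annulus, ENNReal.ofReal (G.density y) ≤ C := by
  have hK : IsCompact {y : 𝔼 | G.R ≤ ‖y‖ ∧ ‖y‖ ≤ 1} :=
    (isCompact_closedBall (0 : 𝔼) 1).of_isClosed_subset
      ((isClosed_le continuous_const continuous_norm).inter
        (isClosed_le continuous_norm continuous_const)) fun y hy => by simpa using hy.2
  obtain ⟨C, hC⟩ := hK.exists_bound_of_continuousOn (f := G.density) (by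
    refine ((G.x_smooth.continuous.mul (continuous_abs.comp
      G.continuous_fderiv_x)).continuousOn).div (continuous_norm.pow n).continuousOn ?_
    intro y hy
    exact pow_ne_zero _ (G.R_pos.trans_le hy.1).ne')
  exact ⟨C.toNNReal, fun y hy => ENNReal.ofReal_le_ofReal
    ((Real.le_norm_self _).trans (hC y ⟨hy.1.le, hy.2.le⟩))⟩

lemma ae_mem_annulus : ∀ᵐ y ∂G.measA, y ∈ G.annulus :=
  (withDensity_absolutelyContinuous _ _).ae_le (ae_restrict_mem G.measurableSet_annulus)

lemma measA_restrict_annulus : G.measA.restrict G.annulus = G.measA :=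
  Measure.restrict_eq_self_of_ae_mem G.ae_mem_annulus

lemma core_some_eq (k : ℕ) :
    G.core (some k) = G.blow (G.scale k) '' G.shell (G.scale k) (Set.Icc 1 2) :=
  (G.blow_image_shell (G.scale_pos k) fun t ht => ⟨by linarith [ht.1],
    by linarith [ht.2, G.four_lt_scale_mul_depth k]⟩).symm

/-- An integral over the annulus is bounded by the integrals over the pieces. -/
lemma exists_lintegral_le_tsum_core (hn : 2 ≤ n) : ∃ C : ℝ≥0, ∀ h : 𝔼 → ℝ≥0∞,
    ∫⁻ y, h y ∂G.measA ≤ C * ∑' p, ENNReal.ofReal (G.weight p) *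
      ∫⁻ Y in G.core p, G.annulus.indicator h (G.chart p Y) := by
  obtain ⟨C, hC⟩ := G.exists_density_le
  refine ⟨max C 1, fun h => ?_⟩
  set I := fun p => ∫⁻ Y in G.core p, G.annulus.indicator h (G.chart p Y) with hI
  -- These sets cover the annulus. The core of the interior piece also contains points outside the
  -- annulus, which is why the integrand is cut by an indicator.
  set S : Option ℕ → Set 𝔼 := fun p =>
    p.elim (G.annulus ∩ Metric.closedBall 0 G.outerRadius)
      (fun k => G.shell (G.scale k) (Set.Icc 1 2)) with hS
  have hcov : G.annulus ⊆ ⋃ p, S p := by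
    intro y hy
    rcases le_or_gt ‖y‖ G.outerRadius with h1 | h1
    · exact Set.mem_iUnion.2 ⟨none, hy, by simpa using h1⟩
    · obtain ⟨k, hk⟩ := G.exists_mem_shell h1 hy.2
      exact Set.mem_iUnion.2 ⟨some k, hk⟩
  have hp : ∀ p, ∫⁻ y in S p, h y ∂G.measA ≤
      (max C 1 : ℝ≥0) * (ENNReal.ofReal (G.weight p) * I p) := by
    rintro (_ | k)
    · have hm : MeasurableSet (G.annulus ∩ Metric.closedBall 0 G.outerRadius) :=
        G.measurableSet_annulus.inter Metric.isClosed_closedBall.measurableSet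
      have h1 : ∫⁻ y in S none, h y ∂G.measA ≤
          ∫⁻ y in G.annulus ∩ Metric.closedBall 0 G.outerRadius, C * G.annulus.indicator h y := by
        simp only [hS, Option.elim_none]
        rw [G.setLIntegral_measA hm Set.inter_subset_left]
        refine setLIntegral_mono' hm fun y hy => ?_
        rw [Set.indicator_of_mem hy.1]
        exact mul_le_mul_left (hC y hy.1) _
      refine h1.trans ?_
      rw [lintegral_const_mul' _ _ ENNReal.coe_ne_top]
      simp only [weight, ENNReal.ofReal_one, one_mul]
      refine mul_le_mul' (by exact_mod_cast le_max_left _ _) ?_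
      exact lintegral_mono_set Set.inter_subset_right
    · have hm := G.measurableSet_shell (G.scale k) (T := Set.Icc 1 2) measurableSet_Icc
      have hsub : G.shell (G.scale k) (Set.Icc 1 2) ⊆ G.annulus := fun y hy =>
        G.collar_subset hy.1
      have h1 := G.setLIntegral_le_unblow hn (G.scale_pos k) hm hsub (fun y hy => hy.2.1)
        (G.annulus.indicator h)
      rw [← G.core_some_eq] at h1
      have h2 : ∫⁻ y in S (some k), h y ∂G.measA =
          ∫⁻ y in G.shell (G.scale k) (Set.Icc 1 2), G.annulus.indicator h y ∂G.measA := by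
        simp only [hS, Option.elim_some]
        refine setLIntegral_congr_fun hm fun y hy => ?_
        rw [Set.indicator_of_mem (hsub hy)]
      have hpos : 0 < G.scale k ^ 2 := pow_pos (G.scale_pos k) 2
      rw [h2]
      calc _ = ENNReal.ofReal (G.weight (some k)) * (ENNReal.ofReal (G.scale k ^ 2) *
            ∫⁻ y in G.shell (G.scale k) (Set.Icc 1 2), G.annulus.indicator h y ∂G.measA) := by
            rw [← mul_assoc, ← ENNReal.ofReal_mul (by simp only [weight]; positivity), weight,
              inv_mul_cancel₀ hpos.ne', ENNReal.ofReal_one, one_mul]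
        _ ≤ ENNReal.ofReal (G.weight (some k)) * I (some k) := mul_le_mul_right h1 _
        _ ≤ _ := le_mul_of_one_le_left' (by exact_mod_cast le_max_right _ _)
  calc ∫⁻ y, h y ∂G.measA = ∫⁻ y in G.annulus, h y ∂G.measA := by rw [G.measA_restrict_annulus]
    _ ≤ ∫⁻ y in ⋃ p, S p, h y ∂G.measA := lintegral_mono_set hcov
    _ ≤ ∑' p, ∫⁻ y in S p, h y ∂G.measA := lintegral_iUnion_le _ _
    _ ≤ ∑' p, (max C 1 : ℝ≥0) * (ENNReal.ofReal (G.weight p) * I p) := ENNReal.tsum_le_tsum hp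
    _ = _ := ENNReal.tsum_mul_left

/-- The interval `(1/2, 4)` has end points in the ratio `8 = 2^3`, so a point lies in at most three
consecutive enlarged shells: three doublings of a number above `1/2` exceed `4`. -/
lemma tsum_shell_indicator_le (y : 𝔼) :
    ∑' k, (G.shell (G.scale k) (Set.Ioo (1 / 2) 4)).indicator (fun _ => (1 : ℝ≥0∞)) y ≤ 3 := by
  classical
  by_cases hex : ∃ k, y ∈ G.shell (G.scale k) (Set.Ioo (1 / 2) 4)
  · set k₀ := Nat.find hex with hk₀
    have hmin : y ∈ G.shell (G.scale k₀) (Set.Ioo (1 / 2) 4) := Nat.find_spec hex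
    have hx : 0 < G.x y := G.x_pos y hmin.1.2
    rw [tsum_eq_sum (s := Finset.Ico k₀ (k₀ + 3))]
    · have h1 : ∀ k ∈ Finset.Ico k₀ (k₀ + 3),
          (G.shell (G.scale k) (Set.Ioo (1 / 2) 4)).indicator (fun _ => (1 : ℝ≥0∞)) y ≤ 1 :=
        fun k _ => Set.indicator_le_self' (fun _ _ => zero_le) _
      refine (Finset.sum_le_card_nsmul _ _ _ h1).trans ?_
      simp
    · intro k hk
      refine Set.indicator_of_notMem (fun hmem => hk ?_) _
      rw [Finset.mem_Ico]
      refine ⟨Nat.find_min' hex hmem, ?_⟩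
      by_contra hlt
      obtain ⟨j, rfl⟩ := Nat.exists_eq_add_of_le (not_lt.1 hlt)
      have h1 : G.scale (k₀ + 3 + j) * G.x y < 4 := hmem.2.2
      have h2 : 1 / 2 < G.scale k₀ * G.x y := hmin.2.1
      rw [add_assoc, G.scale_add k₀, pow_add] at h1
      have h3 : (1 : ℝ) ≤ 2 ^ j := one_le_pow₀ one_le_two
      nlinarith [mul_pos (G.scale_pos k₀) hx]
  · push Not at hex
    rw [ENNReal.tsum_eq_zero.2 fun k => Set.indicator_of_notMem (hex k) _]
    exact zero_le

/-- The integrals over the shells are bounded by the integral over the collar. -/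
lemma tsum_lintegral_shell_le (hn : 2 ≤ n) {h : 𝔼 → ℝ≥0∞} (hh : AEMeasurable h G.measA) :
    ∑' k, ENNReal.ofReal (G.weight (some k)) *
      ∫⁻ Y in dom (some k), h (G.chart (some k) Y) ≤
      ENNReal.ofReal (4 ^ (n - 2)) * (3 * ∫⁻ y in G.collar, h y ∂G.measA) := by
  have hm : ∀ k, MeasurableSet (G.shell (G.scale k) (Set.Ioo (1 / 2) 4)) := fun k =>
    G.measurableSet_shell _ measurableSet_Ioo
  have hk : ∀ k, ENNReal.ofReal (G.weight (some k)) *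
      ∫⁻ Y in dom (some k), h (G.chart (some k) Y) ≤ ENNReal.ofReal (4 ^ (n - 2)) *
      ∫⁻ y in G.shell (G.scale k) (Set.Ioo (1 / 2) 4), h y ∂G.measA := by
    intro k
    have h1 := G.setLIntegral_unblow_le hn (G.scale_pos k) (hm k)
      (fun y hy => G.collar_subset hy.1) (c := 4) (fun y hy => hy.2.2.le) h
    rw [G.blow_image_shell (G.scale_pos k) fun t ht => ⟨by linarith [ht.1],
      by linarith [ht.2, G.four_lt_scale_mul_depth k]⟩] at h1
    have hpos : 0 < G.scale k ^ 2 := pow_pos (G.scale_pos k) 2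
    refine (mul_le_mul_right h1 _).trans (le_of_eq ?_)
    rw [← mul_assoc, ← ENNReal.ofReal_mul (by simp only [weight]; positivity), weight]
    congr 2
    rw [mul_comm, mul_assoc, mul_inv_cancel₀ hpos.ne', mul_one]
  refine (ENNReal.tsum_le_tsum hk).trans ?_
  rw [ENNReal.tsum_mul_left]
  refine mul_le_mul_right ?_ _
  have e : ∀ k, ∫⁻ y in G.shell (G.scale k) (Set.Ioo (1 / 2) 4), h y ∂G.measA =
      ∫⁻ y in G.collar, (G.shell (G.scale k) (Set.Ioo (1 / 2) 4)).indicator (fun _ => (1 : ℝ≥0∞)) y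
        * h y ∂G.measA := by
    intro k
    have : ∀ y, (G.shell (G.scale k) (Set.Ioo (1 / 2) 4)).indicator (fun _ => (1 : ℝ≥0∞)) y * h y =
        (G.shell (G.scale k) (Set.Ioo (1 / 2) 4)).indicator h y := fun y => by
      rw [← Set.indicator_mul_left]
      simp
    simp only [this]
    rw [lintegral_indicator (hm k), Measure.restrict_restrict (hm k),
      Set.inter_eq_left.2 (show G.shell (G.scale k) _ ⊆ G.collar from Set.inter_subset_left)]
  simp only [e]
  have hm' : ∀ k, AEMeasurable (fun y => (G.shell (G.scale k) (Set.Ioo (1 / 2) 4)).indicator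
      (fun _ => (1 : ℝ≥0∞)) y * h y) (G.measA.restrict G.collar) := fun k =>
    (measurable_const.indicator (hm k)).aemeasurable.mul hh.restrict
  rw [← lintegral_tsum hm']
  simp only [ENNReal.tsum_mul_right]
  rw [← lintegral_const_mul' _ _ (by simp)]
  exact lintegral_mono fun y => mul_le_mul_left (G.tsum_shell_indicator_le y) _

end BallData

end

section

namespace BallData

variable {n M : ℕ} (G : BallData n M)

local notation "𝔼" => EuclideanSpace ℝ (Fin n)

/-! ### Powers of `x` and of the derivatives in `x` -/

/-- The vector field `∂_x`. -/
def dxField (_ : Unit) (y : EuclideanSpace ℝ (Fin n)) : EuclideanSpace ℝ (Fin n) :=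
  (fderiv ℝ G.x y y)⁻¹ • y

lemma dx_iterate_eq (i : ℕ) (f : 𝔼 → ℝ) :
    (G.dx)^[i] f = lieWord G.dxField (List.replicate i ()) f := by
  induction i with
  | zero => rfl
  | succ i ih =>
    rw [Function.iterate_succ_apply', ih]
    ext y
    simp only [List.replicate_succ, lieWord_cons, dx, dxField, map_smul, smul_eq_mul]
    rw [div_eq_inv_mul]

lemma contDiffOn_dxField (u : Unit) : ContDiffOn ℝ ∞ (G.dxField u) G.coordDomain := by
  have hx : ContDiff ℝ ∞ (fderiv ℝ G.x) := G.x_smooth.fderiv_right (by simp)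
  exact ((hx.clm_apply contDiff_id).contDiffOn.inv fun y hy => hy.2.ne).smul contDiffOn_id

lemma contDiffOn_field_annulus (a : Option (Fin M)) : ContDiffOn ℝ ∞ (G.field a) G.annulus :=
  (G.contDiffOn_field a).mono G.annulus_subset

lemma contDiffOn_dxField_annulus (u : Unit) : ContDiffOn ℝ ∞ (G.dxField u) G.annulus :=
  (G.contDiffOn_dxField u).mono G.annulus_subset

lemma contDiffOn_lieWord_annulus {f : 𝔼 → ℝ} (hf : ContDiffOn ℝ ∞ f G.annulus)
    (τ : List (Option (Fin M))) : ContDiffOn ℝ ∞ (lieWord G.field τ f) G.annulus :=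
  contDiffOn_lieWord_infty G.isOpen_annulus G.contDiffOn_field_annulus τ hf

lemma contDiffOn_dx_iterate {f : 𝔼 → ℝ} (hf : ContDiffOn ℝ ∞ f G.annulus) (i : ℕ) :
    ContDiffOn ℝ ∞ ((G.dx)^[i] f) G.annulus := by
  rw [dx_iterate_eq]
  exact contDiffOn_lieWord_infty G.isOpen_annulus G.contDiffOn_dxField_annulus _ hf

lemma contDiffOn_dThetaPow {f : 𝔼 → ℝ} (hf : ContDiffOn ℝ ∞ f G.annulus) (β : Fin M → ℕ) :
    ContDiffOn ℝ ∞ (G.dThetaPow β f) G.annulus := by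
  rw [dThetaPow_eq]
  exact G.contDiffOn_lieWord_annulus hf _

lemma differentiableAt_of_contDiffOn_annulus {f : 𝔼 → ℝ} (hf : ContDiffOn ℝ ∞ f G.annulus) {y : 𝔼}
    (hy : y ∈ G.annulus) : DifferentiableAt ℝ f y :=
  (hf.contDiffAt (G.isOpen_annulus.mem_nhds hy)).differentiableAt (by simp)

lemma hasFDerivAt_x (y : 𝔼) : HasFDerivAt G.x (fderiv ℝ G.x y) y :=
  (G.x_smooth.differentiable (by simp) y).hasFDerivAt

lemma fderiv_x_field_none {y : 𝔼} (hy : y ∈ G.coordDomain) :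
    fderiv ℝ G.x y (G.field none y) = G.x y := by
  have := hy.2.ne
  simp only [field, map_smul, smul_eq_mul]
  field_simp

lemma fderiv_x_field_some {y : 𝔼} (hy : y ∈ G.coordDomain) (i : Fin M) :
    fderiv ℝ G.x y (G.field (some i) y) = 0 := by
  have := hy.2.ne
  simp only [field_some, map_sub, map_smul, smul_eq_mul]
  field_simp
  ring

/-- `x^{i-l} ∂_x^i (x^l h)`. -/
def conj (l : ℤ) (i : ℕ) (h : EuclideanSpace ℝ (Fin n) → ℝ) (y : EuclideanSpace ℝ (Fin n)) : ℝ :=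
  G.x y ^ ((i : ℤ) - l) * (G.dx)^[i] (fun z => G.x z ^ l * h z) y

lemma contDiffOn_zpow_x (l : ℤ) : ContDiffOn ℝ ∞ (fun y => G.x y ^ l) G.annulus := by
  cases l with
  | ofNat l =>
    simp only [Int.ofNat_eq_natCast, zpow_natCast]
    exact (G.x_smooth.pow l).contDiffOn
  | negSucc l =>
    simp only [zpow_negSucc]
    exact (G.x_smooth.pow _).contDiffOn.inv fun y hy => (pow_pos (G.x_pos_of_mem hy) _).ne'

variable {G}

lemma contDiffOn_conj (l : ℤ) (i : ℕ) {h : 𝔼 → ℝ} (hh : ContDiffOn ℝ ∞ h G.annulus) :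
    ContDiffOn ℝ ∞ (G.conj l i h) G.annulus :=
  (G.contDiffOn_zpow_x _).mul (G.contDiffOn_dx_iterate ((G.contDiffOn_zpow_x l).mul hh) i)

lemma conj_zero (l : ℤ) (h : 𝔼 → ℝ) {y : 𝔼} (hy : y ∈ G.annulus) : G.conj l 0 h y = h y := by
  have := (G.x_pos_of_mem hy).ne'
  rw [conj, Function.iterate_zero, id, ← mul_assoc, ← zpow_add₀ this]
  simp

/-- Applying `x ∂_x` either raises the number of derivatives by one or hits the power of `x` in
front. This recursion is triangular, hence usable in both directions between the powers of `x ∂_x`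
and the weighted `∂_x^i`. -/
lemma fderiv_conj (l : ℤ) (i : ℕ) {h : 𝔼 → ℝ} (hh : ContDiffOn ℝ ∞ h G.annulus) {y : 𝔼}
    (hy : y ∈ G.annulus) :
    fderiv ℝ (G.conj l i h) y (G.field none y) =
      G.conj l (i + 1) h y + ((i : ℝ) - l) * G.conj l i h y := by
  have hx := (G.x_pos_of_mem hy).ne'
  have hc := G.annulus_subset hy
  set g := (G.dx)^[i] (fun z => G.x z ^ l * h z) with hg
  have hgd : HasFDerivAt g (fderiv ℝ g y) y := (G.differentiableAt_of_contDiffOn_annulus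
    (G.contDiffOn_dx_iterate ((G.contDiffOn_zpow_x l).mul hh) i) hy).hasFDerivAt
  have hz := (hasDerivAt_zpow ((i : ℤ) - l) (G.x y) (Or.inl hx)).comp_hasFDerivAt y
    (G.hasFDerivAt_x y)
  have hm := (hz.mul hgd).fderiv
  have e : G.conj l i h = ((fun t : ℝ => t ^ ((i : ℤ) - l)) ∘ G.x) * g := rfl
  rw [e, hm]
  simp only [_root_.add_apply, _root_.smul_apply, smul_eq_mul, G.fderiv_x_field_none hc,
    Function.comp_apply, Pi.mul_apply]
  rw [conj, Function.iterate_succ_apply', ← hg, dx]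
  have e2 : ((i + 1 : ℕ) : ℤ) - l = ((i : ℤ) - l) + 1 := by push_cast; ring
  rw [e2, zpow_add_one₀ hx, zpow_sub_one₀ hx]
  simp only [field, map_smul, smul_eq_mul]
  push_cast
  field_simp

/-- Powers of `x ∂_x` in terms of the conjugated derivatives. -/
lemma exists_lieWord_replicate_eq_sum_conj (l : ℤ) (i : ℕ) : ∃ c : ℕ → ℝ, ∀ h : 𝔼 → ℝ,
    ContDiffOn ℝ ∞ h G.annulus → ∀ y ∈ G.annulus, lieWord G.field (List.replicate i none) h y =
      ∑ j ∈ Finset.range (i + 1), c j * G.conj l j h y := by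
  induction i with
  | zero => exact ⟨fun _ => 1, fun h _ y hy => by simp [conj_zero l h hy, lieWord_nil]⟩
  | succ i ih =>
    obtain ⟨c, hc⟩ := ih
    refine ⟨fun j => (if j = 0 then 0 else c (j - 1)) +
      (if j < i + 1 then c j * ((j : ℝ) - l) else 0), fun h hh y hy => ?_⟩
    have hev : lieWord G.field (List.replicate i none) h =ᶠ[𝓝 y]
        fun y => ∑ j ∈ Finset.range (i + 1), c j * G.conj l j h y := by
      filter_upwards [G.isOpen_annulus.mem_nhds hy] with z hz using hc h hh z hz
    have hd : ∀ j, HasFDerivAt (G.conj l j h) (fderiv ℝ (G.conj l j h) y) y := fun j =>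
      (G.differentiableAt_of_contDiffOn_annulus (contDiffOn_conj l j hh) hy).hasFDerivAt
    have hs := HasFDerivAt.fun_sum (u := Finset.range (i + 1)) fun j _ => (hd j).const_mul (c j)
    rw [List.replicate_succ, lieWord_cons, hev.fderiv_eq, hs.fderiv, _root_.sum_apply]
    simp only [_root_.smul_apply, smul_eq_mul, fderiv_conj l _ hh hy, mul_add, add_mul,
      Finset.sum_add_distrib]
    congr 1
    · rw [Finset.sum_range_succ' _ (i + 1)]
      simp
    · rw [Finset.sum_range_succ _ (i + 1), if_neg (lt_irrefl _), zero_mul, add_zero]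
      refine Finset.sum_congr rfl fun j hj => ?_
      rw [if_pos (Finset.mem_range.1 hj)]
      ring

/-- The conjugated derivatives in terms of powers of `x ∂_x`. -/
lemma exists_conj_eq_sum_lieWord_replicate (l : ℤ) (i : ℕ) : ∃ c : ℕ → ℝ, ∀ h : 𝔼 → ℝ,
    ContDiffOn ℝ ∞ h G.annulus → ∀ y ∈ G.annulus, G.conj l i h y =
      ∑ j ∈ Finset.range (i + 1), c j * lieWord G.field (List.replicate j none) h y := by
  induction i with
  | zero => exact ⟨fun _ => 1, fun h _ y hy => by simp [conj_zero l h hy, lieWord_nil]⟩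
  | succ i ih =>
    obtain ⟨c, hc⟩ := ih
    refine ⟨fun j => (if j = 0 then 0 else c (j - 1)) +
      (if j < i + 1 then -(c j * ((i : ℝ) - l)) else 0), fun h hh y hy => ?_⟩
    have hev : G.conj l i h =ᶠ[𝓝 y]
        fun y => ∑ j ∈ Finset.range (i + 1), c j * lieWord G.field (List.replicate j none) h y := by
      filter_upwards [G.isOpen_annulus.mem_nhds hy] with z hz using hc h hh z hz
    have hd : ∀ j, HasFDerivAt (lieWord G.field (List.replicate j none) h)
        (fderiv ℝ (lieWord G.field (List.replicate j none) h) y) y := fun j =>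
      (G.differentiableAt_of_contDiffOn_annulus (G.contDiffOn_lieWord_annulus hh _) hy).hasFDerivAt
    have hs := HasFDerivAt.fun_sum (u := Finset.range (i + 1)) fun j _ => (hd j).const_mul (c j)
    have h1 := fderiv_conj l i hh hy
    have h2 : G.conj l (i + 1) h y = fderiv ℝ (G.conj l i h) y (G.field none y) -
      ((i : ℝ) - l) * G.conj l i h y := by rw [h1]; ring
    rw [h2, hev.fderiv_eq, hs.fderiv, _root_.sum_apply, hc h hh y hy]
    simp only [_root_.smul_apply, smul_eq_mul, add_mul, Finset.sum_add_distrib, ← lieWord_cons,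
      ← List.replicate_succ]
    rw [sub_eq_add_neg]
    congr 1
    · rw [Finset.sum_range_succ' _ (i + 1)]
      simp
    · rw [Finset.sum_range_succ _ (i + 1), if_neg (lt_irrefl _), zero_mul, add_zero,
        Finset.mul_sum, ← Finset.sum_neg_distrib]
      refine Finset.sum_congr rfl fun j hj => ?_
      rw [if_pos (Finset.mem_range.1 hj)]
      ring

/-- Powers of `x` commute with the angular derivatives. -/
lemma dThetaPow_zpow_mul (l : ℤ) (β : Fin M → ℕ) {g : 𝔼 → ℝ} (hg : ContDiffOn ℝ ∞ g G.annulus) :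
    Set.EqOn (G.dThetaPow β (fun z => G.x z ^ l * g z))
      (fun z => G.x z ^ l * G.dThetaPow β g z) G.annulus := by
  have key : ∀ τ : List (Option (Fin M)), (∀ a ∈ τ, a ≠ none) →
      Set.EqOn (lieWord G.field τ (fun z => G.x z ^ l * g z))
        (fun z => G.x z ^ l * lieWord G.field τ g z) G.annulus := by
    intro τ
    induction τ with
    | nil => exact fun _ _ _ => rfl
    | cons a τ ih =>
      intro hτ y hy
      obtain ⟨i, rfl⟩ := Option.ne_none_iff_exists'.1 (hτ a (by simp))
      have ih' := ih fun b hb => hτ b (by simp [hb])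
      have hev : lieWord G.field τ (fun z => G.x z ^ l * g z) =ᶠ[𝓝 y]
          ((fun t : ℝ => t ^ l) ∘ G.x) * lieWord G.field τ g := by
        filter_upwards [G.isOpen_annulus.mem_nhds hy] with z hz using ih' hz
      have hz := (hasDerivAt_zpow l (G.x y) (Or.inl (G.x_pos_of_mem hy).ne')).comp_hasFDerivAt y
        (G.hasFDerivAt_x y)
      have hd := (G.differentiableAt_of_contDiffOn_annulus
        (G.contDiffOn_lieWord_annulus hg τ) hy).hasFDerivAt
      rw [lieWord_cons, hev.fderiv_eq, (hz.mul hd).fderiv]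
      simp only [_root_.add_apply, _root_.smul_apply, smul_eq_mul,
        G.fderiv_x_field_some (G.annulus_subset hy), Function.comp_apply, lieWord_cons]
      ring
  simp only [dThetaPow_eq]
  refine key _ fun a ha => ?_
  simp only [sortedWord, List.replicate_zero, List.nil_append, List.mem_flatMap,
    List.mem_replicate] at ha
  obtain ⟨i, -, -, rfl⟩ := ha
  simp

variable (G)

/-- The components of the norm of `ℋ^m` in the annulus. -/
def comp (m : ℕ) (p : ℕ × (Fin M → ℕ)) (f : EuclideanSpace ℝ (Fin n) → ℝ)
    (y : EuclideanSpace ℝ (Fin n)) : ℝ :=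
  G.x y ^ ((p.1 : ℤ) - (m : ℤ)) * (G.dx)^[p.1] (G.dThetaPow p.2 (fun z => G.χ z * f z)) y

lemma normH_eq (m : ℕ) (f : 𝔼 → ℝ) : G.normH m f =
    (∑ p ∈ multiIndices M m, eLpNorm (G.comp m p f) 2 G.measA) +
      ballNorm m (fun y => (1 - G.χ y) * f y) := rfl

variable {G}

/-- The exponents of `x` balance: `i - (m + l)` splits into `-m` and the `i - l` of `conj`. So
`ℋ^{m,r}` measures `x^(-m)` times conormal derivatives, whatever power `x^l` accompanies the
function. -/
lemma comp_pow_mul (m l i : ℕ) (β : Fin M → ℕ) {f : 𝔼 → ℝ} (hf : ContDiffOn ℝ ∞ f G.annulus)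
    {y : 𝔼} (hy : y ∈ G.annulus) :
    G.comp (m + l) (i, β) (fun y => G.x y ^ l * f y) y =
      (G.x y ^ m)⁻¹ * G.conj l i (G.dThetaPow β (fun z => G.χ z * f z)) y := by
  have hx := (G.x_pos_of_mem hy).ne'
  have hχf : ContDiffOn ℝ ∞ (fun z => G.χ z * f z) G.annulus := G.χ_smooth.contDiffOn.mul hf
  have h1 : Set.EqOn (G.dThetaPow β (fun z => G.χ z * (G.x z ^ l * f z)))
      (fun z => G.x z ^ (l : ℤ) * G.dThetaPow β (fun z => G.χ z * f z) z) G.annulus := by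
    have e : (fun z => G.χ z * (G.x z ^ l * f z)) = fun z => G.x z ^ (l : ℤ) * (G.χ z * f z) := by
      ext z; rw [zpow_natCast]; ring
    rw [e]
    exact dThetaPow_zpow_mul l β hχf
  have h2 : (G.dx)^[i] (G.dThetaPow β (fun z => G.χ z * (G.x z ^ l * f z))) y =
      (G.dx)^[i] (fun z => G.x z ^ (l : ℤ) * G.dThetaPow β (fun z => G.χ z * f z) z) y := by
    simp only [dx_iterate_eq]
    exact lieWord_congr G.isOpen_annulus h1 _ hy
  rw [comp, conj, h2]
  rw [← mul_assoc]
  congr 1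
  rw [← zpow_natCast, ← zpow_neg, ← zpow_add₀ hx]
  congr 1
  push_cast
  ring

lemma contDiffOn_comp (m : ℕ) (p : ℕ × (Fin M → ℕ)) {f : 𝔼 → ℝ}
    (hf : ContDiffOn ℝ ∞ f G.annulus) : ContDiffOn ℝ ∞ (G.comp m p f) G.annulus :=
  (G.contDiffOn_zpow_x _).mul (G.contDiffOn_dx_iterate
    (G.contDiffOn_dThetaPow (G.χ_smooth.contDiffOn.mul hf) _) _)

lemma aestronglyMeasurable_measA {F : Type*} [NormedAddCommGroup F] {f : 𝔼 → F}
    (hf : ContinuousOn f G.annulus) : AEStronglyMeasurable f G.measA :=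
  (hf.aestronglyMeasurable G.measurableSet_annulus).mono_ac (withDensity_absolutelyContinuous _ _)

/-- A pointwise bound by a sum in the annulus gives a bound of the norms. -/
lemma eLpNorm_le_sum {ι : Type*} {s : Finset ι} {f : 𝔼 → ℝ} {g : ι → 𝔼 → ℝ} {C : ℝ≥0}
    {μ : Measure 𝔼} (hg : ∀ i ∈ s, AEStronglyMeasurable (g i) μ)
    (h : ∀ᵐ y ∂μ, |f y| ≤ C * ∑ i ∈ s, |g i y|) :
    eLpNorm f 2 μ ≤ C * ∑ i ∈ s, eLpNorm (g i) 2 μ := by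
  have h1 : eLpNorm f 2 μ ≤ eLpNorm ((C : ℝ) • ∑ i ∈ s, fun y => |g i y|) 2 μ := by
    refine eLpNorm_mono_ae ?_
    filter_upwards [h] with y hy
    rw [Real.norm_eq_abs]
    refine hy.trans (le_of_eq ?_)
    simp only [Pi.smul_apply, Finset.sum_apply, smul_eq_mul, norm_mul, Real.norm_eq_abs]
    rw [abs_of_nonneg C.coe_nonneg, abs_of_nonneg (Finset.sum_nonneg fun i _ => abs_nonneg _)]
  refine h1.trans ?_
  rw [eLpNorm_const_smul]
  have e : ‖(C : ℝ)‖ₑ = C := by simp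
  rw [e]
  gcongr
  refine (eLpNorm_sum_le (fun i hi => (hg i hi).norm) (by norm_num)).trans (le_of_eq ?_)
  exact Finset.sum_congr rfl fun i _ => eLpNorm_norm (g i)

lemma abs_sum_le_sum_abs_mul {s : Finset ℕ} (c a : ℕ → ℝ) :
    |∑ j ∈ s, c j * a j| ≤ (∑ j ∈ s, ‖c j‖₊ : ℝ≥0) * ∑ j ∈ s, |a j| := by
  refine (Finset.abs_sum_le_sum_abs _ _).trans ?_
  rw [Finset.mul_sum]
  refine Finset.sum_le_sum fun j hj => ?_
  rw [abs_mul]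
  gcongr
  have := Finset.single_le_sum (f := fun j => ‖c j‖₊) (fun _ _ => zero_le) hj
  exact_mod_cast this

lemma normH_le_normHr {m r j : ℕ} (hj : j ≤ r) (f : 𝔼 → ℝ) :
    G.normH (m + j) (fun y => G.x y ^ j * f y) ≤ G.normHr m r f :=
  Finset.single_le_sum (f := fun j => G.normH (m + j) (fun y => G.x y ^ j * f y))
    (fun _ _ => zero_le) (Finset.mem_range.2 (by omega))

lemma eLpNorm_comp_le_normH {m : ℕ} {p : ℕ × (Fin M → ℕ)} (hp : p ∈ multiIndices M m)
    (f : 𝔼 → ℝ) : eLpNorm (G.comp m p f) 2 G.measA ≤ G.normH m f := by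
  rw [normH_eq]
  exact (Finset.single_le_sum (f := fun p => eLpNorm (G.comp m p f) 2 G.measA)
    (fun _ _ => zero_le) hp).trans le_self_add

variable (G)

/-- The conormal derivatives are controlled by the norm of `ℋ^{m,r}`. -/
lemma exists_eLpNorm_lieWord_le_normHr (m r : ℕ) : ∃ C : ℝ≥0, ∀ f : 𝔼 → ℝ,
    ContDiffOn ℝ ∞ f G.annulus → ∀ τ ∈ sortedWords M (m + r),
      eLpNorm (fun y => (G.x y ^ m)⁻¹ * lieWord G.field τ (fun z => G.χ z * f z) y) 2 G.measA ≤
        C * G.normHr m r f := by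
  choose c hc using exists_lieWord_replicate_eq_sum_conj (G := G) (r : ℤ)
  let K : ℕ → ℝ≥0 := fun i => ∑ j ∈ Finset.range (i + 1), ‖c i j‖₊
  refine ⟨∑ i ∈ Finset.range (m + r + 1), K i * (i + 1 : ℕ), fun f hf τ hτ => ?_⟩
  obtain ⟨i, β, hi, rfl⟩ := mem_sortedWords.1 hτ
  have hχf : ContDiffOn ℝ ∞ (fun z => G.χ z * f z) G.annulus := G.χ_smooth.contDiffOn.mul hf
  set h := G.dThetaPow β (fun z => G.χ z * f z) with hh
  have hhs : ContDiffOn ℝ ∞ h G.annulus := G.contDiffOn_dThetaPow hχf β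
  have hxf : ContDiffOn ℝ ∞ (fun y => G.x y ^ r * f y) G.annulus :=
    (G.x_smooth.pow r).contDiffOn.mul hf
  have hpt : ∀ᵐ y ∂G.measA,
      |(G.x y ^ m)⁻¹ * lieWord G.field (sortedWord i β) (fun z => G.χ z * f z) y| ≤
      K i * ∑ j ∈ Finset.range (i + 1), |G.comp (m + r) (j, β) (fun y => G.x y ^ r * f y) y| := by
    filter_upwards [G.ae_mem_annulus] with y hy
    rw [lieWord_sortedWord, hc i h hhs y hy, Finset.mul_sum]
    have : ∀ j, G.comp (m + r) (j, β) (fun y => G.x y ^ r * f y) y =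
        (G.x y ^ m)⁻¹ * G.conj r j h y := fun j => comp_pow_mul m r j β hf hy
    simp only [this]
    refine le_trans (le_of_eq ?_) (abs_sum_le_sum_abs_mul (c i) _)
    congr 1
    exact Finset.sum_congr rfl fun j _ => by ring
  refine (eLpNorm_le_sum (fun j _ => aestronglyMeasurable_measA
    (contDiffOn_comp _ _ hxf).continuousOn) hpt).trans ?_
  -- Only the last summand of `normHr`, the norm of `x^r f` in `ℋ^{m+r}`, is needed for all conormal
  -- derivatives up to order `m + r`.
  have hb : ∀ j ∈ Finset.range (i + 1),
      eLpNorm (G.comp (m + r) (j, β) (fun y => G.x y ^ r * f y)) 2 G.measA ≤ G.normHr m r f := by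
    intro j hj
    rw [Finset.mem_range] at hj
    exact (eLpNorm_comp_le_normH (mem_multiIndices.2 (by simp only; omega)) _).trans
      (normH_le_normHr le_rfl f)
  calc _ ≤ (K i : ℝ≥0∞) * ((i + 1 : ℕ) * G.normHr m r f) := by
        gcongr
        refine (Finset.sum_le_card_nsmul _ _ _ hb).trans ?_
        simp
    _ = ((K i * (i + 1 : ℕ) : ℝ≥0) : ℝ≥0∞) * G.normHr m r f := by
        rw [ENNReal.coe_mul, mul_assoc]; rfl
    _ ≤ _ := by
        gcongr
        exact_mod_cast Finset.single_le_sum (f := fun i => K i * ((i + 1 : ℕ) : ℝ≥0))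
          (fun _ _ => zero_le) (Finset.mem_range.2 (by omega : i < m + r + 1))

/-- The components of the norm of `ℋ^{0,r}` are controlled by the conormal derivatives. -/
lemma exists_eLpNorm_comp_le (r : ℕ) : ∃ C : ℝ≥0, ∀ f : 𝔼 → ℝ,
    ContDiffOn ℝ ∞ f G.annulus → ∀ j ≤ r, ∀ p ∈ multiIndices M j,
      eLpNorm (G.comp j p (fun y => G.x y ^ j * f y)) 2 G.measA ≤
        C * ∑ τ ∈ sortedWords M r,
          eLpNorm (lieWord G.field τ (fun z => G.χ z * f z)) 2 G.measA := by
  choose c hc using fun l : ℕ => exists_conj_eq_sum_lieWord_replicate (G := G) (l : ℤ)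
  let K : ℕ → ℕ → ℝ≥0 := fun l i => ∑ j ∈ Finset.range (i + 1), ‖c l i j‖₊
  refine ⟨∑ l ∈ Finset.range (r + 1), ∑ i ∈ Finset.range (r + 1), K l i * (i + 1 : ℕ),
    fun f hf l hl p hp => ?_⟩
  obtain ⟨i, β⟩ := p
  rw [mem_multiIndices] at hp
  simp only at hp
  have hχf : ContDiffOn ℝ ∞ (fun z => G.χ z * f z) G.annulus := G.χ_smooth.contDiffOn.mul hf
  set S := ∑ τ ∈ sortedWords M r, eLpNorm (lieWord G.field τ (fun z => G.χ z * f z)) 2 G.measA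
  have hpt : ∀ᵐ y ∂G.measA, |G.comp l (i, β) (fun y => G.x y ^ l * f y) y| ≤
      K l i * ∑ j ∈ Finset.range (i + 1),
        |lieWord G.field (sortedWord j β) (fun z => G.χ z * f z) y| := by
    filter_upwards [G.ae_mem_annulus] with y hy
    have h1 := comp_pow_mul 0 l i β hf hy
    rw [zero_add] at h1
    rw [h1, pow_zero, inv_one, one_mul, hc l i _ (G.contDiffOn_dThetaPow hχf β) y hy]
    simp only [lieWord_sortedWord]
    exact abs_sum_le_sum_abs_mul (c l i) _
  refine (eLpNorm_le_sum (fun j _ => aestronglyMeasurable_measA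
    (G.contDiffOn_lieWord_annulus hχf _).continuousOn) hpt).trans ?_
  have hb : ∀ j ∈ Finset.range (i + 1),
      eLpNorm (lieWord G.field (sortedWord j β) (fun z => G.χ z * f z)) 2 G.measA ≤ S := by
    intro j hj
    rw [Finset.mem_range] at hj
    exact Finset.single_le_sum (f := fun τ =>
      eLpNorm (lieWord G.field τ (fun z => G.χ z * f z)) 2 G.measA) (fun _ _ => zero_le)
      (mem_sortedWords.2 ⟨j, β, by omega, rfl⟩)
  calc _ ≤ (K l i : ℝ≥0∞) * ((i + 1 : ℕ) * S) := by
        gcongr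
        refine (Finset.sum_le_card_nsmul _ _ _ hb).trans ?_
        simp
    _ = ((K l i * (i + 1 : ℕ) : ℝ≥0) : ℝ≥0∞) * S := by
        rw [ENNReal.coe_mul, mul_assoc]; rfl
    _ ≤ _ := by
        gcongr
        have h1 := Finset.single_le_sum (f := fun i => K l i * ((i + 1 : ℕ) : ℝ≥0))
          (fun _ _ => zero_le) (Finset.mem_range.2 (by omega : i < r + 1))
        have h2 := Finset.single_le_sum
          (f := fun l => ∑ i ∈ Finset.range (r + 1), K l i * ((i + 1 : ℕ) : ℝ≥0))
          (fun _ _ => zero_le) (Finset.mem_range.2 (by omega : l < r + 1))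
        exact_mod_cast h1.trans h2

end BallData

end

section

/-! ### Jets of products and pointwise quadratic bounds -/

section Jet

variable {n : ℕ}

local notation "𝔼" => EuclideanSpace ℝ (Fin n)

/-- The Leibniz bound for functions that are regular only near the point, obtained on a common open
neighborhood; pulled back functions are regular only on the domains of the charts. -/
lemma norm_iteratedFDeriv_mul_le_of_contDiffAt {f g : 𝔼 → ℝ} {y : 𝔼} {k : ℕ}
    (hf : ContDiffAt ℝ k f y) (hg : ContDiffAt ℝ k g y) :
    ‖iteratedFDeriv ℝ k (fun y => f y * g y) y‖ ≤ ∑ i ∈ Finset.range (k + 1),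
      (k.choose i : ℝ) * ‖iteratedFDeriv ℝ i f y‖ * ‖iteratedFDeriv ℝ (k - i) g y‖ := by
  obtain ⟨U, hU, -, hy, hfU⟩ := hf.exists_isOpen_contDiffOn isOpen_univ (Set.mem_univ y)
  obtain ⟨U', hU', hUU', hy', hgU⟩ := hg.exists_isOpen_contDiffOn hU hy
  have h := norm_iteratedFDerivWithin_mul_le (hfU.mono hUU') hgU hU'.uniqueDiffOn hy' le_rfl
  simpa only [iteratedFDerivWithin_of_isOpen _ hU' hy'] using h

lemma jetNorm_mul_le {f g : 𝔼 → ℝ} {y : 𝔼} {k : ℕ}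
    (hf : ContDiffAt ℝ k f y) (hg : ContDiffAt ℝ k g y) :
    jetNorm k (fun y => f y * g y) y ≤ (k + 1) * 2 ^ k * (jetNorm k f y * jetNorm k g y) := by
  have hs : ∀ (f : 𝔼 → ℝ), ∀ i ≤ k, ‖iteratedFDeriv ℝ i f y‖ ≤ jetNorm k f y := fun f i hi =>
    Finset.single_le_sum (f := fun i => ‖iteratedFDeriv ℝ i f y‖) (fun _ _ => norm_nonneg _)
      (Finset.mem_range.2 (by omega))
  have h1 : ∀ j ∈ Finset.range (k + 1), ‖iteratedFDeriv ℝ j (fun y => f y * g y) y‖ ≤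
      2 ^ k * (jetNorm k f y * jetNorm k g y) := by
    intro j hj
    have hjk : j ≤ k := by simpa [Nat.lt_succ_iff] using hj
    have hjk' : ((j : ℕ) : WithTop ℕ∞) ≤ (k : ℕ) := by exact_mod_cast hjk
    refine (norm_iteratedFDeriv_mul_le_of_contDiffAt (hf.of_le hjk') (hg.of_le hjk')).trans ?_
    calc _ ≤ ∑ i ∈ Finset.range (j + 1), (j.choose i : ℝ) * (jetNorm k f y * jetNorm k g y) := by
          refine Finset.sum_le_sum fun i hi => ?_
          rw [mul_assoc]
          have hij : i ≤ j := by simpa [Nat.lt_succ_iff] using hi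
          have := jetNorm_nonneg k f y
          gcongr
          · exact hs f i (by omega)
          · exact hs g (j - i) (by omega)
      _ = 2 ^ j * (jetNorm k f y * jetNorm k g y) := by
          rw [← Finset.sum_mul]
          congr 1
          exact_mod_cast Nat.sum_range_choose j
      _ ≤ _ := by
          have := mul_nonneg (jetNorm_nonneg k f y) (jetNorm_nonneg k g y)
          gcongr
          norm_num
  refine (Finset.sum_le_card_nsmul _ _ _ h1).trans (le_of_eq ?_)
  simp
  ring

lemma exists_jetNorm_le {K : Set 𝔼} (hK : IsCompact K) {f : 𝔼 → ℝ}
    (hf : ∀ y ∈ K, ContDiffAt ℝ ∞ f y) (k : ℕ) : ∃ C : ℝ, 0 ≤ C ∧ ∀ y ∈ K, jetNorm k f y ≤ C := by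
  obtain ⟨C, hC⟩ := hK.exists_bound_of_continuousOn (f := jetNorm k f) (by
    refine continuousOn_finsetSum _ fun j _ => ContinuousOn.norm fun y hy => ?_
    exact ((hf y hy).iteratedFDeriv_right (m := 0) (i := j)
      (by simpa using natCast_le_infty j)).continuousAt.continuousWithinAt)
  refine ⟨|C|, abs_nonneg _, fun y hy => ?_⟩
  exact ((Real.le_norm_self _).trans (hC y hy)).trans (le_abs_self _)

/-- Multiplication by a smooth function is bounded on jets. -/
lemma exists_jetNorm_mul_le {K : Set 𝔼} (hK : IsCompact K) {a : 𝔼 → ℝ}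
    (ha : ∀ y ∈ K, ContDiffAt ℝ ∞ a y) (k : ℕ) : ∃ C : ℝ, 0 ≤ C ∧ ∀ (f : 𝔼 → ℝ), ∀ y ∈ K,
      ContDiffAt ℝ k f y → jetNorm k (fun y => a y * f y) y ≤ C * jetNorm k f y := by
  obtain ⟨C, hC0, hC⟩ := exists_jetNorm_le hK ha k
  refine ⟨(k + 1) * 2 ^ k * C, by positivity, fun f y hy hf => ?_⟩
  refine (jetNorm_mul_le ((ha y hy).of_le (natCast_le_infty k)) hf).trans ?_
  rw [mul_assoc _ C]
  exact mul_le_mul_of_nonneg_left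
    (mul_le_mul_of_nonneg_right (hC y hy) (jetNorm_nonneg k f y)) (by positivity)

lemma jetNorm_eq_zero {f : 𝔼 → ℝ} {y : 𝔼} (hy : y ∉ tsupport f) (k : ℕ) : jetNorm k f y = 0 := by
  refine Finset.sum_eq_zero fun j _ => ?_
  rw [((notMem_tsupport_iff_eventuallyEq.1 hy).iteratedFDeriv ℝ j).eq_of_nhds, norm_eq_zero]
  exact congrFun (iteratedFDeriv_fun_zero (𝕜 := ℝ) (n := j) (E := 𝔼) (F := ℝ)) y

lemma sobNorm_le_eLpNorm_jetNorm (k : ℕ) (f : 𝔼 → ℝ) :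
    sobNorm k f ≤ (k + 1 : ℕ) * eLpNorm (jetNorm k f) 2 volume := by
  have : ∀ j ∈ Finset.range (k + 1), eLpNorm (iteratedFDeriv ℝ j f) 2 volume ≤
      eLpNorm (jetNorm k f) 2 volume := by
    intro j hj
    refine eLpNorm_mono fun y => ?_
    rw [Real.norm_of_nonneg (jetNorm_nonneg k f y)]
    exact Finset.single_le_sum (f := fun i => ‖iteratedFDeriv ℝ i f y‖)
      (fun _ _ => norm_nonneg _) hj
  refine (Finset.sum_le_card_nsmul _ _ _ this).trans (le_of_eq ?_)
  simp

lemma norm_iteratedFDeriv_le_jetNorm {j k : ℕ} (h : j ≤ k) (f : 𝔼 → ℝ) (y : 𝔼) :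
    ‖iteratedFDeriv ℝ j f y‖ ≤ jetNorm k f y :=
  Finset.single_le_sum (f := fun i => ‖iteratedFDeriv ℝ i f y‖) (fun _ _ => norm_nonneg _)
    (Finset.mem_range.2 (by omega))

/-- Cauchy–Schwarz for a finite sum, which costs the number of terms. It turns pointwise linear
bounds into bounds between integrals of squares, which add up over the pieces. -/
lemma ofReal_le_mul_sum_enorm {ι : Type*} {s : Finset ι} {a C : ℝ} {b : ι → ℝ}
    (h : a ≤ C * ∑ i ∈ s, |b i|) (ha : 0 ≤ a) :
    ‖a‖ₑ ^ 2 ≤ ENNReal.ofReal (C ^ 2 * s.card) * ∑ i ∈ s, ‖b i‖ₑ ^ 2 := by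
  have h1 : a ^ 2 ≤ (C ^ 2 * s.card) * ∑ i ∈ s, |b i| ^ 2 := by
    calc a ^ 2 ≤ (C * ∑ i ∈ s, |b i|) ^ 2 := by gcongr
      _ = C ^ 2 * (∑ i ∈ s, |b i|) ^ 2 := by ring
      _ ≤ C ^ 2 * (s.card * ∑ i ∈ s, |b i| ^ 2) := by gcongr; exact sq_sum_le_card_mul_sum_sq
      _ = _ := by ring
  have e : ∀ t : ℝ, ‖t‖ₑ ^ 2 = ENNReal.ofReal (|t| ^ 2) := fun t => by
    rw [Real.enorm_eq_ofReal_abs, ENNReal.ofReal_pow (abs_nonneg t)]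
  simp only [e]
  rw [← ENNReal.ofReal_sum_of_nonneg fun i _ => by positivity, ← ENNReal.ofReal_mul (by positivity),
    abs_of_nonneg ha]
  exact ENNReal.ofReal_le_ofReal h1

end Jet

namespace BallData

variable {n M : ℕ} (G : BallData n M)

local notation "𝔼" => EuclideanSpace ℝ (Fin n)

/-! ### The norms of the pieces -/

/-- The sum of the squares of the conormal derivatives of order at most `s`. -/
def conormalSq (s : ℕ) (f : EuclideanSpace ℝ (Fin n) → ℝ) (y : EuclideanSpace ℝ (Fin n)) : ℝ≥0∞ :=
  ∑ τ ∈ sortedWords M s, ‖lieWord G.field τ f y‖ₑ ^ 2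

/-- All shells share the support of one cutoff and one frame of cone fields, so both constants come
from the compact support of `bump (some 0)`. The pullback of conormal derivatives is exact, so `k`
does not enter. -/
lemma exists_sobNorm_piece_some_le (s : ℕ) : ∃ C : ℝ≥0, ∀ (k : ℕ) (f : 𝔼 → ℝ),
    ContDiffOn ℝ ∞ f (unitBall n) → sobNorm s (G.piece (some k) f) ^ 2 ≤
      C * ∫⁻ Y in dom (some k), G.conormalSq s f (G.chart (some k) Y) := by
  have hK : IsCompact (tsupport (G.bump (some 0))) := G.hasCompactSupport_bump _
  have hKd : tsupport (G.bump (some 0)) ⊆ dom (some 0) := G.tsupport_bump (some 0)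
  obtain ⟨C₁, h1, hC₁⟩ := exists_jetNorm_mul_le hK (a := G.bump (some 0))
    (fun y _ => (G.contDiff_bump (some 0)).contDiffAt) s
  obtain ⟨C₂, h2, hC₂⟩ := exists_norm_iteratedFDeriv_le (isOpen_compl_singleton (x := (0 : 𝔼)))
    G.contDiffOn_coneField hK (fun Y hY => (G.dom_some_spec (k := 0) (hKd hY)).1)
    (fun Y hY => G.span_coneField (G.dom_some_spec (k := 0) (hKd hY)).1) s (sortedWords M s)
    (fun τ hτ => exists_perm_mem_sortedWords τ hτ)
  set A := C₁ * ((s + 1) * C₂)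
  have hA : 0 ≤ A := by positivity
  refine ⟨(s + 1 : ℕ) ^ 2 * (A ^ 2 * (sortedWords M s).card).toNNReal, fun k f hf => ?_⟩
  have hpt : ∀ Y, ‖jetNorm s (G.piece (some k) f) Y‖ₑ ^ 2 ≤ (dom (some k)).indicator
      (fun Y => ENNReal.ofReal (A ^ 2 * (sortedWords M s).card) *
        G.conormalSq s f (G.chart (some k) Y)) Y := by
    intro Y
    by_cases hY : Y ∈ tsupport (G.bump (some 0))
    · have hYd : Y ∈ dom (some k) := hKd hY
      rw [Set.indicator_of_mem hYd]
      refine ofReal_le_mul_sum_enorm ?_ (jetNorm_nonneg _ _ _)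
      have hg := G.contDiffAt_comp_chart le_rfl hf hYd
      refine (hC₁ _ Y hY (hg.of_le (natCast_le_infty s))).trans ?_
      rw [mul_assoc]
      refine mul_le_mul_of_nonneg_left ?_ h1
      have : ∀ j ∈ Finset.range (s + 1),
          ‖iteratedFDeriv ℝ j (fun Y => f (G.chart (some k) Y)) Y‖ ≤
          C₂ * ∑ τ ∈ sortedWords M s, |lieWord G.field τ f (G.chart (some k) Y)| := by
        intro j hj
        refine (hC₂ _ Y hY (hg.of_le (natCast_le_infty s)) j
          (by simpa [Nat.lt_succ_iff] using hj)).trans (le_of_eq ?_)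
        congr 1
        exact Finset.sum_congr rfl fun τ _ => by
          rw [G.lieWord_comp_chart τ (hf.of_le (natCast_le_infty _)) hYd]
      refine (Finset.sum_le_card_nsmul _ _ _ this).trans (le_of_eq ?_)
      simp
      ring
    · have : Y ∉ tsupport (G.piece (some k) f) := fun h => hY (tsupport_mul_subset_left h)
      simp [jetNorm_eq_zero this]
  have hm : MeasurableSet (dom (some k) : Set 𝔼) := (isOpen_dom _).measurableSet
  calc sobNorm s (G.piece (some k) f) ^ 2
      ≤ ((s + 1 : ℕ) * eLpNorm (jetNorm s (G.piece (some k) f)) 2 volume) ^ 2 := by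
        gcongr; exact sobNorm_le_eLpNorm_jetNorm s _
    _ = (s + 1 : ℕ) ^ 2 * ∫⁻ Y, ‖jetNorm s (G.piece (some k) f) Y‖ₑ ^ 2 := by
        rw [mul_pow, eLpNorm_two_sq]
    _ ≤ (s + 1 : ℕ) ^ 2 * ∫⁻ Y, (dom (some k)).indicator
      (fun Y => ENNReal.ofReal (A ^ 2 * (sortedWords M s).card) *
        G.conormalSq s f (G.chart (some k) Y)) Y := by gcongr; exact hpt _
    _ = _ := by
        rw [lintegral_indicator hm, lintegral_const_mul' _ _ ENNReal.ofReal_ne_top, ← mul_assoc]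
        push_cast
        rfl

lemma exists_x_le : ∃ X : ℝ, 0 < X ∧ ∀ y ∈ unitBall n, G.x y ≤ X := by
  obtain ⟨C, hC⟩ := (isCompact_closedBall (0 : 𝔼) 1).exists_bound_of_continuousOn
    G.x_smooth.continuous.continuousOn
  refine ⟨|C| + 1, by positivity, fun y hy => ?_⟩
  have := hC y (Metric.ball_subset_closedBall hy)
  linarith [Real.le_norm_self (G.x y), le_abs_self C]

/-- Conormal derivatives of `χ f` and their weighted versions. -/
lemma exists_enorm_le_weighted (m : ℕ) : ∃ C : ℝ≥0, ∀ y ∈ G.annulus, ∀ t : ℝ,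
    ‖t‖ₑ ≤ C * ‖(G.x y ^ m)⁻¹ * t‖ₑ := by
  obtain ⟨X, hX, hle⟩ := G.exists_x_le
  refine ⟨(X ^ m).toNNReal, fun y hy t => ?_⟩
  have hx := G.x_pos_of_mem hy
  have h1 : |t| ≤ X ^ m * |(G.x y ^ m)⁻¹ * t| := by
    rw [abs_mul, abs_of_pos (show 0 < (G.x y ^ m)⁻¹ by positivity), ← mul_assoc]
    refine le_mul_of_one_le_left (abs_nonneg t) ?_
    rw [← div_eq_mul_inv, one_le_div (by positivity)]
    gcongr
    exact hle y (G.annulus_subset_ball hy)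
  rw [Real.enorm_eq_ofReal_abs, Real.enorm_eq_ofReal_abs]
  exact (ENNReal.ofReal_le_ofReal h1).trans (le_of_eq (ENNReal.ofReal_mul (by positivity)))

lemma lieWord_χ_mul {f : 𝔼 → ℝ} {y : 𝔼} (hy : y ∈ G.collar) (τ : List (Option (Fin M))) :
    lieWord G.field τ (fun z => G.χ z * f z) y = lieWord G.field τ f y :=
  lieWord_congr G.isOpen_collar (fun z hz => by rw [G.χ_eq_one hz.1.le hz.2.le, one_mul]) τ hy

lemma exists_setLIntegral_conormalSq_le (m r : ℕ) : ∃ C : ℝ≥0, ∀ f : 𝔼 → ℝ,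
    ContDiffOn ℝ ∞ f G.annulus →
      ∫⁻ y in G.collar, ENNReal.ofReal ((G.x y ^ m)⁻¹ ^ 2) * G.conormalSq (m + r) f y ∂G.measA ≤
        C * G.normHr m r f ^ 2 := by
  obtain ⟨C, hC⟩ := G.exists_eLpNorm_lieWord_le_normHr m r
  refine ⟨(sortedWords M (m + r)).card * C ^ 2, fun f hf => ?_⟩
  have hχf : ContDiffOn ℝ ∞ (fun z => G.χ z * f z) G.annulus := G.χ_smooth.contDiffOn.mul hf
  have hmeas : ∀ τ, AEMeasurable (fun y => ‖(G.x y ^ m)⁻¹ *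
      lieWord G.field τ (fun z => G.χ z * f z) y‖ₑ ^ 2) G.measA := by
    intro τ
    have : ContinuousOn (fun y => (G.x y ^ m)⁻¹ *
        lieWord G.field τ (fun z => G.χ z * f z) y) G.annulus :=
      ((G.x_smooth.continuous.pow m).continuousOn.inv₀ fun y hy =>
        (pow_pos (G.x_pos_of_mem hy) m).ne').mul (G.contDiffOn_lieWord_annulus hχf τ).continuousOn
    exact (aestronglyMeasurable_measA this).enorm.pow_const 2
  have h1 : ∀ y ∈ G.collar, ENNReal.ofReal ((G.x y ^ m)⁻¹ ^ 2) * G.conormalSq (m + r) f y =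
      ∑ τ ∈ sortedWords M (m + r),
        ‖(G.x y ^ m)⁻¹ * lieWord G.field τ (fun z => G.χ z * f z) y‖ₑ ^ 2 := by
    intro y hy
    rw [conormalSq, Finset.mul_sum]
    refine Finset.sum_congr rfl fun τ _ => ?_
    have hx := G.x_pos_of_mem (G.collar_subset hy)
    rw [G.lieWord_χ_mul hy, enorm_mul, mul_pow,
      Real.enorm_of_nonneg (show 0 ≤ (G.x y ^ m)⁻¹ by positivity),
      ENNReal.ofReal_pow (by positivity)]
  rw [setLIntegral_congr_fun G.isOpen_collar.measurableSet h1]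
  refine (setLIntegral_le_lintegral _ _).trans ?_
  rw [lintegral_finsetSum' _ fun τ _ => hmeas τ]
  refine (Finset.sum_le_card_nsmul _ _ ((C * G.normHr m r f) ^ 2) fun τ hτ => ?_).trans (le_of_eq ?_)
  · rw [← eLpNorm_two_sq]
    gcongr
    exact hC f hf τ hτ
  · push_cast
    rw [nsmul_eq_mul, mul_pow, mul_assoc]

lemma aemeasurable_conormalSq (s : ℕ) {f : 𝔼 → ℝ} (hf : ContDiffOn ℝ ∞ f G.annulus) :
    AEMeasurable (G.conormalSq s f) G.measA :=
  Finset.aemeasurable_fun_sum _ fun τ _ =>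
    (aestronglyMeasurable_measA (G.contDiffOn_lieWord_annulus hf τ).continuousOn).enorm.pow_const 2

/-- The shells of a function of `ℋ^{m,r}`. -/
lemma exists_tsum_sobNorm_piece_some_le (hn : 2 ≤ n) (m r : ℕ) : ∃ C : ℝ≥0, ∀ f : 𝔼 → ℝ,
    ContDiffOn ℝ ∞ f (unitBall n) →
      ∑' k, ENNReal.ofReal (G.weight (some k)) * sobNorm (m + r) (G.piece (some k) f) ^ 2 ≤
        C * G.normHr m r f ^ 2 := by
  obtain ⟨C₁, hC₁⟩ := G.exists_sobNorm_piece_some_le (m + r)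
  obtain ⟨C₂, hC₂⟩ := G.exists_setLIntegral_conormalSq_le m r
  obtain ⟨C₃, hC₃⟩ := G.exists_enorm_le_weighted m
  refine ⟨C₁ * ((4 ^ (n - 2) : ℝ).toNNReal * (3 * (C₃ ^ 2 * C₂))), fun f hf => ?_⟩
  have hfA := hf.mono G.annulus_subset_ball
  calc _ ≤ ∑' k, C₁ * (ENNReal.ofReal (G.weight (some k)) *
        ∫⁻ Y in dom (some k), G.conormalSq (m + r) f (G.chart (some k) Y)) := by
        refine ENNReal.tsum_le_tsum fun k => ?_
        rw [mul_left_comm]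
        exact mul_le_mul_right (hC₁ k f hf) _
    _ ≤ C₁ * (ENNReal.ofReal (4 ^ (n - 2)) *
          (3 * ∫⁻ y in G.collar, G.conormalSq (m + r) f y ∂G.measA)) := by
        rw [ENNReal.tsum_mul_left]
        exact mul_le_mul_right (G.tsum_lintegral_shell_le hn (G.aemeasurable_conormalSq _ hfA)) _
    _ ≤ C₁ * (ENNReal.ofReal (4 ^ (n - 2)) * (3 * (C₃ ^ 2 * ∫⁻ y in G.collar,
          ENNReal.ofReal ((G.x y ^ m)⁻¹ ^ 2) * G.conormalSq (m + r) f y ∂G.measA))) := by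
        gcongr
        rw [← lintegral_const_mul' _ _ (by simp)]
        refine setLIntegral_mono' G.isOpen_collar.measurableSet fun y hy => ?_
        simp only [conormalSq, Finset.mul_sum]
        refine Finset.sum_le_sum fun τ _ => ?_
        have hx := G.x_pos_of_mem (G.collar_subset hy)
        have := hC₃ y (G.collar_subset hy) (lieWord G.field τ f y)
        rw [ENNReal.ofReal_pow (by positivity), ← mul_pow, ← mul_pow]
        gcongr
        rw [enorm_mul, Real.enorm_of_nonneg (show 0 ≤ (G.x y ^ m)⁻¹ by positivity)] at this
        exact this
    _ ≤ C₁ * (ENNReal.ofReal (4 ^ (n - 2)) * (3 * (C₃ ^ 2 * (C₂ * G.normHr m r f ^ 2)))) := by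
        gcongr; exact hC₂ f hfA
    _ = _ := by
        push_cast
        rw [ENNReal.ofReal]
        ring

/-- Uniform bounds of the shells of a function of `ℋ^{1,r}`. -/
lemma exists_sobNorm_piece_some_le_normHr (hn : 2 ≤ n) (r : ℕ) : ∃ C : ℝ≥0, ∀ (k : ℕ) (f : 𝔼 → ℝ),
    ContDiffOn ℝ ∞ f (unitBall n) →
      sobNorm (1 + r) (G.piece (some k) f) ^ 2 ≤ C * G.normHr 1 r f ^ 2 := by
  obtain ⟨C₁, hC₁⟩ := G.exists_sobNorm_piece_some_le (1 + r)
  obtain ⟨C₂, hC₂⟩ := G.exists_setLIntegral_conormalSq_le 1 r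
  refine ⟨C₁ * ((4 ^ (n - 2) * 16 : ℝ).toNNReal * C₂), fun k f hf => ?_⟩
  have hfA := hf.mono G.annulus_subset_ball
  have hl := G.scale_pos k
  have hm := G.measurableSet_shell (G.scale k) (T := Set.Ioo (1 / 2) 4) measurableSet_Ioo
  have h1 := G.setLIntegral_unblow_le hn hl hm (fun y hy => G.collar_subset hy.1) (c := 4)
    (fun y hy => hy.2.2.le) (G.conormalSq (1 + r) f)
  rw [G.blow_image_shell hl fun t ht => ⟨by linarith [ht.1],
      by linarith [ht.2, G.four_lt_scale_mul_depth k]⟩] at h1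
  calc _ ≤ C₁ * ∫⁻ Y in dom (some k), G.conormalSq (1 + r) f (G.chart (some k) Y) := hC₁ k f hf
    _ ≤ C₁ * (ENNReal.ofReal (4 ^ (n - 2) * G.scale k ^ 2) *
        ∫⁻ y in G.shell (G.scale k) (Set.Ioo (1 / 2) 4), G.conormalSq (1 + r) f y ∂G.measA) :=
        mul_le_mul_right h1 _
    -- Here the weight of `ℋ^{1,r}` is spent: on the enlarged shell `l x ≤ 4`, hence `l² ≤ 16 x⁻²`,
    -- and the factor `l²` of the change of variables disappears.
    _ ≤ C₁ * (ENNReal.ofReal (4 ^ (n - 2) * 16) *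
        ∫⁻ y in G.shell (G.scale k) (Set.Ioo (1 / 2) 4),
          ENNReal.ofReal ((G.x y ^ 1)⁻¹ ^ 2) * G.conormalSq (1 + r) f y ∂G.measA) := by
        refine mul_le_mul_right ?_ _
        rw [← lintegral_const_mul' _ _ ENNReal.ofReal_ne_top,
          ← lintegral_const_mul' _ _ ENNReal.ofReal_ne_top]
        refine setLIntegral_mono' hm fun y hy => ?_
        rw [← mul_assoc, ← ENNReal.ofReal_mul (by positivity)]
        refine mul_le_mul_left (ENNReal.ofReal_le_ofReal ?_) _
        have hx := G.x_pos_of_mem (G.collar_subset hy.1)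
        rw [mul_assoc]
        refine mul_le_mul_of_nonneg_left ?_ (by positivity)
        rw [pow_one, inv_pow, ← div_eq_mul_inv, le_div_iff₀ (by positivity), ← mul_pow]
        calc (G.scale k * G.x y) ^ 2 ≤ 4 ^ 2 := by
              gcongr
              exact hy.2.2.le
          _ = 16 := by norm_num
    _ ≤ C₁ * (ENNReal.ofReal (4 ^ (n - 2) * 16) * (C₂ * G.normHr 1 r f ^ 2)) := by
        gcongr
        exact (lintegral_mono_set Set.inter_subset_left).trans (hC₂ f hfA)
    _ = _ := by
        push_cast
        rw [ENNReal.ofReal]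
        ring

end BallData

end

section

lemma sum_sq_le_card_sq_mul {ι : Type*} {s : Finset ι} {t : ι → ℝ≥0∞} {B : ℝ≥0∞}
    (h : ∀ i ∈ s, t i ^ 2 ≤ B) : (∑ i ∈ s, t i) ^ 2 ≤ (s.card : ℝ≥0∞) ^ 2 * B := by
  have hB : (B ^ (2⁻¹ : ℝ)) ^ 2 = B := by
    rw [← ENNReal.rpow_natCast, ← ENNReal.rpow_mul]; norm_num
  have h1 : ∀ i ∈ s, t i ≤ B ^ (2⁻¹ : ℝ) := fun i hi => by
    rw [← ENNReal.pow_le_pow_left_iff two_ne_zero, hB]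
    exact h i hi
  rw [← hB, ← mul_pow]
  gcongr
  refine (Finset.sum_le_card_nsmul _ _ _ h1).trans (le_of_eq ?_)
  rw [nsmul_eq_mul]

lemma add_sq_le_two_mul (a b : ℝ≥0∞) : (a + b) ^ 2 ≤ 2 * (a ^ 2 + b ^ 2) := by
  have := ENNReal.rpow_add_le_mul_rpow_add_rpow a b (p := 2) (by norm_num)
  norm_num at this
  exact_mod_cast this

namespace BallData

variable {n M : ℕ} (G : BallData n M)

local notation "𝔼" => EuclideanSpace ℝ (Fin n)

/-- The density of `x dx dθ` vanishes only on the boundary of the ball, so on a compact part of it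
the density is bounded below. -/
lemma exists_setLIntegral_volume_le {K : Set 𝔼} (hK : IsCompact K) (hKb : K ⊆ unitBall n) :
    ∃ C : ℝ≥0, ∀ h : 𝔼 → ℝ≥0∞,
      ∫⁻ y in K ∩ G.annulus, h y ≤ C * ∫⁻ y in K ∩ G.annulus, h y ∂G.measA := by
  have hK' : IsCompact (K ∩ {y | G.R ≤ ‖y‖}) :=
    hK.inter_right (isClosed_le continuous_const continuous_norm)
  have hlt : ∀ y ∈ K, ‖y‖ < 1 := fun y hy => by simpa [unitBall] using hKb hy
  obtain ⟨C, hC⟩ := hK'.exists_bound_of_continuousOn (f := fun y => (G.density y)⁻¹) (by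
    refine ContinuousOn.inv₀ (((G.x_smooth.continuous.mul (continuous_abs.comp
      G.continuous_fderiv_x)).continuousOn).div (continuous_norm.pow n).continuousOn ?_) ?_
    · intro y hy
      exact pow_ne_zero _ (G.R_pos.trans_le hy.2).ne'
    · intro y hy
      have h1 := G.x_pos y (hlt y hy.1)
      have h2 := abs_pos.2 (G.x_radial y hy.2 (hlt y hy.1).le).ne
      have h3 := G.R_pos.trans_le hy.2
      unfold density
      positivity)
  refine ⟨C.toNNReal, fun h => ?_⟩
  have hm : MeasurableSet (K ∩ G.annulus) := hK.measurableSet.inter G.measurableSet_annulus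
  rw [G.setLIntegral_measA hm Set.inter_subset_right, ← lintegral_const_mul' _ _ ENNReal.coe_ne_top]
  refine setLIntegral_mono' hm fun y hy => ?_
  have hx := G.x_pos_of_mem hy.2
  have hc := G.annulus_subset hy.2
  have hd : 0 < G.density y := by
    have := abs_pos.2 hc.2.ne
    have := norm_pos_iff.2 hc.1
    unfold density
    positivity
  rw [← mul_assoc]
  refine le_mul_of_one_le_left zero_le ?_
  have h1 := hC y ⟨hy.1, hy.2.1.le⟩
  rw [norm_inv, Real.norm_of_nonneg hd.le] at h1
  have h2 : 0 ≤ C := (inv_nonneg.2 hd.le).trans h1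
  rw [show ((C.toNNReal : ℝ≥0) : ℝ≥0∞) = ENNReal.ofReal C from rfl, ← ENNReal.ofReal_mul h2,
    ← ENNReal.ofReal_one]
  refine ENNReal.ofReal_le_ofReal ?_
  calc (1 : ℝ) = (G.density y)⁻¹ * G.density y := (inv_mul_cancel₀ hd.ne').symm
    _ ≤ C * G.density y := by gcongr

lemma eLpNorm_jetNorm_le_ballNorm (s : ℕ) {f : 𝔼 → ℝ} (hf : ContDiffOn ℝ ∞ f (unitBall n)) :
    eLpNorm (jetNorm s f) 2 (volume.restrict (unitBall n)) ≤ ballNorm s f := by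
  have hm : ∀ j, AEStronglyMeasurable (fun y => iteratedFDeriv ℝ j f y)
      (volume.restrict (unitBall n)) := fun j => by
    refine ContinuousOn.aestronglyMeasurable (fun y hy => ?_) Metric.isOpen_ball.measurableSet
    exact ((hf.contDiffAt (Metric.isOpen_ball.mem_nhds hy)).iteratedFDeriv_right (m := 0) (i := j)
      (by simpa using natCast_le_infty j)).continuousAt.continuousWithinAt
  have e : jetNorm s f = ∑ j ∈ Finset.range (s + 1), fun y => ‖iteratedFDeriv ℝ j f y‖ := by
    ext y; simp [jetNorm]
  rw [e]
  refine (eLpNorm_sum_le (fun j _ => (hm j).norm) (by norm_num)).trans (le_of_eq ?_)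
  exact Finset.sum_congr rfl fun j _ => eLpNorm_norm _

/-- The inner sphere of the annulus is the one place where `χ f` need not vanish nearby although the
point is outside the annulus; it is a null set. -/
lemma ae_norm_ne : ∀ᵐ y : 𝔼, ‖y‖ ≠ G.R := by
  have := Measure.addHaar_sphere_of_ne_zero (volume : Measure 𝔼) 0 G.R_pos.ne'
  rw [← compl_mem_ae_iff] at this
  filter_upwards [this] with y hy
  simpa using hy

/-- The interior piece of a function of `ℋ^{m,r}`. -/
lemma exists_sobNorm_piece_none_le (m r : ℕ) : ∃ C : ℝ≥0, ∀ f : 𝔼 → ℝ,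
    ContDiffOn ℝ ∞ f (unitBall n) →
      sobNorm (m + r) (G.piece none f) ^ 2 ≤ C * G.normHr m r f ^ 2 := by
  set s := m + r with hs
  set K := tsupport (G.bump none) with hKdef
  have hK : IsCompact K := G.hasCompactSupport_bump none
  have hKb : K ⊆ unitBall n := G.tsupport_bump none
  have hlt : ∀ y ∈ K, ‖y‖ < 1 := fun y hy => by simpa [unitBall] using hKb hy
  have hKR : IsCompact (K ∩ {y | G.R ≤ ‖y‖}) :=
    hK.inter_right (isClosed_le continuous_const continuous_norm)
  have hxK : ∀ y ∈ K, G.x y ^ r ≠ 0 := fun y hy => (pow_pos (G.x_pos y (hlt y hy)) r).ne'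
  obtain ⟨C₁, h1, hC₁⟩ := exists_jetNorm_mul_le hK (a := G.bump none)
    (fun y _ => (G.contDiff_bump none).contDiffAt) s
  obtain ⟨C₂, h2, hC₂⟩ := exists_jetNorm_mul_le hK (a := fun y => G.bump none y * (G.x y ^ r)⁻¹)
    (fun y hy => (G.contDiff_bump none).contDiffAt.mul
      ((G.x_smooth.pow r).contDiffAt.inv (hxK y hy))) s
  obtain ⟨C₃, h3, hC₃⟩ := exists_norm_iteratedFDeriv_le G.isOpen_coordDomain G.contDiffOn_field hKR
    (fun y hy => G.mem_coordDomain hy.2 (hlt y hy.1).le)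
    (fun y hy => G.span_field (G.mem_coordDomain hy.2 (hlt y hy.1).le)
      (G.x_pos y (hlt y hy.1)).ne') s (sortedWords M s)
    (fun τ hτ => exists_perm_mem_sortedWords τ hτ)
  obtain ⟨C₄, hC₄⟩ := G.exists_setLIntegral_volume_le hK hKb
  obtain ⟨C₅, hC₅⟩ := G.exists_eLpNorm_lieWord_le_normHr m r
  obtain ⟨C₆, hC₆⟩ := G.exists_enorm_le_weighted m
  set A := ENNReal.ofReal (((s + 1) * C₃) ^ 2 * (sortedWords M s).card) with hA
  set B : ℝ≥0 := 2 * ((C₁.toNNReal) ^ 2 * ((((s + 1) * C₃) ^ 2 * (sortedWords M s).card).toNNReal *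
    (C₄ * ((sortedWords M s).card * (C₆ ^ 2 * C₅ ^ 2)))) + C₂.toNNReal ^ 2) with hB
  refine ⟨(s + 1 : ℕ) ^ 2 * B, fun f hf => ?_⟩
  set g := fun z => G.χ z * f z with hg
  set h := fun y => (1 - G.χ y) * (G.x y ^ r * f y) with hh
  have hgs : ContDiffOn ℝ ∞ g (unitBall n) := G.χ_smooth.contDiffOn.mul hf
  have hhs : ContDiffOn ℝ ∞ h (unitBall n) :=
    (contDiff_const.sub G.χ_smooth).contDiffOn.mul ((G.x_smooth.pow r).contDiffOn.mul hf)
  have hat : ∀ {w : 𝔼 → ℝ}, ContDiffOn ℝ ∞ w (unitBall n) → ∀ y ∈ K, ContDiffAt ℝ s w y :=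
    fun hw y hy => (hw.contDiffAt (Metric.isOpen_ball.mem_nhds (hKb hy))).of_le (natCast_le_infty s)
  -- the pointwise bound
  have hpt : ∀ y ∈ K, ‖jetNorm s (G.piece none f) y‖ₑ ^ 2 ≤
      2 * (ENNReal.ofReal C₁ ^ 2 * ‖jetNorm s g y‖ₑ ^ 2 +
        ENNReal.ofReal C₂ ^ 2 * ‖jetNorm s h y‖ₑ ^ 2) := by
    intro y hy
    -- The function is split into `χ f`, controlled by conormal derivatives, and `(1 - χ) f`. The
    -- norm controls the latter through `x^r f`; dividing by `x^r` is harmless because `x` is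
    -- positive on the compact support of the cutoff.
    have hev : G.piece none f =ᶠ[𝓝 y] fun y => G.bump none y * g y +
        G.bump none y * (G.x y ^ r)⁻¹ * h y := by
      filter_upwards [Metric.isOpen_ball.mem_nhds (hKb hy)] with z hz
      have : G.x z ^ r ≠ 0 := (pow_pos (G.x_pos z (by simpa [unitBall] using hz)) r).ne'
      simp only [piece, chart, id, hg, hh]
      field_simp
      ring
    have ha : ContDiffAt ℝ s (fun y => G.bump none y * g y) y :=
      ((G.contDiff_bump none).of_infty s).contDiffAt.mul (hat hgs y hy)
    have hb : ContDiffAt ℝ s (fun y => G.bump none y * (G.x y ^ r)⁻¹ * h y) y :=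
      (((G.contDiff_bump none).of_infty s).contDiffAt.mul
        (((G.x_smooth.pow r).of_infty s).contDiffAt.inv (hxK y hy))).mul (hat hhs y hy)
    have hle : jetNorm s (G.piece none f) y ≤ C₁ * jetNorm s g y + C₂ * jetNorm s h y := by
      rw [jetNorm_congr hev]
      refine le_trans ?_ (add_le_add (hC₁ g y hy (hat hgs y hy)) (hC₂ h y hy (hat hhs y hy)))
      simp only [jetNorm]
      rw [← Finset.sum_add_distrib]
      refine Finset.sum_le_sum fun j hj => ?_
      have hjs : ((j : ℕ) : WithTop ℕ∞) ≤ (s : ℕ) := by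
        exact_mod_cast Nat.lt_succ_iff.1 (Finset.mem_range.1 hj)
      have := iteratedFDeriv_add_apply (ha.of_le hjs) (hb.of_le hjs)
      have e : (fun y => G.bump none y * g y + G.bump none y * (G.x y ^ r)⁻¹ * h y) =
        (fun y => G.bump none y * g y) + fun y => G.bump none y * (G.x y ^ r)⁻¹ * h y := rfl
      rw [e, this]
      exact norm_add_le _ _
    have e1 : ‖jetNorm s (G.piece none f) y‖ₑ ≤
        ENNReal.ofReal C₁ * ‖jetNorm s g y‖ₑ + ENNReal.ofReal C₂ * ‖jetNorm s h y‖ₑ := by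
      rw [Real.enorm_of_nonneg (jetNorm_nonneg _ _ _), Real.enorm_of_nonneg (jetNorm_nonneg _ _ _),
        Real.enorm_of_nonneg (jetNorm_nonneg _ _ _), ← ENNReal.ofReal_mul h1,
        ← ENNReal.ofReal_mul h2, ← ENNReal.ofReal_add (mul_nonneg h1 (jetNorm_nonneg _ _ _))
          (mul_nonneg h2 (jetNorm_nonneg _ _ _))]
      exact ENNReal.ofReal_le_ofReal hle
    calc _ ≤ (ENNReal.ofReal C₁ * ‖jetNorm s g y‖ₑ + ENNReal.ofReal C₂ * ‖jetNorm s h y‖ₑ) ^ 2 := by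
          gcongr
      _ ≤ _ := (add_sq_le_two_mul _ _).trans (by rw [mul_pow, mul_pow])
  -- the term with `χ`
  have hg1 : ∫⁻ y in K, ‖jetNorm s g y‖ₑ ^ 2 ≤
      A * (C₄ * ((sortedWords M s).card * (C₆ ^ 2 * C₅ ^ 2) * G.normHr m r f ^ 2)) := by
    have hfA := hf.mono G.annulus_subset_ball
    have hgA := hgs.mono G.annulus_subset_ball
    have hpt1 : ∀ᵐ y ∂volume.restrict K, ‖jetNorm s g y‖ₑ ^ 2 ≤
        G.annulus.indicator (fun y => A * G.conormalSq s g y) y := by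
      filter_upwards [ae_restrict_mem hK.measurableSet, ae_restrict_of_ae G.ae_norm_ne]
        with y hy hyR
      rcases lt_or_gt_of_ne hyR with hlt' | hgt
      · have : y ∉ tsupport g := by
          rw [notMem_tsupport_iff_eventuallyEq]
          filter_upwards [(isOpen_lt continuous_norm continuous_const).mem_nhds hlt'] with z hz
          simp only [hg, G.χ_zero z (le_of_lt hz), zero_mul, Pi.zero_apply]
        rw [jetNorm_eq_zero this]
        simp
      · have hyA : y ∈ G.annulus := ⟨hgt, hlt y hy⟩
        rw [Set.indicator_of_mem hyA]
        refine ofReal_le_mul_sum_enorm ?_ (jetNorm_nonneg _ _ _)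
        rw [mul_assoc]
        have := fun j (hj : j ∈ Finset.range (s + 1)) => hC₃ g y ⟨hy, hgt.le⟩ (hat hgs y hy) j
          (Nat.lt_succ_iff.1 (Finset.mem_range.1 hj))
        refine (Finset.sum_le_card_nsmul _ _ _ this).trans (le_of_eq ?_)
        simp
    calc _ ≤ ∫⁻ y in K, G.annulus.indicator (fun y => A * G.conormalSq s g y) y :=
          lintegral_mono_ae hpt1
      _ = A * ∫⁻ y in K ∩ G.annulus, G.conormalSq s g y := by
          rw [lintegral_indicator G.measurableSet_annulus,
            Measure.restrict_restrict G.measurableSet_annulus, Set.inter_comm,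
            lintegral_const_mul' _ _ ENNReal.ofReal_ne_top]
      _ ≤ A * (C₄ * ∫⁻ y, G.conormalSq s g y ∂G.measA) :=
          mul_le_mul_right ((hC₄ _).trans (mul_le_mul_right (setLIntegral_le_lintegral _ _) _)) _
      _ ≤ _ := by
          gcongr
          simp only [conormalSq]
          rw [lintegral_finsetSum' _ fun τ _ => (aestronglyMeasurable_measA
            (G.contDiffOn_lieWord_annulus hgA τ).continuousOn).enorm.pow_const 2]
          refine (Finset.sum_le_card_nsmul _ _ (C₆ ^ 2 * (C₅ * G.normHr m r f) ^ 2)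
            fun τ hτ => ?_).trans (le_of_eq ?_)
          · rw [← eLpNorm_two_sq]
            have h6 : eLpNorm (lieWord G.field τ g) 2 G.measA ≤ C₆ • eLpNorm (fun y =>
                (G.x y ^ m)⁻¹ * lieWord G.field τ (fun z => G.χ z * f z) y) 2 G.measA := by
              refine eLpNorm_le_nnreal_smul_eLpNorm_of_ae_le_mul ?_ 2
              filter_upwards [G.ae_mem_annulus] with y hy
              have := hC₆ y hy (lieWord G.field τ g y)
              simp only [enorm_eq_nnnorm] at this
              exact_mod_cast this
            rw [ENNReal.smul_def, smul_eq_mul] at h6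
            rw [← mul_pow]
            gcongr
            exact h6.trans (mul_le_mul_right (hC₅ f hfA τ hτ) _)
          · rw [nsmul_eq_mul, mul_pow]
            ring
  have hh1 : ∫⁻ y in K, ‖jetNorm s h y‖ₑ ^ 2 ≤ G.normHr m r f ^ 2 := by
    rw [← eLpNorm_two_sq]
    gcongr
    refine (eLpNorm_mono_measure _ (Measure.restrict_mono hKb le_rfl)).trans ?_
    refine (eLpNorm_jetNorm_le_ballNorm s hhs).trans ?_
    refine le_trans ?_ (normH_le_normHr (m := m) (le_refl r) f)
    rw [normH_eq]
    exact le_add_self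
  have hmeas : AEMeasurable (fun y => ENNReal.ofReal C₂ ^ 2 * ‖jetNorm s h y‖ₑ ^ 2)
      (volume.restrict K) := by
    have : ContinuousOn (jetNorm s h) K := by
      refine continuousOn_finsetSum _ fun j _ => ContinuousOn.norm fun y hy => ?_
      exact ((hhs.contDiffAt (Metric.isOpen_ball.mem_nhds (hKb hy))).iteratedFDeriv_right (m := 0)
        (i := j) (by simpa using natCast_le_infty j)).continuousAt.continuousWithinAt
    exact ((this.aestronglyMeasurable hK.measurableSet).enorm.pow_const 2).const_mul _
  have hsupp : Function.support (fun y => ‖jetNorm s (G.piece none f) y‖ₑ ^ 2) ⊆ K := by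
    intro y hy
    by_contra hyK
    refine hy ?_
    have : y ∉ tsupport (G.piece none f) := fun h => hyK (tsupport_mul_subset_left h)
    simp [jetNorm_eq_zero this]
  calc sobNorm s (G.piece none f) ^ 2
      ≤ ((s + 1 : ℕ) * eLpNorm (jetNorm s (G.piece none f)) 2 volume) ^ 2 := by
        gcongr; exact sobNorm_le_eLpNorm_jetNorm s _
    _ = (s + 1 : ℕ) ^ 2 * ∫⁻ y in K, ‖jetNorm s (G.piece none f) y‖ₑ ^ 2 := by
        rw [mul_pow, eLpNorm_two_sq, setLIntegral_eq_of_support_subset hsupp]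
    _ ≤ (s + 1 : ℕ) ^ 2 * (2 * (ENNReal.ofReal C₁ ^ 2 * (∫⁻ y in K, ‖jetNorm s g y‖ₑ ^ 2) +
          ENNReal.ofReal C₂ ^ 2 * ∫⁻ y in K, ‖jetNorm s h y‖ₑ ^ 2)) := by
        gcongr
        refine (setLIntegral_mono' hK.measurableSet hpt).trans (le_of_eq ?_)
        rw [lintegral_const_mul' _ _ (by simp), lintegral_add_right' _ hmeas,
          lintegral_const_mul' _ _ (by simp), lintegral_const_mul' _ _ (by simp)]
    _ ≤ (s + 1 : ℕ) ^ 2 * (2 * (ENNReal.ofReal C₁ ^ 2 * (A * (C₄ * ((sortedWords M s).card *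
          (C₆ ^ 2 * C₅ ^ 2) * G.normHr m r f ^ 2))) + ENNReal.ofReal C₂ ^ 2 * G.normHr m r f ^ 2)) := by
        gcongr
    _ = _ := by
        rw [hB, hA]
        push_cast
        simp only [ENNReal.ofReal]
        ring

end BallData

end

section

namespace BallData

variable {n M : ℕ} (G : BallData n M)

local notation "𝔼" => EuclideanSpace ℝ (Fin n)

/-! ### A quadratic form that controls the norm of `ℋ^{0,r}` -/

/-- A quadratic form equivalent to the square of the norm of `ℋ^{0,r}`. -/
def energy (r : ℕ) (f : EuclideanSpace ℝ (Fin n) → ℝ) : ℝ≥0∞ :=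
  (∑ τ ∈ sortedWords M r, ∫⁻ y, ‖lieWord G.field τ f y‖ₑ ^ 2 ∂G.measA) +
    ∑ τ ∈ words n r, ∫⁻ y in G.core none, ‖flatWord τ f y‖ₑ ^ 2

lemma mem_core_none {y : 𝔼} : y ∈ G.core none ↔ ‖y‖ ≤ G.outerRadius := by simp [core]

lemma core_none_subset_ball : G.core none ⊆ unitBall n := G.core_subset_dom none

lemma measurableSet_core_none : MeasurableSet (G.core none) := (G.isCompact_core none).measurableSet

lemma contDiffAt_of_mem_core {f : 𝔼 → ℝ} (hf : ContDiffOn ℝ ∞ f (unitBall n)) {y : 𝔼}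
    (hy : y ∈ G.core none) (s : ℕ) : ContDiffAt ℝ s f y :=
  (hf.contDiffAt (Metric.isOpen_ball.mem_nhds (G.core_none_subset_ball hy))).of_le
    (natCast_le_infty s)

lemma contDiffOn_flatWord {f : 𝔼 → ℝ} (hf : ContDiffOn ℝ ∞ f (unitBall n)) (τ : List (Fin n)) :
    ContDiffOn ℝ ∞ (flatWord τ f) (unitBall n) :=
  contDiffOn_lieWord_infty Metric.isOpen_ball (fun _ => contDiffOn_const) τ hf

lemma exists_setLIntegral_jetNorm_le_energy (r : ℕ) : ∃ C : ℝ≥0, ∀ f : 𝔼 → ℝ,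
    ContDiffOn ℝ ∞ f (unitBall n) →
      ∫⁻ y in G.core none, ‖jetNorm r f y‖ₑ ^ 2 ≤ C * G.energy r f := by
  obtain ⟨C, -, hC⟩ := exists_jetNorm_le_flatWord (n := n) r
  refine ⟨(C ^ 2 * (words n r).card).toNNReal, fun f hf => ?_⟩
  calc _ ≤ ∫⁻ y in G.core none, ENNReal.ofReal (C ^ 2 * (words n r).card) *
          ∑ τ ∈ words n r, ‖flatWord τ f y‖ₑ ^ 2 :=
        setLIntegral_mono' G.measurableSet_core_none fun y hy =>
          ofReal_le_mul_sum_enorm (hC f y r le_rfl (G.contDiffAt_of_mem_core hf hy r))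
            (jetNorm_nonneg _ _ _)
    _ = ENNReal.ofReal (C ^ 2 * (words n r).card) *
          ∑ τ ∈ words n r, ∫⁻ y in G.core none, ‖flatWord τ f y‖ₑ ^ 2 := by
        rw [lintegral_const_mul' _ _ ENNReal.ofReal_ne_top, lintegral_finsetSum' _ fun τ _ =>
          (((contDiffOn_flatWord hf τ).continuousOn.mono
            G.core_none_subset_ball).aestronglyMeasurable
              G.measurableSet_core_none).enorm.pow_const 2]
    _ ≤ _ := mul_le_mul_right le_add_self _

/-- On the collar `χ = 1` and nothing changes. The rest of the annulus lies in the core of the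
interior piece, where the density is bounded and the derivatives of `χ` are absorbed by the ordinary
derivatives in the energy. -/
lemma exists_lintegral_lieWord_χ_mul_le_energy (r : ℕ) : ∃ C : ℝ≥0, ∀ f : 𝔼 → ℝ,
    ContDiffOn ℝ ∞ f (unitBall n) → ∀ τ ∈ sortedWords M r,
      ∫⁻ y, ‖lieWord G.field τ (fun z => G.χ z * f z) y‖ₑ ^ 2 ∂G.measA ≤ C * G.energy r f := by
  have hK0 : IsCompact (G.core none ∩ {y | G.R ≤ ‖y‖}) :=
    (G.isCompact_core none).inter_right (isClosed_le continuous_const continuous_norm)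
  obtain ⟨C₁, h1, hC₁⟩ := exists_abs_lieWord_le G.isOpen_coordDomain G.contDiffOn_field hK0
    (fun y hy => G.mem_coordDomain hy.2
      ((G.mem_core_none.1 hy.1).trans G.outerRadius_lt_one.le)) r
  obtain ⟨C₂, h2, hC₂⟩ := exists_jetNorm_mul_le (G.isCompact_core none)
    (fun y _ => G.χ_smooth.contDiffAt) r
  obtain ⟨C₃, hC₃⟩ := G.exists_setLIntegral_jetNorm_le_energy r
  obtain ⟨C₄, hC₄⟩ := G.exists_density_le
  refine ⟨1 + C₄ * ((C₁ * C₂).toNNReal ^ 2 * C₃), fun f hf τ hτ => ?_⟩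
  have hτr := length_le_of_mem_sortedWords hτ
  have hpt : ∀ y ∈ G.annulus ∩ G.core none,
      ‖lieWord G.field τ (fun z => G.χ z * f z) y‖ₑ ^ 2 ≤
        ENNReal.ofReal (C₁ * C₂) ^ 2 * ‖jetNorm r f y‖ₑ ^ 2 := by
    intro y hy
    have hfy := G.contDiffAt_of_mem_core hf hy.2 r
    have hχf : ContDiffAt ℝ r (fun z => G.χ z * f z) y :=
      (G.χ_smooth.of_infty r).contDiffAt.mul hfy
    have : |lieWord G.field τ (fun z => G.χ z * f z) y| ≤ C₁ * C₂ * jetNorm r f y := by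
      refine (hC₁ τ hτr _ y ⟨hy.2, hy.1.1.le⟩ (hχf.of_le (by exact_mod_cast hτr))).trans ?_
      rw [mul_assoc]
      refine mul_le_mul_of_nonneg_left ?_ h1
      exact (jetNorm_mono hτr _ y).trans (hC₂ f y hy.2 hfy)
    rw [← mul_pow]
    gcongr
    rw [Real.enorm_eq_ofReal_abs, Real.enorm_of_nonneg (jetNorm_nonneg _ _ _),
      ← ENNReal.ofReal_mul (by positivity)]
    exact ENNReal.ofReal_le_ofReal this
  have hm : MeasurableSet (G.annulus ∩ G.core none) :=
    G.measurableSet_annulus.inter G.measurableSet_core_none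
  have hcov : G.annulus ⊆ G.collar ∪ (G.annulus ∩ G.core none) := by
    intro y hy
    rcases lt_or_ge G.innerRadius ‖y‖ with h | h
    · exact Or.inl ⟨h, hy.2⟩
    · exact Or.inr ⟨hy, G.mem_core_none.2 (h.trans G.innerRadius_le_outerRadius)⟩
  calc _ = ∫⁻ y in G.annulus, ‖lieWord G.field τ (fun z => G.χ z * f z) y‖ₑ ^ 2 ∂G.measA := by
        rw [G.measA_restrict_annulus]
    _ ≤ (∫⁻ y in G.collar, ‖lieWord G.field τ (fun z => G.χ z * f z) y‖ₑ ^ 2 ∂G.measA) +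
          ∫⁻ y in G.annulus ∩ G.core none,
            ‖lieWord G.field τ (fun z => G.χ z * f z) y‖ₑ ^ 2 ∂G.measA :=
        (lintegral_mono_set hcov).trans (lintegral_union_le _ _ _)
    _ ≤ (∫⁻ y, ‖lieWord G.field τ f y‖ₑ ^ 2 ∂G.measA) +
          C₄ * (ENNReal.ofReal (C₁ * C₂) ^ 2 * ∫⁻ y in G.core none, ‖jetNorm r f y‖ₑ ^ 2) := by
        refine add_le_add ?_ ?_
        · rw [setLIntegral_congr_fun G.isOpen_collar.measurableSet
            fun y hy => by rw [G.lieWord_χ_mul hy]]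
          exact setLIntegral_le_lintegral _ _
        · rw [G.setLIntegral_measA hm Set.inter_subset_left,
            ← lintegral_const_mul' _ _ (by simp), ← lintegral_const_mul' _ _ (by simp)]
          refine (setLIntegral_mono' hm fun y hy => ?_).trans
            (lintegral_mono_set Set.inter_subset_right)
          exact mul_le_mul' (hC₄ y hy.1) (hpt y hy)
    _ ≤ G.energy r f + C₄ * (ENNReal.ofReal (C₁ * C₂) ^ 2 * (C₃ * G.energy r f)) := by
        gcongr
        · exact (Finset.single_le_sum (f := fun τ => ∫⁻ y, ‖lieWord G.field τ f y‖ₑ ^ 2 ∂G.measA)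
            (fun _ _ => zero_le) hτ).trans le_self_add
        · exact hC₃ f hf
    _ = _ := by
        push_cast
        simp only [ENNReal.ofReal]
        ring

/-- The factor `1 - χ` vanishes identically on the collar, so only the core of the interior piece
contributes. -/
lemma exists_eLpNorm_ballNorm_le_energy (r : ℕ) : ∃ C : ℝ≥0, ∀ f : 𝔼 → ℝ,
    ContDiffOn ℝ ∞ f (unitBall n) → ∀ j ≤ r, ∀ i ≤ j,
      eLpNorm (fun y => iteratedFDeriv ℝ i (fun y => (1 - G.χ y) * (G.x y ^ j * f y)) y) 2
        (volume.restrict (unitBall n)) ^ 2 ≤ C * G.energy r f := by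
  obtain ⟨C₃, hC₃⟩ := G.exists_setLIntegral_jetNorm_le_energy r
  choose c hc0 hc using fun j : ℕ => exists_jetNorm_mul_le (G.isCompact_core none)
    (a := fun y => (1 - G.χ y) * G.x y ^ j)
    (fun y _ => ((contDiff_const.sub G.χ_smooth).mul (G.x_smooth.pow j)).contDiffAt) r
  refine ⟨∑ j ∈ Finset.range (r + 1), (c j).toNNReal ^ 2 * C₃, fun f hf j hj i hij => ?_⟩
  have hpt : ∀ y ∈ unitBall n,
      ‖iteratedFDeriv ℝ i (fun y => (1 - G.χ y) * (G.x y ^ j * f y)) y‖ₑ ^ 2 ≤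
      (G.core none).indicator (fun y => ENNReal.ofReal (c j) ^ 2 * ‖jetNorm r f y‖ₑ ^ 2) y := by
    intro y hy
    rcases lt_or_ge G.innerRadius ‖y‖ with h | h
    · have hev : (fun y => (1 - G.χ y) * (G.x y ^ j * f y)) =ᶠ[𝓝 y] 0 := by
        filter_upwards [G.isOpen_collar.mem_nhds ⟨h, by simpa [unitBall] using hy⟩] with z hz
        simp [G.χ_eq_one hz.1.le hz.2.le]
      rw [(hev.iteratedFDeriv ℝ i).eq_of_nhds]
      simp
    · have hyc : y ∈ G.core none := G.mem_core_none.2 (h.trans G.innerRadius_le_outerRadius)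
      rw [Set.indicator_of_mem hyc, ← mul_pow]
      gcongr
      rw [← ofReal_norm, Real.enorm_of_nonneg (jetNorm_nonneg _ _ _),
        ← ENNReal.ofReal_mul (hc0 j)]
      refine ENNReal.ofReal_le_ofReal ?_
      refine le_trans ?_ (hc j f y hyc (G.contDiffAt_of_mem_core hf hyc r))
      simp only [← mul_assoc]
      exact norm_iteratedFDeriv_le_jetNorm (hij.trans hj) _ y
  rw [eLpNorm_two_sq]
  calc _ ≤ ∫⁻ y in unitBall n,
        (G.core none).indicator (fun y => ENNReal.ofReal (c j) ^ 2 * ‖jetNorm r f y‖ₑ ^ 2) y :=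
        setLIntegral_mono' Metric.isOpen_ball.measurableSet hpt
    _ ≤ ENNReal.ofReal (c j) ^ 2 * ∫⁻ y in G.core none, ‖jetNorm r f y‖ₑ ^ 2 := by
        rw [← lintegral_const_mul' _ _ (by simp)]
        refine (setLIntegral_le_lintegral _ _).trans ?_
        rw [lintegral_indicator G.measurableSet_core_none]
    _ ≤ ENNReal.ofReal (c j) ^ 2 * (C₃ * G.energy r f) := mul_le_mul_right (hC₃ f hf) _
    _ ≤ _ := by
        rw [← mul_assoc]
        gcongr
        have := Finset.single_le_sum (f := fun j => (c j).toNNReal ^ 2 * C₃)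
          (fun _ _ => zero_le) (Finset.mem_range.2 (by omega : j < r + 1))
        refine le_trans (le_of_eq ?_) (ENNReal.coe_le_coe.2 this)
        push_cast
        rfl

/-- The norm of `ℋ^{0,r}` is controlled by the energy. -/
lemma exists_normHr_sq_le_energy (r : ℕ) : ∃ C : ℝ≥0, ∀ f : 𝔼 → ℝ,
    ContDiffOn ℝ ∞ f (unitBall n) → G.normHr 0 r f ^ 2 ≤ C * G.energy r f := by
  obtain ⟨C₁, hC₁⟩ := G.exists_eLpNorm_comp_le r
  obtain ⟨C₂, hC₂⟩ := G.exists_lintegral_lieWord_χ_mul_le_energy r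
  obtain ⟨C₃, hC₃⟩ := G.exists_eLpNorm_ballNorm_le_energy r
  let m : ℝ≥0 := ∑ j ∈ Finset.range (r + 1), ((multiIndices M j).card : ℝ≥0)
  let A : ℝ≥0 := C₁ ^ 2 * ((sortedWords M r).card ^ 2 * C₂)
  refine ⟨(r + 1 : ℕ) ^ 2 * (2 * (m ^ 2 * A + (r + 1 : ℕ) ^ 2 * C₃)), fun f hf => ?_⟩
  have hfA := hf.mono G.annulus_subset_ball
  have h1 : ∀ j ∈ Finset.range (r + 1), G.normH (0 + j) (fun y => G.x y ^ j * f y) ^ 2 ≤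
      ((2 * (m ^ 2 * A + (r + 1 : ℕ) ^ 2 * C₃) : ℝ≥0) : ℝ≥0∞) * G.energy r f := by
    intro j hj
    have hjr : j ≤ r := Nat.lt_succ_iff.1 (Finset.mem_range.1 hj)
    rw [zero_add, normH_eq]
    refine (add_sq_le_two_mul _ _).trans ?_
    have ha : (∑ p ∈ multiIndices M j,
        eLpNorm (G.comp j p fun y => G.x y ^ j * f y) 2 G.measA) ^ 2 ≤
        (m : ℝ≥0∞) ^ 2 * (A * G.energy r f) := by
      refine (sum_sq_le_card_sq_mul (B := A * G.energy r f) fun p hp => ?_).trans ?_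
      · calc _ ≤ ((C₁ : ℝ≥0∞) * ∑ τ ∈ sortedWords M r,
              eLpNorm (lieWord G.field τ (fun z => G.χ z * f z)) 2 G.measA) ^ 2 := by
              gcongr
              exact hC₁ f hfA j hjr p hp
          _ ≤ (C₁ : ℝ≥0∞) ^ 2 * ((sortedWords M r).card ^ 2 * (C₂ * G.energy r f)) := by
              rw [mul_pow]
              refine mul_le_mul_right (sum_sq_le_card_sq_mul fun τ hτ => ?_) _
              rw [eLpNorm_two_sq]
              exact hC₂ f hf τ hτ
          _ = _ := by
              simp only [A]
              push_cast
              ring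
      · gcongr
        have := Finset.single_le_sum (f := fun j => ((multiIndices M j).card : ℝ≥0))
          (fun _ _ => zero_le) hj
        exact le_trans (le_of_eq (by simp)) (ENNReal.coe_le_coe.2 this)
    have hb : ballNorm j (fun y => (1 - G.χ y) * (G.x y ^ j * f y)) ^ 2 ≤
        (r + 1 : ℕ) ^ 2 * (C₃ * G.energy r f) := by
      refine (sum_sq_le_card_sq_mul (B := C₃ * G.energy r f) fun i hi => ?_).trans ?_
      · exact hC₃ f hf j hjr i (Nat.lt_succ_iff.1 (Finset.mem_range.1 hi))
      · rw [Finset.card_range]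
        gcongr
    calc _ ≤ 2 * ((m : ℝ≥0∞) ^ 2 * (A * G.energy r f) + (r + 1 : ℕ) ^ 2 * (C₃ * G.energy r f)) := by
          gcongr
      _ = _ := by push_cast; ring
  refine (sum_sq_le_card_sq_mul h1).trans (le_of_eq ?_)
  rw [Finset.card_range]
  push_cast
  ring

/-! ### The norm of `ℋ^{m,r}` is a finite seminorm on test functions -/

lemma comp_add (m : ℕ) (p : ℕ × (Fin M → ℕ)) {f g : 𝔼 → ℝ} (hf : ContDiffOn ℝ ∞ f G.annulus)
    (hg : ContDiffOn ℝ ∞ g G.annulus) : Set.EqOn (G.comp m p fun y => f y + g y)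
      (fun y => G.comp m p f y + G.comp m p g y) G.annulus := by
  intro y hy
  have hχf : ContDiffOn ℝ ∞ (fun z => G.χ z * f z) G.annulus := G.χ_smooth.contDiffOn.mul hf
  have hχg : ContDiffOn ℝ ∞ (fun z => G.χ z * g z) G.annulus := G.χ_smooth.contDiffOn.mul hg
  have h1 : Set.EqOn (G.dThetaPow p.2 (fun z => G.χ z * (f z + g z)))
      (fun z => G.dThetaPow p.2 (fun z => G.χ z * f z) z + G.dThetaPow p.2 (fun z => G.χ z * g z) z)
      G.annulus := by
    simp only [dThetaPow_eq, mul_add]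
    exact lieWord_add G.isOpen_annulus G.contDiffOn_field_annulus _
      (hχf.of_le (natCast_le_infty _)) (hχg.of_le (natCast_le_infty _))
  simp only [comp, dx_iterate_eq]
  rw [lieWord_congr G.isOpen_annulus h1 _ hy, lieWord_add G.isOpen_annulus
    G.contDiffOn_dxField_annulus _ ((G.contDiffOn_dThetaPow hχf _).of_le (natCast_le_infty _))
    ((G.contDiffOn_dThetaPow hχg _).of_le (natCast_le_infty _)) hy, mul_add]

lemma ballNorm_add_le (k : ℕ) {f g : 𝔼 → ℝ} (hf : ContDiff ℝ ∞ f) (hg : ContDiff ℝ ∞ g) :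
    ballNorm k (fun y => f y + g y) ≤ ballNorm k f + ballNorm k g := by
  simp only [ballNorm]
  rw [← Finset.sum_add_distrib]
  refine Finset.sum_le_sum fun i _ => ?_
  have e : (fun y => iteratedFDeriv ℝ i (fun y => f y + g y) y) =
      (fun y => iteratedFDeriv ℝ i f y) + fun y => iteratedFDeriv ℝ i g y := by
    ext1 y
    exact iteratedFDeriv_add_apply (hf.of_infty i).contDiffAt (hg.of_infty i).contDiffAt
  rw [e]
  exact eLpNorm_add_le ((hf.of_infty i).continuous_iteratedFDeriv le_rfl).aestronglyMeasurable
    ((hg.of_infty i).continuous_iteratedFDeriv le_rfl).aestronglyMeasurable (by norm_num)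

lemma normH_add_le (m : ℕ) {f g : 𝔼 → ℝ} (hf : ContDiff ℝ ∞ f) (hg : ContDiff ℝ ∞ g) :
    G.normH m (fun y => f y + g y) ≤ G.normH m f + G.normH m g := by
  simp only [normH_eq]
  rw [add_add_add_comm, ← Finset.sum_add_distrib]
  refine add_le_add (Finset.sum_le_sum fun p _ => ?_) ?_
  · have : G.comp m p (fun y => f y + g y) =ᵐ[G.measA] G.comp m p f + G.comp m p g := by
      filter_upwards [G.ae_mem_annulus] with y hy
        using G.comp_add m p hf.contDiffOn hg.contDiffOn hy
    rw [eLpNorm_congr_ae this]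
    exact eLpNorm_add_le
      (aestronglyMeasurable_measA (contDiffOn_comp m p hf.contDiffOn).continuousOn)
      (aestronglyMeasurable_measA (contDiffOn_comp m p hg.contDiffOn).continuousOn) (by norm_num)
  · simp only [mul_add]
    exact ballNorm_add_le m ((contDiff_const.sub G.χ_smooth).mul hf)
      ((contDiff_const.sub G.χ_smooth).mul hg)

lemma normHr_add_le (m r : ℕ) {f g : 𝔼 → ℝ} (hf : ContDiff ℝ ∞ f) (hg : ContDiff ℝ ∞ g) :
    G.normHr m r (fun y => f y + g y) ≤ G.normHr m r f + G.normHr m r g := by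
  simp only [normHr]
  rw [← Finset.sum_add_distrib]
  refine Finset.sum_le_sum fun j _ => ?_
  simp only [mul_add]
  exact G.normH_add_le _ ((G.x_smooth.pow j).mul hf) ((G.x_smooth.pow j).mul hg)

lemma ballNorm_lt_top (k : ℕ) {f : 𝔼 → ℝ} (hf : ContDiff ℝ ∞ f) : ballNorm k f < ⊤ := by
  refine ENNReal.sum_lt_top.2 fun i _ => ?_
  have hc := (hf.of_infty i).continuous_iteratedFDeriv le_rfl
  obtain ⟨C, hC⟩ := (isCompact_closedBall (0 : 𝔼) 1).exists_bound_of_continuousOn hc.continuousOn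
  have : IsFiniteMeasure (volume.restrict (unitBall n)) := ⟨by
    rw [Measure.restrict_apply_univ]; exact measure_ball_lt_top⟩
  refine (MemLp.of_bound (C := C) hc.aestronglyMeasurable ?_).2
  filter_upwards [ae_restrict_mem Metric.isOpen_ball.measurableSet] with y hy
  exact hC y (Metric.ball_subset_closedBall hy)

instance : IsFiniteMeasure G.measA := ⟨by
  obtain ⟨C, hC⟩ := G.exists_density_le
  rw [← setLIntegral_one, Measure.restrict_univ, ← G.measA_restrict_annulus,
    G.setLIntegral_measA G.measurableSet_annulus subset_rfl]
  calc _ ≤ ∫⁻ y in G.annulus, (C : ℝ≥0∞) :=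
        setLIntegral_mono' G.measurableSet_annulus fun y hy => by rw [mul_one]; exact hC y hy
    _ = C * volume G.annulus := setLIntegral_const _ _
    _ < ⊤ := ENNReal.mul_lt_top ENNReal.coe_lt_top
        ((measure_mono G.annulus_subset_ball).trans_lt measure_ball_lt_top)⟩

/-- The weight can be singular only at `x = 0`, which the compact support avoids. At the inner
sphere the derivatives are still continuous, because the coordinates extend to an open set
containing it. -/
lemma eLpNorm_comp_lt_top (m : ℕ) (p : ℕ × (Fin M → ℕ)) {f : 𝔼 → ℝ} (hf : IsTest f) :
    eLpNorm (G.comp m p f) 2 G.measA < ⊤ := by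
  have hχf : ContDiff ℝ ∞ (fun z => G.χ z * f z) := G.χ_smooth.mul hf.1
  set K := tsupport f ∩ {y | G.R ≤ ‖y‖} with hK
  have hKc : IsCompact K :=
    (show IsCompact (tsupport f) from hf.2.1).inter_right (isClosed_le continuous_const continuous_norm)
  have hlt : ∀ y ∈ K, ‖y‖ < 1 := fun y hy => by simpa [unitBall] using hf.2.2 hy.1
  have hsub : tsupport (fun z => G.χ z * f z) ⊆ K := by
    refine closure_minimal (fun y hy => ⟨subset_tsupport _ fun h => hy (by simp [h]), ?_⟩)
      hKc.isClosed
    by_contra h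
    exact hy (by simp [G.χ_zero y (le_of_lt (not_le.1 h))])
  have hc : ContinuousOn (G.comp m p f) K := by
    intro y hy
    have hyc := G.mem_coordDomain hy.2 (hlt y hy).le
    have hx := G.x_pos y (hlt y hy)
    refine ContinuousAt.continuousWithinAt (ContinuousAt.mul ?_ ?_)
    · exact G.x_smooth.continuous.continuousAt.zpow₀ _ (Or.inl hx.ne')
    · rw [dx_iterate_eq, dThetaPow_eq]
      have h2 := contDiffOn_lieWord_infty G.isOpen_coordDomain G.contDiffOn_dxField
        (List.replicate p.1 ()) (contDiffOn_lieWord_infty G.isOpen_coordDomain G.contDiffOn_field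
        (sortedWord 0 p.2) hχf.contDiffOn)
      exact h2.continuousOn.continuousAt (G.isOpen_coordDomain.mem_nhds hyc)
  obtain ⟨C, hC⟩ := hKc.exists_bound_of_continuousOn hc
  refine (MemLp.of_bound (C := max C 0) (aestronglyMeasurable_measA
    (contDiffOn_comp m p hf.1.contDiffOn).continuousOn) (ae_of_all _ fun y => ?_)).2
  by_cases hy : y ∈ K
  · exact (hC y hy).trans (le_max_left _ _)
  · have h0 : y ∉ tsupport (fun z => G.χ z * f z) := fun h => hy (hsub h)
    have h1 : y ∉ tsupport (G.dThetaPow p.2 fun z => G.χ z * f z) := by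
      refine fun h => h0 (closure_mono ?_ h |> fun h' => isClosed_closure.closure_subset h')
      intro z hz
      by_contra hz'
      refine hz ?_
      rw [dThetaPow_eq]
      exact lieWord_eq_zero_of_notMem_tsupport hz' _
    rw [comp, dx_iterate_eq, lieWord_eq_zero_of_notMem_tsupport h1]
    simp

lemma isTest_mul {a f : 𝔼 → ℝ} (ha : ContDiff ℝ ∞ a) (hf : IsTest f) :
    IsTest (fun y => a y * f y) :=
  ⟨ha.mul hf.1, hf.2.1.mul_left, (tsupport_mul_subset_right).trans hf.2.2⟩

lemma normHr_lt_top (m r : ℕ) {f : 𝔼 → ℝ} (hf : IsTest f) : G.normHr m r f < ⊤ := by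
  refine ENNReal.sum_lt_top.2 fun j _ => ?_
  have hxf := isTest_mul (G.x_smooth.pow j) hf
  rw [normH_eq]
  exact ENNReal.add_lt_top.2 ⟨ENNReal.sum_lt_top.2 fun p _ => G.eLpNorm_comp_lt_top _ p hxf,
    ballNorm_lt_top _ ((contDiff_const.sub G.χ_smooth).mul hxf.1)⟩

end BallData

end

section

namespace BallData

variable {n M : ℕ} (G : BallData n M)

local notation "𝔼" => EuclideanSpace ℝ (Fin n)

/-! ### Products in the conormal spaces -/

/-- `C ≤ (C + 1)²` replaces the square root of the constant. -/
lemma _root_.ENNReal.le_add_one_mul_of_sq_le {a b : ℝ≥0∞} {C : ℝ≥0} (h : a ^ 2 ≤ C * b ^ 2) :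
    a ≤ (C + 1 : ℝ≥0) * b := by
  rw [← ENNReal.pow_le_pow_left_iff two_ne_zero, mul_pow]
  refine h.trans (mul_le_mul_left ?_ _)
  have : C ≤ (C + 1) ^ 2 := by nlinarith [C.2, sq_nonneg C]
  exact_mod_cast this

/-- The `ℓ^∞` bound for the factors `w`: no weight appears, and the constant is the same for all
pieces. -/
lemma exists_sobNorm_piece_le (hn : 2 ≤ n) (r : ℕ) : ∃ C : ℝ≥0, ∀ (p : Option ℕ) (f : 𝔼 → ℝ),
    ContDiffOn ℝ ∞ f (unitBall n) → sobNorm (r + 1) (G.piece p f) ≤ C * G.normHr 1 r f := by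
  obtain ⟨C₁, hC₁⟩ := G.exists_sobNorm_piece_none_le 1 r
  obtain ⟨C₂, hC₂⟩ := G.exists_sobNorm_piece_some_le_normHr hn r
  refine ⟨(C₁ + 1) + (C₂ + 1), fun p f hf => ?_⟩
  rw [add_comm r 1]
  push_cast
  rw [add_mul]
  cases p with
  | none => exact (ENNReal.le_add_one_mul_of_sq_le (hC₁ f hf)).trans (by push_cast; exact le_self_add)
  | some k =>
    exact (ENNReal.le_add_one_mul_of_sq_le (hC₂ k f hf)).trans (by push_cast; exact le_add_self)

lemma _root_.ENNReal.tsum_option_eq {α : Type*} (f : Option α → ℝ≥0∞) :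
    ∑' p, f p = f none + ∑' a, f (some a) := by
  rw [← (Equiv.optionEquivSumPUnit.{0} α).symm.tsum_eq f,
    Summable.tsum_sum ENNReal.summable ENNReal.summable, add_comm]
  simp

/-- The `ℓ²` bound for the factor `u`, where the weights are those of the change of variables. The
interior piece has weight one. -/
lemma exists_tsum_sobNorm_piece_le (hn : 2 ≤ n) (m r : ℕ) : ∃ C : ℝ≥0, ∀ f : 𝔼 → ℝ,
    ContDiffOn ℝ ∞ f (unitBall n) →
      ∑' p, ENNReal.ofReal (G.weight p) * sobNorm r (G.piece p f) ^ 2 ≤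
        C * G.normHr m r f ^ 2 := by
  obtain ⟨C₁, hC₁⟩ := G.exists_sobNorm_piece_none_le m r
  obtain ⟨C₂, hC₂⟩ := G.exists_tsum_sobNorm_piece_some_le hn m r
  refine ⟨C₁ + C₂, fun f hf => ?_⟩
  have hle : ∀ p, sobNorm r (G.piece p f) ^ 2 ≤ sobNorm (m + r) (G.piece p f) ^ 2 := fun p => by
    gcongr
    exact sobNorm_mono (by omega) _
  rw [ENNReal.tsum_option_eq, ENNReal.coe_add, add_mul]
  refine add_le_add ?_ ?_
  · simp only [weight, ENNReal.ofReal_one, one_mul]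
    exact (hle none).trans (hC₁ f hf)
  · exact (ENNReal.tsum_le_tsum fun k => mul_le_mul_right (hle _) _).trans (hC₂ f hf)

/-- The multilinear estimate in the pieces. -/
lemma exists_setLIntegral_prod_jetNorm_le {r : ℕ} (hr : n < 2 * (r + 1)) (N : ℕ) : ∃ C : ℝ≥0,
    ∀ (k : Fin N → ℕ) (k' : ℕ), ∑ i, k i + k' ≤ r → ∀ (f : Fin N → 𝔼 → ℝ) (u : 𝔼 → ℝ),
      (∀ i, ContDiffOn ℝ ∞ (f i) (unitBall n)) → ContDiffOn ℝ ∞ u (unitBall n) →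
      ∀ p, ∫⁻ Y in G.core p, ‖(∏ i, jetNorm (k i) (fun Y => f i (G.chart p Y)) Y) *
          jetNorm k' (fun Y => u (G.chart p Y)) Y‖ₑ ^ 2 ≤
        C * (∏ i, sobNorm (r + 1) (G.piece p (f i))) ^ 2 * sobNorm r (G.piece p u) ^ 2 := by
  obtain ⟨C, hC⟩ := exists_eLpNorm_prod_jetNorm_le hr N
  refine ⟨C ^ 2, fun k k' hk f u hf hu p => ?_⟩
  have h1 := hC k k' hk (fun i => G.piece p (f i)) (G.piece p u)
    (fun i => G.isCcInfty_piece (hf i) p) (G.isCcInfty_piece hu p)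
  have h2 : ∀ Y ∈ G.core p, ‖(∏ i, jetNorm (k i) (fun Y => f i (G.chart p Y)) Y) *
      jetNorm k' (fun Y => u (G.chart p Y)) Y‖ₑ ^ 2 =
      ‖(∏ i, jetNorm (k i) (G.piece p (f i)) Y) * jetNorm k' (G.piece p u) Y‖ₑ ^ 2 := by
    intro Y hY
    simp only [G.jetNorm_piece _ hY]
  rw [setLIntegral_congr_fun (G.isCompact_core p).measurableSet h2]
  refine (setLIntegral_le_lintegral _ _).trans ?_
  rw [← eLpNorm_two_sq]
  push_cast
  rw [← mul_pow, ← mul_pow]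
  gcongr

/-- The multilinear estimate for conormal derivatives of smooth functions. -/
lemma exists_eLpNorm_prod_lieWord_le (hn : 2 ≤ n) {r : ℕ} (hr : n < 2 * (r + 1)) (m N : ℕ) :
    ∃ C : ℝ≥0, ∀ (τ : Fin N → List (Option (Fin M))) (τ' : List (Option (Fin M))),
      ∑ i, (τ i).length + τ'.length ≤ r → ∀ (f : Fin N → 𝔼 → ℝ) (u : 𝔼 → ℝ),
      (∀ i, ContDiffOn ℝ ∞ (f i) (unitBall n)) → ContDiffOn ℝ ∞ u (unitBall n) →
      eLpNorm (fun y => (∏ i, lieWord G.field (τ i) (f i) y) * lieWord G.field τ' u y) 2 G.measA ≤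
        C * G.normHr m r u * ∏ i, G.normHr 1 r (f i) := by
  obtain ⟨C₁, h1, hC₁⟩ := G.exists_abs_lieWord_le_jetNorm r
  obtain ⟨C₂, hC₂⟩ := G.exists_lintegral_le_tsum_core hn
  obtain ⟨C₃, hC₃⟩ := G.exists_setLIntegral_prod_jetNorm_le hr N
  obtain ⟨C₄, hC₄⟩ := G.exists_sobNorm_piece_le hn r
  obtain ⟨C₅, hC₅⟩ := G.exists_tsum_sobNorm_piece_le hn m r
  set A : ℝ≥0 := C₂ * ((C₁ ^ N * C₁).toNNReal ^ 2 * (C₃ * ((C₄ ^ N) ^ 2 * C₅))) with hA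
  refine ⟨A + 1, fun τ τ' hτ f u hf hu => ?_⟩
  rw [mul_assoc]
  refine ENNReal.le_add_one_mul_of_sq_le ?_
  rw [eLpNorm_two_sq]
  set h : 𝔼 → ℝ≥0∞ := fun y =>
    ‖(∏ i, lieWord G.field (τ i) (f i) y) * lieWord G.field τ' u y‖ₑ ^ 2 with hh
  have hlen : ∀ i, (τ i).length ≤ r := fun i => by
    have := Finset.single_le_sum (f := fun i => (τ i).length) (fun _ _ => Nat.zero_le _)
      (Finset.mem_univ i)
    omega
  have hpt : ∀ p, ∀ Y ∈ G.core p, G.annulus.indicator h (G.chart p Y) ≤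
      ENNReal.ofReal (C₁ ^ N * C₁) ^ 2 *
      ‖(∏ i, jetNorm (τ i).length (fun Y => f i (G.chart p Y)) Y) *
          jetNorm τ'.length (fun Y => u (G.chart p Y)) Y‖ₑ ^ 2 := by
    intro p Y hY
    by_cases hYA : G.chart p Y ∈ G.annulus
    · rw [Set.indicator_of_mem hYA, hh, ← mul_pow]
      simp only
      gcongr
      have hJ : 0 ≤ (∏ i, jetNorm (τ i).length (fun Y => f i (G.chart p Y)) Y) *
          jetNorm τ'.length (fun Y => u (G.chart p Y)) Y :=
        mul_nonneg (Finset.prod_nonneg fun i _ => jetNorm_nonneg _ _ _) (jetNorm_nonneg _ _ _)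
      rw [Real.enorm_eq_ofReal_abs, Real.enorm_of_nonneg hJ, ← ENNReal.ofReal_mul (by positivity)]
      refine ENNReal.ofReal_le_ofReal ?_
      rw [abs_mul, Finset.abs_prod]
      have e : C₁ ^ N * C₁ * ((∏ i, jetNorm (τ i).length (fun Y => f i (G.chart p Y)) Y) *
          jetNorm τ'.length (fun Y => u (G.chart p Y)) Y) =
          (∏ i, C₁ * jetNorm (τ i).length (fun Y => f i (G.chart p Y)) Y) *
          (C₁ * jetNorm τ'.length (fun Y => u (G.chart p Y)) Y) := by
        rw [Finset.prod_mul_distrib, Finset.prod_const, Finset.card_univ, Fintype.card_fin]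
        ring
      rw [e]
      refine mul_le_mul (Finset.prod_le_prod (fun _ _ => abs_nonneg _) fun i _ => ?_) ?_
        (abs_nonneg _) (Finset.prod_nonneg fun i _ => mul_nonneg h1 (jetNorm_nonneg _ _ _))
      · exact hC₁ (τ i) (f i) p (hlen i) ((hf i).of_le (natCast_le_infty _)) Y hY hYA
      · exact hC₁ τ' u p (by omega) (hu.of_le (natCast_le_infty _)) Y hY hYA
    · rw [Set.indicator_of_notMem hYA]
      exact zero_le
  have hpiece : ∀ p, ∫⁻ Y in G.core p, G.annulus.indicator h (G.chart p Y) ≤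
      ENNReal.ofReal (C₁ ^ N * C₁) ^ 2 * (C₃ * ((C₄ ^ N * ∏ i, G.normHr 1 r (f i)) ^ 2 *
        sobNorm r (G.piece p u) ^ 2)) := by
    intro p
    refine (setLIntegral_mono' (G.isCompact_core p).measurableSet (hpt p)).trans ?_
    rw [lintegral_const_mul' _ _ (by simp)]
    refine mul_le_mul_right ((hC₃ _ _ hτ f u hf hu p).trans ?_) _
    rw [mul_assoc]
    gcongr
    calc _ ≤ ∏ i, (C₄ : ℝ≥0∞) * G.normHr 1 r (f i) :=
          Finset.prod_le_prod' fun i _ => hC₄ p (f i) (hf i)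
      _ = _ := by
          rw [Finset.prod_mul_distrib, Finset.prod_const, Finset.card_univ, Fintype.card_fin]
  -- The bounds of the factors `f i` do not depend on the piece and leave the sum; only the weighted
  -- squares of the pieces of `u` are summed.
  calc ∫⁻ y, h y ∂G.measA
      ≤ C₂ * ∑' p, ENNReal.ofReal (G.weight p) *
        ∫⁻ Y in G.core p, G.annulus.indicator h (G.chart p Y) := hC₂ h
    _ ≤ C₂ * ∑' p, ENNReal.ofReal (C₁ ^ N * C₁) ^ 2 * (C₃ *
          ((C₄ ^ N * ∏ i, G.normHr 1 r (f i)) ^ 2)) *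
          (ENNReal.ofReal (G.weight p) * sobNorm r (G.piece p u) ^ 2) := by
        refine mul_le_mul_right (ENNReal.tsum_le_tsum fun p => ?_) _
        refine (mul_le_mul_right (hpiece p) _).trans (le_of_eq ?_)
        ring
    _ ≤ C₂ * (ENNReal.ofReal (C₁ ^ N * C₁) ^ 2 * (C₃ *
          ((C₄ ^ N * ∏ i, G.normHr 1 r (f i)) ^ 2)) * (C₅ * G.normHr m r u ^ 2)) := by
        rw [ENNReal.tsum_mul_left]
        gcongr
        exact hC₅ u hu
    _ = _ := by
        rw [hA]
        push_cast
        simp only [ENNReal.ofReal]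
        ring

lemma exists_mem_core {y : 𝔼} (hy : y ∈ unitBall n) : ∃ p, ∃ Y ∈ G.core p, G.chart p Y = y := by
  have hy1 : ‖y‖ < 1 := by simpa [unitBall] using hy
  rcases le_or_gt ‖y‖ G.outerRadius with h | h
  · exact ⟨none, y, G.mem_core_none.2 h, rfl⟩
  · obtain ⟨k, hk⟩ := G.exists_mem_shell h hy1
    refine ⟨some k, G.blow (G.scale k) y, ?_, G.unblow_blow (G.scale_pos k) (G.collar_subset hk.1)⟩
    rw [core_some_eq]
    exact Set.mem_image_of_mem _ hk

/-- Functions of `ℋ^{1,r}` are bounded. -/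
lemma exists_enorm_le_normHr (hn : 2 ≤ n) {r : ℕ} (hr : n < 2 * (r + 1)) : ∃ C : ℝ≥0,
    ∀ f : 𝔼 → ℝ, ContDiffOn ℝ ∞ f (unitBall n) → ∀ y ∈ unitBall n,
      ‖f y‖ₑ ≤ C * G.normHr 1 r f := by
  obtain ⟨C₁, hC₁⟩ := exists_enorm_le_sobNorm hr
  obtain ⟨C₂, hC₂⟩ := G.exists_sobNorm_piece_le hn r
  refine ⟨C₁ * C₂, fun f hf y hy => ?_⟩
  obtain ⟨p, Y, hY, rfl⟩ := G.exists_mem_core hy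
  rw [show f (G.chart p Y) = G.piece p f Y from (G.piece_eventuallyEq f hY).eq_of_nhds.symm,
    ENNReal.coe_mul, mul_assoc]
  exact (hC₁ _ (G.isCcInfty_piece hf p) Y).trans (mul_le_mul_right (hC₂ p f hf) _)

end BallData

end

section

lemma _root_.HasCompactSupport.integrable_mul_of_continuousOn {n : ℕ}
    {f ψ : EuclideanSpace ℝ (Fin n) → ℝ} {U : Set (EuclideanSpace ℝ (Fin n))} (hU : IsOpen U)
    (hf : ContinuousOn f U) (hψ : Continuous ψ) (hc : HasCompactSupport ψ) (hs : tsupport ψ ⊆ U) :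
    Integrable (fun y => f y * ψ y) := by
  refine Continuous.integrable_of_hasCompactSupport ?_ hc.mul_left
  refine continuous_iff_continuousAt.2 fun y => ?_
  by_cases hy : y ∈ tsupport ψ
  · exact (hf.continuousAt (hU.mem_nhds (hs hy))).mul hψ.continuousAt
  · have : (fun y => f y * ψ y) =ᶠ[𝓝 y] fun _ => 0 := by
      filter_upwards [notMem_tsupport_iff_eventuallyEq.1 hy] with z hz
      simp [hz]
    exact continuousAt_const.congr this.symm

namespace BallData

variable {n M : ℕ} (G : BallData n M)

local notation "𝔼" => EuclideanSpace ℝ (Fin n)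

/-! ### The closures of the conormal derivatives -/

/-- Integration by parts in each Cartesian coordinate, with formal adjoint `ψ ↦ -div (ψ V)`. The
field is smooth only in the annulus, but multiplication by `ψ` makes its components globally smooth
with compact support. -/
lemma exists_adjoint_field (a : Option (Fin M)) {ψ : 𝔼 → ℝ} (hψ : IsCcInfty ψ)
    (hs : tsupport ψ ⊆ G.annulus) : ∃ ψ' : 𝔼 → ℝ, IsCcInfty ψ' ∧ tsupport ψ' ⊆ G.annulus ∧
      ∀ f : 𝔼 → ℝ, ContDiffOn ℝ ∞ f G.annulus →
        ∫ y, fderiv ℝ f y (G.field a y) * ψ y = ∫ y, f y * ψ' y := by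
  set e : Fin n → 𝔼 := fun i => EuclideanSpace.single i 1 with he
  set g : Fin n → 𝔼 → ℝ := fun i y => G.field a y i * ψ y with hg
  have hgs : ∀ i, tsupport (g i) ⊆ tsupport ψ := fun i => tsupport_mul_subset_right
  have hcc : ∀ i, IsCcInfty (g i) := fun i => by
    refine ⟨contDiff_of_forall_mem_tsupport fun y hy => ?_, hψ.2.mul_left⟩
    have h1 : ContDiffAt ℝ ∞ (G.field a) y :=
      (G.contDiffOn_field_annulus a).contDiffAt (G.isOpen_annulus.mem_nhds (hs (hgs i hy)))
    exact (contDiffAt_euclidean.1 h1 i).mul hψ.1.contDiffAt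
  have hds : ∀ i, tsupport (fun y => fderiv ℝ (g i) y (e i)) ⊆ tsupport ψ := fun i =>
    (tsupport_fderiv_apply_subset ℝ (e i)).trans (hgs i)
  refine ⟨fun y => -∑ i, fderiv ℝ (g i) y (e i), ⟨?_, ?_⟩, ?_, fun f hf => ?_⟩
  · exact (ContDiff.sum fun i _ => ((hcc i).fderiv_apply (e i)).1).neg
  · refine HasCompactSupport.of_support_subset_isCompact hψ.2 fun y hy => ?_
    by_contra hy'
    refine hy ?_
    simp only
    rw [Finset.sum_eq_zero, neg_zero]
    exact fun i _ => image_eq_zero_of_notMem_tsupport (f := fun y => fderiv ℝ (g i) y (e i))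
      fun h => hy' (hds i h)
  · refine (closure_minimal ?_ (isClosed_tsupport ψ)).trans hs
    intro y hy
    by_contra hy'
    refine hy ?_
    simp only
    rw [Finset.sum_eq_zero, neg_zero]
    exact fun i _ => image_eq_zero_of_notMem_tsupport (f := fun y => fderiv ℝ (g i) y (e i))
      fun h => hy' (hds i h)
  · have hd : ∀ y ∈ G.annulus, DifferentiableAt ℝ f y := fun y hy =>
      (hf.contDiffAt (G.isOpen_annulus.mem_nhds hy)).differentiableAt (by simp)
    have hdc : ∀ i, ContinuousOn (fun y => fderiv ℝ f y (e i)) G.annulus := fun i =>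
      (hf.continuousOn_fderiv_of_isOpen G.isOpen_annulus (by simp)).clm_apply continuousOn_const
    have i1 : ∀ i, Integrable fun y => fderiv ℝ f y (e i) * g i y := fun i =>
      (hcc i).2.integrable_mul_of_continuousOn G.isOpen_annulus (hdc i) (hcc i).1.continuous
        ((hgs i).trans hs)
    have i2 : ∀ i, Integrable fun y => f y * fderiv ℝ (g i) y (e i) := fun i =>
      ((hcc i).fderiv_apply (e i)).2.integrable_mul_of_continuousOn G.isOpen_annulus
        hf.continuousOn ((hcc i).fderiv_apply (e i)).1.continuous ((hds i).trans hs)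
    have i3 : ∀ i, Integrable fun y => f y * g i y := fun i =>
      (hcc i).2.integrable_mul_of_continuousOn G.isOpen_annulus hf.continuousOn
        (hcc i).1.continuous ((hgs i).trans hs)
    have key : ∀ i, ∫ y, f y * fderiv ℝ (g i) y (e i) = -∫ y, fderiv ℝ f y (e i) * g i y :=
      fun i => integral_mul_fderiv_eq_neg_fderiv_mul_of_integrable (i1 i) (i2 i) (i3 i)
        (fun y hy => hd y (hs (hgs i hy))) fun y _ => (hcc i).1.differentiable (by simp) y
    have hL : ∀ y, fderiv ℝ f y (G.field a y) * ψ y = ∑ i, fderiv ℝ f y (e i) * g i y := by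
      intro y
      have hexp : G.field a y = ∑ i, G.field a y i • e i := by
        simpa [he] using ((EuclideanSpace.basisFun (Fin n) ℝ).sum_repr (G.field a y)).symm
      conv_lhs => rw [hexp]
      rw [map_sum, Finset.sum_mul]
      refine Finset.sum_congr rfl fun i _ => ?_
      rw [map_smul, smul_eq_mul, hg]
      ring
    simp only [hL, mul_neg, Finset.mul_sum]
    rw [integral_finsetSum _ fun i _ => i1 i, integral_neg, integral_finsetSum _ fun i _ => i2 i,
      ← Finset.sum_neg_distrib]
    exact Finset.sum_congr rfl fun i _ => by rw [key, neg_neg]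

lemma exists_adjoint (τ : List (Option (Fin M))) : ∀ {ψ : 𝔼 → ℝ}, IsCcInfty ψ →
    tsupport ψ ⊆ G.annulus → ∃ ψ' : 𝔼 → ℝ, IsCcInfty ψ' ∧ tsupport ψ' ⊆ G.annulus ∧
      ∀ f : 𝔼 → ℝ, ContDiffOn ℝ ∞ f G.annulus →
        ∫ y, lieWord G.field τ f y * ψ y = ∫ y, f y * ψ' y := by
  induction τ with
  | nil => exact fun hψ hs => ⟨_, hψ, hs, fun _ _ => rfl⟩
  | cons a τ ih =>
    intro ψ hψ hs
    obtain ⟨ψ₁, h1, hs1, H1⟩ := G.exists_adjoint_field a hψ hs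
    obtain ⟨ψ₂, h2, hs2, H2⟩ := ih h1 hs1
    exact ⟨ψ₂, h2, hs2, fun f hf =>
      (H1 _ (G.contDiffOn_lieWord_annulus hf τ)).trans (H2 f hf)⟩

lemma measA_absolutelyContinuous : G.measA ≪ volume.restrict (unitBall n) :=
  (withDensity_absolutelyContinuous _ _).trans
    (Measure.restrict_mono G.annulus_subset_ball le_rfl).absolutelyContinuous

lemma restrict_annulus_absolutelyContinuous : volume.restrict G.annulus ≪ G.measA := by
  refine withDensity_absolutelyContinuous' G.measurable_density.ennreal_ofReal.aemeasurable ?_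
  filter_upwards [ae_restrict_mem G.measurableSet_annulus] with y hy
  have h := G.x_pos_of_mem hy
  have hc := G.annulus_subset hy
  have hn : 0 < ‖y‖ := norm_pos_iff.2 hc.1
  have h2 := abs_pos.2 hc.2.ne
  exact (ENNReal.ofReal_pos.2 (by positivity)).ne'

lemma normL2_add_le {f g : 𝔼 → ℝ} (hf : AEStronglyMeasurable f (volume.restrict (unitBall n)))
    (hg : AEStronglyMeasurable g (volume.restrict (unitBall n))) :
    G.normL2 (fun y => f y + g y) ≤ G.normL2 f + G.normL2 g := by
  have hχ := G.χ_smooth.continuous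
  simp only [normL2, mul_add]
  have h1 : ∀ {f : 𝔼 → ℝ}, AEStronglyMeasurable f (volume.restrict (unitBall n)) →
      AEStronglyMeasurable (fun y => G.χ y * f y) G.measA := fun h =>
    hχ.aestronglyMeasurable.mul (h.mono_ac G.measA_absolutelyContinuous)
  have h2 : ∀ {f : 𝔼 → ℝ}, AEStronglyMeasurable f (volume.restrict (unitBall n)) →
      AEStronglyMeasurable (fun y => (1 - G.χ y) * f y) (volume.restrict (unitBall n)) := fun h =>
    (continuous_const.sub hχ).aestronglyMeasurable.mul h
  refine (add_le_add (eLpNorm_add_le (h1 hf) (h1 hg) one_le_two)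
    (eLpNorm_add_le (h2 hf) (h2 hg) one_le_two)).trans (le_of_eq ?_)
  ring

lemma normL2_neg (f : 𝔼 → ℝ) : G.normL2 (fun y => -f y) = G.normL2 f := by
  simp only [normL2, mul_neg]
  exact congrArg₂ _ (eLpNorm_neg ..) (eLpNorm_neg ..)

lemma normL2_sub_comm (f g : 𝔼 → ℝ) :
    G.normL2 (fun y => f y - g y) = G.normL2 (fun y => g y - f y) := by
  rw [← normL2_neg]
  simp

/-- Integration against a test function of the annulus is continuous in `L²(𝔸)`. -/
lemma exists_lintegral_mul_le {ψ : 𝔼 → ℝ} (hψ : IsCcInfty ψ) (hs : tsupport ψ ⊆ G.annulus) :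
    ∃ C : ℝ≥0, ∀ h : 𝔼 → ℝ, AEStronglyMeasurable h G.measA →
      ∫⁻ y, ‖h y * ψ y‖ₑ ≤ C * eLpNorm h 2 G.measA := by
  obtain ⟨C, hC⟩ := G.exists_setLIntegral_volume_le hψ.2 (hs.trans G.annulus_subset_ball)
  obtain ⟨B, hB⟩ := hψ.2.exists_bound_of_continuous hψ.1.continuous
  have hfin : G.measA Set.univ ^ (1 / (1 : ℝ≥0∞).toReal - 1 / (2 : ℝ≥0∞).toReal) ≠ ⊤ :=
    ENNReal.rpow_ne_top_of_nonneg (by norm_num) (measure_ne_top _ _)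
  obtain ⟨m, hm⟩ : ∃ m : ℝ≥0, (m : ℝ≥0∞) = _ := ⟨_, ENNReal.coe_toNNReal hfin⟩
  refine ⟨C * (B.toNNReal * m), fun h hh => ?_⟩
  have hsup : (Function.support fun y => ‖h y * ψ y‖ₑ) ⊆ tsupport ψ ∩ G.annulus := fun y hy => by
    have : y ∈ tsupport ψ := by
      by_contra h'
      exact hy (by simp [image_eq_zero_of_notMem_tsupport h'])
    exact ⟨this, hs this⟩
  rw [← setLIntegral_eq_of_support_subset hsup]
  refine (hC _).trans ?_
  rw [ENNReal.coe_mul, mul_assoc]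
  refine mul_le_mul_right ?_ _
  calc _ ≤ ∫⁻ y, ‖h y * ψ y‖ₑ ∂G.measA := setLIntegral_le_lintegral _ _
    _ ≤ ∫⁻ y, B.toNNReal * ‖h y‖ₑ ∂G.measA := by
      refine lintegral_mono fun y => ?_
      rw [enorm_mul, mul_comm]
      refine mul_le_mul_left ?_ _
      rw [← ofReal_norm]
      exact ENNReal.ofReal_le_ofReal (hB y)
    _ = B.toNNReal * eLpNorm h 1 G.measA := by
      rw [lintegral_const_mul' _ _ ENNReal.coe_ne_top, eLpNorm_one_eq_lintegral_enorm]
    _ ≤ B.toNNReal * (eLpNorm h 2 G.measA * m) := by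
      rw [hm]
      exact mul_le_mul_right (eLpNorm_le_eLpNorm_mul_rpow_measure_univ one_le_two hh) _
    _ = _ := by rw [ENNReal.coe_mul]; ring

/-- `normL2` combines two measures, so the function is split by `χ` and `1 - χ` and each part is
estimated by Hölder's inequality for a finite measure. -/
lemma exists_lintegral_mul_le_normL2 {ψ : 𝔼 → ℝ} (hψ : IsCcInfty ψ)
    (hs : tsupport ψ ⊆ G.annulus) :
    ∃ C : ℝ≥0, ∀ h : 𝔼 → ℝ, AEStronglyMeasurable h (volume.restrict (unitBall n)) →
      ∫⁻ y, ‖h y * ψ y‖ₑ ≤ C * G.normL2 h := by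
  have hχ := G.χ_smooth.continuous
  obtain ⟨C, hC⟩ := G.exists_lintegral_mul_le hψ hs
  obtain ⟨B, hB⟩ := hψ.2.exists_bound_of_continuous hψ.1.continuous
  have hfin : (volume.restrict (unitBall n)) Set.univ ^
      (1 / (1 : ℝ≥0∞).toReal - 1 / (2 : ℝ≥0∞).toReal) ≠ ⊤ := by
    refine ENNReal.rpow_ne_top_of_nonneg (by norm_num) ?_
    rw [Measure.restrict_apply_univ]
    exact measure_ball_lt_top.ne
  obtain ⟨m, hm⟩ : ∃ m : ℝ≥0, (m : ℝ≥0∞) = _ := ⟨_, ENNReal.coe_toNNReal hfin⟩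
  refine ⟨C + B.toNNReal * m, fun h hh => ?_⟩
  have hhA := hh.mono_ac G.measA_absolutelyContinuous
  have hsup : (Function.support fun y => ‖h y * ψ y‖ₑ) ⊆ unitBall n := fun y hy => by
    by_contra h'
    exact hy (by simp [image_eq_zero_of_notMem_tsupport fun h'' =>
      h' (G.annulus_subset_ball (hs h''))])
  have hsplit : ∫⁻ y, ‖h y * ψ y‖ₑ ≤ (∫⁻ y, ‖(G.χ y * h y) * ψ y‖ₑ) +
      ∫⁻ y in unitBall n, ‖((1 - G.χ y) * h y) * ψ y‖ₑ := by
    have hm2 : AEMeasurable (fun y => ‖((1 - G.χ y) * h y) * ψ y‖ₑ)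
        (volume.restrict (unitBall n)) :=
      (((continuous_const.sub hχ).aestronglyMeasurable.mul hh).mul
        hψ.1.continuous.aestronglyMeasurable).enorm
    rw [← setLIntegral_eq_of_support_subset hsup]
    calc _ ≤ ∫⁻ y in unitBall n, (‖(G.χ y * h y) * ψ y‖ₑ + ‖((1 - G.χ y) * h y) * ψ y‖ₑ) := by
          refine lintegral_mono fun y => ?_
          refine le_trans (le_of_eq ?_) (enorm_add_le _ _)
          congr 1
          ring
      _ = _ := lintegral_add_right' _ hm2
      _ ≤ _ := add_le_add (setLIntegral_le_lintegral _ _) le_rfl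
  refine hsplit.trans ?_
  rw [normL2, ENNReal.coe_add, add_mul]
  refine add_le_add ((hC _ (hχ.aestronglyMeasurable.mul hhA)).trans
    (mul_le_mul_right le_self_add _)) ?_
  calc _ ≤ ∫⁻ y in unitBall n, B.toNNReal * ‖(1 - G.χ y) * h y‖ₑ := by
        refine lintegral_mono fun y => ?_
        rw [enorm_mul _ (ψ y), mul_comm]
        refine mul_le_mul_left ?_ _
        rw [← ofReal_norm]
        exact ENNReal.ofReal_le_ofReal (hB y)
    _ = B.toNNReal * eLpNorm (fun y => (1 - G.χ y) * h y) 1 (volume.restrict (unitBall n)) := by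
      rw [lintegral_const_mul' _ _ ENNReal.coe_ne_top, eLpNorm_one_eq_lintegral_enorm]
    _ ≤ B.toNNReal * (eLpNorm (fun y => (1 - G.χ y) * h y) 2 (volume.restrict (unitBall n)) *
        m) := by
      rw [hm]
      exact mul_le_mul_right (eLpNorm_le_eLpNorm_mul_rpow_measure_univ one_le_two
        ((continuous_const.sub hχ).aestronglyMeasurable.mul hh)) _
    _ ≤ B.toNNReal * (G.normL2 h * m) := by
      exact mul_le_mul_right (mul_le_mul_left le_add_self _) _
    _ = _ := by rw [ENNReal.coe_mul, normL2]; ring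

lemma _root_.AdaptedSobolev.IsTest.contDiffOn {f : 𝔼 → ℝ} (hf : IsTest f) (s : Set 𝔼) :
    ContDiffOn ℝ ∞ f s := hf.1.contDiffOn

lemma _root_.AdaptedSobolev.IsTest.sub {f g : 𝔼 → ℝ} (hf : IsTest f) (hg : IsTest g) :
    IsTest (fun y => f y - g y) :=
  ⟨hf.1.sub hg.1, by
    have := hf.2.1.add hg.2.1.neg
    rwa [← sub_eq_add_neg] at this, (tsupport_sub f g).trans (Set.union_subset hf.2.2 hg.2.2)⟩

/-- The multilinear estimate with no factors `w`. -/
lemma exists_eLpNorm_lieWord_le (hn : 2 ≤ n) {r : ℕ} (hr : n < 2 * (r + 1)) (m : ℕ) :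
    ∃ C : ℝ≥0, ∀ τ : List (Option (Fin M)), τ.length ≤ r → ∀ f : 𝔼 → ℝ,
      ContDiffOn ℝ ∞ f (unitBall n) →
      eLpNorm (fun y => lieWord G.field τ f y) 2 G.measA ≤ C * G.normHr m r f := by
  obtain ⟨C, hC⟩ := G.exists_eLpNorm_prod_lieWord_le hn hr m 0
  exact ⟨C, fun τ hτ f hf => by
    simpa using hC (fun i => i.elim0) τ (by simpa using hτ) (fun i => i.elim0) f
      (fun i => i.elim0) hf⟩

/-- The closure of `𝒟_{k,β}` is single-valued. -/
lemma isD_unique (hn : 2 ≤ n) {k : ℕ} {β : Fin M → ℕ} {w v v' : 𝔼 → ℝ}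
    (hw : AEStronglyMeasurable w (volume.restrict (unitBall n)))
    (hv : G.IsD k β w v) (hv' : G.IsD k β w v') : v =ᵐ[G.measA] v' := by
  obtain ⟨hm, φ, hφ, hφw, hφv⟩ := hv
  obtain ⟨hm', φ', hφ', hφw', hφv'⟩ := hv'
  have hL : ∀ j, IsTest (fun y => φ j y - φ' j y) := fun j => (hφ j).sub (hφ' j)
  set h : 𝔼 → ℝ := fun y => v y - v' y with hh
  have hhm : AEStronglyMeasurable h G.measA := hm.sub hm'
  set τ := sortedWord k β
  have hDm : ∀ {f : 𝔼 → ℝ}, IsTest f → AEStronglyMeasurable (lieWord G.field τ f) G.measA :=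
    fun hf => G.aestronglyMeasurable_measA
      (G.contDiffOn_lieWord_annulus (hf.contDiffOn _) τ).continuousOn
  have htest : ∀ f : 𝔼 → ℝ, IsTest f → AEStronglyMeasurable f (volume.restrict (unitBall n)) :=
    fun f hf => hf.1.continuous.aestronglyMeasurable
  simp only [D_eq] at hφv hφv'
  set δ : ℕ → ℝ≥0∞ := fun j =>
    eLpNorm (fun y => lieWord G.field τ (φ j) y - v y) 2 G.measA +
      eLpNorm (fun y => lieWord G.field τ (φ' j) y - v' y) 2 G.measA with hδ
  have hδ0 : Tendsto δ atTop (𝓝 0) := by simpa using hφv.add hφv'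
  set ε : ℕ → ℝ≥0∞ := fun j =>
    G.normL2 (fun y => φ j y - w y) + G.normL2 (fun y => φ' j y - w y) with hε
  have hε0 : Tendsto ε atTop (𝓝 0) := by simpa using hφw.add hφw'
  have hδb : ∀ j, eLpNorm (fun y => h y - lieWord G.field τ (fun y => φ j y - φ' j y) y) 2 G.measA
      ≤ δ j := fun j => by
    have : (fun y => h y - lieWord G.field τ (fun y => φ j y - φ' j y) y) =ᵐ[G.measA]
        fun y => (v y - lieWord G.field τ (φ j) y) + (lieWord G.field τ (φ' j) y - v' y) := by
      filter_upwards [G.ae_mem_annulus] with y hy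
      rw [lieWord_sub G.isOpen_annulus G.contDiffOn_field_annulus τ
        (((hφ j).contDiffOn _).of_le (natCast_le_infty _))
        (((hφ' j).contDiffOn _).of_le (natCast_le_infty _)) hy, hh]
      ring
    rw [eLpNorm_congr_ae this]
    refine (eLpNorm_add_le (hm.sub (hDm (hφ j))) ((hDm (hφ' j)).sub hm') one_le_two).trans
      (add_le_add (le_of_eq ?_) le_rfl)
    exact eLpNorm_sub_comm _ _ _ _
  have hεb : ∀ j, G.normL2 (fun y => φ j y - φ' j y) ≤ ε j := fun j => by
    rw [show (fun y => φ j y - φ' j y) = fun y => (φ j y - w y) + (w y - φ' j y) by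
      ext; ring]
    refine (G.normL2_add_le ((htest _ (hφ j)).sub hw) (hw.sub (htest _ (hφ' j)))).trans
      (add_le_add le_rfl (G.normL2_sub_comm _ _).le)
  -- Neither derivative is assumed square integrable, but their difference is at finite distance
  -- from a derivative of a test function. The order `n + τ.length` is simply large enough for the
  -- estimate of that derivative.
  have hfin : eLpNorm h 2 G.measA < ⊤ := by
    obtain ⟨j, hj⟩ := (hδ0.eventually_lt_const ENNReal.zero_lt_top).exists
    obtain ⟨C, hC⟩ := G.exists_eLpNorm_lieWord_le hn
      (show n < 2 * (n + τ.length + 1) by omega) 0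
    have e : h = fun y => (h y - lieWord G.field τ (fun y => φ j y - φ' j y) y) +
      lieWord G.field τ (fun y => φ j y - φ' j y) y := by ext; ring
    rw [e]
    refine (eLpNorm_add_le (hhm.sub (hDm (hL j))) (hDm (hL j)) one_le_two).trans_lt
      (ENNReal.add_lt_top.2 ⟨(hδb j).trans_lt hj,
        (hC _ (by omega) _ ((hL j).contDiffOn _)).trans_lt
          (ENNReal.mul_lt_top ENNReal.coe_lt_top (G.normHr_lt_top _ _ (hL j)))⟩)
  have hac := G.restrict_annulus_absolutelyContinuous
  have hzero : ∀ ψ : 𝔼 → ℝ, IsCcInfty ψ → tsupport ψ ⊆ G.annulus →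
      ∫ y, ψ y * h y = 0 := by
    intro ψ hψ hs
    obtain ⟨ψ', hψ', hs', H⟩ := G.exists_adjoint τ hψ hs
    obtain ⟨C₁, h1⟩ := G.exists_lintegral_mul_le hψ hs
    obtain ⟨C₂, h2⟩ := G.exists_lintegral_mul_le_normL2 hψ' hs'
    -- With the derivatives moved to the test function, the integral is bounded by the distance of
    -- the derivatives from their limits plus that of the functions from their common limit `w`;
    -- both tend to zero. A non-integrable integrand has integral zero by convention.
    have hb : ∀ j, ‖∫ y, ψ y * h y‖ₑ ≤ C₁ * δ j + C₂ * ε j := fun j => by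
      have hf := (hL j).contDiffOn G.annulus
      set f := fun y => φ j y - φ' j y
      have hi : Integrable fun y => lieWord G.field τ f y * ψ y :=
        hψ.2.integrable_mul_of_continuousOn G.isOpen_annulus
          (G.contDiffOn_lieWord_annulus hf τ).continuousOn hψ.1.continuous hs
      have hlt : ∫⁻ y, ‖(h y - lieWord G.field τ f y) * ψ y‖ₑ ≤ C₁ * δ j :=
        (h1 _ (hhm.sub (hDm (hL j)))).trans (mul_le_mul_right (hδb j) _)
      by_cases hint : Integrable fun y => h y * ψ y
      · have e : ∫ y, ψ y * h y = (∫ y, (h y - lieWord G.field τ f y) * ψ y) +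
            ∫ y, f y * ψ' y := by
          have hi' : Integrable fun y => (h y - lieWord G.field τ f y) * ψ y := by
            simp only [sub_mul]
            exact hint.sub hi
          rw [← H f hf, ← integral_add hi' hi]
          congr 1 with y
          ring
        rw [e]
        refine (enorm_add_le _ _).trans (add_le_add
          ((enorm_integral_le_lintegral_enorm _).trans hlt) ?_)
        exact (enorm_integral_le_lintegral_enorm _).trans
          ((h2 f (htest _ (hL j))).trans (mul_le_mul_right (hεb j) _))
      · rw [integral_undef (by simpa only [mul_comm] using hint)]
        simp
    have hlim : Tendsto (fun j => C₁ * δ j + C₂ * ε j) atTop (𝓝 0) := by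
      simpa using (ENNReal.Tendsto.const_mul hδ0 (Or.inr ENNReal.coe_ne_top)).add
        (ENNReal.Tendsto.const_mul hε0 (Or.inr ENNReal.coe_ne_top))
    have := ge_of_tendsto' hlim hb
    exact enorm_eq_zero.1 (le_antisymm this zero_le)
  -- A locally integrable function that annihilates all test functions of the annulus is zero almost
  -- everywhere.
  have hloc : LocallyIntegrableOn h G.annulus := by
    refine (locallyIntegrableOn_iff G.isOpen_annulus.isLocallyClosed).2 fun K hK hKc => ?_
    obtain ⟨ψ, h1, h2, h3, h4⟩ := exists_cutoff hKc G.isOpen_annulus hK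
    obtain ⟨C, hC⟩ := G.exists_lintegral_mul_le ⟨h1, h2⟩ h3
    refine ⟨hhm.mono_ac ((Measure.restrict_mono hK le_rfl).absolutelyContinuous.trans hac), ?_⟩
    refine lt_of_le_of_lt ?_ ((hC h hhm).trans_lt (ENNReal.mul_lt_top ENNReal.coe_lt_top hfin))
    rw [setLIntegral_congr_fun (g := fun y => ‖h y * ψ y‖ₑ) hKc.measurableSet
      fun y hy => by simp [(h4 y hy).eq_of_nhds]]
    exact setLIntegral_le_lintegral _ _
  have key := G.isOpen_annulus.ae_eq_zero_of_integral_contDiff_smul_eq_zero hloc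
    fun ψ h1 h2 h3 => hzero ψ ⟨h1, h2⟩ h3
  have key' : ∀ᵐ y ∂G.measA, y ∈ G.annulus → h y = 0 :=
    (G.measA_absolutelyContinuous.trans Measure.restrict_le_self.absolutelyContinuous) key
  filter_upwards [key', G.ae_mem_annulus] with y hy hyA
  exact sub_eq_zero.1 (hy hyA)

end BallData

end

section

namespace BallData

variable {n M : ℕ} (G : BallData n M)

local notation "𝔼" => EuclideanSpace ℝ (Fin n)

/-! ### Approximating sequences -/

variable {G}

lemma Approximates.comp_strictMono {m r : ℕ} {φ : ℕ → EuclideanSpace ℝ (Fin n) → ℝ}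
    {w : EuclideanSpace ℝ (Fin n) → ℝ} (h : G.Approximates m r φ w) {σ : ℕ → ℕ}
    (hσ : StrictMono σ) : G.Approximates m r (fun j => φ (σ j)) w := by
  refine ⟨fun j => h.1 _, fun ε hε => ?_, h.2.2.comp hσ.tendsto_atTop⟩
  obtain ⟨j₀, hj⟩ := h.2.1 ε hε
  exact ⟨j₀, fun i j hi hj' => hj _ _ (hi.trans (hσ.le_apply)) (hj'.trans hσ.le_apply)⟩

lemma Approximates.normHr_bounded {m r : ℕ} {φ : ℕ → EuclideanSpace ℝ (Fin n) → ℝ}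
    {w : EuclideanSpace ℝ (Fin n) → ℝ} (h : G.Approximates m r φ w) :
    ∃ C : ℝ≥0, ∀ᶠ j in atTop, G.normHr m r (φ j) ≤ C := by
  obtain ⟨j₀, hj⟩ := h.2.1 1 one_pos
  have hfin : G.normHr m r (φ j₀) ≠ ⊤ := (G.normHr_lt_top m r (h.1 j₀)).ne
  refine ⟨1 + (G.normHr m r (φ j₀)).toNNReal, ?_⟩
  filter_upwards [eventually_ge_atTop j₀] with j hjj
  have e : φ j = fun y => (φ j y - φ j₀ y) + φ j₀ y := by ext; ring
  rw [e, ENNReal.coe_add, ENNReal.coe_toNNReal hfin]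
  exact (G.normHr_add_le m r ((h.1 j).sub (h.1 j₀)).1 (h.1 j₀).1).trans
    (add_le_add (hj j j₀ hjj le_rfl).le le_rfl)

lemma Approximates.hNorm_lt_top {m r : ℕ} {φ : ℕ → EuclideanSpace ℝ (Fin n) → ℝ}
    {w : EuclideanSpace ℝ (Fin n) → ℝ} (h : G.Approximates m r φ w) : G.hNorm m r w < ⊤ := by
  obtain ⟨C, hC⟩ := h.normHr_bounded
  refine lt_of_le_of_lt (iInf₂_le φ h) ?_
  refine lt_of_le_of_lt ?_ (ENNReal.coe_lt_top (r := C))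
  exact liminf_le_of_frequently_le' hC.frequently

lemma MemHr.hNorm_lt_top {m r : ℕ} {w : EuclideanSpace ℝ (Fin n) → ℝ} (h : G.MemHr m r w) :
    G.hNorm m r w < ⊤ := h.2.choose_spec.hNorm_lt_top

variable (G)

/-- `hNorm` is an infimum of lower limits, so below any strictly larger `c` there is a sequence with
infinitely many norms under `c`; a subsequence has all of them there. -/
lemma exists_approximates_le {m r : ℕ} {w : 𝔼 → ℝ} {c : ℝ≥0∞} (h : G.hNorm m r w < c) :
    ∃ φ, G.Approximates m r φ w ∧ ∀ j, G.normHr m r (φ j) ≤ c := by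
  obtain ⟨φ, h⟩ := iInf_lt_iff.1 h
  obtain ⟨hφ, h⟩ := iInf_lt_iff.1 h
  have hf : ∃ᶠ j in atTop, G.normHr m r (φ j) < c := frequently_lt_of_liminf_lt (by isBoundedDefault) h
  obtain ⟨σ, hσ, H⟩ := extraction_of_frequently_atTop hf
  exact ⟨fun j => φ (σ j), hφ.comp_strictMono hσ, fun j => (H j).le⟩

lemma _root_.AdaptedSobolev.IsTest.aestronglyMeasurable_lieWord {f : 𝔼 → ℝ} (hf : IsTest f)
    (τ : List (Option (Fin M))) : AEStronglyMeasurable (lieWord G.field τ f) G.measA :=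
  G.aestronglyMeasurable_measA (G.contDiffOn_lieWord_annulus (hf.contDiffOn _) τ).continuousOn

/-- The derivatives of functions in `ℋ^{m,r}` exist. -/
lemma exists_tendsto_D (hn : 2 ≤ n) {r : ℕ} (hr : n < 2 * (r + 1)) {m : ℕ} {φ : ℕ → 𝔼 → ℝ} {w : 𝔼 → ℝ}
    (h : G.Approximates m r φ w) {k : ℕ} {β : Fin M → ℕ} (hk : k + ∑ a, β a ≤ r) :
    ∃ v, AEStronglyMeasurable v G.measA ∧
      Tendsto (fun j => eLpNorm (fun y => G.D k β (φ j) y - v y) 2 G.measA) atTop (𝓝 0) := by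
  obtain ⟨C, hC⟩ := G.exists_eLpNorm_lieWord_le hn hr m
  set τ := sortedWord k β with hτ
  have hlen : τ.length ≤ r := by rw [hτ, length_sortedWord]; exact hk
  have hdiff : ∀ i j, eLpNorm (fun y => lieWord G.field τ (φ i) y - lieWord G.field τ (φ j) y) 2
      G.measA ≤ C * G.normHr m r (fun y => φ i y - φ j y) := fun i j => by
    refine le_trans (le_of_eq (eLpNorm_congr_ae ?_))
      (hC τ hlen _ (((h.1 i).sub (h.1 j)).contDiffOn _))
    filter_upwards [G.ae_mem_annulus] with y hy
    rw [lieWord_sub G.isOpen_annulus G.contDiffOn_field_annulus τ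
      (((h.1 i).contDiffOn _).of_le (natCast_le_infty _))
      (((h.1 j).contDiffOn _).of_le (natCast_le_infty _)) hy]
  have hmem : ∀ j, MemLp (lieWord G.field τ (φ j)) 2 G.measA := fun j =>
    ⟨(h.1 j).aestronglyMeasurable_lieWord G τ, (hC τ hlen _ ((h.1 j).contDiffOn _)).trans_lt
      (ENNReal.mul_lt_top ENNReal.coe_lt_top (G.normHr_lt_top _ _ (h.1 j)))⟩
  set L : ℕ → Lp ℝ 2 G.measA := fun j => (hmem j).toLp
  have hcau : CauchySeq L := by
    rw [EMetric.cauchySeq_iff]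
    intro ε hε
    obtain ⟨ε', hε', hlt⟩ : ∃ ε' : ℝ≥0∞, 0 < ε' ∧ C * ε' < ε := by
      have h0 : Tendsto (fun x : ℝ≥0∞ => C * x) (𝓝[>] 0) (𝓝 0) := by
        have := ENNReal.Tendsto.const_mul (a := (C : ℝ≥0∞)) (tendsto_id (α := ℝ≥0∞) (x := 𝓝 0))
          (Or.inr ENNReal.coe_ne_top)
        simpa using this.mono_left nhdsWithin_le_nhds
      obtain ⟨x, h1, h2⟩ := ((h0.eventually_lt_const hε).and self_mem_nhdsWithin).exists
      exact ⟨x, h2, h1⟩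
    obtain ⟨j₀, hj⟩ := h.2.1 ε' hε'
    refine ⟨j₀, fun i hi j hj' => ?_⟩
    rw [Lp.edist_toLp_toLp]
    exact ((hdiff i j).trans (mul_le_mul_right (hj i j hi hj').le _)).trans_lt hlt
  obtain ⟨v, hv⟩ := cauchySeq_tendsto_of_complete hcau
  refine ⟨v, (Lp.memLp v).1, ?_⟩
  have := (Lp.tendsto_Lp_iff_tendsto_eLpNorm' L v).1 hv
  refine this.congr fun j => eLpNorm_congr_ae ?_
  filter_upwards [(hmem j).coeFn_toLp] with y hy
  simp only [Pi.sub_apply, L, D_eq, ← hτ]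
  rw [hy]

/-- Bounded approximating sequences along which the derivative converges almost everywhere. -/
lemma exists_seq_tendsto_ae (hn : 2 ≤ n) {r : ℕ} (hr : n < 2 * (r + 1)) {m : ℕ} {w v : 𝔼 → ℝ}
    (hw : AEStronglyMeasurable w (volume.restrict (unitBall n))) {c : ℝ≥0∞}
    (hc : G.hNorm m r w < c) {k : ℕ} {β : Fin M → ℕ} (hk : k + ∑ a, β a ≤ r)
    (hv : G.IsD k β w v) : ∃ φ : ℕ → 𝔼 → ℝ, (∀ j, IsTest (φ j)) ∧ (∀ j, G.normHr m r (φ j) ≤ c) ∧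
      ∀ᵐ y ∂G.measA, Tendsto (fun j => lieWord G.field (sortedWord k β) (φ j) y) atTop
        (𝓝 (v y)) := by
  obtain ⟨φ, hφ, hφc⟩ := G.exists_approximates_le hc
  obtain ⟨v', hm, hv'⟩ := G.exists_tendsto_D hn hr hφ hk
  have heq := G.isD_unique hn hw hv ⟨hm, φ, hφ.1, hφ.2.2, hv'⟩
  simp only [D_eq] at hv'
  obtain ⟨σ, -, H⟩ := (tendstoInMeasure_of_tendsto_eLpNorm two_ne_zero
    (fun j => (hφ.1 j).aestronglyMeasurable_lieWord G (sortedWord k β)) hm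
      hv').exists_seq_tendsto_ae
  refine ⟨fun j => φ (σ j), fun j => hφ.1 _, fun j => hφc _, ?_⟩
  filter_upwards [heq, H] with y h1 h2
  rwa [h1]

/-- Existence of the derivatives is completeness of `L²`. The bound is Fatou's lemma: for test
functions the estimate is uniform along the approximating sequences, and the products of derivatives
converge almost everywhere. Since the closed operators are single-valued, any admissible choice of
derivatives is the limit of such a sequence. -/
theorem multilinear_estimate (hn : 2 ≤ n) {r : ℕ} (hr : n < 2 * (r + 1)) (N : ℕ) :
    ∃ C : ℝ≥0, ∀ (k : Fin N → ℕ) (β : Fin N → Fin M → ℕ) (k' : ℕ) (β' : Fin M → ℕ),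
      (∑ i, (k i + ∑ a, β i a)) + (k' + ∑ a, β' a) ≤ r →
      ∀ (w : Fin N → 𝔼 → ℝ) (u : 𝔼 → ℝ), (∀ i, G.MemHr 1 r (w i)) → G.MemHr 0 r u →
        ((∀ i, ∃ v, G.IsD (k i) (β i) (w i) v) ∧ ∃ v', G.IsD k' β' u v') ∧
        ∀ (v : Fin N → 𝔼 → ℝ) (v' : 𝔼 → ℝ),
          (∀ i, G.IsD (k i) (β i) (w i) (v i)) → G.IsD k' β' u v' →
          eLpNorm (fun y => (∏ i, v i y) * v' y) 2 G.measA ≤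
            (C : ℝ≥0∞) * G.hNorm 0 r u * ∏ i, G.hNorm 1 r (w i) := by
  obtain ⟨C, hC⟩ := G.exists_eLpNorm_prod_lieWord_le hn hr 0 N
  refine ⟨C, fun k β k' β' hk w u hw hu => ?_⟩
  have hki : ∀ i, k i + ∑ a, β i a ≤ r := fun i =>
    (Finset.single_le_sum (f := fun i => k i + ∑ a, β i a) (fun _ _ => Nat.zero_le _)
      (Finset.mem_univ i)).trans (by omega)
  have hk' : k' + ∑ a, β' a ≤ r := by omega
  refine ⟨⟨fun i => ?_, ?_⟩, fun v v' hv hv' => ?_⟩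
  · obtain ⟨φ, hφ⟩ := (hw i).2
    obtain ⟨v, h1, h2⟩ := G.exists_tendsto_D hn hr hφ (hki i)
    exact ⟨v, h1, φ, hφ.1, hφ.2.2, h2⟩
  · obtain ⟨φ, hφ⟩ := hu.2
    obtain ⟨v, h1, h2⟩ := G.exists_tendsto_D hn hr hφ hk'
    exact ⟨v, h1, φ, hφ.1, hφ.2.2, h2⟩
  -- Bounded sequences exist only for bounds strictly above the norms, so the estimate is first
  -- proved with these.
  have main : ∀ (c : Fin N → ℝ≥0∞) (c' : ℝ≥0∞), (∀ i, G.hNorm 1 r (w i) < c i) →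
      G.hNorm 0 r u < c' → eLpNorm (fun y => (∏ i, v i y) * v' y) 2 G.measA ≤
        C * c' * ∏ i, c i := by
    intro c c' hc hc'
    choose φ hφ hφc hφv using fun i => G.exists_seq_tendsto_ae hn hr (hw i).1 (hc i) (hki i) (hv i)
    obtain ⟨φ', hφ', hφc', hφv'⟩ := G.exists_seq_tendsto_ae hn hr hu.1 hc' hk' hv'
    refine (Lp.eLpNorm_lim_le_liminf_eLpNorm (f := fun j y =>
      (∏ i, lieWord G.field (sortedWord (k i) (β i)) (φ i j) y) *
        lieWord G.field (sortedWord k' β') (φ' j) y) (fun j => ?_) _ ?_).trans ?_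
    · exact (Finset.aestronglyMeasurable_fun_prod _ fun i _ =>
        (hφ i j).aestronglyMeasurable_lieWord G _).mul ((hφ' j).aestronglyMeasurable_lieWord G _)
    · filter_upwards [ae_all_iff.2 hφv, hφv'] with y h1 h2
      exact (tendsto_finsetProd _ fun i _ => h1 i).mul h2
    · refine liminf_le_of_frequently_le' (Eventually.of_forall fun j => ?_).frequently
      refine (hC _ _ (by simpa only [length_sortedWord] using hk) _ _
        (fun i => (hφ i j).contDiffOn _) ((hφ' j).contDiffOn _)).trans ?_
      exact mul_le_mul' (mul_le_mul_right (hφc' j) _) (Finset.prod_le_prod' fun i _ => hφc i j)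
  obtain ⟨b', hb'⟩ : ∃ b : ℝ≥0, (b : ℝ≥0∞) = G.hNorm 0 r u :=
    ⟨_, ENNReal.coe_toNNReal hu.hNorm_lt_top.ne⟩
  choose b hb using fun i => (⟨_, ENNReal.coe_toNNReal (hw i).hNorm_lt_top.ne⟩ :
    ∃ b : ℝ≥0, (b : ℝ≥0∞) = G.hNorm 1 r (w i))
  -- All norms are finite, so the passage to the limit in the bounds takes place in the nonnegative
  -- reals, where products are continuous.
  have hlim : Tendsto (fun ε : ℝ≥0 => (((C * (b' + ε)) * ∏ i, (b i + ε) : ℝ≥0) : ℝ≥0∞)) (𝓝[>] 0)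
      (𝓝 ((C * (b' + 0)) * ∏ i, (b i + 0) : ℝ≥0)) := by
    refine ENNReal.tendsto_coe.2 (Tendsto.mono_left ?_ nhdsWithin_le_nhds)
    exact Continuous.tendsto (by fun_prop) 0
  have hfin : eLpNorm (fun y => (∏ i, v i y) * v' y) 2 G.measA ≤
      ((C * (b' + 0)) * ∏ i, (b i + 0) : ℝ≥0) := by
    refine ge_of_tendsto hlim ?_
    filter_upwards [self_mem_nhdsWithin] with ε hε
    have hε' : 0 < ε := hε
    refine (main (fun i => (b i + ε : ℝ≥0)) (b' + ε : ℝ≥0) (fun i => ?_) ?_).trans (le_of_eq ?_)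
    · rw [← hb]
      exact ENNReal.coe_lt_coe.2 (lt_add_of_pos_right _ hε')
    · rw [← hb']
      exact ENNReal.coe_lt_coe.2 (lt_add_of_pos_right _ hε')
    · push_cast
      rfl
  refine hfin.trans (le_of_eq ?_)
  push_cast
  simp only [add_zero, hb, hb']

end BallData

end

section

/-! ### Vector fields on a product -/

section ProdField

variable {A B ι κ : Type*} [NormedAddCommGroup A] [NormedSpace ℝ A] [NormedAddCommGroup B]
  [NormedSpace ℝ B]

lemma lieWord_map (V : ι → A → A) (g : κ → ι) (f : A → ℝ) (τ : List κ) :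
    lieWord V (τ.map g) f = lieWord (fun a => V (g a)) τ f := by
  induction τ with
  | nil => rfl
  | cons a τ ih => ext y; simp only [List.map_cons, lieWord_cons, ih]

/-- Vector fields on the first factor and constant vector fields on the second factor. -/
def prodField (V : ι → A → A) (e : κ → B) : ι ⊕ κ → A × B → A × B :=
  Sum.elim (fun a q => (V a q.1, 0)) fun i _ => (0, e i)

variable {V : ι → A → A} {e : κ → B} {Ω : Set A}

lemma contDiffOn_prodField (hV : ∀ a, ContDiffOn ℝ ∞ (V a) Ω) (a : ι ⊕ κ) :
    ContDiffOn ℝ ∞ (prodField V e a) (Ω ×ˢ Set.univ) := by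
  cases a with
  | inl a => exact ((hV a).comp contDiffOn_fst fun q hq => hq.1).prodMk contDiffOn_const
  | inr i => exact contDiffOn_const

lemma span_prodField {q : A × B} (hV : Submodule.span ℝ (Set.range fun a => V a q.1) = ⊤)
    (he : Submodule.span ℝ (Set.range e) = ⊤) :
    Submodule.span ℝ (Set.range fun a => prodField V e a q) = ⊤ := by
  rw [eq_top_iff]
  rintro ⟨v, w⟩ -
  rw [show ((v, w) : A × B) = LinearMap.inl ℝ A B v + LinearMap.inr ℝ A B w by simp]
  refine Submodule.add_mem _ ?_ ?_
  · have : v ∈ Submodule.span ℝ (Set.range fun a => V a q.1) := by rw [hV]; trivial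
    have h2 := Submodule.mem_map_of_mem (f := LinearMap.inl ℝ A B) this
    rw [Submodule.map_span, ← Set.range_comp] at h2
    refine Submodule.span_mono ?_ h2
    rintro _ ⟨a, rfl⟩
    exact ⟨.inl a, rfl⟩
  · have : w ∈ Submodule.span ℝ (Set.range e) := by rw [he]; trivial
    have h2 := Submodule.mem_map_of_mem (f := LinearMap.inr ℝ A B) this
    rw [Submodule.map_span, ← Set.range_comp] at h2
    refine Submodule.span_mono ?_ h2
    rintro _ ⟨a, rfl⟩
    exact ⟨.inr a, rfl⟩

lemma lieWord_prodField_inr (hΩ : IsOpen Ω) (τ : List κ) {H : A × B → ℝ}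
    (hH : ContDiffOn ℝ τ.length H (Ω ×ˢ Set.univ)) {y : A} (hy : y ∈ Ω) (z : B) :
    lieWord (prodField V e) (τ.map .inr) H (y, z) =
      lieWord (fun a _ => e a) τ (fun z => H (y, z)) z := by
  rw [lieWord_map]
  refine (lieWord_comp (V := fun a (_ : B) => e a) (Φ := fun z : B => (y, z))
    (W := fun a => prodField V e (.inr a)) isOpen_univ (hΩ.prod isOpen_univ)
    (fun z _ => ⟨hy, trivial⟩) (fun a => contDiffOn_const) (fun z _ => by fun_prop)
    (fun a z _ => ?_) τ hH (Set.mem_univ z)).symm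
  have : HasFDerivAt (fun z : B => (y, z)) (ContinuousLinearMap.inr ℝ A B) z :=
    hasFDerivAt_prodMk_right y z
  rw [this.fderiv]
  rfl

lemma lieWord_prodField_inl (hΩ : IsOpen Ω) (hV : ∀ a, ContDiffOn ℝ ∞ (V a) Ω) (τ : List ι)
    {H : A × B → ℝ} (hH : ContDiffOn ℝ τ.length H (Ω ×ˢ Set.univ)) {y : A} (hy : y ∈ Ω) (z : B) :
    lieWord (prodField V e) (τ.map .inl) H (y, z) = lieWord V τ (fun y => H (y, z)) y := by
  rw [lieWord_map]
  refine (lieWord_comp (V := V) (Φ := fun y : A => (y, z))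
    (W := fun a => prodField V e (.inl a)) hΩ (hΩ.prod isOpen_univ)
    (fun y hy => ⟨hy, trivial⟩) (fun a => contDiffOn_prodField (e := e) hV (.inl a))
    (fun z _ => by fun_prop) (fun a y _ => ?_) τ hH hy).symm
  have : HasFDerivAt (fun y : A => (y, z)) (ContinuousLinearMap.inl ℝ A B) y :=
    hasFDerivAt_prodMk_left y z
  rw [this.fderiv]
  rfl

lemma _root_.List.exists_perm_map_inl_append_map_inr (τ : List (ι ⊕ κ)) :
    ∃ (τ₁ : List ι) (τ₂ : List κ), τ.Perm (τ₁.map .inl ++ τ₂.map .inr) := by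
  induction τ with
  | nil => exact ⟨[], [], .nil⟩
  | cons a τ ih =>
    obtain ⟨τ₁, τ₂, h⟩ := ih
    cases a with
    | inl a => exact ⟨a :: τ₁, τ₂, h.cons _⟩
    | inr b => exact ⟨τ₁, b :: τ₂, (h.cons _).trans List.perm_middle.symm⟩

end ProdField

namespace BallData

variable {n M : ℕ} (G : BallData n M)

local notation "𝔼" => EuclideanSpace ℝ (Fin n)

/-! ### Bounds for the coefficients in the pieces -/

/-- A coefficient in the coordinates of a piece. -/
def pieceCoeff {N : ℕ} (F : EuclideanSpace ℝ (Fin n) → (Fin N → ℝ) → ℝ) (p : Option ℕ)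
    (q : EuclideanSpace ℝ (Fin n) × (Fin N → ℝ)) : ℝ := F (G.chart p q.1) q.2

variable {N r : ℕ} {F : EuclideanSpace ℝ (Fin n) → (Fin N → ℝ) → ℝ}

lemma contDiffOn_pieceCoeff
    (hF : ContDiffOn ℝ r (fun q : 𝔼 × (Fin N → ℝ) => F q.1 q.2) (unitBall n ×ˢ Set.univ))
    (p : Option ℕ) : ContDiffOn ℝ r (G.pieceCoeff F p) (dom p ×ˢ Set.univ) := by
  have hc : ContDiffOn ℝ r (G.chart p) (dom p) := fun Y hY =>
    ((G.contDiffAt_chart hY).of_le (natCast_le_infty r)).contDiffWithinAt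
  exact hF.comp (f := fun q : 𝔼 × (Fin N → ℝ) => (G.chart p q.1, q.2))
    ((hc.comp contDiffOn_fst fun q hq => hq.1).prodMk contDiffOn_snd)
    fun q hq => ⟨G.chart_mem_ball hq.1, trivial⟩

lemma span_pi_single (N : ℕ) :
    Submodule.span ℝ (Set.range fun i : Fin N => (Pi.single i 1 : Fin N → ℝ)) = ⊤ := by
  have := (Pi.basisFun ℝ (Fin N)).span_eq
  rwa [show ((Pi.basisFun ℝ (Fin N) : Fin N → Fin N → ℝ)) = fun i => Pi.single i 1 by
    ext1 i; simp] at this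

lemma iteratedFDeriv_apply_single_eq_lieWord
    (hF : ContDiffOn ℝ r (fun q : 𝔼 × (Fin N → ℝ) => F q.1 q.2) (unitBall n ×ˢ Set.univ))
    (τ : List (Fin N)) (hτ : τ.length ≤ r) (V : Unit → 𝔼 → 𝔼) {y : 𝔼} (hy : y ∈ unitBall n)
    (z : Fin N → ℝ) :
    iteratedFDeriv ℝ τ.length (F y) z (fun a => Pi.single (τ.get a) 1) =
      lieWord (prodField V fun i : Fin N => (Pi.single i 1 : Fin N → ℝ)) (τ.map .inr)
        (fun q : 𝔼 × (Fin N → ℝ) => F q.1 q.2) (y, z) := by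
  have hF' : ContDiffOn ℝ τ.length (fun q : 𝔼 × (Fin N → ℝ) => F q.1 q.2)
    (unitBall n ×ˢ Set.univ) := hF.of_le (mod_cast hτ)
  rw [lieWord_prodField_inr Metric.isOpen_ball τ hF' hy z]
  have h := lieWord_const_ofFn (f := F y) isOpen_univ
    (fun i : Fin N => (Pi.single i 1 : Fin N → ℝ)) (s := τ.length)
    (hF'.comp (f := fun z : Fin N → ℝ => (y, z)) (contDiffOn_const.prodMk contDiffOn_id)
      fun z _ => ⟨hy, trivial⟩) τ.get (Set.mem_univ z)
  rw [List.ofFn_get] at h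
  exact h.symm

/-- The last letters act first, so this word takes the derivatives in `z` and then the cone fields.
By naturality the result is `𝒟_{k,β} ∂_z^γ F` at a point of the collar, where `χ = 1`, and the
hypothesis on `F` bounds it. -/
lemma abs_lieWord_pieceCoeff_le (hF : G.IsCoeff r N F) {K B : ℝ}
    (hB : ∀ (k : ℕ) (β : Fin M → ℕ) (l : ℕ) (e : Fin l → Fin N),
      k + ∑ i, β i + l ≤ r → ∀ y ∈ G.annulus, ∀ z : Fin N → ℝ, (∀ i, |z i| ≤ K) →
        |G.D k β (fun y' => G.χ y' *
          iteratedFDeriv ℝ l (F y') z (fun a => Pi.single (e a) 1)) y| ≤ B)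
    {k' : ℕ} {Y : 𝔼} (hY : Y ∈ dom (some k')) {z : Fin N → ℝ} (hz : ∀ i, |z i| ≤ K)
    {k : ℕ} {β : Fin M → ℕ} {τ : List (Fin N)} (hl : k + ∑ i, β i + τ.length ≤ r) :
    |lieWord (prodField G.coneField fun i : Fin N => (Pi.single i 1 : Fin N → ℝ))
      ((sortedWord k β).map .inl ++ τ.map .inr) (G.pieceCoeff F (some k')) (Y, z)| ≤ B := by
  set σ := sortedWord k β with hσ
  have hlen : σ.length = k + ∑ i, β i := length_sortedWord k β
  set e : Fin N → Fin N → ℝ := fun i => Pi.single i 1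
  set d : Set 𝔼 := dom (some k') with hd
  have hdo : IsOpen d := isOpen_dom (some k')
  have hV : ∀ a, ContDiffOn ℝ ∞ (G.coneField a) d := fun a =>
    (G.contDiffOn_coneField a).mono fun Y hY => (G.dom_some_spec hY).1
  have hH := G.contDiffOn_pieceCoeff hF.1 (some k')
  set g : 𝔼 → ℝ := fun y => iteratedFDeriv ℝ τ.length (F y) z (fun a => Pi.single (τ.get a) 1)
    with hg
  have hgc : ContDiffOn ℝ σ.length g (unitBall n) := by
    have h1 : ContDiffOn ℝ σ.length (lieWord (prodField (fun (_ : Unit) (y : 𝔼) => y) e)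
        (τ.map .inr) (fun q : 𝔼 × (Fin N → ℝ) => F q.1 q.2)) (unitBall n ×ˢ Set.univ) :=
      contDiffOn_lieWord_nat (Metric.isOpen_ball.prod isOpen_univ)
        (contDiffOn_prodField fun _ => contDiffOn_id) _ hF.1 (by
          rw [List.length_map, hlen]; exact hl)
    refine (h1.comp (f := fun y : 𝔼 => (y, z)) (contDiffOn_id.prodMk contDiffOn_const)
      fun y hy => ⟨hy, trivial⟩).congr fun y hy => ?_
    exact iteratedFDeriv_apply_single_eq_lieWord hF.1 τ (by omega) _ hy z
  have hz1 : ∀ Y ∈ d, lieWord (prodField G.coneField e) (τ.map .inr)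
      (G.pieceCoeff F (some k')) (Y, z) = g (G.chart (some k') Y) := fun Y hY => by
    rw [lieWord_prodField_inr hdo τ (hH.of_le (mod_cast (by omega))) hY z, hg]
    simp only
    rw [iteratedFDeriv_apply_single_eq_lieWord hF.1 τ (by omega)
      (fun (_ : Unit) (y : 𝔼) => y) (G.chart_mem_ball hY) z,
      lieWord_prodField_inr Metric.isOpen_ball τ (hF.1.of_le (mod_cast (by omega)))
        (G.chart_mem_ball hY) z]
    rfl
  rw [lieWord_append, lieWord_prodField_inl hdo hV σ
    (contDiffOn_lieWord_nat (hdo.prod isOpen_univ) (contDiffOn_prodField hV) _ hH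
      (by rw [List.length_map, hlen]; exact hl)) hY z,
    lieWord_congr hdo hz1 σ hY, G.lieWord_comp_chart σ hgc hY]
  have hcol := G.chart_some_mem_collar hY
  have := hB k β τ.length τ.get hl _ (G.collar_subset hcol) z hz
  rw [D_eq] at this
  refine le_trans (le_of_eq ?_) this
  congr 1
  refine lieWord_congr G.isOpen_collar (fun y hy => ?_) σ hcol
  simp only [G.χ_eq_one hy.1.le hy.2.le, one_mul, hg]

/-- In the shells the cone fields and the coordinate fields in `z` form a frame of the product, so
bounds of iterated derivatives along it control all Fréchet derivatives, uniformly in the shell. The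
interior piece is compact. -/
lemma exists_norm_iteratedFDeriv_pieceCoeff_le (hF : G.IsCoeff r N F) (K : ℝ) :
    ∃ B : ℝ, 0 ≤ B ∧ ∀ p, ∀ Y ∈ G.core p, ∀ z : Fin N → ℝ, (∀ i, |z i| ≤ K) → ∀ j ≤ r,
      ‖iteratedFDeriv ℝ j (G.pieceCoeff F p) (Y, z)‖ ≤ B := by
  set Z : Set (Fin N → ℝ) := Set.univ.pi fun _ => Set.Icc (-K) K with hZ
  have hZc : IsCompact Z := isCompact_univ_pi fun _ => isCompact_Icc
  have hZm : ∀ z : Fin N → ℝ, (∀ i, |z i| ≤ K) ↔ z ∈ Z := fun z => by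
    simp only [hZ, Set.mem_univ_pi, Set.mem_Icc, abs_le]
  obtain ⟨B, hB⟩ := hF.2 K
  set e : Fin N → Fin N → ℝ := fun i => Pi.single i 1
  -- Only words with the conormal derivatives sorted and the derivatives in `z` acting first are
  -- covered by the hypothesis. They represent every mixed word up to permutation, which is all the
  -- frame estimate requires.
  set W : Finset (List (Option (Fin M) ⊕ Fin N)) :=
    ((sortedWords M r ×ˢ words N r).filter fun p => p.1.length + p.2.length ≤ r).image
      fun p => p.1.map .inl ++ p.2.map .inr with hWdef
  have hW : ∀ τ : List (Option (Fin M) ⊕ Fin N), τ.length ≤ r → ∃ τ' ∈ W, τ.Perm τ' := by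
    intro τ hτ
    obtain ⟨τ₁, τ₂, h⟩ := τ.exists_perm_map_inl_append_map_inr
    have hl := h.length_eq
    rw [List.length_append, List.length_map, List.length_map] at hl
    obtain ⟨τ₃, h3, hp⟩ := exists_perm_mem_sortedWords (m := r) τ₁ (by omega)
    refine ⟨_, Finset.mem_image.2 ⟨(τ₃, τ₂), Finset.mem_filter.2 ⟨Finset.mem_product.2
      ⟨h3, mem_words.2 (by simp only; omega)⟩, ?_⟩, rfl⟩, h.trans ((hp.map _).append_right _)⟩
    have := hp.length_eq
    simp only
    omega
  have hcore0 : ∀ q ∈ G.core (some 0) ×ˢ Z, q.1 ≠ 0 := fun q hq =>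
    (G.dom_some_spec (k := 0) (G.core_subset_dom _ hq.1)).1
  obtain ⟨C, hC0, hC⟩ := exists_norm_iteratedFDeriv_le
    (V := prodField G.coneField e) (Ω := ({0}ᶜ : Set 𝔼) ×ˢ (Set.univ : Set (Fin N → ℝ)))
    (isOpen_compl_singleton.prod isOpen_univ) (contDiffOn_prodField G.contDiffOn_coneField)
    ((G.isCompact_core (some 0)).prod hZc) (fun q hq => ⟨hcore0 q hq, trivial⟩)
    (fun q hq => span_prodField (G.span_coneField (hcore0 q hq)) (span_pi_single N)) r W hW
  have hopen : ∀ p, IsOpen ((dom p : Set 𝔼) ×ˢ (Set.univ : Set (Fin N → ℝ))) := fun p =>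
    (isOpen_dom p).prod isOpen_univ
  -- The interior piece needs only continuity of the derivatives up to order `r` on a compact set.
  -- For `j > r` the value of `b` is a dummy.
  have hnone : ∀ j, ∃ b : ℝ, j ≤ r → ∀ q ∈ G.core none ×ˢ Z,
      ‖iteratedFDeriv ℝ j (G.pieceCoeff F none) q‖ ≤ b := fun j => by
    by_cases hj : j ≤ r
    · have hc : ContinuousOn (iteratedFDeriv ℝ j (G.pieceCoeff F none))
          (dom none ×ˢ Set.univ) := by
        have h1 := ((G.contDiffOn_pieceCoeff hF.1 none).continuousOn_iteratedFDerivWithin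
          (m := j) (mod_cast hj) (hopen none).uniqueDiffOn)
        exact h1.congr fun q hq => (iteratedFDerivWithin_of_isOpen j (hopen none) hq).symm
      obtain ⟨b, hb⟩ := ((G.isCompact_core none).prod hZc).exists_bound_of_continuousOn
        (hc.mono fun q hq => ⟨G.core_subset_dom none hq.1, trivial⟩)
      exact ⟨b, fun _ => hb⟩
    · exact ⟨0, fun h => absurd h hj⟩
  choose b hb using hnone
  refine ⟨∑ j ∈ Finset.range (r + 1), |b j| + C * (W.card * |B|), by positivity,
    fun p Y hY z hz j hj => ?_⟩
  cases p with
  | none =>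
    refine (hb j hj (Y, z) ⟨hY, (hZm z).1 hz⟩).trans ((le_abs_self _).trans ?_)
    refine (Finset.single_le_sum (f := fun j => |b j|) (fun _ _ => abs_nonneg _)
      (Finset.mem_range.2 (by omega))).trans (le_add_of_nonneg_right (by positivity))
  | some k' =>
    refine (hC (G.pieceCoeff F (some k')) (Y, z) ⟨hY, (hZm z).1 hz⟩ ?_ j hj).trans
      (le_trans ?_ (le_add_of_nonneg_left (Finset.sum_nonneg fun _ _ => abs_nonneg _)))
    · exact (G.contDiffOn_pieceCoeff hF.1 (some k')).contDiffAt
        ((hopen _).mem_nhds ⟨G.core_subset_dom _ hY, trivial⟩)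
    · refine mul_le_mul_of_nonneg_left ?_ hC0
      rw [← nsmul_eq_mul]
      refine Finset.sum_le_card_nsmul _ _ _ fun τ hτ => ?_
      obtain ⟨⟨τ₁, τ₂⟩, h1, rfl⟩ := Finset.mem_image.1 hτ
      obtain ⟨h1, h2⟩ := Finset.mem_filter.1 h1
      obtain ⟨k, β, -, rfl⟩ := mem_sortedWords.1 (Finset.mem_product.1 h1).1
      refine (G.abs_lieWord_pieceCoeff_le hF hB (G.core_subset_dom _ hY) hz ?_).trans
        (le_abs_self B)
      rw [← length_sortedWord]
      exact h2

end BallData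

end

section

/-! ### Compositions with nonlinear functions -/

section Composition

variable {E F : Type*} [NormedAddCommGroup E] [NormedSpace ℝ E] [NormedAddCommGroup F]
  [NormedSpace ℝ F]

/-- Faà di Bruno's formula, one term for each ordered partition, localized to neighborhoods on which
both functions are regular. -/
lemma norm_iteratedFDeriv_comp_le_sum {H : F → ℝ} {Φ : E → F} {y : E} {i : ℕ}
    (hH : ContDiffAt ℝ i H (Φ y)) (hΦ : ContDiffAt ℝ i Φ y) :
    ‖iteratedFDeriv ℝ i (fun y => H (Φ y)) y‖ ≤ ∑ c : OrderedFinpartition i,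
      ‖iteratedFDeriv ℝ c.length H (Φ y)‖ * ∏ m, ‖iteratedFDeriv ℝ (c.partSize m) Φ y‖ := by
  obtain ⟨U, hU, -, hyU, hHU⟩ := hH.exists_isOpen_contDiffOn isOpen_univ (Set.mem_univ _)
  obtain ⟨u, hu, h⟩ := hΦ.contDiffOn le_rfl (by simp)
  obtain ⟨V, hVs, hV, hyV⟩ := mem_nhds_iff.1
    (inter_mem hu (hΦ.continuousAt.preimage_mem_nhds (hU.mem_nhds hyU)))
  have hΦV : ContDiffOn ℝ i Φ V := h.mono fun z hz => (hVs hz).1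
  have key := ((hHU.ftaylorSeriesWithin hU.uniqueDiffOn).comp
    (hΦV.ftaylorSeriesWithin hV.uniqueDiffOn)
      fun z hz => (hVs hz).2).eq_iteratedFDerivWithin_of_uniqueDiffOn le_rfl hV.uniqueDiffOn hyV
  rw [iteratedFDerivWithin_of_isOpen i hV hyV] at key
  rw [show (fun y => H (Φ y)) = H ∘ Φ from rfl, ← key]
  refine (norm_sum_le _ _).trans (Finset.sum_le_sum fun c _ => ?_)
  refine (c.norm_compAlongOrderedFinpartition_le _ _).trans (le_of_eq ?_)
  simp only [ftaylorSeriesWithin, iteratedFDerivWithin_of_isOpen _ hU hyU,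
    iteratedFDerivWithin_of_isOpen _ hV hyV]

lemma norm_iteratedFDeriv_id_le {k : ℕ} (hk : 0 < k) (y : E) :
    ‖iteratedFDeriv ℝ k (fun y : E => y) y‖ ≤ 1 := by
  obtain ⟨k, rfl⟩ := Nat.exists_eq_add_of_lt hk
  rw [zero_add, ← norm_iteratedFDeriv_fderiv]
  have : fderiv ℝ (fun y : E => y) = fun _ => ContinuousLinearMap.id ℝ E := by
    ext1 z; exact fderiv_fun_id
  rw [this]
  rcases k with _ | k
  · rw [norm_iteratedFDeriv_zero]
    exact ContinuousLinearMap.norm_id_le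
  · rw [iteratedFDeriv_const_of_ne (Nat.succ_ne_zero k)]
    simp

/-- The identity component of the graph contributes at most one in positive order: its first
derivative is the identity and the higher ones vanish. -/
lemma norm_iteratedFDeriv_graph_le {N k : ℕ} (hk : 0 < k) {v : Fin N → E → ℝ} {y : E}
    (hv : ∀ i, ContDiffAt ℝ k (v i) y) :
    ‖iteratedFDeriv ℝ k (fun q => (q, fun i => v i q)) y‖ ≤
      1 + ∑ i, ‖iteratedFDeriv ℝ k (v i) y‖ := by
  set Φ : E → E × (Fin N → ℝ) := fun q => (q, fun i => v i q) with hΦ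
  have hc : ContDiffAt ℝ k Φ y := contDiffAt_id.prodMk (contDiffAt_pi.2 hv)
  have h0 : 0 ≤ ∑ i, ‖iteratedFDeriv ℝ k (v i) y‖ := Finset.sum_nonneg fun _ _ => norm_nonneg _
  refine ContinuousMultilinearMap.opNorm_le_bound (by positivity) fun m => ?_
  have hm : 0 ≤ ∏ i, ‖m i‖ := Finset.prod_nonneg fun _ _ => norm_nonneg _
  rw [Prod.norm_def]
  refine max_le ?_ ((pi_norm_le_iff_of_nonneg (by positivity)).2 fun i => ?_)
  · have h := (ContinuousLinearMap.fst ℝ E (Fin N → ℝ)).iteratedFDeriv_comp_left hc le_rfl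
    have h1 : (iteratedFDeriv ℝ k Φ y m).1 = iteratedFDeriv ℝ k (fun y : E => y) y m := by
      rw [show (fun y : E => y) = (ContinuousLinearMap.fst ℝ E (Fin N → ℝ)) ∘ Φ from rfl, h]
      rfl
    rw [h1]
    refine (ContinuousMultilinearMap.le_opNorm _ _).trans (mul_le_mul_of_nonneg_right ?_ hm)
    linarith [norm_iteratedFDeriv_id_le hk y]
  · set L : E × (Fin N → ℝ) →L[ℝ] ℝ :=
      (ContinuousLinearMap.proj i).comp (ContinuousLinearMap.snd ℝ E (Fin N → ℝ))
    have h := L.iteratedFDeriv_comp_left hc le_rfl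
    have h1 : (iteratedFDeriv ℝ k Φ y m).2 i = iteratedFDeriv ℝ k (v i) y m := by
      rw [show v i = L ∘ Φ from rfl, h]
      rfl
    rw [h1]
    refine (ContinuousMultilinearMap.le_opNorm _ _).trans (mul_le_mul_of_nonneg_right ?_ hm)
    have := Finset.single_le_sum (f := fun i => ‖iteratedFDeriv ℝ k (v i) y‖)
      (fun _ _ => norm_nonneg _) (Finset.mem_univ i)
    linarith

end Composition

lemma _root_.OrderedFinpartition.sum_partSize {i : ℕ} (c : OrderedFinpartition i) :
    ∑ m, c.partSize m = i := by
  have := Fintype.card_congr c.equivSigma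
  simpa using this

variable {n : ℕ}

local notation "𝔼" => EuclideanSpace ℝ (Fin n)

lemma IsCcInfty.continuous_jetNorm {f : EuclideanSpace ℝ (Fin n) → ℝ} (hf : IsCcInfty f) (k : ℕ) :
    Continuous (jetNorm k f) :=
  continuous_finsetSum _ fun j _ =>
    ((hf.1.of_infty j).continuous_iteratedFDeriv le_rfl).norm

/-- The terms of the expansion of the derivatives of a composition. -/
abbrev CompositionTerm (r N : ℕ) : Type :=
  Σ i : Fin (r + 1), Σ c : OrderedFinpartition i, Fin c.length → Option (Fin N)

/-- The size of a term of the expansion of the derivatives of a composition. -/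
def compositionTermNorm {r N : ℕ} (t : CompositionTerm r N)
    (v : Option (Fin N) → EuclideanSpace ℝ (Fin n) → ℝ) (U : EuclideanSpace ℝ (Fin n) → ℝ)
    (y : EuclideanSpace ℝ (Fin n)) : ℝ :=
  (∏ m, jetNorm (t.2.1.partSize m) (v (t.2.2 m)) y) * jetNorm (r - t.1) U y

lemma compositionTermNorm_nonneg {r N : ℕ} (t : CompositionTerm r N)
    (v : Option (Fin N) → 𝔼 → ℝ) (U : 𝔼 → ℝ) (y : 𝔼) : 0 ≤ compositionTermNorm t v U y :=
  mul_nonneg (Finset.prod_nonneg fun _ _ => jetNorm_nonneg _ _ _) (jetNorm_nonneg _ _ _)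

/-- The index `none` carries a function equal to `1` near the point, which stands for the identity
component of the graph. Each Faà di Bruno term thus becomes a pure product of jets, one for each
part of the partition, and the multilinear estimate applies to it. -/
lemma jetNorm_composition_mul_le {r N : ℕ} {B : ℝ} (hB : 0 ≤ B) {H : 𝔼 × (Fin N → ℝ) → ℝ}
    {v : Option (Fin N) → 𝔼 → ℝ} {U : 𝔼 → ℝ} {y : 𝔼} (hnone : v none =ᶠ[𝓝 y] fun _ => 1)
    (hv : ∀ i, ContDiffAt ℝ ∞ (v (some i)) y) (hU : ContDiffAt ℝ ∞ U y)
    (hH : ContDiffAt ℝ r H (y, fun i => v (some i) y))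
    (hHB : ∀ j ≤ r, ‖iteratedFDeriv ℝ j H (y, fun i => v (some i) y)‖ ≤ B) :
    jetNorm r (fun q => H (q, fun i => v (some i) q) * U q) y ≤
      (r + 1) * (2 ^ r * B) * ∑ t : CompositionTerm r N, compositionTermNorm t v U y := by
  set Φ : 𝔼 → 𝔼 × (Fin N → ℝ) := fun q => (q, fun i => v (some i) q) with hΦ
  have hΦc : ContDiffAt ℝ r Φ y :=
    contDiffAt_id.prodMk (contDiffAt_pi.2 fun i => (hv i).of_le (natCast_le_infty r))
  have hone : ∀ k, 1 ≤ jetNorm k (v none) y := fun k => by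
    refine le_trans ?_ (norm_iteratedFDeriv_le_jetNorm (Nat.zero_le k) _ _)
    rw [norm_iteratedFDeriv_zero, hnone.eq_of_nhds]
    simp
  have hpart : ∀ k, 0 < k → k ≤ r →
      ‖iteratedFDeriv ℝ k Φ y‖ ≤ ∑ a, jetNorm k (v a) y := fun k hk hkr => by
    refine (norm_iteratedFDeriv_graph_le hk fun i =>
      (hv i).of_le (natCast_le_infty k)).trans ?_
    rw [Fintype.sum_option]
    exact add_le_add (hone k) (Finset.sum_le_sum fun i _ => norm_iteratedFDeriv_le_jetNorm le_rfl _ _)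
  set Q : ∀ i : Fin (r + 1), ℝ := fun i =>
    ∑ c : OrderedFinpartition i, ∑ α : Fin c.length → Option (Fin N),
      ∏ m, jetNorm (c.partSize m) (v (α m)) y with hQ
  have hQ0 : ∀ i, 0 ≤ Q i := fun i => Finset.sum_nonneg fun c _ => Finset.sum_nonneg fun α _ =>
    Finset.prod_nonneg fun _ _ => jetNorm_nonneg _ _ _
  have hcomp : ∀ i : Fin (r + 1), ‖iteratedFDeriv ℝ i (fun q => H (Φ q)) y‖ ≤ B * Q i := by
    intro i
    have hir : (i : ℕ) ≤ r := Nat.lt_succ_iff.1 i.2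
    have hir' : ((i : ℕ) : WithTop ℕ∞) ≤ r := mod_cast hir
    refine (norm_iteratedFDeriv_comp_le_sum (Φ := Φ) (hH.of_le hir') (hΦc.of_le hir')).trans ?_
    rw [hQ, Finset.mul_sum]
    refine Finset.sum_le_sum fun c _ => ?_
    refine mul_le_mul (hHB _ (c.length_le.trans hir)) ?_
      (Finset.prod_nonneg fun _ _ => norm_nonneg _) hB
    calc _ ≤ ∏ m, ∑ a, jetNorm (c.partSize m) (v a) y :=
          Finset.prod_le_prod (fun _ _ => norm_nonneg _) fun m _ =>
            hpart _ (c.partSize_pos m) ((c.partSize_le m).trans hir)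
      _ = _ := by rw [Finset.prod_univ_sum, Fintype.piFinset_univ]
  have hsum : ∑ t : CompositionTerm r N, compositionTermNorm t v U y =
      ∑ i, Q i * jetNorm (r - i) U y := by
    rw [Fintype.sum_sigma]
    refine Finset.sum_congr rfl fun i _ => ?_
    rw [Fintype.sum_sigma, hQ, Finset.sum_mul]
    refine Finset.sum_congr rfl fun c _ => ?_
    rw [Finset.sum_mul]
    rfl
  have hHΦ : ContDiffAt ℝ r (fun q => H (Φ q)) y := ContDiffAt.comp y hH hΦc
  have hj : ∀ j ∈ Finset.range (r + 1), ‖iteratedFDeriv ℝ j (fun q => H (Φ q) * U q) y‖ ≤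
      2 ^ r * B * ∑ i, Q i * jetNorm (r - i) U y := by
    intro j hj
    have hjr : j ≤ r := Nat.lt_succ_iff.1 (Finset.mem_range.1 hj)
    refine (norm_iteratedFDeriv_mul_le_of_contDiffAt (hHΦ.of_le (mod_cast hjr))
      (hU.of_le (natCast_le_infty j))).trans ?_
    rw [← Fin.sum_univ_eq_sum_range (fun i => (j.choose i : ℝ) *
      ‖iteratedFDeriv ℝ i (fun q => H (Φ q)) y‖ * ‖iteratedFDeriv ℝ (j - i) U y‖), Finset.mul_sum]
    have hterm : ∀ i : Fin (r + 1), (j.choose i : ℝ) *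
        ‖iteratedFDeriv ℝ i (fun q => H (Φ q)) y‖ * ‖iteratedFDeriv ℝ (j - i) U y‖ ≤
        2 ^ r * B * (Q i * jetNorm (r - i) U y) := fun i => by
      have hch : (j.choose i : ℝ) ≤ 2 ^ r := by
        exact_mod_cast (Nat.choose_le_two_pow j i).trans
          (Nat.pow_le_pow_right two_pos hjr)
      calc _ ≤ 2 ^ r * (B * Q i) * jetNorm (r - i) U y :=
            mul_le_mul (mul_le_mul hch (hcomp i) (norm_nonneg _) (by positivity))
              (norm_iteratedFDeriv_le_jetNorm (by omega) _ _) (norm_nonneg _)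
              (mul_nonneg (by positivity) (mul_nonneg hB (hQ0 i)))
        _ = _ := by ring
    refine le_trans ?_ (Finset.sum_le_sum fun i _ => hterm i)
    rw [Fin.sum_univ_eq_sum_range (fun i => (j.choose i : ℝ) *
      ‖iteratedFDeriv ℝ i (fun q => H (Φ q)) y‖ * ‖iteratedFDeriv ℝ (j - i) U y‖) (j + 1),
      Fin.sum_univ_eq_sum_range (fun i => (j.choose i : ℝ) *
      ‖iteratedFDeriv ℝ i (fun q => H (Φ q)) y‖ * ‖iteratedFDeriv ℝ (j - i) U y‖) (r + 1)]
    exact Finset.sum_le_sum_of_subset_of_nonneg (Finset.range_mono (by omega))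
      fun _ _ _ => by positivity
  rw [jetNorm, hsum]
  refine (Finset.sum_le_card_nsmul _ _ _ hj).trans (le_of_eq ?_)
  rw [Finset.card_range, nsmul_eq_mul]
  push_cast
  ring

/-- Products of a function of Sobolev regularity with compositions of functions of higher
regularity. -/
lemma exists_setLIntegral_jetNorm_composition_mul_le {r : ℕ} (hr : n < 2 * (r + 1)) (N : ℕ)
    {B : ℝ} (hB : 0 ≤ B) (S : ℝ≥0) : ∃ C : ℝ≥0, ∀ (K : Set 𝔼), MeasurableSet K →
      ∀ (H : 𝔼 × (Fin N → ℝ) → ℝ) (v : Option (Fin N) → 𝔼 → ℝ) (U g : 𝔼 → ℝ),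
      (∀ a, IsCcInfty (v a)) → IsCcInfty U → (∀ a, sobNorm (r + 1) (v a) ≤ S) →
      (∀ y ∈ K, v none =ᶠ[𝓝 y] fun _ => 1) →
      (∀ y ∈ K, ContDiffAt ℝ r H (y, fun i => v (some i) y)) →
      (∀ y ∈ K, ∀ j ≤ r, ‖iteratedFDeriv ℝ j H (y, fun i => v (some i) y)‖ ≤ B) →
      (∀ y ∈ K, g =ᶠ[𝓝 y] fun q => H (q, fun i => v (some i) q) * U q) →
      ∫⁻ y in K, ‖jetNorm r g y‖ₑ ^ 2 ≤ C * sobNorm r U ^ 2 := by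
  -- The number of factors in a term is the number of parts of its partition, so the multilinear
  -- estimate is needed for every number of factors and not only for `N`.
  choose c hc using fun N => exists_eLpNorm_prod_jetNorm_le (n := n) hr N
  set D : ℝ := ((r + 1) * (2 ^ r * B)) ^ 2 * (Finset.univ : Finset (CompositionTerm r N)).card
  refine ⟨D.toNNReal * ∑ t : CompositionTerm r N, (c t.2.1.length * S ^ t.2.1.length) ^ 2,
    fun K hK H v U g hv hU hS hnone hH hHB hg => ?_⟩
  have hpt : ∀ y ∈ K, ‖jetNorm r g y‖ₑ ^ 2 ≤ ENNReal.ofReal D *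
      ∑ t : CompositionTerm r N, ‖compositionTermNorm t v U y‖ₑ ^ 2 := fun y hy => by
    refine ofReal_le_mul_sum_enorm (C := (r + 1) * (2 ^ r * B)) ?_ (jetNorm_nonneg _ _ _)
    have : jetNorm r g y = jetNorm r (fun q => H (q, fun i => v (some i) q) * U q) y :=
      Finset.sum_congr rfl fun j _ => by rw [((hg y hy).iteratedFDeriv ℝ j).eq_of_nhds]
    rw [this]
    refine (jetNorm_composition_mul_le hB (hnone y hy) (fun i => (hv _).1.contDiffAt)
      hU.1.contDiffAt (hH y hy) (hHB y hy)).trans (le_of_eq ?_)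
    congr 1
    exact Finset.sum_congr rfl fun t _ => (abs_of_nonneg (compositionTermNorm_nonneg _ _ _ _)).symm
  have hcont : ∀ t : CompositionTerm r N, Continuous (compositionTermNorm t v U) := fun t =>
    (continuous_finsetProd _ fun m _ => (hv _).continuous_jetNorm _).mul (hU.continuous_jetNorm _)
  have hterm : ∀ t : CompositionTerm r N, ∫⁻ y, ‖compositionTermNorm t v U y‖ₑ ^ 2 ≤
      ((c t.2.1.length * S ^ t.2.1.length : ℝ≥0) ^ 2 : ℝ≥0) * sobNorm r U ^ 2 := fun t => by
    -- The parts of a partition of `i` have total size `i`, and `r - i` derivatives are left for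
    -- `U`: in all `r`.
    have h1 := hc t.2.1.length t.2.1.partSize (r - t.1)
      (by rw [t.2.1.sum_partSize]; have := t.1.2; omega) (fun m => v (t.2.2 m)) U
      (fun m => hv _) hU
    rw [ENNReal.coe_pow, ← mul_pow]
    refine eLpNorm_two_le_iff.1 (h1.trans (mul_le_mul_left ?_ _))
    rw [ENNReal.coe_mul]
    refine mul_le_mul_right ?_ _
    calc _ ≤ ∏ m : Fin t.2.1.length, (S : ℝ≥0∞) := Finset.prod_le_prod' fun m _ => hS _
      _ = _ := by simp
  calc _ ≤ ∫⁻ y in K, ENNReal.ofReal D *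
        ∑ t : CompositionTerm r N, ‖compositionTermNorm t v U y‖ₑ ^ 2 :=
        setLIntegral_mono' hK hpt
    _ ≤ ∫⁻ y, ENNReal.ofReal D *
        ∑ t : CompositionTerm r N, ‖compositionTermNorm t v U y‖ₑ ^ 2 :=
        setLIntegral_le_lintegral _ _
    _ = ENNReal.ofReal D * ∑ t : CompositionTerm r N,
        ∫⁻ y, ‖compositionTermNorm t v U y‖ₑ ^ 2 := by
      rw [lintegral_const_mul' _ _ ENNReal.ofReal_ne_top, lintegral_finsetSum']
      exact fun t _ => ((hcont t).measurable.enorm.pow_const 2).aemeasurable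
    _ ≤ ENNReal.ofReal D * ∑ t : CompositionTerm r N,
        (((c t.2.1.length * S ^ t.2.1.length : ℝ≥0) ^ 2 : ℝ≥0) * sobNorm r U ^ 2) :=
        mul_le_mul_right (Finset.sum_le_sum fun t _ => hterm t) _
    _ = _ := by
      rw [← Finset.sum_mul, ENNReal.coe_mul, ENNReal.ofNNReal_finsetSum, mul_assoc]
      rfl

end

section

variable {n : ℕ}

lemma IsCcInfty.sobNorm_lt_top {f : EuclideanSpace ℝ (Fin n) → ℝ} (hf : IsCcInfty f) (s : ℕ) :
    sobNorm s f < ⊤ := by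
  refine ENNReal.sum_lt_top.2 fun j _ => ?_
  exact (((hf.1.of_infty j).continuous_iteratedFDeriv le_rfl).memLp_of_hasCompactSupport
    (hf.2.iteratedFDeriv (𝕜 := ℝ) j)).2

namespace BallData

variable {M : ℕ} (G : BallData n M)

local notation "𝔼" => EuclideanSpace ℝ (Fin n)

/-! ### The energy of a composition -/

/-- Only regularity `C^r` is assumed, so that it applies to `F(·, w) u` before any smoothing. The
ordinary derivatives in the energy are those of the interior piece, a single term of the sum. -/
lemma exists_energy_le_tsum_jetNorm (hn : 2 ≤ n) (r : ℕ) : ∃ C : ℝ≥0, ∀ g : 𝔼 → ℝ,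
    ContDiffOn ℝ r g (unitBall n) → G.energy r g ≤ C * ∑' p, ENNReal.ofReal (G.weight p) *
      ∫⁻ Y in G.core p, ‖jetNorm r (fun Y => g (G.chart p Y)) Y‖ₑ ^ 2 := by
  obtain ⟨C₁, h1, hC₁⟩ := G.exists_abs_lieWord_le_jetNorm r
  obtain ⟨C₂, hC₂⟩ := G.exists_lintegral_le_tsum_core hn
  obtain ⟨C₃, h3, hC₃⟩ := exists_abs_lieWord_le (Metric.isOpen_ball (x := (0 : 𝔼)) (ε := 1))
    (V := fun (i : Fin n) _ => EuclideanSpace.single i (1 : ℝ)) (fun _ => contDiffOn_const)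
    (G.isCompact_core none) G.core_none_subset_ball r
  refine ⟨(sortedWords M r).card * (C₂ * C₁.toNNReal ^ 2) + (words n r).card * C₃.toNNReal ^ 2,
    fun g hg => ?_⟩
  set T : ℝ≥0∞ := ∑' p, ENNReal.ofReal (G.weight p) *
      ∫⁻ Y in G.core p, ‖jetNorm r (fun Y => g (G.chart p Y)) Y‖ₑ ^ 2 with hT
  have hsq : ∀ {a b C : ℝ}, 0 ≤ b → |a| ≤ C * b → ‖a‖ₑ ^ 2 ≤ (C.toNNReal : ℝ≥0∞) ^ 2 * ‖b‖ₑ ^ 2 := by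
    intro a b C hb hab
    rw [← mul_pow]
    refine pow_le_pow_left₀ zero_le ?_ 2
    rw [Real.enorm_eq_ofReal_abs, Real.enorm_of_nonneg hb]
    refine (ENNReal.ofReal_le_ofReal hab).trans (le_of_eq ?_)
    rw [ENNReal.ofReal_mul' hb]
    rfl
  have hτ : ∀ τ ∈ sortedWords M r, ∫⁻ y, ‖lieWord G.field τ g y‖ₑ ^ 2 ∂G.measA ≤
      C₂ * C₁.toNNReal ^ 2 * T := by
    intro τ hτ
    have hl := length_le_of_mem_sortedWords hτ
    refine (hC₂ _).trans ?_
    rw [mul_assoc]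
    refine mul_le_mul_right ?_ _
    rw [hT, ← ENNReal.tsum_mul_left]
    refine ENNReal.tsum_le_tsum fun p => ?_
    rw [mul_left_comm]
    refine mul_le_mul_right ?_ _
    rw [← lintegral_const_mul' _ _ (by simp)]
    refine setLIntegral_mono' (G.isCompact_core p).measurableSet fun Y hY => ?_
    by_cases hYA : G.chart p Y ∈ G.annulus
    · rw [Set.indicator_of_mem hYA]
      refine hsq (jetNorm_nonneg _ _ _) ((hC₁ τ g p hl (hg.of_le (mod_cast hl)) Y hY hYA).trans ?_)
      exact mul_le_mul_of_nonneg_left (jetNorm_mono hl _ _) h1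
    · rw [Set.indicator_of_notMem hYA]
      exact zero_le
  have hflat : ∀ τ ∈ words n r, ∫⁻ y in G.core none, ‖flatWord τ g y‖ₑ ^ 2 ≤
      C₃.toNNReal ^ 2 * T := by
    intro τ hτ
    have hl : τ.length ≤ r := mem_words.1 hτ
    have h0 : ∫⁻ Y in G.core none, ‖jetNorm r g Y‖ₑ ^ 2 ≤ T := by
      refine le_trans (le_of_eq ?_) (ENNReal.le_tsum none)
      simp [weight, chart]
    refine le_trans ?_ (mul_le_mul_right h0 _)
    rw [← lintegral_const_mul' _ _ (by simp)]
    refine setLIntegral_mono' G.measurableSet_core_none fun Y hY => ?_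
    refine hsq (jetNorm_nonneg _ _ _) ((hC₃ τ hl g Y hY ?_).trans ?_)
    · exact (hg.contDiffAt (Metric.isOpen_ball.mem_nhds (G.core_none_subset_ball hY))).of_le
        (mod_cast hl)
    · exact mul_le_mul_of_nonneg_left (jetNorm_mono hl g Y) h3
  rw [energy]
  refine (add_le_add (Finset.sum_le_card_nsmul _ _ _ hτ)
    (Finset.sum_le_card_nsmul _ _ _ hflat)).trans (le_of_eq ?_)
  simp only [nsmul_eq_mul]
  push_cast
  ring

variable {N r : ℕ} {F : EuclideanSpace ℝ (Fin n) → (Fin N → ℝ) → ℝ}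

lemma contDiffOn_coeff_mul (hF : G.IsCoeff r N F) {w : Fin N → 𝔼 → ℝ} {u : 𝔼 → ℝ}
    (hw : ∀ i, IsTest (w i)) (hu : IsTest u) :
    ContDiffOn ℝ r (fun y => F y (fun i => w i y) * u y) (unitBall n) := by
  refine ContDiffOn.mul ?_ ((hu.contDiffOn _).of_le (natCast_le_infty r))
  exact hF.1.comp (f := fun y => (y, fun i => w i y)) (contDiffOn_id.prodMk
    (contDiffOn_pi.2 fun i => ((hw i).contDiffOn _).of_le (natCast_le_infty r)))
    fun y hy => ⟨hy, trivial⟩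

/-- Nonlinear functions of the elements of `ℋ^{1,r}` act on `ℋ^{0,r}`: the estimate for test
functions. -/
lemma exists_energy_coeff_mul_le (hn : 2 ≤ n) (hr : n < 2 * (r + 1)) (hF : G.IsCoeff r N F)
    (Λ : ℝ≥0) : ∃ C : ℝ≥0, ∀ (w : Fin N → 𝔼 → ℝ) (u : 𝔼 → ℝ), (∀ i, IsTest (w i)) → IsTest u →
      (∀ i, G.normHr 1 r (w i) ≤ Λ) →
      G.energy r (fun y => F y (fun i => w i y) * u y) ≤ C * G.normHr 0 r u ^ 2 := by
  obtain ⟨C₁, hC₁⟩ := G.exists_enorm_le_normHr hn hr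
  obtain ⟨C₂, hC₂⟩ := G.exists_sobNorm_piece_le hn r
  obtain ⟨C₃, hC₃⟩ := G.exists_tsum_sobNorm_piece_le hn 0 r
  obtain ⟨C₄, hC₄⟩ := G.exists_energy_le_tsum_jetNorm hn r
  -- The values of the `w i` are bounded by `C₁ * Λ` through the Sobolev embedding, so `F` matters
  -- only for `z` in that box.
  obtain ⟨B, hB0, hB⟩ := G.exists_norm_iteratedFDeriv_pieceCoeff_le hF (C₁ * Λ : ℝ≥0)
  have hone : ContDiffOn ℝ ∞ (fun _ : 𝔼 => (1 : ℝ)) (unitBall n) := contDiffOn_const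
  -- The piece of the constant `1` is the cutoff itself, and all shells share one cutoff, so there
  -- are only two norms to bound.
  obtain ⟨S₀, hS₀⟩ : ∃ S₀ : ℝ≥0, ∀ p, sobNorm (r + 1) (G.piece p fun _ => 1) ≤ S₀ := by
    have hfin := fun p => ((G.isCcInfty_piece hone p).sobNorm_lt_top (r + 1)).ne
    refine ⟨(sobNorm (r + 1) (G.piece none fun _ => 1)).toNNReal +
      (sobNorm (r + 1) (G.piece (some 0) fun _ => 1)).toNNReal, fun p => ?_⟩
    rw [ENNReal.coe_add, ENNReal.coe_toNNReal (hfin _), ENNReal.coe_toNNReal (hfin _)]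
    cases p with
    | none => exact le_self_add
    | some k => exact le_add_self
  obtain ⟨C₅, hC₅⟩ := exists_setLIntegral_jetNorm_composition_mul_le hr N hB0 (S₀ + C₂ * Λ)
  refine ⟨C₄ * (C₅ * C₃), fun w u hw hu hΛ => ?_⟩
  have hwb : ∀ i, ∀ y ∈ unitBall n, |w i y| ≤ (C₁ * Λ : ℝ≥0) := fun i y hy => by
    have := (hC₁ (w i) ((hw i).contDiffOn _) y hy).trans (mul_le_mul_right (hΛ i) _)
    rw [← ENNReal.coe_mul, ← ofReal_norm, ENNReal.ofReal_le_coe] at this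
    exact this
  have hpiece : ∀ p, ∫⁻ Y in G.core p,
      ‖jetNorm r (fun Y => F (G.chart p Y) (fun i => w i (G.chart p Y)) * u (G.chart p Y)) Y‖ₑ ^ 2
      ≤ C₅ * sobNorm r (G.piece p u) ^ 2 := by
    intro p
    set v : Option (Fin N) → 𝔼 → ℝ := fun a => a.elim (G.piece p fun _ => 1) fun i => G.piece p (w i)
      with hv
    have hval : ∀ Y ∈ G.core p, ∀ i, v (some i) Y = w i (G.chart p Y) := fun Y hY i =>
      (G.piece_eventuallyEq (w i) hY).eq_of_nhds
    refine hC₅ (G.core p) (G.isCompact_core p).measurableSet (G.pieceCoeff F p) v (G.piece p u) _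
      (fun a => ?_) (G.isCcInfty_piece (hu.contDiffOn _) p) (fun a => ?_) (fun Y hY => ?_)
      (fun Y hY => ?_) (fun Y hY j hj => ?_) (fun Y hY => ?_)
    · cases a with
      | none => exact G.isCcInfty_piece hone p
      | some i => exact G.isCcInfty_piece ((hw i).contDiffOn _) p
    · rw [ENNReal.coe_add, ENNReal.coe_mul]
      cases a with
      | none => exact (hS₀ p).trans le_self_add
      | some i =>
        exact ((hC₂ p (w i) ((hw i).contDiffOn _)).trans (mul_le_mul_right (hΛ i) _)).trans
          le_add_self
    · exact G.piece_eventuallyEq (fun _ => 1) hY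
    · exact (G.contDiffOn_pieceCoeff hF.1 p).contDiffAt (((isOpen_dom p).prod isOpen_univ).mem_nhds
        ⟨G.core_subset_dom p hY, trivial⟩)
    · refine hB p Y hY _ (fun i => ?_) j hj
      rw [hval Y hY i]
      exact hwb i _ (G.chart_mem_ball (G.core_subset_dom p hY))
    · have h1 : ∀ᶠ q in 𝓝 Y, ∀ i, v (some i) q = w i (G.chart p q) :=
        eventually_all.2 fun i => G.piece_eventuallyEq (w i) hY
      filter_upwards [h1, G.piece_eventuallyEq u hY] with q hq hq'
      rw [hq', pieceCoeff]
      simp only [hq]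
  refine (hC₄ _ (G.contDiffOn_coeff_mul hF hw hu)).trans ?_
  rw [ENNReal.coe_mul, mul_assoc]
  refine mul_le_mul_right ?_ _
  calc _ ≤ ∑' p, C₅ * (ENNReal.ofReal (G.weight p) * sobNorm r (G.piece p u) ^ 2) := by
        refine ENNReal.tsum_le_tsum fun p => (mul_le_mul_right (hpiece p) _).trans (le_of_eq ?_)
        ring
    _ = C₅ * ∑' p, ENNReal.ofReal (G.weight p) * sobNorm r (G.piece p u) ^ 2 :=
      ENNReal.tsum_mul_left
    _ ≤ C₅ * (C₃ * G.normHr 0 r u ^ 2) := mul_le_mul_right (hC₃ u (hu.contDiffOn _)) _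
    _ = _ := by rw [ENNReal.coe_mul, mul_assoc]

end BallData

end

section

/-! ### Mollification -/

section Mollification

open ContinuousLinearMap Convolution

variable {n : ℕ}

local notation "𝔼" => EuclideanSpace ℝ (Fin n)

lemma contDiff_flatWord {r m : ℕ} {g : 𝔼 → ℝ} (hg : ContDiff ℝ r g) (τ : List (Fin n))
    (hτ : m + τ.length ≤ r) : ContDiff ℝ m (flatWord τ g) :=
  contDiffOn_univ.1 (contDiffOn_lieWord_nat isOpen_univ (fun _ => contDiffOn_const) τ
    hg.contDiffOn hτ)

lemma hasCompactSupport_flatWord {g : 𝔼 → ℝ} (hg : HasCompactSupport g) (τ : List (Fin n)) :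
    HasCompactSupport (flatWord τ g) :=
  HasCompactSupport.of_support_subset_isCompact hg fun y hy => by
    by_contra h
    exact hy (lieWord_eq_zero_of_notMem_tsupport h τ)

/-- Constant fields commute with convolution, so the derivatives can all be placed on the `C^r`
factor. -/
lemma flatWord_convolution {r : ℕ} {ρ g : 𝔼 → ℝ} (hρ : LocallyIntegrable ρ volume)
    (hg : ContDiff ℝ r g) (hc : HasCompactSupport g) (τ : List (Fin n)) (hτ : τ.length ≤ r) :
    flatWord τ (ρ ⋆[lsmul ℝ ℝ, volume] g) = ρ ⋆[lsmul ℝ ℝ, volume] flatWord τ g := by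
  induction τ with
  | nil => rfl
  | cons a τ ih =>
    rw [List.length_cons] at hτ
    ext y
    have h1 : ContDiff ℝ 1 (flatWord τ g) := contDiff_flatWord (m := 1) hg τ (by omega)
    have hcs := hasCompactSupport_flatWord hc τ
    rw [flatWord, lieWord_cons, show lieWord (fun i _ => EuclideanSpace.single i (1 : ℝ)) τ
      (ρ ⋆[lsmul ℝ ℝ, volume] g) = _ from ih (by omega),
      (hcs.hasFDerivAt_convolution_right (lsmul ℝ ℝ) hρ h1 y).fderiv,
      convolution_precompR_apply _ hρ (hcs.fderiv ℝ) (h1.continuous_fderiv (by simp))]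
    rfl

/-- Approximation by smooth functions, in `C^r`, of functions of compact support. -/
lemma exists_contDiff_approx {r : ℕ} {g : 𝔼 → ℝ} (hg : ContDiff ℝ r g) (hc : HasCompactSupport g)
    {U : Set 𝔼} (hU : IsOpen U) (hs : tsupport g ⊆ U) :
    ∃ K, IsCompact K ∧ K ⊆ U ∧ tsupport g ⊆ K ∧ ∀ η : ℝ, 0 < η → ∃ φ : 𝔼 → ℝ, ContDiff ℝ ∞ φ ∧
      tsupport φ ⊆ K ∧ ∀ τ : List (Fin n), τ.length ≤ r → ∀ y,
        |flatWord τ (fun y => φ y - g y) y| ≤ η := by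
  -- The mollified functions are all supported in one compact thickening, chosen before the accuracy
  -- `η`.
  obtain ⟨δ, hδ, hδU⟩ := IsCompact.exists_cthickening_subset_open hc hU hs
  set K := Metric.cthickening δ (tsupport g)
  refine ⟨K, IsCompact.cthickening hc, hδU, Metric.self_subset_cthickening _, fun η hη => ?_⟩
  have huc : ∀ τ : List (Fin n), ∃ d > 0, τ.length ≤ r → ∀ y z, dist y z < d →
      dist (flatWord τ g y) (flatWord τ g z) < η := fun τ => by
    by_cases hτ : τ.length ≤ r
    · have h := (hasCompactSupport_flatWord hc τ).uniformContinuous_of_continuous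
        (contDiff_flatWord (m := 0) hg τ (by omega)).continuous
      obtain ⟨d, hd, h⟩ := Metric.uniformContinuous_iff.1 h η hη
      exact ⟨d, hd, fun _ y z hyz => h hyz⟩
    · exact ⟨1, one_pos, fun h => absurd h hτ⟩
  choose d hd0 hd using huc
  obtain ⟨d', hd', hdle⟩ : ∃ d' > 0, ∀ τ ∈ words n r, d' ≤ d τ := by
    have h : ∀ᶠ x in 𝓝[>] (0 : ℝ), ∀ τ ∈ words n r, x ≤ d τ :=
      (Filter.eventually_all_finset _).2 fun τ _ =>
        (eventually_le_nhds (hd0 τ)).filter_mono nhdsWithin_le_nhds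
    obtain ⟨x, h1, h2⟩ := (h.and self_mem_nhdsWithin).exists
    exact ⟨x, h2, h1⟩
  have hmin : 0 < min δ d' := lt_min hδ hd'
  let ρ : ContDiffBump (0 : 𝔼) := ⟨min δ d' / 2, min δ d', by positivity, by linarith⟩
  have hρc : ContDiff ℝ ∞ (ρ.normed volume) := ρ.contDiff_normed
  have hρl : LocallyIntegrable (ρ.normed volume) volume := hρc.continuous.locallyIntegrable
  have hgl : LocallyIntegrable g volume := hg.continuous.locallyIntegrable
  set φ : 𝔼 → ℝ := ρ.normed volume ⋆[lsmul ℝ ℝ, volume] g with hφ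
  have hφc : ContDiff ℝ ∞ φ :=
    ρ.hasCompactSupport_normed.contDiff_convolution_left _ hρc hgl
  refine ⟨φ, hφc, ?_, fun τ hτ y => ?_⟩
  · refine closure_minimal ((support_convolution_subset _).trans ?_) Metric.isClosed_cthickening
    rintro _ ⟨a, ha, b, hb, rfl⟩
    rw [ρ.support_normed_eq] at ha
    refine Metric.mem_cthickening_of_dist_le (a + b) b δ _ (subset_tsupport g hb) ?_
    rw [dist_eq_norm, add_sub_cancel_right, ← dist_zero_right]
    exact (Metric.mem_ball.1 ha).le.trans (min_le_left _ _)
  · have hsub := lieWord_sub (V := fun (i : Fin n) _ => EuclideanSpace.single i (1 : ℝ))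
      isOpen_univ (fun _ => contDiffOn_const) τ (f := φ) (g := g)
      (hφc.of_infty _).contDiffOn (hg.of_le (mod_cast hτ)).contDiffOn (Set.mem_univ y)
    rw [flatWord, hsub]
    simp only
    rw [show lieWord (fun i _ => EuclideanSpace.single i (1 : ℝ)) τ φ = _ from
      flatWord_convolution hρl hg hc τ hτ, ← Real.dist_eq]
    refine ρ.dist_normed_convolution_le
      (contDiff_flatWord (m := 0) hg τ (by omega)).continuous.aestronglyMeasurable fun z hz => ?_
    refine (hd τ hτ z y ?_).le
    exact (Metric.mem_ball.1 hz).trans_le ((min_le_right _ _).trans (hdle τ (mem_words.2 hτ)))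

end Mollification

namespace BallData

variable {n M : ℕ} (G : BallData n M)

local notation "𝔼" => EuclideanSpace ℝ (Fin n)

/-- Uniform smallness of the derivatives up to order `r`, with supports in a fixed compact subset of
the ball, makes the energy small: there the coordinate fields are bounded and all measures involved
are finite. -/
lemma exists_isTest_energy_le {r : ℕ} {g : 𝔼 → ℝ} (hg : ContDiff ℝ r g)
    (hc : HasCompactSupport g) (hs : tsupport g ⊆ unitBall n) {ε : ℝ≥0∞} (hε : 0 < ε) :
    ∃ φ, IsTest φ ∧ G.energy r (fun y => φ y - g y) ≤ ε ∧ G.normL2 (fun y => φ y - g y) ≤ ε := by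
  obtain ⟨K, hK, hKb, hgK, happ⟩ := exists_contDiff_approx hg hc Metric.isOpen_ball hs
  have hL : IsCompact (K ∩ {y | G.R ≤ ‖y‖}) :=
    hK.inter_right (isClosed_le continuous_const continuous_norm)
  obtain ⟨C₁, h1, hC₁⟩ := exists_abs_lieWord_le G.isOpen_coordDomain G.contDiffOn_field hL
    (fun y hy => G.mem_coordDomain hy.2 (by
      have : ‖y‖ < 1 := by simpa [unitBall] using hKb hy.1
      exact this.le)) r
  obtain ⟨C₂, h2, hC₂⟩ := exists_jetNorm_le_flatWord (n := n) r
  set D : ℝ := C₁ * (C₂ * (words n r).card) with hD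
  have hfinb : volume (unitBall n) < ⊤ := measure_ball_lt_top
  have : IsFiniteMeasure (volume.restrict (unitBall n)) := ⟨by
    rwa [Measure.restrict_apply_univ]⟩
  set A : ℝ → ℝ≥0∞ := fun η => (sortedWords M r).card *
    (ENNReal.ofReal (D * η) ^ 2 * G.measA Set.univ) +
      (words n r).card * (ENNReal.ofReal η ^ 2 * volume (G.core none)) with hA
  set A' : ℝ → ℝ≥0∞ := fun η => G.measA Set.univ ^ ((2 : ℝ≥0∞).toReal)⁻¹ * ENNReal.ofReal η +
    (volume.restrict (unitBall n)) Set.univ ^ ((2 : ℝ≥0∞).toReal)⁻¹ * ENNReal.ofReal η with hA'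
  have hlim : Tendsto A (𝓝[>] 0) (𝓝 0) ∧ Tendsto A' (𝓝[>] 0) (𝓝 0) := by
    have h0 : ∀ c : ℝ, Tendsto (fun η : ℝ => ENNReal.ofReal (c * η)) (𝓝[>] 0) (𝓝 0) := fun c => by
      have := (ENNReal.continuous_ofReal.comp (continuous_const.mul continuous_id)).tendsto
        (f := fun η : ℝ => ENNReal.ofReal (c * η)) 0
      simpa using this.mono_left nhdsWithin_le_nhds
    have h0' : Tendsto (fun η : ℝ => ENNReal.ofReal η) (𝓝[>] 0) (𝓝 0) := by simpa using h0 1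
    have hsq : ∀ {f : ℝ → ℝ≥0∞}, Tendsto f (𝓝[>] 0) (𝓝 0) →
        Tendsto (fun η => f η ^ 2) (𝓝[>] 0) (𝓝 0) := fun h => by
      simpa using ENNReal.Tendsto.pow (n := 2) h
    have hml : ∀ {f : ℝ → ℝ≥0∞} {c : ℝ≥0∞}, c ≠ ⊤ → Tendsto f (𝓝[>] 0) (𝓝 0) →
        Tendsto (fun η => c * f η) (𝓝[>] 0) (𝓝 0) := fun hc h => by
      simpa using ENNReal.Tendsto.const_mul h (Or.inr hc)
    have hmr : ∀ {f : ℝ → ℝ≥0∞} {c : ℝ≥0∞}, c ≠ ⊤ → Tendsto f (𝓝[>] 0) (𝓝 0) →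
        Tendsto (fun η => f η * c) (𝓝[>] 0) (𝓝 0) := fun hc h => by
      simpa using ENNReal.Tendsto.mul_const h (Or.inr hc)
    have hp : ∀ {μ : Measure 𝔼} [IsFiniteMeasure μ],
        μ Set.univ ^ ((2 : ℝ≥0∞).toReal)⁻¹ ≠ ⊤ := fun {μ} _ =>
      ENNReal.rpow_ne_top_of_nonneg (by norm_num) (measure_ne_top _ _)
    constructor
    · simpa using (hml (ENNReal.natCast_ne_top _) (hmr (measure_ne_top _ _) (hsq (h0 D)))).add
        (hml (ENNReal.natCast_ne_top _) (hmr (G.isCompact_core none).measure_lt_top.ne (hsq h0')))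
    · have h := (hml (hp (μ := G.measA)) h0').add
        (hml (hp (μ := volume.restrict (unitBall n))) h0')
      rwa [add_zero] at h
  obtain ⟨η, ⟨hη1, hη2⟩, hη⟩ := (((hlim.1.eventually_lt_const hε).and
    (hlim.2.eventually_lt_const hε)).and self_mem_nhdsWithin).exists
  have hη0 : 0 < η := hη
  obtain ⟨φ, hφ, hφs, hφη⟩ := happ η hη0
  have hφc : HasCompactSupport φ := HasCompactSupport.of_support_subset_isCompact hK
    ((subset_tsupport φ).trans hφs)
  have hfr : ContDiff ℝ r (fun y => φ y - g y) := (hφ.of_infty r).sub hg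
  have hfK : tsupport (fun y => φ y - g y) ⊆ K :=
    (tsupport_sub φ g).trans (Set.union_subset hφs hgK)
  set f : 𝔼 → ℝ := fun y => φ y - g y
  have hjet : ∀ y, jetNorm r f y ≤ C₂ * (words n r).card * η := fun y => by
    refine (hC₂ f y r le_rfl hfr.contDiffAt).trans ?_
    rw [mul_assoc, ← nsmul_eq_mul (words n r).card]
    exact mul_le_mul_of_nonneg_left (Finset.sum_le_card_nsmul _ _ _ fun τ hτ =>
      hφη τ (mem_words.1 hτ) y) h2
  have hlie : ∀ τ ∈ sortedWords M r, ∀ y ∈ G.annulus, |lieWord G.field τ f y| ≤ D * η := by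
    intro τ hτ y hy
    have hl := length_le_of_mem_sortedWords hτ
    by_cases hyK : y ∈ K
    · refine (hC₁ τ hl f y ⟨hyK, hy.1.le⟩ (hfr.of_le (mod_cast hl)).contDiffAt).trans ?_
      rw [hD, mul_assoc]
      exact mul_le_mul_of_nonneg_left ((jetNorm_mono hl f y).trans (hjet y)) h1
    · rw [lieWord_eq_zero_of_notMem_tsupport (fun h => hyK (hfK h)) τ, abs_zero]
      positivity
  have henorm : ∀ {a b : ℝ}, |a| ≤ b → ‖a‖ₑ ^ 2 ≤ ENNReal.ofReal b ^ 2 := fun h => by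
    rw [Real.enorm_eq_ofReal_abs]
    exact pow_le_pow_left₀ zero_le (ENNReal.ofReal_le_ofReal h) 2
  have hf0 : ∀ y, |f y| ≤ η := fun y => hφη [] (Nat.zero_le _) y
  refine ⟨φ, ⟨hφ, hφc, hφs.trans hKb⟩, le_trans ?_ hη1.le, le_trans ?_ hη2.le⟩
  · refine add_le_add ?_ ?_
    · rw [← nsmul_eq_mul]
      refine Finset.sum_le_card_nsmul _ _ _ fun τ hτ => ?_
      rw [← lintegral_const]
      refine lintegral_mono_ae ?_
      filter_upwards [G.ae_mem_annulus] with y hy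
      exact henorm (hlie τ hτ y hy)
    · rw [← nsmul_eq_mul]
      refine Finset.sum_le_card_nsmul _ _ _ fun τ hτ => ?_
      rw [← setLIntegral_const]
      exact lintegral_mono fun y => henorm (hφη τ (mem_words.1 hτ) y)
  · have hb : ∀ {a : ℝ}, 0 ≤ a → a ≤ 1 → ∀ y, ‖a * f y‖ ≤ η := fun h1 h2 y => by
      rw [norm_mul, Real.norm_eq_abs, Real.norm_eq_abs, abs_of_nonneg h1]
      exact (mul_le_of_le_one_left (abs_nonneg _) h2).trans (hf0 y)
    refine add_le_add ?_ ?_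
    · exact eLpNorm_le_of_ae_bound (Eventually.of_forall fun y =>
        hb (G.χ_nonneg y) (G.χ_le_one y) y)
    · exact eLpNorm_le_of_ae_bound (Eventually.of_forall fun y =>
        hb (by linarith [G.χ_le_one y]) (by linarith [G.χ_nonneg y]) y)

end BallData

end

section

/-! ### Convex combinations of bounded sequences -/

/-- For a functional satisfying the parallelogram identity, a bounded sequence has a Cauchy sequence
of convex combinations. -/
lemma exists_convexHull_cauchy {V : Type*} [AddCommGroup V] [Module ℝ V] (T : Submodule ℝ V)
    (q : V → ℝ≥0∞) (h0 : q 0 = 0)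
    (hq : ∀ f ∈ T, ∀ h ∈ T, q (f - h) + q (f + h) = 2 * (q f + q h)) {g : ℕ → V}
    (hg : ∀ j, g j ∈ T) {c : ℝ≥0∞} (hc : c ≠ ⊤) (hgc : ∀ j, q (g j) ≤ c) :
    ∃ f : ℕ → V, (∀ m, f m ∈ convexHull ℝ (g '' Set.Ici m)) ∧
      (∀ m, q (f m) ≤ c + ((m : ℝ≥0∞) + 1)⁻¹) ∧
      ∀ ε : ℝ≥0∞, 0 < ε → ∃ m₀, ∀ m l, m₀ ≤ m → m₀ ≤ l → q (f m - f l) < ε := by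
  set S : ℕ → Set V := fun m => convexHull ℝ (g '' Set.Ici m) with hS
  have hST : ∀ m, S m ⊆ T := fun m => convexHull_min (by
    rintro _ ⟨j, -, rfl⟩
    exact hg j) T.convex
  have hSmono : ∀ {m l}, m ≤ l → S l ⊆ S m := fun h =>
    convexHull_mono (Set.image_mono (Set.Ici_subset_Ici.2 h))
  -- The infima of `q` over the convex hulls of the tails increase and are bounded by `c`, hence
  -- converge; near-minimizers in these hulls will be Cauchy.
  set I : ℕ → ℝ≥0∞ := fun m => ⨅ f ∈ S m, q f with hI
  have hIc : ∀ m, I m ≤ c := fun m => (iInf₂_le (g m) (subset_convexHull ℝ _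
    (Set.mem_image_of_mem g (Set.mem_Ici.2 le_rfl)))).trans (hgc m)
  have hImono : Monotone I := fun m l h => le_iInf₂ fun f hf => iInf₂_le f (hSmono h hf)
  set e : ℕ → ℝ≥0∞ := fun m => ((m : ℝ≥0∞) + 1)⁻¹ with he
  have he0 : ∀ m, e m ≠ 0 := fun m => by simp [he]
  have hel : Tendsto e atTop (𝓝 0) := by
    have := (tendsto_add_atTop_iff_nat 1).2 ENNReal.tendsto_inv_nat_nhds_zero
    simpa [he] using this
  have hean : Antitone e := fun m l h => by
    simp only [he]
    gcongr
  have hex : ∀ m, ∃ f ∈ S m, q f < I m + e m := fun m => by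
    have h : I m < I m + e m := ENNReal.lt_add_right ((hIc m).trans_lt hc.lt_top).ne (he0 m)
    obtain ⟨f, h⟩ := iInf_lt_iff.1 h
    obtain ⟨hf, h⟩ := iInf_lt_iff.1 h
    exact ⟨f, hf, h⟩
  choose f hfS hfq using hex
  refine ⟨f, hfS, fun m => (hfq m).le.trans (add_le_add (hIc m) le_rfl), fun ε hε => ?_⟩
  set L := ⨆ m, I m with hL
  have hLc : L ≠ ⊤ := ((iSup_le hIc).trans_lt hc.lt_top).ne
  have hIL : Tendsto I atTop (𝓝 L) := tendsto_atTop_iSup hImono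
  have hdouble : ∀ v ∈ T, q (v + v) = 4 * q v := fun v hv => by
    have := hq v hv v hv
    rw [sub_self, h0, zero_add] at this
    rw [this]
    ring
  -- The midpoint of `f m` and `f l` stays in the hull of the tail from `m`, so `q (f m + f l)` is
  -- at least four times the infimum there. The parallelogram identity then leaves for `q (f m - f
  -- l)` only the gap between the infimum and its limit, and the errors.
  have hkey : ∀ m l, m ≤ l → q (f m - f l) ≤ (2 * I m + 2 * L + 4 * e m) - 4 * I m := by
    intro m l hml
    have hm := hST m (hfS m)
    have hl := hST l (hfS l)
    have hmid : (1 / 2 : ℝ) • f m + (1 / 2 : ℝ) • f l ∈ S m :=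
      (convex_convexHull ℝ _) (hfS m) (hSmono hml (hfS l)) (by norm_num) (by norm_num)
        (by norm_num)
    have hsum : q (f m + f l) = 4 * q ((1 / 2 : ℝ) • f m + (1 / 2 : ℝ) • f l) := by
      rw [← hdouble _ (hST m hmid), add_add_add_comm, ← add_smul, ← add_smul]
      norm_num
    have h4 : 4 * I m ≤ q (f m + f l) := by
      rw [hsum]
      exact mul_le_mul_right (iInf₂_le _ hmid) _
    refine ENNReal.le_sub_of_add_le_right
      (ENNReal.mul_ne_top (by norm_num) ((hIc m).trans_lt hc.lt_top).ne) ?_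
    calc q (f m - f l) + 4 * I m ≤ q (f m - f l) + q (f m + f l) := add_le_add le_rfl h4
      _ = 2 * (q (f m) + q (f l)) := hq _ hm _ hl
      _ ≤ 2 * ((I m + e m) + (L + e m)) := by
        refine mul_le_mul_right (add_le_add (hfq m).le ?_) _
        exact (hfq l).le.trans (add_le_add (le_iSup I l) (hean hml))
      _ = _ := by ring
  have hlim : Tendsto (fun m => (2 * I m + 2 * L + 4 * e m) - 4 * I m) atTop (𝓝 0) := by
    have h1 : Tendsto (fun m => 2 * I m + 2 * L + 4 * e m) atTop (𝓝 (2 * L + 2 * L + 4 * 0)) :=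
      ((ENNReal.Tendsto.const_mul hIL (Or.inr (by norm_num))).add tendsto_const_nhds).add
        (ENNReal.Tendsto.const_mul hel (Or.inr (by norm_num)))
    have h2 : Tendsto (fun m => 4 * I m) atTop (𝓝 (4 * L)) :=
      ENNReal.Tendsto.const_mul hIL (Or.inr (by norm_num))
    have h3 := ENNReal.Tendsto.sub h1 h2 (Or.inr (ENNReal.mul_ne_top (by norm_num) hLc))
    rwa [mul_zero, add_zero, ← add_mul, show (2 + 2 : ℝ≥0∞) = 4 by norm_num, tsub_self] at h3
  obtain ⟨m₀, hm₀⟩ := eventually_atTop.1 (hlim.eventually_lt_const hε)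
  -- Symmetry of `q` is not assumed; it follows from the parallelogram identity with one entry equal
  -- to zero.
  have hsymm : ∀ m l, q (f m - f l) = q (f l - f m) := fun m l => by
    have hm := hST m (hfS m)
    have hl := hST l (hfS l)
    have h1 := hq 0 T.zero_mem (f m - f l) (T.sub_mem hm hl)
    have h2 := hq 0 T.zero_mem (f l - f m) (T.sub_mem hl hm)
    rw [zero_sub, zero_add, h0, zero_add, neg_sub] at h1 h2
    rw [add_comm, h2] at h1
    exact ((ENNReal.mul_right_inj two_ne_zero ENNReal.ofNat_ne_top).1 h1).symm
  refine ⟨m₀, fun m l hm hl => ?_⟩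
  rcases le_total m l with h | h
  · exact (hkey m l h).trans_lt (hm₀ m hm)
  · rw [hsymm]
    exact (hkey l m h).trans_lt (hm₀ l hl)

lemma isTest_zero {n : ℕ} : IsTest (fun _ : EuclideanSpace ℝ (Fin n) => (0 : ℝ)) :=
  ⟨contDiff_const, HasCompactSupport.zero, by
    rw [show (fun _ : EuclideanSpace ℝ (Fin n) => (0 : ℝ)) = 0 from rfl, tsupport_zero]
    exact Set.empty_subset _⟩

lemma IsTest.add {n : ℕ} {f g : EuclideanSpace ℝ (Fin n) → ℝ} (hf : IsTest f) (hg : IsTest g) :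
    IsTest (fun y => f y + g y) :=
  ⟨hf.1.add hg.1, hf.2.1.add hg.2.1,
    (tsupport_add f g).trans (Set.union_subset hf.2.2 hg.2.2)⟩

/-- The test functions as a subspace. -/
def testSubmodule (n : ℕ) : Submodule ℝ (EuclideanSpace ℝ (Fin n) → ℝ) where
  carrier := {f | IsTest f}
  add_mem' hf hg := hf.add hg
  zero_mem' := isTest_zero
  smul_mem' _ _ hf := ⟨contDiff_const.mul hf.1, hf.2.1.mul_left,
    (tsupport_mul_subset_right).trans hf.2.2⟩

lemma enorm_sub_sq_add_enorm_add_sq (a b : ℝ) :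
    ‖a - b‖ₑ ^ 2 + ‖a + b‖ₑ ^ 2 = 2 * (‖a‖ₑ ^ 2 + ‖b‖ₑ ^ 2) := by
  have h : ∀ t : ℝ, ‖t‖ₑ ^ 2 = ENNReal.ofReal (t ^ 2) := fun t => by
    rw [Real.enorm_eq_ofReal_abs, ← ENNReal.ofReal_pow (abs_nonneg t), sq_abs]
  simp only [h]
  rw [← ENNReal.ofReal_add (sq_nonneg _) (sq_nonneg _), ← ENNReal.ofReal_add (sq_nonneg _)
    (sq_nonneg _), show (2 : ℝ≥0∞) = ENNReal.ofReal 2 by simp, ← ENNReal.ofReal_mul zero_le_two]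
  congr 1
  ring

lemma lintegral_parallelogram {α : Type*} [MeasurableSpace α] {μ : Measure α} {a b s d : α → ℝ}
    (ha : AEStronglyMeasurable a μ) (hb : AEStronglyMeasurable b μ)
    (hd : d =ᵐ[μ] fun y => a y - b y) (hs : s =ᵐ[μ] fun y => a y + b y) :
    (∫⁻ y, ‖d y‖ₑ ^ 2 ∂μ) + ∫⁻ y, ‖s y‖ₑ ^ 2 ∂μ =
      2 * ((∫⁻ y, ‖a y‖ₑ ^ 2 ∂μ) + ∫⁻ y, ‖b y‖ₑ ^ 2 ∂μ) := by
  have h1 : ∫⁻ y, ‖d y‖ₑ ^ 2 ∂μ = ∫⁻ y, ‖a y - b y‖ₑ ^ 2 ∂μ :=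
    lintegral_congr_ae (hd.fun_comp fun t => ‖t‖ₑ ^ 2)
  have h2 : ∫⁻ y, ‖s y‖ₑ ^ 2 ∂μ = ∫⁻ y, ‖a y + b y‖ₑ ^ 2 ∂μ :=
    lintegral_congr_ae (hs.fun_comp fun t => ‖t‖ₑ ^ 2)
  have h3 : AEMeasurable (fun y => ‖a y - b y‖ₑ ^ 2) μ := (ha.sub hb).enorm.pow_const 2
  rw [h1, h2, ← lintegral_add_left' (ha.enorm.pow_const 2),
    ← lintegral_const_mul' _ _ ENNReal.ofNat_ne_top, ← lintegral_add_left' h3]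
  exact lintegral_congr fun y => enorm_sub_sq_add_enorm_add_sq _ _

namespace BallData

variable {n M : ℕ} (G : BallData n M)

local notation "𝔼" => EuclideanSpace ℝ (Fin n)

lemma energy_zero (r : ℕ) : G.energy r (fun _ => 0) = 0 := by
  simp [energy, lieWord_zero]

/-- Each summand is the square of an `L²` norm of a linear expression. The norm `normHr`, a sum of
such norms, has no such identity, which is why the energy is used. -/
lemma energy_parallelogram {r : ℕ} {f g : 𝔼 → ℝ} (hf : ContDiffOn ℝ r f (unitBall n))
    (hg : ContDiffOn ℝ r g (unitBall n)) :
    G.energy r (fun y => f y - g y) + G.energy r (fun y => f y + g y) =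
      2 * (G.energy r f + G.energy r g) := by
  have h1 : ∀ τ ∈ sortedWords M r, (∫⁻ y, ‖lieWord G.field τ (fun y => f y - g y) y‖ₑ ^ 2 ∂G.measA) +
      ∫⁻ y, ‖lieWord G.field τ (fun y => f y + g y) y‖ₑ ^ 2 ∂G.measA =
      2 * ((∫⁻ y, ‖lieWord G.field τ f y‖ₑ ^ 2 ∂G.measA) +
        ∫⁻ y, ‖lieWord G.field τ g y‖ₑ ^ 2 ∂G.measA) := fun τ hτ => by
    have hl := length_le_of_mem_sortedWords hτ
    have hfA : ContDiffOn ℝ r f G.annulus := hf.mono G.annulus_subset_ball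
    have hgA : ContDiffOn ℝ r g G.annulus := hg.mono G.annulus_subset_ball
    have hm : ∀ {f : 𝔼 → ℝ}, ContDiffOn ℝ r f G.annulus →
        AEStronglyMeasurable (lieWord G.field τ f) G.measA := fun hf =>
      G.aestronglyMeasurable_measA
        (continuousOn_lieWord G.isOpen_annulus G.contDiffOn_field_annulus hf hl)
    refine lintegral_parallelogram (hm hfA) (hm hgA) ?_ ?_
    · filter_upwards [G.ae_mem_annulus] with y hy
      exact lieWord_sub G.isOpen_annulus G.contDiffOn_field_annulus τ
        (hfA.of_le (mod_cast hl)) (hgA.of_le (mod_cast hl)) hy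
    · filter_upwards [G.ae_mem_annulus] with y hy
      exact lieWord_add G.isOpen_annulus G.contDiffOn_field_annulus τ
        (hfA.of_le (mod_cast hl)) (hgA.of_le (mod_cast hl)) hy
  have h2 : ∀ τ ∈ words n r, (∫⁻ y in G.core none, ‖flatWord τ (fun y => f y - g y) y‖ₑ ^ 2) +
      ∫⁻ y in G.core none, ‖flatWord τ (fun y => f y + g y) y‖ₑ ^ 2 =
      2 * ((∫⁻ y in G.core none, ‖flatWord τ f y‖ₑ ^ 2) +
        ∫⁻ y in G.core none, ‖flatWord τ g y‖ₑ ^ 2) := fun τ hτ => by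
    have hl : τ.length ≤ r := mem_words.1 hτ
    have hm : ∀ {f : 𝔼 → ℝ}, ContDiffOn ℝ r f (unitBall n) →
        AEStronglyMeasurable (flatWord τ f) (volume.restrict (G.core none)) := fun hf =>
      ((continuousOn_lieWord Metric.isOpen_ball (fun _ => contDiffOn_const) hf hl).mono
        G.core_none_subset_ball).aestronglyMeasurable G.measurableSet_core_none
    refine lintegral_parallelogram (hm hf) (hm hg) ?_ ?_
    · filter_upwards [ae_restrict_mem G.measurableSet_core_none] with y hy
      exact lieWord_sub Metric.isOpen_ball (fun _ => contDiffOn_const) τ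
        (hf.of_le (mod_cast hl)) (hg.of_le (mod_cast hl)) (G.core_none_subset_ball hy)
    · filter_upwards [ae_restrict_mem G.measurableSet_core_none] with y hy
      exact lieWord_add Metric.isOpen_ball (fun _ => contDiffOn_const) τ
        (hf.of_le (mod_cast hl)) (hg.of_le (mod_cast hl)) (G.core_none_subset_ball hy)
  simp only [energy]
  rw [add_add_add_comm, ← Finset.sum_add_distrib, ← Finset.sum_add_distrib,
    Finset.sum_congr rfl h1, Finset.sum_congr rfl h2, ← Finset.mul_sum, ← Finset.mul_sum,
    Finset.sum_add_distrib, Finset.sum_add_distrib]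
  ring

lemma normL2_const_mul (c : ℝ) (f : 𝔼 → ℝ) :
    G.normL2 (fun y => c * f y) = ‖c‖ₑ * G.normL2 f := by
  simp only [normL2, mul_left_comm _ c, mul_add]
  exact congrArg₂ _ (eLpNorm_const_smul c _ _ _) (eLpNorm_const_smul c _ _ _)

/-- A function approximated in `𝐋²` by test functions of bounded energy belongs to `ℋ^{0,r}`. -/
lemma exists_memHr_of_energy_le (r : ℕ) : ∃ C : ℝ≥0, ∀ (g : ℕ → 𝔼 → ℝ) (v : 𝔼 → ℝ) (c : ℝ≥0∞),
    (∀ j, IsTest (g j)) → AEStronglyMeasurable v (volume.restrict (unitBall n)) → c ≠ ⊤ →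
    (∀ j, G.energy r (g j) ≤ c) → Tendsto (fun j => G.normL2 (fun y => g j y - v y)) atTop (𝓝 0) →
      G.MemHr 0 r v ∧ G.hNorm 0 r v ^ 2 ≤ C * c := by
  obtain ⟨C, hC⟩ := G.exists_normHr_sq_le_energy r
  refine ⟨C, fun g v c hg hv hc hgc hlim => ?_⟩
  obtain ⟨f, hf, hfc, hcau⟩ := exists_convexHull_cauchy (testSubmodule n) (G.energy r)
    (G.energy_zero r) (fun f hf h hh => G.energy_parallelogram
      ((hf.contDiffOn _).of_le (natCast_le_infty r)) ((hh.contDiffOn _).of_le (natCast_le_infty r)))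
    hg hc hgc
  have hft : ∀ m, IsTest (f m) := fun m => convexHull_min (t := (testSubmodule n : Set (𝔼 → ℝ))) (by
    rintro _ ⟨j, -, rfl⟩
    exact hg j) (testSubmodule n).convex (hf m)
  have hL2 : Tendsto (fun m => G.normL2 (fun y => f m y - v y)) atTop (𝓝 0) := by
    rw [ENNReal.tendsto_nhds_zero] at hlim ⊢
    intro ε hε
    obtain ⟨m₀, hm₀⟩ := eventually_atTop.1 (hlim ε hε)
    filter_upwards [eventually_ge_atTop m₀] with m hm
    -- Being within `ε` of `v` in `𝐋²` is a convex condition, so convex combinations of tails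
    -- inherit the convergence.
    have hconv : Convex ℝ {h : 𝔼 → ℝ | IsTest h ∧ G.normL2 (fun y => h y - v y) ≤ ε} := by
      rintro h₁ ⟨ht₁, hb₁⟩ h₂ ⟨ht₂, hb₂⟩ a b ha hb hab
      refine ⟨(testSubmodule n).convex ht₁ ht₂ ha hb hab, ?_⟩
      have e : (fun y => (a • h₁ + b • h₂) y - v y) =
          fun y => a * (h₁ y - v y) + b * (h₂ y - v y) := by
        ext y
        simp only [Pi.add_apply, Pi.smul_apply, smul_eq_mul]
        linear_combination v y * hab
      rw [e]
      have hm : ∀ {h : 𝔼 → ℝ}, IsTest h → ∀ a : ℝ, AEStronglyMeasurable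
          (fun y => a * (h y - v y)) (volume.restrict (unitBall n)) := fun ht a =>
        (ht.1.continuous.aestronglyMeasurable.sub hv).const_mul a
      refine (G.normL2_add_le (hm ht₁ a) (hm ht₂ b)).trans ?_
      rw [normL2_const_mul, normL2_const_mul]
      calc _ ≤ ‖a‖ₑ * ε + ‖b‖ₑ * ε :=
            add_le_add (mul_le_mul_right hb₁ _) (mul_le_mul_right hb₂ _)
        _ = ε := by
          rw [← add_mul, Real.enorm_of_nonneg ha, Real.enorm_of_nonneg hb,
            ← ENNReal.ofReal_add ha hb, hab, ENNReal.ofReal_one, one_mul]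
    refine (convexHull_min ?_ hconv (hf m)).2
    rintro _ ⟨j, hj, rfl⟩
    exact ⟨hg j, hm₀ j (hm.trans (Set.mem_Ici.1 hj))⟩
  have happ : G.Approximates 0 r f v := by
    refine ⟨hft, fun ε hε => ?_, hL2⟩
    obtain ⟨δ, hδ, hδε⟩ : ∃ δ : ℝ≥0∞, 0 < δ ∧ C * δ < ε ^ 2 := by
      have h0 : Tendsto (fun x : ℝ≥0∞ => C * x) (𝓝[>] 0) (𝓝 0) := by
        have := ENNReal.Tendsto.const_mul (a := (C : ℝ≥0∞)) (tendsto_id (α := ℝ≥0∞) (x := 𝓝 0))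
          (Or.inr ENNReal.coe_ne_top)
        simpa using this.mono_left nhdsWithin_le_nhds
      obtain ⟨x, h1, h2⟩ := ((h0.eventually_lt_const (ENNReal.pow_pos hε 2)).and self_mem_nhdsWithin).exists
      exact ⟨x, h2, h1⟩
    obtain ⟨m₀, hm₀⟩ := hcau δ hδ
    refine ⟨m₀, fun i j hi hj => ?_⟩
    have h1 := hC _ (((hft i).sub (hft j)).contDiffOn _)
    refine (ENNReal.pow_lt_pow_left_iff two_ne_zero).1 (h1.trans_lt ?_)
    exact (mul_le_mul_right (hm₀ i j hi hj).le _).trans_lt hδε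
  refine ⟨⟨hv, f, happ⟩, ?_⟩
  have hb : ∀ m : ℕ, G.hNorm 0 r v ^ 2 ≤ C * (c + ((m : ℝ≥0∞) + 1)⁻¹) := fun m => by
    set b := C * (c + ((m : ℝ≥0∞) + 1)⁻¹) with hb
    have hle : G.hNorm 0 r v ≤ b ^ (2⁻¹ : ℝ) := by
      refine (iInf₂_le f happ).trans (liminf_le_of_frequently_le' (Eventually.frequently ?_))
      filter_upwards [eventually_ge_atTop m] with j hj
      rw [ENNReal.le_rpow_inv_iff two_pos, ENNReal.rpow_two]
      refine (hC _ ((hft j).contDiffOn _)).trans (mul_le_mul_right ((hfc j).trans ?_) _)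
      gcongr
    rwa [ENNReal.le_rpow_inv_iff two_pos, ENNReal.rpow_two] at hle
  have hlim' : Tendsto (fun m : ℕ => C * (c + ((m : ℝ≥0∞) + 1)⁻¹)) atTop (𝓝 (C * (c + 0))) := by
    have h1 : Tendsto (fun m : ℕ => ((m : ℝ≥0∞) + 1)⁻¹) atTop (𝓝 0) := by
      have := (tendsto_add_atTop_iff_nat 1).2 ENNReal.tendsto_inv_nat_nhds_zero
      simpa using this
    exact ENNReal.Tendsto.const_mul (tendsto_const_nhds.add h1) (Or.inr ENNReal.coe_ne_top)
  rw [add_zero] at hlim'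
  exact ge_of_tendsto' hlim' hb

end BallData

end

section

/-- Dominated convergence for the squares, with dominating function `B² |f|²`. -/
lemma tendsto_eLpNorm_two_mul_zero {α : Type*} [MeasurableSpace α] {μ : Measure α} {f : α → ℝ}
    (hf : MemLp f 2 μ) {a : ℕ → α → ℝ} (ha : ∀ j, AEStronglyMeasurable (a j) μ) {B : ℝ}
    (hB : ∀ j, ∀ᵐ y ∂μ, |a j y| ≤ B) (hlim : ∀ᵐ y ∂μ, Tendsto (fun j => a j y) atTop (𝓝 0)) :
    Tendsto (fun j => eLpNorm (fun y => a j y * f y) 2 μ) atTop (𝓝 0) := by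
  have hfin : ∫⁻ y, (ENNReal.ofReal B * ‖f y‖ₑ) ^ 2 ∂μ ≠ ⊤ := by
    simp only [mul_pow]
    rw [lintegral_const_mul' _ _ (by simp), ← eLpNorm_two_sq]
    exact ENNReal.mul_ne_top (by simp) (ENNReal.pow_ne_top hf.2.ne)
  have h := tendsto_lintegral_of_dominated_convergence' (μ := μ)
    (F := fun j y => ‖a j y * f y‖ₑ ^ 2) (f := fun _ => 0)
    (fun y => (ENNReal.ofReal B * ‖f y‖ₑ) ^ 2)
    (fun j => ((ha j).mul hf.1).enorm.pow_const 2) (fun j => ?_) hfin ?_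
  · rw [lintegral_zero] at h
    rw [ENNReal.tendsto_nhds_zero] at h ⊢
    intro ε hε
    filter_upwards [h (ε ^ 2) (ENNReal.pow_pos hε 2)] with j hj
    exact eLpNorm_two_le_iff.2 hj
  · filter_upwards [hB j] with y hy
    rw [enorm_mul, Real.enorm_eq_ofReal_abs]
    exact pow_le_pow_left₀ zero_le (mul_le_mul_left (ENNReal.ofReal_le_ofReal hy) _) 2
  · filter_upwards [hlim] with y hy
    have h1 : Tendsto (fun j => ‖a j y * f y‖ₑ) atTop (𝓝 0) := by
      have := (hy.mul_const (f y)).enorm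
      simpa using this
    simpa using ENNReal.Tendsto.pow (n := 2) h1

namespace BallData

variable {n M : ℕ} (G : BallData n M)

local notation "𝔼" => EuclideanSpace ℝ (Fin n)

/-! ### Nonlinear functions in `ℋ^{0,r}` -/

lemma aestronglyMeasurable_χ_mul {f : 𝔼 → ℝ}
    (hf : AEStronglyMeasurable f (volume.restrict (unitBall n))) :
    AEStronglyMeasurable (fun y => G.χ y * f y) G.measA :=
  G.χ_smooth.continuous.aestronglyMeasurable.mul (hf.mono_ac G.measA_absolutelyContinuous)

lemma aestronglyMeasurable_one_sub_χ_mul {f : 𝔼 → ℝ}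
    (hf : AEStronglyMeasurable f (volume.restrict (unitBall n))) :
    AEStronglyMeasurable (fun y => (1 - G.χ y) * f y) (volume.restrict (unitBall n)) :=
  (continuous_const.sub G.χ_smooth.continuous).aestronglyMeasurable.mul hf

lemma normL2_lt_top {f : 𝔼 → ℝ} (hf : IsTest f) : G.normL2 f < ⊤ := by
  have : IsFiniteMeasure (volume.restrict (unitBall n)) := ⟨by
    rw [Measure.restrict_apply_univ]; exact measure_ball_lt_top⟩
  have h : ∀ {a : 𝔼 → ℝ} {μ : Measure 𝔼} [IsFiniteMeasure μ], ContDiff ℝ ∞ a →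
      eLpNorm (fun y => a y * f y) 2 μ < ⊤ := fun {a μ} _ ha => by
    have ht := isTest_mul ha hf
    obtain ⟨B, hB⟩ := ht.2.1.exists_bound_of_continuous ht.1.continuous
    exact (MemLp.of_bound ht.1.continuous.aestronglyMeasurable B (Eventually.of_forall hB)).2
  exact ENNReal.add_lt_top.2 ⟨h G.χ_smooth, h (contDiff_const.sub G.χ_smooth)⟩

lemma normL2_mul_le {a f : 𝔼 → ℝ} {B : ℝ} (ha : ∀ y ∈ unitBall n, |a y| ≤ B) :
    G.normL2 (fun y => a y * f y) ≤ ENNReal.ofReal B * G.normL2 f := by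
  rw [normL2, normL2, mul_add]
  have h : ∀ b y, y ∈ unitBall n → ‖b * (a y * f y)‖ ≤ B * ‖b * f y‖ := fun b y hy => by
    rw [mul_left_comm, norm_mul]
    exact mul_le_mul_of_nonneg_right (ha y hy) (norm_nonneg _)
  refine add_le_add (eLpNorm_le_mul_eLpNorm_of_ae_le_mul ?_ 2)
    (eLpNorm_le_mul_eLpNorm_of_ae_le_mul ?_ 2)
  · filter_upwards [G.ae_mem_annulus] with y hy using h _ y (G.annulus_subset_ball hy)
  · filter_upwards [ae_restrict_mem Metric.isOpen_ball.measurableSet] with y hy using h _ y hy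

lemma tendsto_normL2_mul_zero {u : 𝔼 → ℝ}
    (hu : AEStronglyMeasurable u (volume.restrict (unitBall n))) (hfin : G.normL2 u < ⊤)
    {a : ℕ → 𝔼 → ℝ} (ha : ∀ j, AEStronglyMeasurable (a j) (volume.restrict (unitBall n))) {B : ℝ}
    (hB : ∀ j, ∀ᵐ y ∂(volume.restrict (unitBall n)), |a j y| ≤ B)
    (hlim : ∀ᵐ y ∂(volume.restrict (unitBall n)), Tendsto (fun j => a j y) atTop (𝓝 0)) :
    Tendsto (fun j => G.normL2 (fun y => a j y * u y)) atTop (𝓝 0) := by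
  have hac := G.measA_absolutelyContinuous
  have hfin' := ENNReal.add_lt_top.1 hfin
  have h1 := tendsto_eLpNorm_two_mul_zero ⟨G.aestronglyMeasurable_χ_mul hu, hfin'.1⟩
    (fun j => (ha j).mono_ac hac) (fun j => hac.ae_le (hB j)) (hac.ae_le hlim)
  have h2 := tendsto_eLpNorm_two_mul_zero ⟨G.aestronglyMeasurable_one_sub_χ_mul hu, hfin'.2⟩
    ha hB hlim
  have h3 := h1.add h2
  rw [add_zero] at h3
  refine h3.congr fun j => ?_
  simp only [normL2, mul_left_comm (a j _)]

/-- Convergence in `𝐋²` implies convergence almost everywhere of a subsequence. -/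
lemma exists_subseq_tendsto_ae {φ : ℕ → 𝔼 → ℝ} {w : 𝔼 → ℝ} (hφ : ∀ j, IsTest (φ j))
    (hw : AEStronglyMeasurable w (volume.restrict (unitBall n)))
    (hlim : Tendsto (fun j => G.normL2 (fun y => φ j y - w y)) atTop (𝓝 0)) :
    ∃ σ : ℕ → ℕ, StrictMono σ ∧ ∀ᵐ y ∂(volume.restrict (unitBall n)),
      Tendsto (fun j => φ (σ j) y) atTop (𝓝 (w y)) := by
  have hm : ∀ j, AEStronglyMeasurable (φ j) (volume.restrict (unitBall n)) := fun j =>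
    (hφ j).1.continuous.aestronglyMeasurable
  have hl1 : Tendsto (fun j => eLpNorm ((fun y => G.χ y * φ j y) - fun y => G.χ y * w y) 2 G.measA)
      atTop (𝓝 0) := by
    refine tendsto_of_tendsto_of_tendsto_of_le_of_le tendsto_const_nhds hlim
      (fun _ => zero_le) fun j => ?_
    refine le_trans (le_of_eq ?_) (le_self_add (a := eLpNorm (fun y => G.χ y * (φ j y - w y)) 2 G.measA))
    congr 1
    ext y
    exact (mul_sub _ _ _).symm
  obtain ⟨σ, hσ, h1⟩ := (tendstoInMeasure_of_tendsto_eLpNorm two_ne_zero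
    (fun j => G.aestronglyMeasurable_χ_mul (hm j)) (G.aestronglyMeasurable_χ_mul hw)
      hl1).exists_seq_tendsto_ae
  have hl2 : Tendsto (fun j => eLpNorm ((fun y => (1 - G.χ y) * φ (σ j) y) -
      fun y => (1 - G.χ y) * w y) 2 (volume.restrict (unitBall n))) atTop (𝓝 0) := by
    refine tendsto_of_tendsto_of_tendsto_of_le_of_le tendsto_const_nhds
      (hlim.comp hσ.tendsto_atTop) (fun _ => zero_le) fun j => ?_
    refine le_trans (le_of_eq ?_) (le_add_self (a := eLpNorm (fun y => (1 - G.χ y) *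
      (φ (σ j) y - w y)) 2 (volume.restrict (unitBall n))))
    congr 1
    ext y
    exact (mul_sub _ _ _).symm
  obtain ⟨σ', hσ', h2⟩ := (tendstoInMeasure_of_tendsto_eLpNorm two_ne_zero
    (fun j => G.aestronglyMeasurable_one_sub_χ_mul (hm (σ j)))
      (G.aestronglyMeasurable_one_sub_χ_mul hw) hl2).exists_seq_tendsto_ae
  refine ⟨σ ∘ σ', hσ.comp hσ', ?_⟩
  -- In the annulus the limits of `χ φ` and `(1 - χ) φ` are added. Elsewhere in the ball `χ` is
  -- zero, and the second limit alone suffices.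
  have h1' : ∀ᵐ y, y ∈ G.annulus →
      Tendsto (fun j => G.χ y * φ (σ j) y) atTop (𝓝 (G.χ y * w y)) :=
    (ae_restrict_iff' G.measurableSet_annulus).1
      (G.restrict_annulus_absolutelyContinuous.ae_le h1)
  filter_upwards [h2, ae_restrict_of_ae h1', ae_restrict_mem Metric.isOpen_ball.measurableSet]
    with y h2 h1 hy
  have hy1 : ‖y‖ < 1 := by simpa [unitBall] using hy
  by_cases hyA : y ∈ G.annulus
  · have := ((h1 hyA).comp hσ'.tendsto_atTop).add h2
    refine (this.congr fun j => ?_).trans (le_of_eq ?_)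
    · simp only [Function.comp]
      ring
    · congr 1
      ring
  · have hyR : ‖y‖ ≤ G.R := not_lt.1 fun h => hyA ⟨h, hy1⟩
    simpa [G.χ_zero y hyR] using h2

lemma exists_seq_tendsto_ae_ball {m r : ℕ} {w : 𝔼 → ℝ} (hw : G.MemHr m r w) {c : ℝ≥0∞}
    (hc : G.hNorm m r w < c) : ∃ φ : ℕ → 𝔼 → ℝ, (∀ j, IsTest (φ j)) ∧
      (∀ j, G.normHr m r (φ j) ≤ c) ∧ ∀ᵐ y ∂(volume.restrict (unitBall n)),
        Tendsto (fun j => φ j y) atTop (𝓝 (w y)) := by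
  obtain ⟨φ, hφ, hφc⟩ := G.exists_approximates_le hc
  obtain ⟨σ, -, h⟩ := G.exists_subseq_tendsto_ae hφ.1 hw.1 hφ.2.2
  exact ⟨fun j => φ (σ j), fun j => hφ.1 _, fun j => hφc _, h⟩

variable {N r : ℕ} {F : EuclideanSpace ℝ (Fin n) → (Fin N → ℝ) → ℝ}

/-- The bounds in the pieces, at order zero; the cores cover the ball. -/
lemma exists_abs_coeff_le (hF : G.IsCoeff r N F) (K : ℝ) : ∃ B : ℝ, 0 ≤ B ∧ ∀ y ∈ unitBall n,
    ∀ z : Fin N → ℝ, (∀ i, |z i| ≤ K) → |F y z| ≤ B := by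
  obtain ⟨B, hB0, hB⟩ := G.exists_norm_iteratedFDeriv_pieceCoeff_le hF K
  refine ⟨B, hB0, fun y hy z hz => ?_⟩
  obtain ⟨p, Y, hY, rfl⟩ := G.exists_mem_core hy
  have := hB p Y hY z hz 0 (Nat.zero_le r)
  rwa [norm_iteratedFDeriv_zero] at this

lemma exists_abs_le_of_normHr_le (hn : 2 ≤ n) (hr : n < 2 * (r + 1)) (Λ : ℝ≥0) : ∃ K : ℝ,
    ∀ w : 𝔼 → ℝ, IsTest w → G.normHr 1 r w ≤ Λ → ∀ y ∈ unitBall n, |w y| ≤ K := by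
  obtain ⟨C, hC⟩ := G.exists_enorm_le_normHr hn hr
  refine ⟨(C * Λ : ℝ≥0), fun w hw hΛ y hy => ?_⟩
  have := (hC w (hw.contDiffOn _) y hy).trans (mul_le_mul_right hΛ _)
  rwa [← ENNReal.coe_mul, ← ofReal_norm, ENNReal.ofReal_le_coe] at this

lemma contDiff_coeff_mul (hF : G.IsCoeff r N F) {w : Fin N → 𝔼 → ℝ} {u : 𝔼 → ℝ}
    (hw : ∀ i, IsTest (w i)) (hu : IsTest u) :
    ContDiff ℝ r (fun y => F y (fun i => w i y) * u y) :=
  contDiff_of_forall_mem_tsupport fun _ hy => (G.contDiffOn_coeff_mul hF hw hu).contDiffAt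
    (Metric.isOpen_ball.mem_nhds (hu.2.2 (tsupport_mul_subset_right hy)))

/-- The difference is `F(w_j) (ψ_j - u) + (F(w_j) - F(W)) u`. The first term is small because
`F(w_j)` is bounded, the second by dominated convergence, since `w_j` converges almost everywhere
and `F` is continuous. -/
lemma tendsto_normL2_coeff_mul (hF : G.IsCoeff r N F) {K : ℝ} {w : ℕ → Fin N → 𝔼 → ℝ}
    {W : Fin N → 𝔼 → ℝ} {ψ : ℕ → 𝔼 → ℝ} {u : 𝔼 → ℝ} (hw : ∀ j i, IsTest (w j i))
    (hwK : ∀ j i, ∀ y ∈ unitBall n, |w j i y| ≤ K)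
    (hwW : ∀ i, ∀ᵐ y ∂(volume.restrict (unitBall n)), Tendsto (fun j => w j i y) atTop (𝓝 (W i y)))
    (hψ : ∀ j, IsTest (ψ j)) (hu : AEStronglyMeasurable u (volume.restrict (unitBall n)))
    (hψu : Tendsto (fun j => G.normL2 (fun y => ψ j y - u y)) atTop (𝓝 0)) :
    AEStronglyMeasurable (fun y => F y (fun i => W i y)) (volume.restrict (unitBall n)) ∧
    Tendsto (fun j => G.normL2 (fun y => F y (fun i => w j i y) * ψ j y -
      F y (fun i => W i y) * u y)) atTop (𝓝 0) := by
  obtain ⟨B, hB0, hB⟩ := G.exists_abs_coeff_le hF K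
  have hball := ae_restrict_mem (μ := (volume : Measure 𝔼))
    (Metric.isOpen_ball (x := (0 : 𝔼)) (ε := 1)).measurableSet
  have hcont : ∀ j, ContinuousOn (fun y => F y (fun i => w j i y)) (unitBall n) := fun j =>
    hF.1.continuousOn.comp (f := fun y => (y, fun i => w j i y)) (continuousOn_id.prodMk
      (continuousOn_pi.2 fun i => (hw j i).1.continuous.continuousOn)) fun y hy => ⟨hy, trivial⟩
  have hjm : ∀ j, AEStronglyMeasurable (fun y => F y (fun i => w j i y))
      (volume.restrict (unitBall n)) := fun j =>
    (hcont j).aestronglyMeasurable Metric.isOpen_ball.measurableSet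
  have hlim : ∀ᵐ y ∂(volume.restrict (unitBall n)),
      Tendsto (fun j => F y (fun i => w j i y)) atTop (𝓝 (F y (fun i => W i y))) := by
    filter_upwards [ae_all_iff.2 hwW, hball] with y hy hyb
    have h1 : ContinuousAt (fun q : 𝔼 × (Fin N → ℝ) => F q.1 q.2) (y, fun i => W i y) :=
      hF.1.continuousOn.continuousAt
        ((Metric.isOpen_ball.prod isOpen_univ).mem_nhds ⟨hyb, trivial⟩)
    exact h1.tendsto.comp (tendsto_const_nhds.prodMk_nhds (tendsto_pi_nhds.2 hy))
  have hWm := aestronglyMeasurable_of_tendsto_ae atTop hjm hlim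
  refine ⟨hWm, ?_⟩
  have hfin : G.normL2 u < ⊤ := by
    obtain ⟨j, hj⟩ := (hψu.eventually_lt_const ENNReal.zero_lt_top).exists
    rw [show u = fun y => (u y - ψ j y) + ψ j y by ext; ring]
    refine (G.normL2_add_le (hu.sub (hψ j).1.continuous.aestronglyMeasurable)
      (hψ j).1.continuous.aestronglyMeasurable).trans_lt (ENNReal.add_lt_top.2 ⟨?_,
        G.normL2_lt_top (hψ j)⟩)
    exact (G.normL2_sub_comm _ _).trans_lt hj
  have hWB : ∀ᵐ y ∂(volume.restrict (unitBall n)), |F y (fun i => W i y)| ≤ B := by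
    filter_upwards [hlim, hball] with y hy hyb
    exact le_of_tendsto' hy.abs fun j => hB y hyb _ fun i => hwK j i y hyb
  have h2 : Tendsto (fun j => G.normL2 (fun y => (F y (fun i => w j i y) - F y (fun i => W i y)) *
      u y)) atTop (𝓝 0) := by
    refine G.tendsto_normL2_mul_zero hu hfin (fun j => (hjm j).sub hWm) (B := B + B)
      (fun j => ?_) ?_
    · filter_upwards [hWB, hball] with y hy hyb
      exact (abs_sub _ _).trans (add_le_add (hB y hyb _ fun i => hwK j i y hyb) hy)
    · filter_upwards [hlim] with y hy
      simpa using hy.sub_const (F y fun i => W i y)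
  have h1 : Tendsto (fun j => ENNReal.ofReal B * G.normL2 (fun y => ψ j y - u y)) atTop (𝓝 0) := by
    simpa using ENNReal.Tendsto.const_mul hψu (Or.inr ENNReal.ofReal_ne_top)
  have h3 := h1.add h2
  rw [add_zero] at h3
  refine tendsto_of_tendsto_of_tendsto_of_le_of_le tendsto_const_nhds h3 (fun _ => zero_le)
    fun j => ?_
  have e : (fun y => F y (fun i => w j i y) * ψ j y - F y (fun i => W i y) * u y) =
      fun y => F y (fun i => w j i y) * (ψ j y - u y) +
        (F y (fun i => w j i y) - F y (fun i => W i y)) * u y := by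
    ext y; ring
  simp only [e]
  refine (G.normL2_add_le ((hjm j).mul ((hψ j).1.continuous.aestronglyMeasurable.sub hu))
    (((hjm j).sub hWm).mul hu)).trans (add_le_add ?_ le_rfl)
  exact G.normL2_mul_le fun y hy => hB y hy _ fun i => hwK j i y hy

/-- Nonlinear functions of the elements of `ℋ^{1,r}` act on `ℋ^{0,r}`. -/
theorem coeff_mul_estimate (hn : 2 ≤ n) (hr : n < 2 * (r + 1)) (hF : G.IsCoeff r N F) (Λ : ℝ≥0) :
    ∃ C : ℝ≥0, ∀ (w : Fin N → 𝔼 → ℝ) (u : 𝔼 → ℝ), (∀ i, G.MemHr 1 r (w i)) → G.MemHr 0 r u →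
      ∑ i, G.hNorm 1 r (w i) ≤ (Λ : ℝ≥0∞) →
      G.MemHr 0 r (fun y => F y (fun i => w i y) * u y) ∧
      G.hNorm 0 r (fun y => F y (fun i => w i y) * u y) ≤ (C : ℝ≥0∞) * G.hNorm 0 r u := by
  -- The bound `Λ` is enlarged by one because the approximating sequences obey only bounds strictly
  -- above the norms of their limits.
  obtain ⟨C₀, hC₀⟩ := G.exists_energy_coeff_mul_le hn hr hF (Λ + 1)
  obtain ⟨C₁, hC₁⟩ := G.exists_memHr_of_energy_le r
  obtain ⟨K, hK⟩ := G.exists_abs_le_of_normHr_le hn hr (Λ + 1)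
  set D : ℝ≥0 := C₁ * (2 * (C₀ + 1)) + 1 with hD
  refine ⟨D, fun W u hW hu hΛ => ?_⟩
  have hWΛ : ∀ i, G.hNorm 1 r (W i) < ((Λ + 1 : ℝ≥0) : ℝ≥0∞) := fun i =>
    ((Finset.single_le_sum (f := fun i => G.hNorm 1 r (W i)) (fun _ _ => zero_le)
      (Finset.mem_univ i)).trans hΛ).trans_lt
        (ENNReal.coe_lt_coe.2 (lt_add_of_pos_right _ one_pos))
  choose φ hφ hφΛ hφW using fun i => G.exists_seq_tendsto_ae_ball (hW i) (hWΛ i)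
  -- Such a `c` is positive even if the norm of `u` vanishes, which leaves room for a mollification
  -- error of energy `c²`.
  have main : ∀ c : ℝ≥0, G.hNorm 0 r u < c →
      G.MemHr 0 r (fun y => F y (fun i => W i y) * u y) ∧
      G.hNorm 0 r (fun y => F y (fun i => W i y) * u y) ≤ D * c := by
    intro c hc
    have hc0 : 0 < (c : ℝ≥0∞) := zero_le.trans_lt hc
    obtain ⟨ψ, hψ, hψc⟩ := G.exists_approximates_le hc
    obtain ⟨hWm, hlim⟩ := G.tendsto_normL2_coeff_mul hF (K := K) (w := fun j i => φ i j)
      (fun j i => hφ i j) (fun j i => hK _ (hφ i j) (hφΛ i j)) hφW hψ.1 hu.1 hψ.2.2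
    set g : ℕ → 𝔼 → ℝ := fun j y => F y (fun i => φ i j y) * ψ j y with hg
    have hgr : ∀ j, ContDiff ℝ r (g j) := fun j =>
      G.contDiff_coeff_mul hF (fun i => hφ i j) (hψ.1 j)
    have hgE : ∀ j, G.energy r (g j) ≤ C₀ * (c : ℝ≥0∞) ^ 2 := fun j =>
      (hC₀ (fun i => φ i j) (ψ j) (fun i => hφ i j) (hψ.1 j) fun i => hφΛ i j).trans
        (mul_le_mul_right (pow_le_pow_left₀ zero_le (hψc j) 2) _)
    have hmoll : ∀ j : ℕ, ∃ f, IsTest f ∧ G.energy r (fun y => f y - g j y) ≤ (c : ℝ≥0∞) ^ 2 ∧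
        G.normL2 (fun y => f y - g j y) ≤ ((j : ℝ≥0∞) + 1)⁻¹ := fun j => by
      obtain ⟨f, h1, h2, h3⟩ := G.exists_isTest_energy_le (hgr j) (hψ.1 j).2.1.mul_left
        ((tsupport_mul_subset_right).trans (hψ.1 j).2.2)
        (ε := min ((c : ℝ≥0∞) ^ 2) ((j : ℝ≥0∞) + 1)⁻¹)
        (lt_min (ENNReal.pow_pos hc0 2) (by simp))
      exact ⟨f, h1, h2.trans (min_le_left _ _), h3.trans (min_le_right _ _)⟩
    choose f hf hfE hfL using hmoll
    have hfb : ∀ j, G.energy r (f j) ≤ 2 * (c ^ 2 + C₀ * c ^ 2 : ℝ≥0) := fun j => by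
      -- Written for `f j - g j` and `g j`, the identity contains `f j` as their sum and so bounds
      -- its energy by twice the sum of theirs.
      have h := G.energy_parallelogram (r := r) (f := fun y => f j y - g j y) (g := g j)
        (((hf j).1.of_infty r).sub (hgr j)).contDiffOn (hgr j).contDiffOn
      simp only [sub_add_cancel] at h
      refine (le_add_self.trans h.le).trans (mul_le_mul_right ?_ _)
      push_cast
      exact add_le_add (hfE j) (hgE j)
    have hfG : Tendsto (fun j => G.normL2 (fun y => f j y - F y (fun i => W i y) * u y)) atTop
        (𝓝 0) := by
      have hinv : Tendsto (fun j : ℕ => ((j : ℝ≥0∞) + 1)⁻¹) atTop (𝓝 0) := by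
        have := (tendsto_add_atTop_iff_nat 1).2 ENNReal.tendsto_inv_nat_nhds_zero
        simpa using this
      have h := hinv.add hlim
      rw [add_zero] at h
      refine tendsto_of_tendsto_of_tendsto_of_le_of_le tendsto_const_nhds h (fun _ => zero_le)
        fun j => ?_
      have e : (fun y => f j y - F y (fun i => W i y) * u y) =
          fun y => (f j y - g j y) + (g j y - F y (fun i => W i y) * u y) := by
        ext y; ring
      simp only [e]
      have hgm : AEStronglyMeasurable (g j) (volume.restrict (unitBall n)) :=
        (hgr j).continuous.aestronglyMeasurable
      exact (G.normL2_add_le ((hf j).1.continuous.aestronglyMeasurable.sub hgm)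
        (hgm.sub (hWm.mul hu.1))).trans (add_le_add (hfL j) le_rfl)
    obtain ⟨h1, h2⟩ := hC₁ f _ _ hf (hWm.mul hu.1)
      (ENNReal.mul_ne_top (by norm_num) ENNReal.coe_ne_top) hfb hfG
    refine ⟨h1, ?_⟩
    rw [hD]
    refine ENNReal.le_add_one_mul_of_sq_le (h2.trans (le_of_eq ?_))
    push_cast
    ring
  obtain ⟨b, hb⟩ : ∃ b : ℝ≥0, (b : ℝ≥0∞) = G.hNorm 0 r u :=
    ⟨_, ENNReal.coe_toNNReal hu.hNorm_lt_top.ne⟩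
  have hlt : ∀ ε : ℝ≥0, 0 < ε → G.hNorm 0 r u < ((b + ε : ℝ≥0) : ℝ≥0∞) := fun ε hε => by
    rw [← hb]
    exact ENNReal.coe_lt_coe.2 (lt_add_of_pos_right _ hε)
  refine ⟨(main (b + 1) (hlt 1 one_pos)).1, ?_⟩
  have hlim : Tendsto (fun ε : ℝ≥0 => ((D * (b + ε) : ℝ≥0) : ℝ≥0∞)) (𝓝[>] 0)
      (𝓝 (D * (b + 0) : ℝ≥0)) := by
    refine ENNReal.tendsto_coe.2 (Tendsto.mono_left ?_ nhdsWithin_le_nhds)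
    exact Continuous.tendsto (by fun_prop) 0
  have hfin : G.hNorm 0 r (fun y => F y (fun i => W i y) * u y) ≤ (D * (b + 0) : ℝ≥0) := by
    refine ge_of_tendsto hlim ?_
    filter_upwards [self_mem_nhdsWithin] with ε hε
    rw [ENNReal.coe_mul]
    exact (main (b + ε) (hlt ε hε)).2
  rwa [add_zero, ENNReal.coe_mul, hb] at hfin

end BallData

end

end AdaptedSobolev

end

/-! ### Conclusion -/

theorem theoremT (n M : ℕ) (hn : 3 ≤ n) (G : AdaptedSobolev.BallData n M)
    (r : ℕ) (hr : ((n : ℝ) - 1) / 2 < (r : ℝ)) (N : ℕ) :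
    (∃ C : ℝ≥0, ∀ (k : Fin N → ℕ) (β : Fin N → Fin M → ℕ) (k' : ℕ) (β' : Fin M → ℕ),
      (∑ i, (k i + ∑ a, β i a)) + (k' + ∑ a, β' a) ≤ r →
      ∀ (w : Fin N → EuclideanSpace ℝ (Fin n) → ℝ) (u : EuclideanSpace ℝ (Fin n) → ℝ),
        (∀ i, G.MemHr 1 r (w i)) → G.MemHr 0 r u →
        ((∀ i, ∃ v, G.IsD (k i) (β i) (w i) v) ∧ ∃ v', G.IsD k' β' u v') ∧
        ∀ (v : Fin N → EuclideanSpace ℝ (Fin n) → ℝ) (v' : EuclideanSpace ℝ (Fin n) → ℝ),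
          (∀ i, G.IsD (k i) (β i) (w i) (v i)) → G.IsD k' β' u v' →
          eLpNorm (fun y => (∏ i, v i y) * v' y) 2 G.measA ≤
            (C : ℝ≥0∞) * G.hNorm 0 r u * ∏ i, G.hNorm 1 r (w i)) ∧
    (∀ F : EuclideanSpace ℝ (Fin n) → (Fin N → ℝ) → ℝ, G.IsCoeff r N F →
      ∀ Λ : ℝ≥0, ∃ C : ℝ≥0,
        ∀ (w : Fin N → EuclideanSpace ℝ (Fin n) → ℝ) (u : EuclideanSpace ℝ (Fin n) → ℝ),
          (∀ i, G.MemHr 1 r (w i)) → G.MemHr 0 r u →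
          ∑ i, G.hNorm 1 r (w i) ≤ (Λ : ℝ≥0∞) →
          G.MemHr 0 r (fun y => F y (fun i => w i y) * u y) ∧
          G.hNorm 0 r (fun y => F y (fun i => w i y) * u y) ≤ (C : ℝ≥0∞) * G.hNorm 0 r u) := by
  -- The Sobolev condition is required at order `r + 1`, since the functions of `ℋ^{1,r}` have one
  -- derivative more than `u`.
  have hr' : n < 2 * (r + 1) := by
    have h : (n : ℝ) < 2 * (r + 1) := by linarith
    exact_mod_cast h
  exact ⟨G.multilinear_estimate (by omega) hr' N,
    fun F hF Λ => G.coeff_mul_estimate (by omega) hr' hF Λ⟩
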